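/- Let $d\ge 2$ and let $\mathcal B\subset\mathbb R^d$ be a compact convex set with nonempty interior whose boundary $\partial\mathcal B$ is a smooth ($C^\infty$) hypersurface (a curve if $d=2$). Let $\vec n=(n_1,\dots,n_d):\partial\mathcal B\to S^{d-1}$ be the Gauss map (unit exterior normal), $K(x)\ge 0$ the Gaussian curvature of $\partial\mathcal B$ at $x$ (the determinant of the differential of $\vec n$ on the tangent hyperplane), $dS$ the induced Lebesgue (surface) measure on $\partial\mathcal B$, $(\partial\mathcal B)_+=\{x\in\partial\mathcal B: K(x)>0\}$, and $H(\xi)=\sup_{y\in\mathcal B}\langle y,\xi\rangle$. For $\xi\in\vec n((\partial\mathcal B)_+)$ let $x(\xi)$ be the unique point of $\partial\mathcal B$ with $\vec n(x(\xi))=\xi$ and put $K_\xi=K(x(\xi))$. Write $$\widehat{n_l\,dS}(\zeta)=\int_{\partial\mathcal B} n_l(x)\,e^{-2\pi i\langle x,\zeta\rangle}\,dS(x),\qquad \widehat{\chi}_{\mathcal B}(\zeta)=\int_{\mathcal B}e^{-2\pi i\langle x,\zeta\rangle}\,dx .$$ Then for every $N\in\mathbb N$ there is a constant $C$, depending only on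 $N$ and $\mathcal B$, such that for all $\xi$ with $\xi\in\vec n((\partial\mathcal B)_+)$ and $-\xi\in\vec n((\partial\mathcal B)_+)$, with $\delta=\min(K_\xi,K_{-\xi})$, for all $\lambda>0$ the following two estimates hold. (1) For every $l=1,\dots,d$, $$\Bigl|\widehat{n_l\,dS}(\lambda\xi)-\Bigl(e^{\pi i(d-1)/4}\,\xi_l\,K_\xi^{-1/2}e^{-2\pi i\lambda H(\xi)}+e^{-\pi i(d-1)/4}(-\xi_l)\,K_{-\xi}^{-1/2}e^{2\pi i\lambda H(-\xi)}\Bigr)\lambda^{-(d-1)/2}\Bigr|\le C\bigl(\lambda^{-(d+1)/2}\delta^{-(d+5)/2}+\lambda^{-N}\delta^{-4N}\bigr).$$ (2) $$\Bigl|\widehat{\chi}_{\mathcal B}(\lambda\xi)-\Bigl(\tfrac1{2\pi}e^{\pi i(d+1)/4}K_\xi^{-1/2}e^{-2\pi i\lambda H(\xi)}+\tfrac1{2\pi}e^{-\pi i(d+1)/4}K_{-\xi}^{-1/2}e^{2\pi i\lambda H(-\xi)}\Bigr)\lambda^{-(d+1)/2}\Bigr|\le C\bigl(\lambda^{-(d+3)/2}\delta^{-(d+5)/2}+\lambda^{-N-1}\delta^{-4N}\bigr).$$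 -/

import Mathlib

open MeasureTheory
open scoped ContDiff FourierTransform InnerProductSpace

/-- `M ⊆ ℝᵈ` is a smooth (embedded) hypersurface: near each of its points it is the zero set of a
`C^∞` function whose differential does not vanish at that point. -/
def IsSmoothHypersurface {d : ℕ} (M : Set (EuclideanSpace ℝ (Fin d))) : Prop :=
  ∀ x ∈ M, ∃ (U : Set (EuclideanSpace ℝ (Fin d))) (ρ : EuclideanSpace ℝ (Fin d) → ℝ),
    IsOpen U ∧ x ∈ U ∧ ContDiffOn ℝ ∞ ρ U ∧ fderiv ℝ ρ x ≠ 0 ∧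
      ∀ y ∈ U, (y ∈ M ↔ ρ y = 0)

/-- `ν` is a unit exterior normal of the convex set `B` at `x`: a unit vector such that `B` lies in
the half-space through `x` with outer direction `ν`. For a convex domain with smooth boundary there
is exactly one at each boundary point. -/
def IsUnitExteriorNormal {d : ℕ} (B : Set (EuclideanSpace ℝ (Fin d)))
    (x ν : EuclideanSpace ℝ (Fin d)) : Prop :=
  ‖ν‖ = 1 ∧ ∀ y ∈ B, ⟪ν, y - x⟫_ℝ ≤ 0

/-- The Gauss map of `∂B`: the unit exterior normal at `x ∈ ∂B`. -/
noncomputable def gaussMap {d : ℕ} (B : Set (EuclideanSpace ℝ (Fin d)))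
    (x : EuclideanSpace ℝ (Fin d)) : EuclideanSpace ℝ (Fin d) :=
  Classical.epsilon (IsUnitExteriorNormal B x)

/-- The tangent hyperplane (a linear subspace) of `∂B` at `x`: the orthogonal complement of the
normal. -/
noncomputable def tangentHyperplane {d : ℕ} (B : Set (EuclideanSpace ℝ (Fin d)))
    (x : EuclideanSpace ℝ (Fin d)) : Submodule ℝ (EuclideanSpace ℝ (Fin d)) :=
  (Submodule.span ℝ {gaussMap B x})ᗮ

/-- The Weingarten (shape) operator of `∂B` at `x`: the differential of the Gauss map along `∂B`,
as an endomorphism of the tangent hyperplane. (The derivative within `∂B` is determined on tangent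
vectors, and it maps them to tangent vectors, so that the projection changes nothing.) -/
noncomputable def shapeOperator {d : ℕ} (B : Set (EuclideanSpace ℝ (Fin d)))
    (x : EuclideanSpace ℝ (Fin d)) : tangentHyperplane B x →L[ℝ] tangentHyperplane B x :=
  (tangentHyperplane B x).orthogonalProjectionOnto ∘L
    fderivWithin ℝ (gaussMap B) (frontier B) x ∘L (tangentHyperplane B x).subtypeL

/-- The Gaussian curvature `K(x)` of `∂B` at `x`. -/
noncomputable def gaussCurvature {d : ℕ} (B : Set (EuclideanSpace ℝ (Fin d)))
    (x : EuclideanSpace ℝ (Fin d)) : ℝ :=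
  LinearMap.det (shapeOperator B x : tangentHyperplane B x →ₗ[ℝ] tangentHyperplane B x)

/-- `(∂B)₊`, the set of boundary points of positive curvature. -/
def posCurvBoundary {d : ℕ} (B : Set (EuclideanSpace ℝ (Fin d))) :
    Set (EuclideanSpace ℝ (Fin d)) :=
  {x | x ∈ frontier B ∧ 0 < gaussCurvature B x}

/-- For a unit vector `ξ` in the image of `(∂B)₊` under the Gauss map, the point `x(ξ)` of `(∂B)₊`
with unit exterior normal `ξ`. -/
noncomputable def gaussInv {d : ℕ} (B : Set (EuclideanSpace ℝ (Fin d)))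
    (ξ : EuclideanSpace ℝ (Fin d)) : EuclideanSpace ℝ (Fin d) :=
  Function.invFunOn (gaussMap B) (posCurvBoundary B) ξ

/-- `K_ξ = K(x(ξ))`. -/
noncomputable def curvatureAt {d : ℕ} (B : Set (EuclideanSpace ℝ (Fin d)))
    (ξ : EuclideanSpace ℝ (Fin d)) : ℝ :=
  gaussCurvature B (gaussInv B ξ)

/-- The support function `H(ξ) = sup_{y ∈ B} ⟨y, ξ⟩`. -/
noncomputable def supportFn {d : ℕ} (B : Set (EuclideanSpace ℝ (Fin d)))
    (ξ : EuclideanSpace ℝ (Fin d)) : ℝ :=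
  sSup ((fun y => ⟪y, ξ⟫_ℝ) '' B)

/-- The surface measure `dS` of `∂B`: the `(d-1)`-dimensional Hausdorff measure on `∂B`, normalized
so as to agree with Lebesgue measure on hyperplanes. -/
noncomputable def surfaceMeasure {d : ℕ} (B : Set (EuclideanSpace ℝ (Fin d))) :
    Measure (EuclideanSpace ℝ (Fin d)) :=
  (μHE[d - 1]).restrict (frontier B)

/-- The Fourier transform of the measure `n_l dS`, where `n_l` is the `l`-th component of the Gauss
map: `ζ ↦ ∫_{∂B} n_l(x) e^{-2πi⟨x, ζ⟩} dS(x)`. -/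
noncomputable def fourierNormalSurface {d : ℕ} (B : Set (EuclideanSpace ℝ (Fin d))) (l : Fin d)
    (ζ : EuclideanSpace ℝ (Fin d)) : ℂ :=
  ∫ x, (gaussMap B x l : ℂ) * Complex.exp (-2 * Real.pi * Complex.I * (⟪x, ζ⟫_ℝ : ℂ))
    ∂surfaceMeasure B

/-! Put $\Lambda=2\pi\lambda$, $n=d-1$, and let $\delta$ stand for a small multiple of the smaller
of the two curvatures. Estimate (1) is a consequence of (2): the divergence theorem gives
$\widehat{n_l\,dS}(\zeta)=-2\pi i\,\zeta_l\,\widehat\chi_{\mathcal B}(\zeta)$, so (1) is (2)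
multiplied by $-2\pi i\lambda\xi_l$. For (2), the integral of $e^{-i\Lambda\langle p,\xi\rangle}$
over the solid body is split by cutoffs to two disjoint cylinders of size $r\sim\delta$ around
$x(\xi)$ and $x(-\xi)$.

Outside the cylinders, let $\rho$ be a smooth defining function, $p$ the component of $\nabla\rho$
orthogonal to $\xi$, and $g=|p|^2-\rho$. The field $\langle\nabla\rho,\xi\rangle p-g\xi$ is tangent
to the boundary and moves the phase $-\langle x,\xi\rangle$ at speed $g\ge 0$, so integrating by
parts inside the body leaves no boundary term. Derivatives of $g$ along the field are $O(g)$, and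
those of the cutoffs are bounded uniformly in $r$ because the field vanishes at the two points.
Hence $N+2$ integrations (`oscillatory_bound`) produce $\int(1+\Lambda g)^{-N-2}$. Where $g<\eta$, a
nearby normal is within $O(\sqrt\eta)$ of $\pm\xi$; by convexity and the curvature bound the point
lies in a cylinder once $\sqrt\eta$ is small against $\delta r\sim\delta^2$. So $\eta\sim\delta^4$:
$N$ factors give $(\Lambda\delta^4)^{-N}$, and the two others, since $g\ge|\rho|$, give
$\Lambda^{-1}$ by integration over the boundary layer (`exists_nonstationary_bound`).

Inside a cylinder the body is $\{u\ge\varphi(z)\}$ with $z$ in the tangent hyperplane and $u$ the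
depth. Integrating in $u$ leaves $(i/\Lambda)e^{i\Lambda\varphi(z)}$ up to a rapidly decaying term
from the cutoff. Then `stationary_phase` applies to $\varphi=\frac12|Az|^2+P$ with $|\det A|=\sqrt
K$ and $|Az|^2\ge\delta|z|^2$. The exponential $e^{i\Lambda P}$ is expanded to second order: the
constant term is a Fresnel integral, the linear term sees only the even part of $P$, which is
$O(|z|^4)$, and the remainder carries $P^2=O(|z|^6)$. Integration by parts along the dilation field
makes each $|z|^2$ worth $(\delta\Lambda)^{-1}$, so the relative error is $\Lambda^{-1}\delta^{-3}$.
With the factor $K^{-1/2}$ this is $\delta^{-7/2}$, which is dominated by $\delta^{-(d+5)/2}$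
because $d\ge 2$ and the curvature is bounded.

Constants are uniform by compactness: the boundary charts come from an implicit function theorem in
which the base point is a parameter. The divergence theorem for Hausdorff measure is obtained by
comparing small boundary pieces with their tangent hyperplanes up to a factor $1+\varepsilon$,
summing the local defects with a partition of unity, and letting $\varepsilon\to0$
(`fluxDefect_eq_zero`). -/

set_option linter.unusedSectionVars false

/-! ### Derivatives along a vector field and symbol-type bounds. -/

section FieldDeriv

variable {E : Type*} [NormedAddCommGroup E] [NormedSpace ℝ E]
variable {G : Type*} [NormedAddCommGroup G] [NormedSpace ℝ G]
variable {A : Type*} [NormedCommRing A] [NormedAlgebra ℝ A]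

/-- The derivative of `f` along the vector field `V`. -/
noncomputable def fieldDeriv (V : E → E) (f : E → G) : E → G := fun x => fderiv ℝ f x (V x)

theorem ContDiff.fieldDeriv {V : E → E} {f : E → G} (hf : ContDiff ℝ ∞ f) (hV : ContDiff ℝ ∞ V) :
    ContDiff ℝ ∞ (fieldDeriv V f) :=
  (hf.fderiv_right (m := ∞) (by simp)).clm_apply hV

theorem ContDiff.fieldDeriv_iterate {V : E → E} {f : E → G} (hf : ContDiff ℝ ∞ f)
    (hV : ContDiff ℝ ∞ V) (j : ℕ) : ContDiff ℝ ∞ ((_root_.fieldDeriv V)^[j] f) := by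
  induction j with
  | zero => exact hf
  | succ j ih => rw [Function.iterate_succ_apply']; exact ih.fieldDeriv hV

theorem fieldDeriv_add {V : E → E} {f g : E → G} (hf : ContDiff ℝ ∞ f) (hg : ContDiff ℝ ∞ g) :
    fieldDeriv V (fun x => f x + g x) = fun x => fieldDeriv V f x + fieldDeriv V g x := by
  ext x
  simp only [fieldDeriv]
  rw [fderiv_fun_add (hf.differentiable (by simp) x) (hg.differentiable (by simp) x)]
  simp

theorem fieldDeriv_mul {V : E → E} {f g : E → A} (hf : ContDiff ℝ ∞ f) (hg : ContDiff ℝ ∞ g) :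
    fieldDeriv V (fun x => f x * g x) = fun x => f x * fieldDeriv V g x + fieldDeriv V f x * g x := by
  ext x
  simp only [fieldDeriv]
  rw [fderiv_fun_mul (hf.differentiable (by simp) x) (hg.differentiable (by simp) x)]
  simp [mul_comm]

theorem fieldDeriv_const_mul {V : E → E} {f : E → A} (hf : ContDiff ℝ ∞ f) (c : A) :
    fieldDeriv V (fun x => c * f x) = fun x => c * fieldDeriv V f x := by
  ext x
  simp only [fieldDeriv]
  rw [fderiv_const_mul (hf.differentiable (by simp) x)]
  simp

theorem fieldDeriv_clm_comp {V : E → E} {f : E → G} {G' : Type*} [NormedAddCommGroup G']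
    [NormedSpace ℝ G'] (L : G →L[ℝ] G') (hf : ContDiff ℝ ∞ f) :
    fieldDeriv V (fun x => L (f x)) = fun x => L (fieldDeriv V f x) := by
  ext x
  have h : HasFDerivAt (fun x => L (f x)) (L ∘L fderiv ℝ f x) x :=
    L.hasFDerivAt.comp x (hf.differentiable (by simp) x).hasFDerivAt
  simp [fieldDeriv, h.fderiv]

theorem fieldDeriv_iterate_clm_comp {V : E → E} (hV : ContDiff ℝ ∞ V) {f : E → G} {G' : Type*}
    [NormedAddCommGroup G'] [NormedSpace ℝ G'] (L : G →L[ℝ] G') (hf : ContDiff ℝ ∞ f) (j : ℕ) :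
    (fieldDeriv V)^[j] (fun x => L (f x)) = fun x => L ((fieldDeriv V)^[j] f x) := by
  induction j with
  | zero => rfl
  | succ j ih =>
    rw [Function.iterate_succ_apply', Function.iterate_succ_apply', ih,
      fieldDeriv_clm_comp L (hf.fieldDeriv_iterate hV j)]

theorem fieldDeriv_eqOn_of_eventuallyEq {V : E → E} {f g : E → G} {x : E}
    (h : f =ᶠ[nhds x] g) (j : ℕ) :
    (fieldDeriv V)^[j] f =ᶠ[nhds x] (fieldDeriv V)^[j] g := by
  induction j with
  | zero => exact h
  | succ j ih =>
    rw [Function.iterate_succ_apply', Function.iterate_succ_apply']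
    filter_upwards [ih.fderiv (𝕜 := ℝ)] with y hy
    simp [fieldDeriv, hy]

theorem tsupport_fieldDeriv_subset (V : E → E) (f : E → G) :
    tsupport (fieldDeriv V f) ⊆ tsupport f := by
  refine closure_minimal (fun x hx => ?_) (isClosed_tsupport f)
  by_contra h
  apply hx
  have : f =ᶠ[nhds x] fun _ => 0 := notMem_tsupport_iff_eventuallyEq.mp h
  simp [fieldDeriv, this.fderiv_eq]

/-- The first `n` derivatives of `f` along `V` are bounded on `S` by `C * w`. -/
def FieldBound (V : E → E) (S : Set E) (n : ℕ) (C : ℝ) (w : E → ℝ) (f : E → G) : Prop :=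
  ∀ j ≤ n, ∀ x ∈ S, ‖(fieldDeriv V)^[j] f x‖ ≤ C * w x

namespace FieldBound

variable {V : E → E} {S : Set E} {n : ℕ} {C C' : ℝ} {w w' : E → ℝ} {f g : E → G}

theorem succ_iff : FieldBound V S (n + 1) C w f ↔
    (∀ x ∈ S, ‖f x‖ ≤ C * w x) ∧ FieldBound V S n C w (fieldDeriv V f) := by
  constructor
  · intro h
    exact ⟨h 0 (by omega), fun j hj x hx => by
      rw [← Function.iterate_succ_apply]; exact h (j + 1) (by omega) x hx⟩
  · rintro ⟨h0, h1⟩ j hj x hx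
    cases j with
    | zero => exact h0 x hx
    | succ j => rw [Function.iterate_succ_apply]; exact h1 j (by omega) x hx

theorem zero_iff : FieldBound V S 0 C w f ↔ ∀ x ∈ S, ‖f x‖ ≤ C * w x :=
  ⟨fun h => h 0 le_rfl, fun h j hj x hx => by
    obtain rfl : j = 0 := by omega
    exact h x hx⟩

theorem base (h : FieldBound V S n C w f) : ∀ x ∈ S, ‖f x‖ ≤ C * w x := h 0 (by omega)

theorem weaken (h : FieldBound V S n C w f) (hw : ∀ x ∈ S, C * w x ≤ C' * w' x) :
    FieldBound V S n C' w' f := fun j hj x hx => (h j hj x hx).trans (hw x hx)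

theorem mono_const (h : FieldBound V S n C w f) (hC : C ≤ C') (hw : ∀ x ∈ S, 0 ≤ w x) :
    FieldBound V S n C' w f :=
  h.weaken fun x hx => mul_le_mul_of_nonneg_right hC (hw x hx)

theorem mono_set {S' : Set E} (h : FieldBound V S n C w f) (hS : S' ⊆ S) :
    FieldBound V S' n C w f := fun j hj x hx => h j hj x (hS hx)

theorem mono_level {m : ℕ} (h : FieldBound V S n C w f) (hm : m ≤ n) :
    FieldBound V S m C w f := fun j hj x hx => h j (hj.trans hm) x hx

theorem add (hV : ContDiff ℝ ∞ V) (hf : ContDiff ℝ ∞ f) (hg : ContDiff ℝ ∞ g)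
    (h : FieldBound V S n C w f) (h' : FieldBound V S n C' w g) :
    FieldBound V S n (C + C') w (fun x => f x + g x) := by
  induction n generalizing f g with
  | zero =>
    rw [zero_iff] at *
    intro x hx
    linarith [norm_add_le (f x) (g x), h x hx, h' x hx]
  | succ n ih =>
    rw [succ_iff] at *
    refine ⟨fun x hx => ?_, ?_⟩
    · linarith [norm_add_le (f x) (g x), h.1 x hx, h'.1 x hx]
    · rw [fieldDeriv_add hf hg]
      exact ih (hf.fieldDeriv hV) (hg.fieldDeriv hV) h.2 h'.2

theorem ofReal (hV : ContDiff ℝ ∞ V) {f : E → ℝ} (hf : ContDiff ℝ ∞ f)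
    (h : FieldBound V S n C w f) : FieldBound V S n C w (fun x => (f x : ℂ)) := by
  intro j hj x hx
  have := congrFun (fieldDeriv_iterate_clm_comp hV Complex.ofRealCLM hf j) x
  simp only [Complex.ofRealCLM_apply] at this
  rw [this, Complex.norm_real]
  exact h j hj x hx

/-- Leibniz rule: each derivative falls on one of the two factors, so the constant doubles with each
order. -/
theorem mul (hV : ContDiff ℝ ∞ V) {f g : E → A} (hf : ContDiff ℝ ∞ f) (hg : ContDiff ℝ ∞ g)
    (h : FieldBound V S n C w f) (h' : FieldBound V S n C' w' g)  :
    FieldBound V S n (2 ^ n * (C * C')) (fun x => w x * w' x) (fun x => f x * g x) := by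
  induction n generalizing f g with
  | zero =>
    rw [zero_iff] at *
    intro x hx
    have h1 := h x hx
    have h2 := h' x hx
    calc _ ≤ ‖f x‖ * ‖g x‖ := norm_mul_le _ _
      _ ≤ (C * w x) * (C' * w' x) := by gcongr; exact (norm_nonneg _).trans h1
      _ = _ := by ring
  | succ n ih =>
    have hb := h.base
    have hb' := h'.base
    have hd := (succ_iff.1 h).2
    have hd' := (succ_iff.1 h').2
    have h1 := h.mono_level (Nat.le_succ n)
    have h1' := h'.mono_level (Nat.le_succ n)
    rw [succ_iff]
    refine ⟨fun x hx => ?_, ?_⟩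
    · have h2 := hb x hx
      have h3 := hb' x hx
      have h4 : 0 ≤ (C * w x) * (C' * w' x) :=
        mul_nonneg ((norm_nonneg _).trans h2) ((norm_nonneg _).trans h3)
      calc _ ≤ ‖f x‖ * ‖g x‖ := norm_mul_le _ _
        _ ≤ (C * w x) * (C' * w' x) := by gcongr; exact (norm_nonneg _).trans h2
        _ ≤ 2 ^ (n + 1) * ((C * w x) * (C' * w' x)) := by
          refine le_mul_of_one_le_left h4 (one_le_pow₀ (by norm_num))
        _ = _ := by ring
    · rw [fieldDeriv_mul hf hg]
      refine (add hV (hf.mul (hg.fieldDeriv hV)) ((hf.fieldDeriv hV).mul hg)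
        (ih hf (hg.fieldDeriv hV) h1 hd') (ih (hf.fieldDeriv hV) hg hd h1')).weaken ?_
      intro x _
      apply le_of_eq
      ring

theorem const {c : G} (hc : ∀ x ∈ S, ‖c‖ ≤ C * w x) : FieldBound V S n C w (fun _ => c) := by
  intro j hj x hx
  cases j with
  | zero => exact hc x hx
  | succ j =>
    have h0 : ∀ j, (fieldDeriv V)^[j] (fun _ : E => (0 : G)) = fun _ => 0 := by
      intro j
      induction j with
      | zero => rfl
      | succ j ih => rw [Function.iterate_succ_apply', ih]; ext; simp [fieldDeriv]
    have : fieldDeriv V (fun _ : E => c) = fun _ => 0 := by ext; simp [fieldDeriv]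
    rw [Function.iterate_succ_apply, this, h0]
    simpa using (norm_nonneg _).trans (hc x hx)

theorem const_mul (hV : ContDiff ℝ ∞ V) {f : E → A} (hf : ContDiff ℝ ∞ f) (c : A)
    (h : FieldBound V S n C w f) : FieldBound V S n (‖c‖ * C) w (fun x => c * f x) := by
  induction n generalizing f with
  | zero =>
    rw [zero_iff] at *
    intro x hx
    calc _ ≤ ‖c‖ * ‖f x‖ := norm_mul_le _ _
      _ ≤ ‖c‖ * (C * w x) := by gcongr; exact h x hx
      _ = _ := by ring
  | succ n ih =>
    rw [succ_iff] at *
    refine ⟨fun x hx => ?_, ?_⟩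
    · calc _ ≤ ‖c‖ * ‖f x‖ := norm_mul_le _ _
        _ ≤ ‖c‖ * (C * w x) := by gcongr; exact h.1 x hx
        _ = _ := by ring
    · rw [fieldDeriv_const_mul hf]
      exact ih (hf.fieldDeriv hV) h.2

/-- Composition with a smooth function of one variable. -/
theorem comp_real (n : ℕ) (C K : ℝ) : ∃ C', ∀ {E : Type*} [NormedAddCommGroup E] [NormedSpace ℝ E]
    (V : E → E) (S : Set E) (Q : E → ℝ) (F : ℝ → ℝ), ContDiff ℝ ∞ V → ContDiff ℝ ∞ Q →
    ContDiff ℝ ∞ F → FieldBound V S n C (fun _ => 1) Q →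
    (∀ i ≤ n, ∀ x ∈ S, |deriv^[i] F (Q x)| ≤ K) →
    FieldBound V S n C' (fun _ => 1) (fun x => F (Q x)) := by
  induction n with
  | zero =>
    refine ⟨K, fun V S Q F _ _ _ _ h => zero_iff.2 fun x hx => ?_⟩
    simpa using h 0 le_rfl x hx
  | succ n ih =>
    obtain ⟨C', hC'⟩ := ih
    refine ⟨max K (2 ^ n * (C' * C)), fun V S Q F hV hQ hF hb h => succ_iff.2 ⟨fun x hx => ?_, ?_⟩⟩
    · have := h 0 (by omega) x hx
      simpa using Or.inl this
    · have hF' : ContDiff ℝ ∞ (deriv F) := (contDiff_infty_iff_deriv.1 hF).2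
      have h1 : FieldBound V S n C' (fun _ => 1) (fun x => deriv F (Q x)) :=
        hC' V S Q (deriv F) hV hQ hF' (hb.mono_level (Nat.le_succ n)) fun i hi x hx => by
          rw [← Function.iterate_succ_apply]; exact h (i + 1) (by omega) x hx
      have h2 : fieldDeriv V (fun x => F (Q x)) = fun x => deriv F (Q x) * fieldDeriv V Q x := by
        ext x
        have h3 : HasFDerivAt (fun x => F (Q x)) (deriv F (Q x) • fderiv ℝ Q x) x :=
          ((hF.differentiable (by simp) (Q x)).hasDerivAt).comp_hasFDerivAt x
            (hQ.differentiable (by simp) x).hasFDerivAt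
        simp [fieldDeriv, h3.fderiv]
      rw [h2]
      refine (mul hV (hF'.comp hQ) (hQ.fieldDeriv hV) h1 (succ_iff.1 hb).2).weaken ?_
      intro x _
      simp

theorem norm_one_add_mul_I_inv (x : ℝ) (hx : 0 ≤ x) : ‖(1 + Complex.I * x : ℂ)⁻¹‖ ≤ 2 * (1 + x)⁻¹ := by
  have h1 : (1 + x) / 2 ≤ ‖(1 + Complex.I * x : ℂ)‖ := by
    have hre : |(1 + Complex.I * x : ℂ).re| ≤ ‖(1 + Complex.I * x : ℂ)‖ := Complex.abs_re_le_norm _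
    have him : |(1 + Complex.I * x : ℂ).im| ≤ ‖(1 + Complex.I * x : ℂ)‖ := Complex.abs_im_le_norm _
    simp at hre him
    rw [abs_of_nonneg hx] at him
    linarith
  rw [norm_inv]
  calc _ ≤ ((1 + x) / 2)⁻¹ := inv_anti₀ (by linarith) h1
    _ = _ := by rw [inv_div, div_eq_mul_inv]

theorem one_add_mul_I_ne_zero (x : ℝ) : (1 + Complex.I * x : ℂ) ≠ 0 := by
  intro h
  have := congrArg Complex.re h
  simp at this

theorem contDiff_inv_one_add {g : E → ℝ} (hg : ContDiff ℝ ∞ g) (l : ℝ) :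
    ContDiff ℝ ∞ (fun x => (1 + Complex.I * ((l * g x : ℝ) : ℂ))⁻¹) := by
  refine ContDiff.inv ?_ fun x => one_add_mul_I_ne_zero _
  have : ContDiff ℝ ∞ fun x => ((l * g x : ℝ) : ℂ) :=
    Complex.ofRealCLM.contDiff.comp (contDiff_const.mul hg)
  exact contDiff_const.add (contDiff_const.mul this)

/-- Since $V(1+ilg)^{-1}=-il\,(Vg)(1+ilg)^{-2}$ and $Vg=O(g)$, the factor $l\,Vg=O(1+lg)$ cancels
one of the two inverse powers. The constant depends neither on $l$ nor on the field. -/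
theorem inv_one_add (n : ℕ) (C : ℝ) : ∃ C', 0 ≤ C' ∧
    ∀ {E : Type*} [NormedAddCommGroup E] [NormedSpace ℝ E]
    (V : E → E) (S : Set E) (g : E → ℝ) (l : ℝ), ContDiff ℝ ∞ V → ContDiff ℝ ∞ g → 0 ≤ l →
    (∀ x ∈ S, 0 ≤ g x) → FieldBound V S n C g g →
    FieldBound V S n C' (fun x => (1 + l * g x)⁻¹)
      (fun x => (1 + Complex.I * ((l * g x : ℝ) : ℂ))⁻¹) := by
  induction n with
  | zero =>
    refine ⟨2, by norm_num, fun V S g l _ _ hl hg _ => zero_iff.2 fun x hx => ?_⟩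
    exact norm_one_add_mul_I_inv _ (mul_nonneg hl (hg x hx))
  | succ n ih =>
    obtain ⟨C', hC', ih⟩ := ih
    refine ⟨max 2 (2 ^ n * (|C| * (2 ^ n * (C' * C')))), by positivity,
      fun V S g l hV hgs hl hg hb => succ_iff.2 ⟨fun x hx => ?_, ?_⟩⟩
    · have h0 : 0 ≤ l * g x := mul_nonneg hl (hg x hx)
      refine (norm_one_add_mul_I_inv _ h0).trans ?_
      gcongr
      exact le_max_left _ _
    · have hs := contDiff_inv_one_add hgs l
      have hI := ih V S g l hV hgs hl hg (hb.mono_level (Nat.le_succ n))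
      have hgl : ContDiff ℝ ∞ fun x => ((fieldDeriv V g x : ℝ) : ℂ) :=
        Complex.ofRealCLM.contDiff.comp (hgs.fieldDeriv hV)
      have hgl2 : ContDiff ℝ ∞ fun x => (-(Complex.I * l)) * ((fieldDeriv V g x : ℝ) : ℂ) :=
        contDiff_const.mul hgl
      have hbd : FieldBound V S n |C| (fun x => 1 + l * g x)
          (fun x => (-(Complex.I * l)) * ((fieldDeriv V g x : ℝ) : ℂ)) := by
        refine (const_mul hV hgl (-(Complex.I * l)) ((succ_iff.1 hb).2.ofReal hV
          (hgs.fieldDeriv hV))).weaken fun x hx => ?_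
        have : ‖(-(Complex.I * l) : ℂ)‖ = l := by simp [abs_of_nonneg hl]
        rw [this]
        have h0 : 0 ≤ l * g x := mul_nonneg hl (hg x hx)
        nlinarith [le_abs_self C, abs_nonneg C]
      have h2 : fieldDeriv V (fun x => (1 + Complex.I * ((l * g x : ℝ) : ℂ))⁻¹) =
          fun x => ((-(Complex.I * l)) * ((fieldDeriv V g x : ℝ) : ℂ)) *
            ((1 + Complex.I * ((l * g x : ℝ) : ℂ))⁻¹ * (1 + Complex.I * ((l * g x : ℝ) : ℂ))⁻¹) := by
        ext x
        have h3 : HasFDerivAt (fun x => 1 + Complex.I * ((l * g x : ℝ) : ℂ))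
            (Complex.I • (Complex.ofRealCLM ∘L (l • fderiv ℝ g x))) x := by
          have := (hgs.differentiable (by simp) x).hasFDerivAt.const_mul l
          exact ((Complex.ofRealCLM.hasFDerivAt.comp x this).const_mul Complex.I).const_add 1
        have h4 := ((hasFDerivAt_inv (𝕜 := ℂ) (one_add_mul_I_ne_zero (l * g x))).restrictScalars ℝ).comp x h3
        have h5 : fderiv ℝ (fun x => (1 + Complex.I * ((l * g x : ℝ) : ℂ))⁻¹) x = _ := h4.fderiv
        simp only [fieldDeriv, h5]
        simp
        field_simp
      rw [h2]
      refine (mul hV hgl2 (hs.mul hs) hbd (mul hV hs hs hI hI)).weaken fun x hx => ?_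
      have h0 : 0 ≤ l * g x := mul_nonneg hl (hg x hx)
      have : (1 + l * g x) * ((1 + l * g x)⁻¹ * (1 + l * g x)⁻¹) = (1 + l * g x)⁻¹ := by
        field_simp
      rw [this]
      gcongr
      exact le_max_right _ _

end FieldBound

end FieldDeriv

/-- Repeated integration by parts for an oscillatory integral, along a vector field `V` for which
`μ` satisfies the divergence identity `∫ (V f + κ f) dμ = 0`. -/
theorem oscillatory_bound (M : ℕ) (C : ℝ) : ∃ A : ℝ, 0 ≤ A ∧ ∀ {E : Type*} [NormedAddCommGroup E]
    [NormedSpace ℝ E] [MeasurableSpace E] (μ : Measure E) (V : E → E) (κ : E → ℂ)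
    (g Ψ : E → ℝ) (l : ℝ) (b : E → ℂ) (w : E → ℝ) (S : Set E),
    ContDiff ℝ ∞ V → ContDiff ℝ ∞ κ → ContDiff ℝ ∞ g → ContDiff ℝ ∞ Ψ → ContDiff ℝ ∞ b →
    0 ≤ l → fieldDeriv V Ψ = g → (∀ x ∈ S, 0 ≤ g x) → (∀ x ∈ S, 0 ≤ w x) →
    FieldBound V S M C g g → FieldBound V S M C (fun _ => 1) κ → FieldBound V S M C w b →
    MeasurableSet S → (∀ᵐ x ∂μ, x ∈ tsupport b → x ∈ S) →
    (∀ f : E → ℂ, ContDiff ℝ ∞ f → tsupport f ⊆ tsupport b →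
      Integrable f μ ∧ ∫ x, (fieldDeriv V f x + κ x * f x) ∂μ = 0) →
    IntegrableOn (fun x => w x * (1 + l * g x)⁻¹ ^ M) S μ →
    ‖∫ x, b x * Complex.exp (Complex.I * ((l * Ψ x : ℝ) : ℂ)) ∂μ‖ ≤
      A * ∫ x in S, w x * (1 + l * g x)⁻¹ ^ M ∂μ := by
  induction M generalizing C with
  | zero =>
    refine ⟨|C|, abs_nonneg C, ?_⟩
    intro E _ _ _ μ V κ g Ψ l b w S hV hκ hg hΨ hb hl hD hg0 hw0 hgb hκb hbb hS hsupp hI hint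
    have hmem : ∀ᵐ x ∂μ, x ∉ S → b x * Complex.exp (Complex.I * ((l * Ψ x : ℝ) : ℂ)) = 0 := by
      filter_upwards [hsupp] with x hx hxS
      have : x ∉ tsupport b := fun h => hxS (hx h)
      rw [image_eq_zero_of_notMem_tsupport this, zero_mul]
    rw [← setIntegral_eq_integral_of_ae_compl_eq_zero hmem]
    calc _ ≤ ∫ x in S, |C| * (w x * (1 + l * g x)⁻¹ ^ 0) ∂μ := by
          refine norm_integral_le_of_norm_le (hint.const_mul _) ?_
          filter_upwards [ae_restrict_mem hS] with x hx
          rw [norm_mul, mul_comm Complex.I, Complex.norm_exp_ofReal_mul_I]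
          have := hbb.base x hx
          have := hw0 x hx
          simp only [pow_zero, mul_one]
          nlinarith [le_abs_self C]
      _ = _ := integral_const_mul _ _
  | succ M ih =>
    obtain ⟨K, hK, hinv⟩ := FieldBound.inv_one_add (M + 1) C
    obtain ⟨A, hA, ih⟩ := ih (max C (2 ^ M * ((1 + C) * (2 ^ (M + 1) * (C * K))) +
      ‖(-1 : ℂ)‖ * (2 ^ (M + 1) * (C * K))))
    refine ⟨A, hA, ?_⟩
    intro E _ _ _ μ V κ g Ψ l b w S hV hκ hg hΨ hb hl hD hg0 hw0 hgb hκb hbb hS hsupp hI hint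
    -- With $e=e^{il\Psi}$ one has $Ve=ilg\,e$, so for $c=b/(1+ilg)$ the integrand $be$ equals
    -- $ce+cVe$. The divergence identity for $ce$ turns this into $(c-\kappa c-Vc)e$: one derivative
    -- of $b$ is spent and one factor $(1+lg)^{-1}$ is gained. Dividing by $1+ilg$ instead of $ilg$
    -- keeps everything smooth where $g$ vanishes.
    set G : E → ℂ := fun x => (1 + Complex.I * ((l * g x : ℝ) : ℂ))⁻¹ with hG
    have hGs : ContDiff ℝ ∞ G := FieldBound.contDiff_inv_one_add hg l
    have hGb := hinv V S g l hV hg hl hg0 hgb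
    set c : E → ℂ := fun x => b x * G x with hc
    have hcs : ContDiff ℝ ∞ c := hb.mul hGs
    have hcb := FieldBound.mul hV hb hGs hbb hGb
    set e : E → ℂ := fun x => Complex.exp (Complex.I * ((l * Ψ x : ℝ) : ℂ)) with he
    have hes : ContDiff ℝ ∞ e := by
      have : ContDiff ℝ ∞ fun x => ((l * Ψ x : ℝ) : ℂ) :=
        Complex.ofRealCLM.contDiff.comp (contDiff_const.mul hΨ)
      exact (contDiff_const.mul this).cexp
    have heD : ∀ x, fieldDeriv V e x = Complex.I * ((l * g x : ℝ) : ℂ) * e x := by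
      intro x
      have h1 := (hΨ.differentiable (by simp) x).hasFDerivAt.const_mul l
      have h2 := ((Complex.ofRealCLM.hasFDerivAt.comp x h1).const_mul Complex.I).cexp
      have h3 : fderiv ℝ e x = _ := h2.fderiv
      rw [← hD]
      simp only [fieldDeriv, h3]
      simp [he]
      ring
    have hκ1 : ContDiff ℝ ∞ fun x => 1 + (-1) * κ x := contDiff_const.add (contDiff_const.mul hκ)
    have hDc : ContDiff ℝ ∞ fun x => (-1) * fieldDeriv V c x :=
      contDiff_const.mul (hcs.fieldDeriv hV)
    set b1 : E → ℂ := fun x => (1 + (-1) * κ x) * c x + (-1) * fieldDeriv V c x with hb1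
    have hb1s : ContDiff ℝ ∞ b1 := (hκ1.mul hcs).add hDc
    have hκ1b : FieldBound V S M (1 + C) (fun _ => 1) fun x => 1 + (-1) * κ x := by
      refine FieldBound.add hV contDiff_const (contDiff_const.mul hκ)
        (FieldBound.const (by simp)) ?_
      have := FieldBound.const_mul hV hκ (-1) (hκb.mono_level (Nat.le_succ M))
      simpa using this
    have hb1b : FieldBound V S M (2 ^ M * ((1 + C) * (2 ^ (M + 1) * (C * K))) +
        ‖(-1 : ℂ)‖ * (2 ^ (M + 1) * (C * K))) (fun x => w x * (1 + l * g x)⁻¹) b1 := by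
      have h1 := FieldBound.mul hV hκ1 hcs hκ1b (hcb.mono_level (Nat.le_succ M))
      simp only [one_mul] at h1
      exact FieldBound.add hV (hκ1.mul hcs) hDc h1
        (FieldBound.const_mul hV (hcs.fieldDeriv hV) (-1) (FieldBound.succ_iff.1 hcb).2)
    have hlg : ∀ x ∈ S, 0 ≤ (1 + l * g x)⁻¹ := fun x hx =>
      inv_nonneg.2 (by nlinarith [mul_nonneg hl (hg0 x hx)])
    have hcsupp : tsupport c ⊆ tsupport b := tsupport_mul_subset_left
    have hb1supp : tsupport b1 ⊆ tsupport b := by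
      refine (tsupport_add _ _).trans (Set.union_subset ?_ ?_)
      · exact tsupport_mul_subset_right.trans hcsupp
      · exact tsupport_mul_subset_right.trans ((tsupport_fieldDeriv_subset V c).trans hcsupp)
    have hmain := ih μ V κ g Ψ l b1 (fun x => w x * (1 + l * g x)⁻¹) S hV hκ hg hΨ hb1s hl hD hg0
      (fun x hx => mul_nonneg (hw0 x hx) (hlg x hx))
      ((hgb.mono_level (Nat.le_succ M)).mono_const (le_max_left _ _) hg0)
      ((hκb.mono_level (Nat.le_succ M)).mono_const (le_max_left _ _) (fun _ _ => zero_le_one))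
      (hb1b.mono_const (le_max_right _ _) (fun x hx => mul_nonneg (hw0 x hx) (hlg x hx)))
      hS (by filter_upwards [hsupp] with x hx h using hx (hb1supp h))
      (fun f hf hfs => hI f hf (hfs.trans hb1supp))
      (by convert hint using 2 with x; ring)
    have hbe : Integrable (fun x => b x * e x) μ := (hI _ (hb.mul hes) tsupport_mul_subset_left).1
    have hb1e : Integrable (fun x => b1 x * e x) μ :=
      (hI _ (hb1s.mul hes) (tsupport_mul_subset_left.trans hb1supp)).1
    have hce := (hI (fun x => c x * e x) (hcs.mul hes)
      (tsupport_mul_subset_left.trans hcsupp)).2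
    have hsub : ∫ x, b x * e x ∂μ = ∫ x, b1 x * e x ∂μ := by
      rw [← sub_eq_zero, ← integral_sub hbe hb1e, ← hce]
      refine integral_congr_ae (Filter.Eventually.of_forall fun x => ?_)
      simp only [fieldDeriv_mul hcs hes, heD, hb1]
      have hne := FieldBound.one_add_mul_I_ne_zero (l * g x)
      have : b x = c x * (1 + Complex.I * ((l * g x : ℝ) : ℂ)) := by
        simp only [hc, hG]
        field_simp
      rw [this]
      ring
    have hfin : ∀ x, w x * (1 + l * g x)⁻¹ * (1 + l * g x)⁻¹ ^ M = w x * (1 + l * g x)⁻¹ ^ (M + 1) := by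
      intro x; ring
    simp only [hfin] at hmain
    rw [hsub]
    exact hmain

/-! ### Integration by parts for compactly supported functions. -/

section Divergence

variable {E : Type*} [NormedAddCommGroup E] [NormedSpace ℝ E] [FiniteDimensional ℝ E]

/-- The divergence of a vector field. -/
noncomputable def divergence (X : E → E) (x : E) : ℝ :=
  LinearMap.trace ℝ E (fderiv ℝ X x : E →ₗ[ℝ] E)

theorem ContDiff.divergence {X : E → E} (hX : ContDiff ℝ ∞ X) : ContDiff ℝ ∞ (divergence X) := by
  let L : (E →L[ℝ] E) →ₗ[ℝ] ℝ := LinearMap.trace ℝ E ∘ₗ ContinuousLinearMap.coeLM ℝ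
  have h : _root_.divergence X = fun x => LinearMap.toContinuousLinearMap L (fderiv ℝ X x) := rfl
  rw [h]
  exact (LinearMap.toContinuousLinearMap L).contDiff.comp (hX.fderiv_right (m := ∞) (by simp))

theorem divergence_id : divergence (fun x : E => x) = fun _ => (Module.finrank ℝ E : ℝ) := by
  ext x
  simp [divergence]

variable [MeasurableSpace E] [BorelSpace E]

/-- In coordinates with respect to a basis the integrand is $\sum_i\partial_i(fX_i)$, and each term
integrates to zero. -/
theorem integral_fieldDeriv_add_divergence (μ : Measure E) [μ.IsAddHaarMeasure] {X : E → E}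
    (hX : ContDiff ℝ ∞ X) {f : E → ℂ} (hf : ContDiff ℝ ∞ f) (hfc : HasCompactSupport f) :
    ∫ x, (fieldDeriv X f x + (divergence X x : ℂ) * f x) ∂μ = 0 := by
  let b := Module.finBasis ℝ E
  let ℓ : Fin (Module.finrank ℝ E) → E →L[ℝ] ℝ := fun i => LinearMap.toContinuousLinearMap (b.coord i)
  let g : Fin (Module.finrank ℝ E) → E → ℂ := fun i x => ((ℓ i (X x) : ℝ) : ℂ)
  have hg : ∀ i, ContDiff ℝ ∞ (g i) := fun i =>
    Complex.ofRealCLM.contDiff.comp ((ℓ i).contDiff.comp hX)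
  have hg' : ∀ i x v, fderiv ℝ (g i) x v = ((ℓ i (fderiv ℝ X x v) : ℝ) : ℂ) := by
    intro i x v
    have : HasFDerivAt (g i) (Complex.ofRealCLM ∘L ℓ i ∘L fderiv ℝ X x) x :=
      Complex.ofRealCLM.hasFDerivAt.comp x ((ℓ i).hasFDerivAt.comp x
        (hX.differentiable (by simp) x).hasFDerivAt)
    rw [this.fderiv]
    simp
  have hint : ∀ h : E → ℂ, Continuous h → tsupport h ⊆ tsupport f → Integrable h μ := fun h hc hs =>
    hc.integrable_of_hasCompactSupport (hfc.of_isClosed_subset (isClosed_tsupport _) hs)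
  have hdf : ∀ v, Continuous fun x => fderiv ℝ f x v := fun v =>
    ((hf.fderiv_right (m := ∞) (by simp)).clm_apply contDiff_const).continuous
  have hdg : ∀ i v, Continuous fun x => fderiv ℝ (g i) x v := fun i v =>
    (((hg i).fderiv_right (m := ∞) (by simp)).clm_apply contDiff_const).continuous
  have h1 : ∀ i, Integrable (fun x => fderiv ℝ f x (b i) * g i x) μ := fun i =>
    hint _ ((hdf _).mul (hg i).continuous)
      (tsupport_mul_subset_left.trans (tsupport_fieldDeriv_subset (fun _ => b i) f))
  have h2 : ∀ i, Integrable (fun x => f x * fderiv ℝ (g i) x (b i)) μ := fun i =>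
    hint _ (hf.continuous.mul (hdg i _)) tsupport_mul_subset_left
  have h3 : ∀ i, Integrable (fun x => f x * g i x) μ := fun i =>
    hint _ (hf.continuous.mul (hg i).continuous) tsupport_mul_subset_left
  have key : ∀ i, ∫ x, (fderiv ℝ f x (b i) * g i x + f x * fderiv ℝ (g i) x (b i)) ∂μ = 0 := by
    intro i
    rw [integral_add (h1 i) (h2 i), integral_mul_fderiv_eq_neg_fderiv_mul_of_integrable (h1 i) (h2 i)
      (h3 i) (fun x _ => hf.differentiable (by simp) x)
      (fun x _ => (hg i).differentiable (by simp) x), add_neg_cancel]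
  have hsum : ∀ x, fieldDeriv X f x + (divergence X x : ℂ) * f x =
      ∑ i, (fderiv ℝ f x (b i) * g i x + f x * fderiv ℝ (g i) x (b i)) := by
    intro x
    rw [Finset.sum_add_distrib]
    congr 1
    · rw [fieldDeriv]
      conv_lhs => rw [← b.sum_repr (X x), map_sum]
      refine Finset.sum_congr rfl fun i _ => ?_
      simp [g, ℓ, mul_comm]
    · rw [divergence, LinearMap.trace_eq_matrix_trace ℝ b, Matrix.trace, mul_comm, ← Finset.mul_sum]
      congr 1
      push_cast
      refine Finset.sum_congr rfl fun i _ => ?_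
      simp [hg', ℓ, LinearMap.toMatrix_apply]
  simp_rw [hsum]
  have h4 : ∀ i ∈ Finset.univ, Integrable
      (fun x => fderiv ℝ f x (b i) * g i x + f x * fderiv ℝ (g i) x (b i)) μ :=
    fun i _ => (h1 i).add (h2 i)
  rw [integral_finsetSum _ h4]
  simp [key]

end Divergence

/-! ### The divergence theorem for fields tangent to the boundary. -/

section Tangent

theorem deriv_smoothTransition_bounded : ∃ K : ℝ, ∀ t, |deriv Real.smoothTransition t| ≤ K := by
  have hc : Continuous (deriv Real.smoothTransition) :=
    Real.smoothTransition.contDiff.continuous_deriv (n := 1) (by norm_num)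
  have hs : HasCompactSupport (deriv Real.smoothTransition) := by
    refine HasCompactSupport.intro (isCompact_Icc (a := (0 : ℝ)) (b := 1)) fun t ht => ?_
    rcases not_and_or.1 ht with h | h
    · have : Real.smoothTransition =ᶠ[nhds t] fun _ => 0 := by
        filter_upwards [Iio_mem_nhds (not_le.1 h)] with s hs
        exact Real.smoothTransition.zero_of_nonpos (le_of_lt hs)
      simp [this.deriv_eq]
    · have : Real.smoothTransition =ᶠ[nhds t] fun _ => 1 := by
        filter_upwards [Ioi_mem_nhds (not_le.1 h)] with s hs
        exact Real.smoothTransition.one_of_one_le (le_of_lt hs)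
      simp [this.deriv_eq]
  obtain ⟨K, hK⟩ := hc.bounded_above_of_compact_support hs
  exact ⟨K, hK⟩

variable {E : Type*} [NormedAddCommGroup E] [NormedSpace ℝ E] [FiniteDimensional ℝ E]
  [MeasurableSpace E] [BorelSpace E]

/-- The divergence theorem on a sublevel set `{ρ ≤ 0}` without boundary contribution. -/
theorem setIntegral_fieldDeriv_add_divergence (μ : Measure E) [μ.IsAddHaarMeasure] {B : Set E}
    (hB : IsCompact B) {ρ : E → ℝ} (hρ : ContDiff ℝ ∞ ρ) (hBρ : ∀ x, x ∈ B ↔ ρ x ≤ 0)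
    (hnull : μ {x | ρ x = 0} = 0) {X : E → E} (hX : ContDiff ℝ ∞ X) {f : E → ℂ}
    (hf : ContDiff ℝ ∞ f) {C : ℝ} (hC : ∀ x ∈ B, ‖f x‖ * |fderiv ℝ ρ x (X x)| ≤ C * |ρ x|) :
    ∫ x in B, (fieldDeriv X f x + (divergence X x : ℂ) * f x) ∂μ = 0 := by
  obtain ⟨K, hK⟩ := deriv_smoothTransition_bounded
  have hK0 : 0 ≤ K := (abs_nonneg _).trans (hK 0)
  set ε : ℕ → ℝ := fun n => (1 / 2 : ℝ) ^ n with hε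
  have hε0 : ∀ n, 0 < ε n := fun n => by positivity
  have hεt : Filter.Tendsto ε Filter.atTop (nhds 0) :=
    tendsto_pow_atTop_nhds_zero_of_lt_one (by norm_num) (by norm_num)
  -- The cutoff $\theta_n$ vanishes for $-\rho\le\varepsilon_n$ and equals $1$ for
  -- $-\rho\ge2\varepsilon_n$, so $f\theta_n$ is compactly supported in $B$ and its derivative error
  -- lives in a layer of depth comparable to $\varepsilon_n$.
  let T : ℕ → E → ℝ := fun n x => -ρ x / ε n - 1
  let θ : ℕ → E → ℝ := fun n x => Real.smoothTransition (T n x)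
  have hT : ∀ n, ContDiff ℝ ∞ (T n) := fun n => (hρ.neg.div_const _).sub contDiff_const
  have hθ : ∀ n, ContDiff ℝ ∞ (θ n) := fun n => Real.smoothTransition.contDiff.comp (hT n)
  have hθc : ∀ n, ContDiff ℝ ∞ fun x => ((θ n x : ℝ) : ℂ) := fun n =>
    Complex.ofRealCLM.contDiff.comp (hθ n)
  have hθ0 : ∀ n x, x ∉ B → θ n x = 0 := fun n x hx => by
    have : 0 < ρ x := by rw [hBρ] at hx; exact not_le.1 hx
    apply Real.smoothTransition.zero_of_nonpos
    have : -ρ x / ε n ≤ 0 := div_nonpos_of_nonpos_of_nonneg (by linarith) (hε0 n).le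
    simp only [T]; linarith
  have hθ' : ∀ n x, fieldDeriv X (θ n) x =
      deriv Real.smoothTransition (T n x) * (-(fderiv ℝ ρ x (X x)) / ε n) := by
    intro n x
    have h1 : HasFDerivAt (T n) ((ε n)⁻¹ • (-fderiv ℝ ρ x)) x := by
      have h := ((hρ.differentiable (by simp) x).hasFDerivAt.fun_neg.mul_const (ε n)⁻¹).sub_const 1
      simpa only [T, div_eq_mul_inv] using h
    have h2 : HasFDerivAt (θ n) _ x :=
      ((Real.smoothTransition.contDiff (n := 1)).differentiable (by simp) _).hasDerivAt.comp_hasFDerivAt x h1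
    rw [fieldDeriv, h2.fderiv]
    simp
    ring
  have hθ'c : ∀ n x, fieldDeriv X (fun x => ((θ n x : ℝ) : ℂ)) x = ((fieldDeriv X (θ n) x : ℝ) : ℂ) :=
    fun n x => congrFun (fieldDeriv_clm_comp Complex.ofRealCLM (hθ n)) x
  have hsupp : ∀ n, tsupport (fun x => f x * ((θ n x : ℝ) : ℂ)) ⊆ B := fun n => by
    refine closure_minimal (fun x hx => ?_) hB.isClosed
    by_contra h
    exact hx (by simp [hθ0 n x h])
  set F : E → ℂ := fun x => fieldDeriv X f x + (divergence X x : ℂ) * f x with hF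
  have hFc : Continuous F := ((hf.fieldDeriv hX).add
    ((Complex.ofRealCLM.contDiff.comp hX.divergence).mul hf)).continuous
  have hFi : IntegrableOn F B μ := hFc.continuousOn.integrableOn_compact hB
  have hstep : ∀ n, ∫ x in B, (θ n x : ℂ) * F x ∂μ =
      - ∫ x in B, f x * ((fieldDeriv X (θ n) x : ℝ) : ℂ) ∂μ := by
    intro n
    have h0 := integral_fieldDeriv_add_divergence μ hX (hf.mul (hθc n))
      (hB.of_isClosed_subset (isClosed_tsupport _) (hsupp n))
    rw [← setIntegral_eq_integral_of_forall_compl_eq_zero (s := B)] at h0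
    · rw [← sub_eq_zero, sub_neg_eq_add, ← integral_add, ← h0]
      · congr 1
        ext x
        simp only [fieldDeriv_mul hf (hθc n), hθ'c, hF]
        ring
      · exact (((hθc n).continuous.mul hFc).continuousOn).integrableOn_compact hB
      · refine ((hf.continuous.mul (Complex.continuous_ofReal.comp
          ((hθ n).fieldDeriv hX).continuous)).continuousOn).integrableOn_compact hB
    · intro x hx
      have h1 : x ∉ tsupport (fun x => f x * ((θ n x : ℝ) : ℂ)) := fun h => hx (hsupp n h)
      have h2 := image_eq_zero_of_notMem_tsupport
        (fun h => h1 (tsupport_fieldDeriv_subset X _ h))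
      rw [h2, image_eq_zero_of_notMem_tsupport h1]
      simp
  have hae : ∀ᵐ x ∂(μ.restrict B), ρ x < 0 := by
    rw [ae_restrict_iff' hB.measurableSet]
    have : ∀ᵐ x ∂μ, ρ x ≠ 0 := by simpa [ae_iff] using hnull
    filter_upwards [this] with x hx hxB
    exact lt_of_le_of_ne ((hBρ x).1 hxB) hx
  have hbig : ∀ x, ρ x < 0 → ∀ᶠ n in Filter.atTop, 1 < T n x := by
    intro x hx
    filter_upwards [hεt.eventually (Iio_mem_nhds (show (0 : ℝ) < -ρ x / 2 by linarith))] with n hn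
    have h1 : ε n < -ρ x / 2 := hn
    have : 2 < -ρ x / ε n := by rw [lt_div_iff₀ (hε0 n)]; linarith
    simp only [T]; linarith
  have hd0 : ∀ t, 1 < t ∨ t < 0 → deriv Real.smoothTransition t = 0 := by
    rintro t (h | h)
    · have : Real.smoothTransition =ᶠ[nhds t] fun _ => 1 := by
        filter_upwards [Ioi_mem_nhds h] with s hs
        exact Real.smoothTransition.one_of_one_le (le_of_lt hs)
      simp [this.deriv_eq]
    · have : Real.smoothTransition =ᶠ[nhds t] fun _ => 0 := by
        filter_upwards [Iio_mem_nhds h] with s hs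
        exact Real.smoothTransition.zero_of_nonpos (le_of_lt hs)
      simp [this.deriv_eq]
  have hlim1 : Filter.Tendsto (fun n => ∫ x in B, (θ n x : ℂ) * F x ∂μ) Filter.atTop
      (nhds (∫ x in B, F x ∂μ)) := by
    refine tendsto_integral_of_dominated_convergence (fun x => ‖F x‖)
      (fun n => (((hθc n).continuous.mul hFc)).aestronglyMeasurable) hFi.norm ?_ ?_
    · intro n
      refine Filter.Eventually.of_forall fun x => ?_
      rw [norm_mul, Complex.norm_real, Real.norm_of_nonneg (Real.smoothTransition.nonneg _)]
      exact mul_le_of_le_one_left (norm_nonneg _) (Real.smoothTransition.le_one _)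
    · filter_upwards [hae] with x hx
      refine tendsto_const_nhds.congr' ?_
      filter_upwards [hbig x hx] with n hn
      simp [θ, Real.smoothTransition.one_of_one_le hn.le]
  -- In the layer $|\rho|\le2\varepsilon_n$, so the hypothesis $|f|\,|X\rho|\le C|\rho|$ compensates
  -- the factor $\varepsilon_n^{-1}$ from $X\theta_n$; this is the dominating bound. Pointwise the
  -- error is eventually zero off $\{\rho=0\}$, a null set.
  have hlim2 : Filter.Tendsto (fun n => ∫ x in B, f x * ((fieldDeriv X (θ n) x : ℝ) : ℂ) ∂μ)
      Filter.atTop (nhds (∫ x in B, (0 : ℂ) ∂μ)) := by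
    refine tendsto_integral_of_dominated_convergence (fun x => K * (2 * |C|))
      (fun n => ((hf.continuous.mul (Complex.continuous_ofReal.comp
          ((hθ n).fieldDeriv hX).continuous))).aestronglyMeasurable)
      (by rw [← IntegrableOn]; exact continuousOn_const.integrableOn_compact hB) ?_ ?_
    · intro n
      filter_upwards [ae_restrict_mem hB.measurableSet] with x hx
      rw [norm_mul, Complex.norm_real, hθ', norm_mul, Real.norm_eq_abs, Real.norm_eq_abs]
      by_cases h : 1 < T n x
      · rw [hd0 _ (Or.inl h)]; simp; positivity
      · have hρx : ρ x ≤ 0 := (hBρ x).1 hx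
        have h1 : |ρ x| ≤ 2 * ε n := by
          have h2 : -ρ x / ε n ≤ 2 := by simp only [T] at h; linarith
          rw [div_le_iff₀ (hε0 n)] at h2
          rwa [abs_of_nonpos hρx]
        have h3 : ‖f x‖ * |fderiv ℝ ρ x (X x)| ≤ |C| * (2 * ε n) :=
          (hC x hx).trans (mul_le_mul (le_abs_self C) h1 (abs_nonneg _) (abs_nonneg _))
        rw [abs_div, abs_neg, abs_of_pos (hε0 n)]
        calc ‖f x‖ * (|deriv Real.smoothTransition (T n x)| * (|fderiv ℝ ρ x (X x)| / ε n))
            = |deriv Real.smoothTransition (T n x)| * (‖f x‖ * |fderiv ℝ ρ x (X x)| / ε n) := by ring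
          _ ≤ K * (|C| * (2 * ε n) / ε n) := by
            have := (hε0 n).le
            gcongr
            exact hK _
          _ = K * (2 * |C|) := by have := (hε0 n).ne'; field_simp
    · filter_upwards [hae] with x hx
      refine tendsto_const_nhds.congr' ?_
      filter_upwards [hbig x hx] with n hn
      rw [hθ', hd0 _ (Or.inl hn)]
      simp
  rw [integral_zero] at hlim2
  have hlim3 := hlim2.neg
  simp_rw [← hstep, neg_zero] at hlim3
  exact tendsto_nhds_unique hlim1 hlim3

end Tangent

/-! ### Integration over the boundary layer. -/

section Layer

variable {E : Type*} [NormedAddCommGroup E] [InnerProductSpace ℝ E] [FiniteDimensional ℝ E]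
  [MeasurableSpace E] [BorelSpace E]

/-- The divergence identity is applied to the field $\nabla\rho$ and the function $\arctan(l\rho)$,
which vanishes on the boundary. The derivative term is $l|\nabla\rho|^2/(1+(l\rho)^2)$ and the other
one is bounded by $\frac\pi2|\operatorname{div}\nabla\rho|$, so
$\int|\nabla\rho|^2/(1+(l\rho)^2)=O(l^{-1})$. Since $|\nabla\rho|^2+\rho^2$ is bounded below on $B$,
it remains to treat $\rho^2/(1+(l\rho)^2)$, which is at most $|\rho|/(2l)$. -/
theorem setIntegral_inv_one_add_le (μ : Measure E) [μ.IsAddHaarMeasure] {B : Set E}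
    (hB : IsCompact B) {ρ : E → ℝ} {G : E → E} (hρ : ContDiff ℝ ∞ ρ) (hG : ContDiff ℝ ∞ G)
    (hρG : ∀ x v, fderiv ℝ ρ x v = ⟪G x, v⟫_ℝ) (hBρ : ∀ x, x ∈ B ↔ ρ x ≤ 0)
    (hnull : μ {x | ρ x = 0} = 0) (hG0 : ∀ x, ρ x = 0 → G x ≠ 0) :
    ∃ C, 0 ≤ C ∧ ∀ l : ℝ, 0 < l → ∫ x in B, (1 + l * |ρ x|)⁻¹ ^ 2 ∂μ ≤ C * l⁻¹ := by
  obtain ⟨c, hc, hcB⟩ : ∃ c > 0, ∀ x ∈ B, c ≤ ‖G x‖ ^ 2 + ρ x ^ 2 := by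
    have hcont : ContinuousOn (fun x => ‖G x‖ ^ 2 + ρ x ^ 2) B :=
      ((hG.continuous.norm.pow 2).add (hρ.continuous.pow 2)).continuousOn
    rcases B.eq_empty_or_nonempty with h | h
    · exact ⟨1, one_pos, by simp [h]⟩
    · obtain ⟨x, hx, hm⟩ := hB.exists_isMinOn h hcont
      refine ⟨_, ?_, fun y hy => hm hy⟩
      by_cases h0 : ρ x = 0
      · have := norm_pos_iff.2 (hG0 x h0); positivity
      · positivity
  have hdG := hG.divergence
  set I1 := ∫ x in B, |divergence G x| ∂μ with hI1
  set I2 := ∫ x in B, |ρ x| ∂μ with hI2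
  have hI1n : 0 ≤ I1 := integral_nonneg fun _ => abs_nonneg _
  have hI2n : 0 ≤ I2 := integral_nonneg fun _ => abs_nonneg _
  have hpi := Real.pi_pos
  refine ⟨c⁻¹ * (Real.pi / 2 * I1 + I2 / 2), by positivity, fun l hl => ?_⟩
  have hcO : ∀ h : E → ℝ, Continuous h → IntegrableOn h B μ := fun h hh =>
    hh.continuousOn.integrableOn_compact hB
  have hρc := hρ.continuous
  have hGc := hG.continuous
  have hden : ∀ x, 0 < 1 + (l * ρ x) ^ 2 := fun x => by positivity
  have hcd : Continuous fun x => (1 + (l * ρ x) ^ 2)⁻¹ :=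
    Continuous.inv₀ (by fun_prop) fun x => (hden x).ne'
  have hat : ContDiff ℝ ∞ fun x => Real.arctan (l * ρ x) :=
    Real.contDiff_arctan.comp (contDiff_const.mul hρ)
  have hatc : ContDiff ℝ ∞ fun x => ((Real.arctan (l * ρ x) : ℝ) : ℂ) :=
    Complex.ofRealCLM.contDiff.comp hat
  have hfd : ∀ x, fieldDeriv G (fun x => Real.arctan (l * ρ x)) x =
      l * (‖G x‖ ^ 2 * (1 + (l * ρ x) ^ 2)⁻¹) := by
    intro x
    have h1 := ((hρ.differentiable (by simp) x).hasFDerivAt.const_mul l).arctan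
    rw [fieldDeriv, h1.fderiv]
    simp [hρG]
    ring
  obtain ⟨CG, hCG⟩ : ∃ CG, ∀ x ∈ B, ‖G x‖ ^ 2 ≤ CG := by
    obtain ⟨CG, h⟩ := hB.exists_bound_of_continuousOn (hGc.norm.pow 2).continuousOn
    exact ⟨CG, fun x hx => (le_abs_self _).trans (h x hx)⟩
  have habs : ∀ t : ℝ, |Real.arctan t| ≤ |t| := by
    intro t
    have h := Convex.norm_image_sub_le_of_norm_deriv_le (f := Real.arctan) (s := Set.univ) (C := 1)
      (x := 0) (y := t) (fun x _ => Real.differentiableAt_arctan x) (fun x _ => by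
        rw [Real.deriv_arctan, Real.norm_of_nonneg (by positivity), div_le_one (by positivity)]
        nlinarith [sq_nonneg x]) convex_univ (Set.mem_univ _) (Set.mem_univ _)
    simpa using h
  have hz := setIntegral_fieldDeriv_add_divergence μ hB hρ hBρ hnull hG hatc (C := l * CG)
    (fun x hx => by
      rw [Complex.norm_real, Real.norm_eq_abs, hρG, real_inner_self_eq_norm_sq,
        abs_of_nonneg (by positivity : 0 ≤ ‖G x‖ ^ 2)]
      have h1 := habs (l * ρ x)
      rw [abs_mul, abs_of_pos hl] at h1
      calc _ ≤ (l * |ρ x|) * CG := mul_le_mul h1 (hCG x hx) (by positivity) (by positivity)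
        _ = _ := by ring)
  have hz' : ∫ x in B, (l * (‖G x‖ ^ 2 * (1 + (l * ρ x) ^ 2)⁻¹) +
      divergence G x * Real.arctan (l * ρ x)) ∂μ = 0 := by
    have h0 : ∀ x, fieldDeriv G (fun x => ((Real.arctan (l * ρ x) : ℝ) : ℂ)) x +
        (divergence G x : ℂ) * ((Real.arctan (l * ρ x) : ℝ) : ℂ) =
        (((l * (‖G x‖ ^ 2 * (1 + (l * ρ x) ^ 2)⁻¹) +
      divergence G x * Real.arctan (l * ρ x)) : ℝ) : ℂ) := by
      intro x
      have := congrFun (fieldDeriv_clm_comp (V := G) Complex.ofRealCLM hat) x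
      simp only [Complex.ofRealCLM_apply] at this
      rw [this, hfd]
      push_cast
      ring
    simp_rw [h0] at hz
    rw [integral_complex_ofReal] at hz
    exact_mod_cast hz
  have hi1 : IntegrableOn (fun x => ‖G x‖ ^ 2 * (1 + (l * ρ x) ^ 2)⁻¹) B μ :=
    hcO _ ((hGc.norm.pow 2).mul hcd)
  have hi2 : IntegrableOn (fun x => divergence G x * Real.arctan (l * ρ x)) B μ :=
    hcO _ (hdG.continuous.mul hat.continuous)
  rw [integral_add (hi1.const_mul l) hi2, integral_const_mul] at hz'
  have hA : l * ∫ x in B, ‖G x‖ ^ 2 * (1 + (l * ρ x) ^ 2)⁻¹ ∂μ ≤ Real.pi / 2 * I1 := by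
    have h1 : |∫ x in B, divergence G x * Real.arctan (l * ρ x) ∂μ| ≤ Real.pi / 2 * I1 := by
      rw [hI1, ← integral_const_mul]
      rw [← Real.norm_eq_abs]
      refine norm_integral_le_of_norm_le ((hcO _ hdG.continuous).abs.const_mul _) ?_
      refine Filter.Eventually.of_forall fun x => ?_
      rw [Real.norm_eq_abs, abs_mul, mul_comm]
      gcongr
      rw [abs_le]
      exact ⟨(Real.neg_pi_div_two_lt_arctan _).le, (Real.arctan_lt_pi_div_two _).le⟩
    linarith [neg_abs_le (∫ x in B, divergence G x * Real.arctan (l * ρ x) ∂μ)]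
  have hpt : ∀ x ∈ B, (1 + l * |ρ x|)⁻¹ ^ 2 ≤
      c⁻¹ * (‖G x‖ ^ 2 * (1 + (l * ρ x) ^ 2)⁻¹ + (2 * l)⁻¹ * |ρ x|) := by
    intro x hx
    have h1 : (1 + l * |ρ x|)⁻¹ ^ 2 ≤ (1 + (l * ρ x) ^ 2)⁻¹ := by
      rw [inv_pow]
      apply inv_anti₀ (hden x)
      have : (l * ρ x) ^ 2 = (l * |ρ x|) ^ 2 := by rw [mul_pow, mul_pow, sq_abs]
      rw [this]
      have : 0 ≤ l * |ρ x| := by positivity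
      nlinarith
    have h2 : ρ x ^ 2 * (1 + (l * ρ x) ^ 2)⁻¹ ≤ (2 * l)⁻¹ * |ρ x| := by
      rw [← div_eq_mul_inv, div_le_iff₀ (hden x), mul_assoc, inv_mul_eq_div, le_div_iff₀ (by positivity)]
      rw [mul_pow, ← sq_abs (ρ x)]
      nlinarith [mul_nonneg (abs_nonneg (ρ x)) (sq_nonneg (1 - l * |ρ x|))]
    calc _ ≤ (1 + (l * ρ x) ^ 2)⁻¹ := h1
      _ = c⁻¹ * (c * (1 + (l * ρ x) ^ 2)⁻¹) := by field_simp
      _ ≤ c⁻¹ * ((‖G x‖ ^ 2 + ρ x ^ 2) * (1 + (l * ρ x) ^ 2)⁻¹) := by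
        have := (hden x).le
        gcongr
        exact hcB x hx
      _ ≤ _ := by
        gcongr
        linarith
  have hi3 : IntegrableOn (fun x => (2 * l)⁻¹ * |ρ x|) B μ := hcO _ (by fun_prop)
  calc ∫ x in B, (1 + l * |ρ x|)⁻¹ ^ 2 ∂μ
      ≤ ∫ x in B, c⁻¹ * (‖G x‖ ^ 2 * (1 + (l * ρ x) ^ 2)⁻¹ + (2 * l)⁻¹ * |ρ x|) ∂μ := by
        refine setIntegral_mono_on (hcO _ ?_) ((hi1.add hi3).const_mul _) hB.measurableSet hpt
        refine Continuous.pow (Continuous.inv₀ (by fun_prop) fun x => ?_) 2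
        have : 0 ≤ l * |ρ x| := by positivity
        linarith
    _ = c⁻¹ * (∫ x in B, ‖G x‖ ^ 2 * (1 + (l * ρ x) ^ 2)⁻¹ ∂μ + (2 * l)⁻¹ * I2) := by
        rw [integral_const_mul, integral_add hi1 hi3, integral_const_mul]
    _ ≤ c⁻¹ * (l⁻¹ * (Real.pi / 2 * I1) + (2 * l)⁻¹ * I2) := by
        gcongr
        rw [inv_mul_eq_div, le_div_iff₀ hl]
        linarith
    _ = _ := by rw [mul_inv]; ring

end Layer

/-! ### One-variable cutoffs under the dilation field. -/

section Cutoff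

/-- A fixed smooth even bump on the line, equal to `1` on `[-1/2, 1/2]`, supported in `[-1, 1]`. -/
noncomputable def cutoff : ℝ → ℝ :=
  (⟨1 / 2, 1, by norm_num, by norm_num⟩ : ContDiffBump (0 : ℝ))

theorem contDiff_cutoff : ContDiff ℝ ∞ cutoff := ContDiffBump.contDiff _

theorem cutoff_eq_one {s : ℝ} (h : |s| ≤ 1 / 2) : cutoff s = 1 :=
  ContDiffBump.one_of_mem_closedBall _ (by simpa using h)

theorem cutoff_eq_zero {s : ℝ} (h : 1 ≤ |s|) : cutoff s = 0 :=
  ContDiffBump.zero_of_le_dist _ (by simpa using h)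

theorem cutoff_nonneg (s : ℝ) : 0 ≤ cutoff s := ContDiffBump.nonneg _

theorem cutoff_le_one (s : ℝ) : cutoff s ≤ 1 := ContDiffBump.le_one _

theorem hasCompactSupport_cutoff : HasCompactSupport cutoff :=
  HasCompactSupport.intro (isCompact_Icc (a := (-1 : ℝ)) (b := 1)) fun s hs => by
    refine cutoff_eq_zero ?_
    by_contra h
    exact hs (abs_le.1 (not_le.1 h).le)

/-- The field $2s\,\frac{d}{ds}$ is the form that the Euler field $z\cdot\nabla$ takes on functions
of a quadratic form $s=q(z)$; see `fieldDeriv_iterate_comp_quadratic`. -/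
theorem bounded_fieldDeriv_cutoff (n : ℕ) : ∃ C, 0 ≤ C ∧
    FieldBound (fun s : ℝ => 2 * s) Set.univ n C (fun _ => 1) cutoff := by
  have h : ∀ j : ℕ, ∃ C, ∀ s, ‖(fieldDeriv (fun s : ℝ => 2 * s))^[j] cutoff s‖ ≤ C := by
    intro j
    have hs : tsupport ((fieldDeriv (fun s : ℝ => 2 * s))^[j] cutoff) ⊆ tsupport cutoff := by
      induction j with
      | zero => exact subset_rfl
      | succ j ih =>
        rw [Function.iterate_succ_apply']
        exact (tsupport_fieldDeriv_subset _ _).trans ih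
    exact (contDiff_cutoff.fieldDeriv_iterate (contDiff_const.mul contDiff_id) j).continuous
      |>.bounded_above_of_compact_support
        (hasCompactSupport_cutoff.of_isClosed_subset (isClosed_tsupport _) hs)
  choose C hC using h
  refine ⟨∑ j ∈ Finset.range (n + 1), |C j|, by positivity, fun j hj s _ => ?_⟩
  rw [mul_one]
  exact ((hC j s).trans (le_abs_self _)).trans (Finset.single_le_sum (f := fun j => |C j|)
    (fun _ _ => abs_nonneg _) (Finset.mem_range.2 (by omega)))

/-- The function vanishes identically for $|s|<\frac12$, and elsewhere $1\le2|s|$ turns a constant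
bound into a linear one. -/
theorem bounded_fieldDeriv_one_sub_cutoff (n : ℕ) : ∃ C, 0 ≤ C ∧
    FieldBound (fun s : ℝ => 2 * s) Set.univ n C (fun s => |s|) (fun s => 1 + (-1) * cutoff s) := by
  obtain ⟨C, hC, h⟩ := bounded_fieldDeriv_cutoff n
  have hV : ContDiff ℝ ∞ (fun s : ℝ => 2 * s) := contDiff_const.mul contDiff_id
  have h1 := FieldBound.add hV contDiff_const (contDiff_const.mul contDiff_cutoff)
    (FieldBound.const (c := (1 : ℝ)) (C := 1) (V := fun s : ℝ => 2 * s) (n := n) (S := Set.univ)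
      (w := fun _ => 1) (by simp)) (FieldBound.const_mul hV contDiff_cutoff (-1) h)
  refine ⟨2 * (1 + C), by positivity, fun j hj s hs => ?_⟩
  by_cases hs2 : |s| < 1 / 2
  · have he : (fun s => 1 + (-1) * cutoff s) =ᶠ[nhds s] fun _ => 0 := by
      filter_upwards [(isOpen_lt continuous_abs continuous_const).mem_nhds hs2] with t ht
      rw [cutoff_eq_one (le_of_lt ht)]; norm_num
    rw [(fieldDeriv_eqOn_of_eventuallyEq he j).eq_of_nhds]
    have := FieldBound.const (V := fun s : ℝ => 2 * s) (n := n) (S := Set.univ)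
      (w := fun s : ℝ => |s|) (c := (0 : ℝ)) (C := 2 * (1 + C)) (by intro x _; simp; positivity)
    exact this j hj s hs
  · have := h1 j hj s hs
    simp only [norm_neg, norm_one, one_mul, mul_one] at this
    nlinarith

/-- The factor $s$ survives every differentiation because the field $2s\,\frac{d}{ds}$ vanishes at
the origin. It yields the linear weight in `bounded_fieldDeriv_one_sub_exp`. -/
theorem exists_polynomial_fieldDeriv_exp (j : ℕ) : ∃ p : Polynomial ℝ, ∀ s,
    (fieldDeriv (fun s : ℝ => 2 * s))^[j + 1] (fun s => 1 - Real.exp (-s)) s =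
      s * (p.eval s * Real.exp (-s)) := by
  induction j with
  | zero =>
    refine ⟨2, fun s => ?_⟩
    have h : HasDerivAt (fun s => 1 - Real.exp (-s)) (Real.exp (-s)) s := by
      simpa using ((hasDerivAt_neg s).exp).const_sub 1
    simp [fieldDeriv, h.hasFDerivAt.fderiv, mul_assoc, mul_left_comm]
  | succ j ih =>
    obtain ⟨p, hp⟩ := ih
    refine ⟨2 * (p + Polynomial.X * p.derivative - Polynomial.X * p), fun s => ?_⟩
    rw [Function.iterate_succ_apply', show (fieldDeriv (fun s : ℝ => 2 * s))^[j + 1]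
      (fun s => 1 - Real.exp (-s)) = _ from funext hp]
    have h : HasDerivAt (fun s => s * (p.eval s * Real.exp (-s))) _ s :=
      (hasDerivAt_id s).mul ((p.hasDerivAt s).mul ((hasDerivAt_neg s).exp))
    simp only [fieldDeriv, h.hasFDerivAt.fderiv]
    simp
    ring

theorem bounded_fieldDeriv_one_sub_exp (n : ℕ) : ∃ C, 0 ≤ C ∧
    FieldBound (fun s : ℝ => 2 * s) (Set.Ici 0) n C (fun s => s) (fun s => 1 - Real.exp (-s)) := by
  have h : ∀ j : ℕ, ∃ C, ∀ s, 0 ≤ s →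
      ‖(fieldDeriv (fun s : ℝ => 2 * s))^[j] (fun s => 1 - Real.exp (-s)) s‖ ≤ C * s := by
    intro j
    cases j with
    | zero =>
      refine ⟨1, fun s hs => ?_⟩
      have := Real.add_one_le_exp (-s)
      have h2 : Real.exp (-s) ≤ 1 := Real.exp_le_one_iff.2 (by linarith)
      rw [Function.iterate_zero, id, Real.norm_of_nonneg (by linarith)]
      linarith
    | succ j =>
      obtain ⟨p, hp⟩ := exists_polynomial_fieldDeriv_exp j
      have ht : Filter.Tendsto (fun s => p.eval s * Real.exp (-s)) Filter.atTop (nhds 0) := by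
        simpa [div_eq_mul_inv, ← Real.exp_neg] using p.tendsto_div_exp_atTop
      have hb : ∃ C, ∀ s ∈ Set.Ici (0 : ℝ), ‖p.eval s * Real.exp (-s)‖ ≤ C := by
        obtain ⟨T, hT⟩ := Filter.eventually_atTop.1
          (ht.norm.eventually (Iio_mem_nhds (show ‖(0 : ℝ)‖ < 1 by simp)))
        obtain ⟨C, hC⟩ := (isCompact_Icc (a := (0 : ℝ)) (b := T)).exists_bound_of_continuousOn
          (f := fun s => p.eval s * Real.exp (-s)) (by fun_prop)
        refine ⟨max C 1, fun s hs => ?_⟩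
        by_cases h : s ≤ T
        · exact (hC s ⟨hs, h⟩).trans (le_max_left _ _)
        · exact (le_of_lt (hT s (not_le.1 h).le)).trans (le_max_right _ _)
      obtain ⟨C, hC⟩ := hb
      refine ⟨C, fun s hs => ?_⟩
      rw [hp, norm_mul, Real.norm_of_nonneg hs, mul_comm]
      exact mul_le_mul_of_nonneg_right (hC s hs) hs
  choose C hC using h
  refine ⟨∑ j ∈ Finset.range (n + 1), |C j|, by positivity, fun j hj s hs => ?_⟩
  refine (hC j s hs).trans (mul_le_mul_of_nonneg_right ?_ hs)
  exact (le_abs_self _).trans (Finset.single_le_sum (f := fun j => |C j|)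
    (fun _ _ => abs_nonneg _) (Finset.mem_range.2 (by omega)))

/-- Dilation derivatives of a function of a quadratic form. -/
theorem fieldDeriv_iterate_comp_quadratic {F : Type*} [NormedAddCommGroup F] [NormedSpace ℝ F]
    {q : F → ℝ} (hq : ContDiff ℝ ∞ q) (hq2 : ∀ z, fderiv ℝ q z z = 2 * q z) {H : ℝ → ℝ}
    (hH : ContDiff ℝ ∞ H) (j : ℕ) :
    (fieldDeriv fun z : F => z)^[j] (fun z => H (q z)) =
      fun z => (fieldDeriv fun s : ℝ => 2 * s)^[j] H (q z) := by
  have hV : ContDiff ℝ ∞ (fun s : ℝ => 2 * s) := contDiff_const.mul contDiff_id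
  induction j with
  | zero => rfl
  | succ j ih =>
    rw [Function.iterate_succ_apply', Function.iterate_succ_apply', ih]
    ext z
    have h := ((hH.fieldDeriv_iterate hV j).differentiable (by simp) (q z)).hasFDerivAt.comp z
      (hq.differentiable (by simp) z).hasFDerivAt
    have h' : fderiv ℝ (fun z => (fieldDeriv fun s : ℝ => 2 * s)^[j] H (q z)) z = _ := h.fderiv
    simp [fieldDeriv, h', hq2]

theorem FieldBound.comp_quadratic {F : Type*} [NormedAddCommGroup F] [NormedSpace ℝ F]
    {q : F → ℝ} (hq : ContDiff ℝ ∞ q) (hq2 : ∀ z, fderiv ℝ q z z = 2 * q z) {H : ℝ → ℝ}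
    (hH : ContDiff ℝ ∞ H) {n : ℕ} {C : ℝ} {w : ℝ → ℝ} {T : Set ℝ} {S : Set F}
    (h : FieldBound (fun s : ℝ => 2 * s) T n C w H) (hS : ∀ z ∈ S, q z ∈ T) :
    FieldBound (fun z : F => z) S n C (fun z => w (q z)) (fun z => H (q z)) := by
  intro j hj z hz
  rw [fieldDeriv_iterate_comp_quadratic hq hq2 hH j]
  exact h j hj _ (hS z hz)

end Cutoff

/-! ### Integrals of weights depending on a quadratic form. -/

section Quadratic

variable {F : Type*} [NormedAddCommGroup F] [InnerProductSpace ℝ F]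

theorem contDiff_norm_sq_clm (A : F →L[ℝ] F) : ContDiff ℝ ∞ fun z => ‖A z‖ ^ 2 :=
  A.contDiff.norm_sq ℝ

theorem fderiv_norm_sq_clm (A : F →L[ℝ] F) (c : ℝ) (z : F) :
    fderiv ℝ (fun z => c * ‖A z‖ ^ 2) z z = 2 * (c * ‖A z‖ ^ 2) := by
  have h : HasFDerivAt (fun z => c * ‖A z‖ ^ 2) _ z := (A.hasFDerivAt.norm_sq).const_mul c
  rw [h.fderiv]
  simp
  ring

variable [FiniteDimensional ℝ F] [MeasurableSpace F] [BorelSpace F]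

theorem integral_comp_clm (A : F →L[ℝ] F) (hA : A.det ≠ 0) {G : Type*} [NormedAddCommGroup G]
    [NormedSpace ℝ G] (f : F → G) :
    ∫ z, f (A z) = |A.det|⁻¹ • ∫ z, f z := by
  let e : F ≃L[ℝ] F := A.toContinuousLinearEquivOfDetNeZero hA
  have hm : Measure.map A volume = ENNReal.ofReal |(A.det)⁻¹| • (volume : Measure F) :=
    Measure.map_linearMap_addHaar_eq_smul_addHaar volume hA
  have he : MeasurableEmbedding A := e.toHomeomorph.measurableEmbedding
  rw [← he.integral_map, hm, integral_smul_measure, abs_inv, ENNReal.toReal_ofReal (by positivity)]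

theorem integrable_comp_clm (A : F →L[ℝ] F) (hA : A.det ≠ 0) {G : Type*} [NormedAddCommGroup G]
    {f : F → G} (hf : Integrable f) : Integrable fun z => f (A z) := by
  let e : F ≃L[ℝ] F := A.toContinuousLinearEquivOfDetNeZero hA
  have hm : Measure.map A volume = ENNReal.ofReal |(A.det)⁻¹| • (volume : Measure F) :=
    Measure.map_linearMap_addHaar_eq_smul_addHaar volume hA
  have he : MeasurableEmbedding A := e.toHomeomorph.measurableEmbedding
  have := hf.smul_measure (c := ENNReal.ofReal |(A.det)⁻¹|) ENNReal.ofReal_ne_top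
  rw [← hm, he.integrable_map_iff] at this
  exact this

theorem integrable_norm_pow_mul_inv_one_add (k M : ℕ) (hM : Module.finrank ℝ F + 2 * k < 2 * M) :
    Integrable fun w : F => (‖w‖ ^ 2) ^ k * (1 + ‖w‖ ^ 2)⁻¹ ^ M := by
  have hkM : k ≤ M := by omega
  have h := integrable_rpow_neg_one_add_norm_sq (E := F) (μ := volume) (r := 2 * ((M - k : ℕ) : ℝ))
    (by rw [Nat.cast_sub hkM]; have : ((Module.finrank ℝ F + 2 * k : ℕ) : ℝ) < ((2 * M : ℕ) : ℝ) := by exact_mod_cast hM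
        push_cast at this; linarith)
  refine h.mono' (by
    refine Continuous.aestronglyMeasurable (Continuous.mul (by fun_prop) ?_)
    exact Continuous.pow (Continuous.inv₀ (by fun_prop) fun x => by positivity) M) ?_
  refine Filter.Eventually.of_forall fun w => ?_
  rw [Real.norm_of_nonneg (by positivity)]
  have h1 : (0 : ℝ) < 1 + ‖w‖ ^ 2 := by positivity
  have h2 : (1 + ‖w‖ ^ 2) ^ (-(2 * ((M - k : ℕ) : ℝ)) / 2) = (1 + ‖w‖ ^ 2)⁻¹ ^ (M - k) := by
    rw [neg_div, mul_div_cancel_left₀ _ (two_ne_zero), Real.rpow_neg h1.le, Real.rpow_natCast, inv_pow]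
  rw [h2]
  calc (‖w‖ ^ 2) ^ k * (1 + ‖w‖ ^ 2)⁻¹ ^ M ≤ (1 + ‖w‖ ^ 2) ^ k * (1 + ‖w‖ ^ 2)⁻¹ ^ M := by
        gcongr; linarith
    _ = (1 + ‖w‖ ^ 2)⁻¹ ^ (M - k) := by
        rw [← Nat.sub_add_cancel hkM, pow_add]
        simp
        field_simp

/-- The substitution $w=\sqrt l\,Az$ removes $A$ and $l$; the condition on $M$ is integrability of
the rescaled weight at infinity. -/
theorem integral_quadratic_weight (k M : ℕ) (hM : Module.finrank ℝ F + 2 * k < 2 * M) :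
    ∃ c, 0 ≤ c ∧ ∀ (A : F →L[ℝ] F) (l : ℝ), A.det ≠ 0 → 0 < l →
      Integrable (fun z => (‖A z‖ ^ 2) ^ k * (1 + l * ‖A z‖ ^ 2)⁻¹ ^ M) ∧
      ∫ z, (‖A z‖ ^ 2) ^ k * (1 + l * ‖A z‖ ^ 2)⁻¹ ^ M =
        c * (|A.det|⁻¹ * l ^ (-((k : ℝ) + (Module.finrank ℝ F : ℝ) / 2))) := by
  have h0 := integrable_norm_pow_mul_inv_one_add (F := F) k M hM
  refine ⟨∫ w : F, (‖w‖ ^ 2) ^ k * (1 + ‖w‖ ^ 2)⁻¹ ^ M, integral_nonneg fun _ => by positivity, ?_⟩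
  intro A l hA hl
  set s := Real.sqrt l with hs
  have hs0 : 0 < s := Real.sqrt_pos.2 hl
  have hs2 : s ^ 2 = l := Real.sq_sqrt hl.le
  have hdet : (s • A).det = s ^ (Module.finrank ℝ F) * A.det := by
    simp [ContinuousLinearMap.det, LinearMap.det_smul]
  have hdet0 : (s • A).det ≠ 0 := by rw [hdet]; positivity
  have hfun : ∀ z, (‖A z‖ ^ 2) ^ k * (1 + l * ‖A z‖ ^ 2)⁻¹ ^ M =
      (l ^ k)⁻¹ * ((‖(s • A) z‖ ^ 2) ^ k * (1 + ‖(s • A) z‖ ^ 2)⁻¹ ^ M) := by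
    intro z
    have : ‖(s • A) z‖ ^ 2 = l * ‖A z‖ ^ 2 := by
      simp [norm_smul, mul_pow, hs2]
    rw [this, mul_pow]
    field_simp
  simp_rw [hfun]
  refine ⟨(integrable_comp_clm (s • A) hdet0 h0).const_mul _, ?_⟩
  rw [integral_const_mul, integral_comp_clm (s • A) hdet0 (fun w => (‖w‖ ^ 2) ^ k * (1 + ‖w‖ ^ 2)⁻¹ ^ M)]
  have hpow : l ^ (-((k : ℝ) + (Module.finrank ℝ F : ℝ) / 2)) = (l ^ k)⁻¹ * (s ^ (Module.finrank ℝ F))⁻¹ := by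
    rw [Real.rpow_neg hl.le, Real.rpow_add hl, Real.rpow_natCast, mul_inv, hs, Real.sqrt_eq_rpow,
      ← Real.rpow_natCast (l ^ (1 / 2 : ℝ)), ← Real.rpow_mul hl.le]
    congr 3
    ring
  rw [hpow, hdet, abs_mul, abs_of_pos (by positivity : 0 < s ^ (Module.finrank ℝ F)), smul_eq_mul]
  rw [mul_inv]
  ring

end Quadratic

/-! ### Oscillatory integrals with a nondegenerate quadratic phase. -/

section QuadraticPhase

variable {F : Type*} [NormedAddCommGroup F] [InnerProductSpace ℝ F]

theorem fieldDeriv_iterate_norm_sq_clm (A : F →L[ℝ] F) (c : ℝ) (j : ℕ) :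
    (fieldDeriv fun z : F => z)^[j] (fun z => c * ‖A z‖ ^ 2) = fun z => 2 ^ j * (c * ‖A z‖ ^ 2) := by
  induction j with
  | zero => simp
  | succ j ih =>
    rw [Function.iterate_succ_apply', ih]
    ext z
    have := fderiv_norm_sq_clm A (2 ^ j * c) z
    simp only [mul_assoc] at this
    simp only [fieldDeriv, this]
    ring

theorem FieldBound.norm_sq_clm (A : F →L[ℝ] F) (c : ℝ) (hc : 0 ≤ c) (S : Set F) (n : ℕ) :
    FieldBound (fun z : F => z) S n (2 ^ n * c) (fun z => ‖A z‖ ^ 2) (fun z => c * ‖A z‖ ^ 2) := by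
  intro j hj z _
  rw [fieldDeriv_iterate_norm_sq_clm, Real.norm_of_nonneg (by positivity), mul_assoc]
  exact mul_le_mul_of_nonneg_right (pow_le_pow_right₀ (by norm_num) hj) (by positivity)

variable [FiniteDimensional ℝ F] [MeasurableSpace F] [BorelSpace F]

/-- Integration by parts is carried out along the Euler field, whose divergence is the constant $n$.
The phase speed $|Az|^2+z\cdot\nabla P$ is at least $\frac12|Az|^2$, and $k+n+1$ steps make the
weight $|Az|^{2k}$ integrable. By scaling, each factor $|Az|^2$ of the amplitude is worth $l^{-1}$.
-/
theorem quadratic_oscillatory_bound (F : Type*) [NormedAddCommGroup F] [InnerProductSpace ℝ F]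
    [FiniteDimensional ℝ F] [MeasurableSpace F] [BorelSpace F] (k : ℕ) (C : ℝ) :
    ∃ K, 0 ≤ K ∧ ∀ (A : F →L[ℝ] F) (P : F → ℝ) (S : Set F) (l : ℝ) (b : F → ℂ), A.det ≠ 0 →
      ContDiff ℝ ∞ P → MeasurableSet S → 0 < l → ContDiff ℝ ∞ b → HasCompactSupport b →
      tsupport b ⊆ S → (∀ z ∈ S, |fderiv ℝ P z z| ≤ ‖A z‖ ^ 2 / 2) →
      FieldBound (fun z : F => z) S (k + Module.finrank ℝ F + 2) C (fun z => ‖A z‖ ^ 2) P →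
      FieldBound (fun z : F => z) S (k + Module.finrank ℝ F + 1) C (fun z => (‖A z‖ ^ 2) ^ k) b →
      ‖∫ z, b z * Complex.exp (Complex.I * ((l * (1 / 2 * ‖A z‖ ^ 2 + P z) : ℝ) : ℂ))‖ ≤
        K * (|A.det|⁻¹ * l ^ (-((k : ℝ) + (Module.finrank ℝ F : ℝ) / 2))) := by
  set n := Module.finrank ℝ F with hn
  set M := k + n + 1 with hM
  obtain ⟨c, hc, hint⟩ := integral_quadratic_weight (F := F) k M (by omega)
  -- The factor $2$ comes from $|Az|^2\le2g$, used to bound the derivatives of $g$ by $g$ itself;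
  -- the summand $n$ bounds the divergence of the Euler field.
  set C0 : ℝ := 2 * (2 ^ M * 1 + |C|) + n with hC0
  have hCC0 : C ≤ C0 := by
    have := le_abs_self C
    have : (0 : ℝ) ≤ 2 ^ M := by positivity
    have : (0 : ℝ) ≤ n := by positivity
    rw [hC0]; linarith [abs_nonneg C]
  obtain ⟨K, hK, hosc⟩ := oscillatory_bound M C0
  refine ⟨K * (c * (1 / 2) ^ (-((k : ℝ) + (n : ℝ) / 2))), by positivity, ?_⟩
  intro A P S l b hA hP hS hl hb hbc hbS hVP hPb hbb
  have hV : ContDiff ℝ ∞ (fun z : F => z) := contDiff_id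
  have hQ := contDiff_norm_sq_clm A
  have hQ1 : ContDiff ℝ ∞ fun z => 1 * ‖A z‖ ^ 2 := contDiff_const.mul hQ
  have hDP := hP.fieldDeriv hV
  set g : F → ℝ := fun z => 1 * ‖A z‖ ^ 2 + fieldDeriv (fun z : F => z) P z with hg
  have hgs : ContDiff ℝ ∞ g := hQ1.add hDP
  have hglow : ∀ z ∈ S, 1 / 2 * ‖A z‖ ^ 2 ≤ g z := fun z hz => by
    have := (abs_le.1 (hVP z hz)).1
    simp only [hg, fieldDeriv]
    linarith
  have hg0 : ∀ z ∈ S, 0 ≤ g z := fun z hz => le_trans (by positivity) (hglow z hz)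
  have hgb : FieldBound (fun z : F => z) S M C0 g g := by
    have h1 := FieldBound.add hV hQ1 hDP (FieldBound.norm_sq_clm A 1 zero_le_one S M)
      (FieldBound.succ_iff.1 hPb).2
    refine h1.weaken fun z hz => ?_
    have h2 := hglow z hz
    have h3 : (2 ^ M * 1 + C) * ‖A z‖ ^ 2 ≤ (2 ^ M * 1 + |C|) * ‖A z‖ ^ 2 := by
      gcongr; exact le_abs_self C
    have h4 : 0 ≤ (2 ^ M * 1 + |C|) := by positivity
    have h5 : (0 : ℝ) ≤ n := by positivity
    calc _ ≤ (2 ^ M * 1 + |C|) * ‖A z‖ ^ 2 := h3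
      _ ≤ (2 ^ M * 1 + |C|) * (2 * g z) := by gcongr; linarith
      _ ≤ C0 * g z := by rw [hC0]; nlinarith [hg0 z hz]
  have hΨ : fieldDeriv (fun z : F => z) (fun z => 1 / 2 * ‖A z‖ ^ 2 + P z) = g := by
    rw [fieldDeriv_add (contDiff_const.mul hQ) hP]
    ext z
    simp only [hg, fieldDeriv, fderiv_norm_sq_clm]
    ring
  have hmain := hosc volume (fun z : F => z) (fun _ => (n : ℂ)) g
    (fun z => 1 / 2 * ‖A z‖ ^ 2 + P z) l b (fun z => (‖A z‖ ^ 2) ^ k) S hV contDiff_const hgs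
    ((contDiff_const.mul hQ).add hP) hb hl.le hΨ hg0 (fun z _ => by positivity) hgb
    (FieldBound.const fun z _ => by
      rw [Complex.norm_natCast, hC0]; have : (0 : ℝ) ≤ 2 ^ M := by positivity
      linarith [abs_nonneg C])
    (hbb.mono_const hCC0 fun z _ => by positivity) hS
    (Filter.Eventually.of_forall fun x hx => hbS hx)
    (fun f hf hfb => by
      have hfc := hbc.of_isClosed_subset (isClosed_tsupport f) hfb
      refine ⟨hf.continuous.integrable_of_hasCompactSupport hfc, ?_⟩
      have := integral_fieldDeriv_add_divergence (volume : Measure F) hV hf hfc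
      simpa [divergence_id] using this)
  obtain ⟨hi, hv⟩ := hint A (l * (1 / 2)) hA (by positivity)
  have hle : ∀ z ∈ S, (‖A z‖ ^ 2) ^ k * (1 + l * g z)⁻¹ ^ M ≤
      (‖A z‖ ^ 2) ^ k * (1 + l * (1 / 2) * ‖A z‖ ^ 2)⁻¹ ^ M := fun z hz => by
    have := mul_le_mul_of_nonneg_left (hglow z hz) hl.le
    have h0 := mul_nonneg hl.le (hg0 z hz)
    refine mul_le_mul_of_nonneg_left ?_ (by positivity)
    refine pow_le_pow_left₀ (by positivity) (inv_anti₀ (by positivity) (by linarith)) _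
  have hmeas : IntegrableOn (fun z => (‖A z‖ ^ 2) ^ k * (1 + l * g z)⁻¹ ^ M) S := by
    refine Integrable.mono' hi.integrableOn ?_ ?_
    · refine Measurable.aestronglyMeasurable ?_
      have := hgs.continuous.measurable
      have := hQ.continuous.measurable
      fun_prop
    · filter_upwards [ae_restrict_mem hS] with z hz
      rw [Real.norm_of_nonneg]
      · exact hle z hz
      · have := hg0 z hz
        positivity
  refine (hmain hmeas).trans ?_
  rw [mul_assoc]
  refine mul_le_mul_of_nonneg_left ?_ hK
  calc _ ≤ ∫ z in S, (‖A z‖ ^ 2) ^ k * (1 + l * (1 / 2) * ‖A z‖ ^ 2)⁻¹ ^ M :=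
        setIntegral_mono_on hmeas hi.integrableOn hS hle
    _ ≤ ∫ z, (‖A z‖ ^ 2) ^ k * (1 + l * (1 / 2) * ‖A z‖ ^ 2)⁻¹ ^ M :=
        setIntegral_le_integral hi (Filter.Eventually.of_forall fun z => by positivity)
    _ = _ := by
        rw [hv, Real.mul_rpow hl.le (by norm_num)]
        ring

/-- The Fresnel integral with Gaussian damping. -/
theorem integral_gaussian_quadratic (A : F →L[ℝ] F) (hA : A.det ≠ 0) {b : ℂ} (hb : 0 < b.re) :
    ∫ z, Complex.exp (-b * ‖A z‖ ^ 2) =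
      |A.det|⁻¹ • (Real.pi / b : ℂ) ^ ((Module.finrank ℝ F : ℂ) / 2) := by
  rw [integral_comp_clm A hA fun w => Complex.exp (-b * ‖w‖ ^ 2),
    GaussianFourier.integral_cexp_neg_mul_sq_norm hb]

theorem integrable_gaussian_quadratic (A : F →L[ℝ] F) (hA : A.det ≠ 0) {b : ℝ} (hb : 0 < b) :
    Integrable fun z => Real.exp (-(b * ‖A z‖ ^ 2)) := by
  have h := GaussianFourier.integrable_cexp_neg_mul_sq_norm_add (V := F) (b := (b : ℂ))
    (by simpa using hb) 0 0
  have h2 := (integrable_comp_clm A hA h).norm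
  refine h2.congr (Filter.Eventually.of_forall fun z => ?_)
  simp only [Complex.norm_exp]
  congr 1
  simp [← Complex.ofReal_pow]

/-- Here $\pi/(-il/2)=(2\pi/l)\,i$, and the principal branch gives $i^{n/2}=e^{i\pi n/4}$. This is
the source of the phase shifts in the theorem. -/
theorem fresnel_constant {l : ℝ} (hl : 0 < l) (n : ℕ) :
    (Real.pi / (0 - Complex.I * ((l / 2 : ℝ) : ℂ)) : ℂ) ^ ((n : ℂ) / 2) =
      ((2 * Real.pi / l) ^ ((n : ℝ) / 2) : ℝ) * Complex.exp (Real.pi * Complex.I * n / 4) := by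
  have hr : 0 < 2 * Real.pi / l := by positivity
  have h1 : (Real.pi / (0 - Complex.I * ((l / 2 : ℝ) : ℂ)) : ℂ) =
      ((2 * Real.pi / l : ℝ) : ℂ) * Complex.I := by
    have : (l : ℂ) ≠ 0 := by exact_mod_cast hl.ne'
    have hI := Complex.I_ne_zero
    push_cast
    rw [zero_sub, div_eq_iff (by simp [this, hI])]
    field_simp
    rw [Complex.I_sq]
    ring
  rw [h1, Complex.cpow_def_of_ne_zero (mul_ne_zero (by exact_mod_cast hr.ne') Complex.I_ne_zero),
    Complex.log_ofReal_mul hr Complex.I_ne_zero, Complex.log_I, Real.rpow_def_of_pos hr,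
    Complex.ofReal_exp, ← Complex.exp_add]
  congr 1
  push_cast
  ring

end QuadraticPhase

/-! ### The Fresnel integral with a cutoff. -/

section StationaryPhase

variable {F : Type*} [NormedAddCommGroup F] [InnerProductSpace ℝ F]

theorem contDiff_smul_norm_sq (c : ℝ) : ContDiff ℝ ∞ fun z : F => c * ‖z‖ ^ 2 :=
  contDiff_const.mul (contDiff_norm_sq ℝ)

theorem contDiff_radial_cutoff (c : ℝ) : ContDiff ℝ ∞ fun z : F => cutoff (c * ‖z‖ ^ 2) :=
  contDiff_cutoff.comp (contDiff_smul_norm_sq c)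

theorem radial_cutoff_eq_zero {F : Type*} [NormedAddCommGroup F] {r : ℝ} (hr : 0 < r) {z : F} (hz : r ≤ ‖z‖) :
    cutoff ((r ^ 2)⁻¹ * ‖z‖ ^ 2) = 0 := by
  apply cutoff_eq_zero
  rw [abs_of_nonneg (by positivity), inv_mul_eq_div, le_div_iff₀ (by positivity), one_mul]
  gcongr

theorem tsupport_radial_cutoff_subset {F : Type*} [NormedAddCommGroup F] {r : ℝ} (hr : 0 < r) :
    tsupport (fun z : F => cutoff ((r ^ 2)⁻¹ * ‖z‖ ^ 2)) ⊆ Metric.closedBall 0 r := by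
  refine closure_minimal (fun z hz => ?_) Metric.isClosed_closedBall
  rw [mem_closedBall_zero_iff]
  by_contra h
  exact hz (radial_cutoff_eq_zero hr (not_le.1 h).le)

theorem hasCompactSupport_radial_cutoff [FiniteDimensional ℝ F] {r : ℝ} (hr : 0 < r) :
    HasCompactSupport (fun z : F => cutoff ((r ^ 2)⁻¹ * ‖z‖ ^ 2)) :=
  (isCompact_closedBall (0 : F) r).of_isClosed_subset (isClosed_tsupport _)
    (tsupport_radial_cutoff_subset hr)

theorem FieldBound.radial {H : ℝ → ℝ} (hH : ContDiff ℝ ∞ H) {n : ℕ} {C : ℝ} {w : ℝ → ℝ}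
    {T : Set ℝ} {S : Set F} {c : ℝ} (h : FieldBound (fun s : ℝ => 2 * s) T n C w H)
    (hS : ∀ z ∈ S, c * ‖z‖ ^ 2 ∈ T) :
    FieldBound (fun z : F => z) S n C (fun z => w (c * ‖z‖ ^ 2)) (fun z => H (c * ‖z‖ ^ 2)) :=
  FieldBound.comp_quadratic (contDiff_smul_norm_sq c)
    (fun z => by simpa using fderiv_norm_sq_clm (ContinuousLinearMap.id ℝ F) c z) hH h hS

/-- The two amplitudes agree at the origin and their difference is $O(|Az|^2/(\delta r^2))$ together
with its Euler derivatives, so the case $k=1$ of `quadratic_oscillatory_bound` applies. The bound is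
uniform in $R$ and $\beta$, which permits the limits $R\to\infty$ and then $\beta\to0$. -/
theorem fresnel_cutoff_sub_gaussian (F : Type*) [NormedAddCommGroup F] [InnerProductSpace ℝ F]
    [FiniteDimensional ℝ F] [MeasurableSpace F] [BorelSpace F] :
    ∃ K, 0 ≤ K ∧ ∀ (A : F →L[ℝ] F) (δ r R β l : ℝ), A.det ≠ 0 → 0 < δ → 0 < r → r ≤ R → 0 < l →
      0 ≤ β → β ≤ (δ * r ^ 2)⁻¹ → (∀ z, δ * ‖z‖ ^ 2 ≤ ‖A z‖ ^ 2) →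
      ‖∫ z, ((cutoff ((r ^ 2)⁻¹ * ‖z‖ ^ 2) -
          cutoff ((R ^ 2)⁻¹ * ‖z‖ ^ 2) * Real.exp (-(β * ‖A z‖ ^ 2)) : ℝ) : ℂ) *
          Complex.exp (Complex.I * ((l * (1 / 2 * ‖A z‖ ^ 2) : ℝ) : ℂ))‖ ≤
        K * ((δ * r ^ 2)⁻¹ * (|A.det|⁻¹ * l ^ (-(1 + (Module.finrank ℝ F : ℝ) / 2)))) := by
  set n := Module.finrank ℝ F with hn
  set M := 1 + n + 1 with hM
  obtain ⟨C1, hC1, h1⟩ := bounded_fieldDeriv_one_sub_cutoff M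
  obtain ⟨C2, hC2, h2⟩ := bounded_fieldDeriv_cutoff M
  obtain ⟨C3, hC3, h3⟩ := bounded_fieldDeriv_one_sub_exp M
  set C := C1 + C1 + 2 ^ M * (C2 * C3) with hC
  have hC0 : 0 ≤ C := by positivity
  obtain ⟨K, hK, hosc⟩ := quadratic_oscillatory_bound F 1 C
  refine ⟨K, hK, ?_⟩
  intro A δ r R β l hA hδ hr hrR hl hβ hβD hAδ
  have hR : 0 < R := hr.trans_le hrR
  set D := (δ * r ^ 2)⁻¹ with hD
  have hD0 : 0 < D := by positivity
  have hV : ContDiff ℝ ∞ (fun z : F => z) := contDiff_id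
  set Q : F → ℝ := fun z => ‖A z‖ ^ 2 with hQ
  have hQ0 : ∀ z, 0 ≤ Q z := fun z => by positivity
  have hQs : ContDiff ℝ ∞ Q := contDiff_norm_sq_clm A
  have hqQ : ∀ s, r ≤ s → ∀ z : F, (s ^ 2)⁻¹ * ‖z‖ ^ 2 ≤ D * Q z := by
    intro s hs z
    have hs0 : 0 < s := hr.trans_le hs
    calc (s ^ 2)⁻¹ * ‖z‖ ^ 2 ≤ (r ^ 2)⁻¹ * ‖z‖ ^ 2 := by gcongr
      _ = D * (δ * ‖z‖ ^ 2) := by rw [hD]; field_simp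
      _ ≤ D * Q z := by gcongr; exact hAδ z
  have hone : ContDiff ℝ ∞ fun s => 1 + (-1) * cutoff s :=
    contDiff_const.add (contDiff_const.mul contDiff_cutoff)
  have hones : ∀ c : ℝ, ContDiff ℝ ∞ fun z : F => 1 + (-1) * cutoff (c * ‖z‖ ^ 2) := fun c =>
    hone.comp (contDiff_smul_norm_sq c)
  have hcut : ∀ s, r ≤ s → FieldBound (fun z : F => z) Set.univ M C1 (fun z => D * Q z)
      (fun z => 1 + (-1) * cutoff ((s ^ 2)⁻¹ * ‖z‖ ^ 2)) := by
    intro s hs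
    have hs0 : 0 < s := hr.trans_le hs
    refine (FieldBound.radial hone h1 fun _ _ => Set.mem_univ _).weaken fun z _ => ?_
    rw [abs_of_nonneg (by positivity)]
    exact mul_le_mul_of_nonneg_left (hqQ s hs z) hC1
  have hexpf : ContDiff ℝ ∞ fun s : ℝ => 1 - Real.exp (-s) :=
    contDiff_const.sub (Real.contDiff_exp.comp contDiff_neg)
  have hβQ : ContDiff ℝ ∞ fun z => β * ‖A z‖ ^ 2 := contDiff_const.mul hQs
  have hexps : ContDiff ℝ ∞ fun z => 1 - Real.exp (-(β * ‖A z‖ ^ 2)) := hexpf.comp hβQ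
  have hexp : FieldBound (fun z : F => z) Set.univ M C3 (fun z => D * Q z)
      (fun z => 1 - Real.exp (-(β * ‖A z‖ ^ 2))) := by
    refine (FieldBound.comp_quadratic hβQ (fun z => fderiv_norm_sq_clm A β z)
      hexpf h3 fun z _ => Set.mem_Ici.2 (by positivity)).weaken fun z _ => ?_
    exact mul_le_mul_of_nonneg_left (mul_le_mul_of_nonneg_right hβD (hQ0 z)) hC3
  have hcutR : FieldBound (fun z : F => z) Set.univ M C2 (fun _ => 1)
      (fun z => cutoff ((R ^ 2)⁻¹ * ‖z‖ ^ 2)) :=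
    FieldBound.radial contDiff_cutoff h2 fun _ _ => Set.mem_univ _
  have hmul := FieldBound.mul hV (contDiff_radial_cutoff _) hexps hcutR hexp
  have hsum := FieldBound.add hV ((hones _).add (contDiff_const.mul (hones _)))
    ((contDiff_radial_cutoff _).mul hexps)
    (FieldBound.add hV (hones _) (contDiff_const.mul (hones _)) (hcut R hrR)
      (FieldBound.const_mul hV (hones _) (-1) (hcut r le_rfl)))
    (hmul.weaken (C' := 2 ^ M * (C2 * C3)) (w' := fun z => D * Q z) (fun z _ => by simp))
  have hsums := ((hones ((R ^ 2)⁻¹)).add (contDiff_const (c := (-1 : ℝ)).mul (hones ((r ^ 2)⁻¹)))).add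
    ((contDiff_radial_cutoff ((R ^ 2)⁻¹)).mul hexps)
  set b : F → ℝ := fun z => cutoff ((r ^ 2)⁻¹ * ‖z‖ ^ 2) -
          cutoff ((R ^ 2)⁻¹ * ‖z‖ ^ 2) * Real.exp (-(β * ‖A z‖ ^ 2)) with hb
  -- Writing $\chi_r-\chi_Re^{-\beta Q}=(1-\chi_R)-(1-\chi_r)+\chi_R(1-e^{-\beta Q})$ displays three
  -- pieces, each of which is $O(DQ)$.
  have hbeq : (fun z => (1 + (-1) * cutoff ((R ^ 2)⁻¹ * ‖z‖ ^ 2) +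
      (-1) * (1 + (-1) * cutoff ((r ^ 2)⁻¹ * ‖z‖ ^ 2))) + cutoff ((R ^ 2)⁻¹ * ‖z‖ ^ 2) *
        (1 - Real.exp (-(β * ‖A z‖ ^ 2)))) = b := by
    ext z; simp only [hb]; ring
  have hbs : ContDiff ℝ ∞ b := by rw [← hbeq]; exact hsums
  have hbb : FieldBound (fun z : F => z) Set.univ M C (fun z => D * Q z) b := by
    rw [← hbeq]
    simpa [hC] using hsum
  have hbzero : ∀ z, R ≤ ‖z‖ → b z = 0 := fun z hz => by
    simp only [hb]
    rw [radial_cutoff_eq_zero hR hz, radial_cutoff_eq_zero hr (hrR.trans hz)]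
    simp
  set b' : F → ℂ := fun z => ((D⁻¹ : ℝ) : ℂ) * ((b z : ℝ) : ℂ) with hb'
  have hbc : ContDiff ℝ ∞ fun z => ((b z : ℝ) : ℂ) := Complex.ofRealCLM.contDiff.comp hbs
  have hb's : ContDiff ℝ ∞ b' := contDiff_const.mul hbc
  have hb'c : HasCompactSupport b' :=
    HasCompactSupport.intro (isCompact_closedBall (0 : F) R) fun z hz => by
      rw [mem_closedBall_zero_iff, not_le] at hz
      simp [hb', hbzero z hz.le]
  have hb'b : FieldBound (fun z : F => z) Set.univ M C (fun z => (‖A z‖ ^ 2) ^ 1) b' := by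
    refine (FieldBound.const_mul hV hbc _ (hbb.ofReal hV hbs)).weaken fun z _ => ?_
    rw [Complex.norm_real, Real.norm_of_nonneg (by positivity), pow_one]
    apply le_of_eq
    have := hD0.ne'
    field_simp
    simp only [hQ]
  have hmain := hosc A (fun _ => 0) Set.univ l b' hA contDiff_const MeasurableSet.univ hl hb's hb'c
    (Set.subset_univ _) (fun z _ => by simp; positivity)
    (FieldBound.const fun z _ => by simp; positivity) hb'b
  have hfin : ∫ z, b' z * Complex.exp (Complex.I * ((l * (1 / 2 * ‖A z‖ ^ 2 + 0) : ℝ) : ℂ)) =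
      ((D⁻¹ : ℝ) : ℂ) * ∫ z, ((b z : ℝ) : ℂ) *
        Complex.exp (Complex.I * ((l * (1 / 2 * ‖A z‖ ^ 2) : ℝ) : ℂ)) := by
    rw [← integral_const_mul]
    simp only [hb', mul_assoc, add_zero]
  rw [hfin, norm_mul, Complex.norm_real, Real.norm_of_nonneg (by positivity), Nat.cast_one,
    inv_mul_le_iff₀ hD0] at hmain
  refine hmain.trans (le_of_eq ?_)
  ring

/-- As the outer radius tends to infinity the comparison integral becomes an exact complex Gaussian,
and as the damping $\beta$ tends to $0$ its value tends to the Fresnel constant. The distance to the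
cutoff integral stays controlled throughout. -/
theorem fresnel_cutoff_asymptotic (F : Type*) [NormedAddCommGroup F] [InnerProductSpace ℝ F]
    [FiniteDimensional ℝ F] [MeasurableSpace F] [BorelSpace F] :
    ∃ K, 0 ≤ K ∧ ∀ (A : F →L[ℝ] F) (δ r l : ℝ), A.det ≠ 0 → 0 < δ → 0 < r → 0 < l →
      (∀ z, δ * ‖z‖ ^ 2 ≤ ‖A z‖ ^ 2) →
      ‖(∫ z, ((cutoff ((r ^ 2)⁻¹ * ‖z‖ ^ 2) : ℝ) : ℂ) *
          Complex.exp (Complex.I * ((l * (1 / 2 * ‖A z‖ ^ 2) : ℝ) : ℂ))) -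
        |A.det|⁻¹ • ((((2 * Real.pi / l) ^ ((Module.finrank ℝ F : ℝ) / 2) : ℝ) : ℂ) *
          Complex.exp (Real.pi * Complex.I * (Module.finrank ℝ F) / 4))‖ ≤
        K * ((δ * r ^ 2)⁻¹ * (|A.det|⁻¹ * l ^ (-(1 + (Module.finrank ℝ F : ℝ) / 2)))) := by
  obtain ⟨K, hK, hbd⟩ := fresnel_cutoff_sub_gaussian F
  refine ⟨K, hK, ?_⟩
  intro A δ r l hA hδ hr hl hAδ
  set n := Module.finrank ℝ F with hn
  set D := (δ * r ^ 2)⁻¹ with hD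
  have hD0 : 0 < D := by positivity
  set e : F → ℂ := fun z => Complex.exp (Complex.I * ((l * (1 / 2 * ‖A z‖ ^ 2) : ℝ) : ℂ)) with he
  have hec : Continuous e := by fun_prop
  have hen : ∀ z, ‖e z‖ = 1 := fun z => by
    simp only [he]; rw [mul_comm, Complex.norm_exp_ofReal_mul_I]
  set I0 := ∫ z, ((cutoff ((r ^ 2)⁻¹ * ‖z‖ ^ 2) : ℝ) : ℂ) * e z with hI0
  have hint : ∀ (s β : ℝ), 0 < s → Integrable fun z : F =>
      ((cutoff ((s ^ 2)⁻¹ * ‖z‖ ^ 2) * Real.exp (-(β * ‖A z‖ ^ 2)) : ℝ) : ℂ) * e z := by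
    intro s β hs
    refine Continuous.integrable_of_hasCompactSupport ?_ ?_
    · have := (contDiff_radial_cutoff (F := F) ((s ^ 2)⁻¹)).continuous
      fun_prop
    · refine HasCompactSupport.intro (isCompact_closedBall (0 : F) s) fun z hz => ?_
      rw [mem_closedBall_zero_iff, not_le] at hz
      simp [radial_cutoff_eq_zero hs hz.le]
  have hgauss : ∀ β : ℝ, 0 < β → β ≤ D →
      ‖I0 - ∫ z, ((Real.exp (-(β * ‖A z‖ ^ 2)) : ℝ) : ℂ) * e z‖ ≤
        K * (D * (|A.det|⁻¹ * l ^ (-(1 + (n : ℝ) / 2)))) := by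
    intro β hβ hβD
    have hlim : Filter.Tendsto (fun m : ℕ => ∫ z : F,
        ((cutoff (((r + m) ^ 2)⁻¹ * ‖z‖ ^ 2) * Real.exp (-(β * ‖A z‖ ^ 2)) : ℝ) : ℂ) * e z)
        Filter.atTop (nhds (∫ z, ((Real.exp (-(β * ‖A z‖ ^ 2)) : ℝ) : ℂ) * e z)) := by
      refine tendsto_integral_of_dominated_convergence (fun z => Real.exp (-(β * ‖A z‖ ^ 2)))
        (fun m => (hint (r + m) β (by positivity)).aestronglyMeasurable)
        (integrable_gaussian_quadratic A hA hβ) ?_ ?_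
      · intro m
        refine Filter.Eventually.of_forall fun z => ?_
        rw [norm_mul, hen, mul_one, Complex.norm_real, norm_mul,
          Real.norm_of_nonneg (cutoff_nonneg _), Real.norm_of_nonneg (Real.exp_pos _).le]
        exact mul_le_of_le_one_left (Real.exp_pos _).le (cutoff_le_one _)
      · refine Filter.Eventually.of_forall fun z => tendsto_const_nhds.congr' ?_
        obtain ⟨m0, hm0⟩ := exists_nat_gt (2 * ‖z‖)
        filter_upwards [Filter.eventually_ge_atTop m0] with m hm
        have hm' : (m0 : ℝ) ≤ m := by exact_mod_cast hm
        rw [cutoff_eq_one, one_mul]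
        rw [abs_of_nonneg (by positivity), inv_mul_eq_div, div_le_iff₀ (by positivity)]
        nlinarith [norm_nonneg z]
    refine le_of_tendsto (tendsto_const_nhds.sub hlim).norm (Filter.Eventually.of_forall fun m => ?_)
    have h := hbd A δ r (r + m) β l hA hδ hr (by simp) hl hβ.le hβD hAδ
    have hr0 := hint r 0 hr
    simp only [zero_mul, neg_zero, Real.exp_zero, mul_one] at hr0
    rw [hI0, ← integral_sub hr0 (hint (r + m) β (by positivity))]
    refine le_trans (le_of_eq ?_) h
    congr 2
    ext z
    simp only [he]
    push_cast
    ring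
  have hval : ∀ β : ℝ, 0 < β → ∫ z, ((Real.exp (-(β * ‖A z‖ ^ 2)) : ℝ) : ℂ) * e z =
      |A.det|⁻¹ • (Real.pi / (β - Complex.I * ((l / 2 : ℝ) : ℂ)) : ℂ) ^ ((n : ℂ) / 2) := by
    intro β hβ
    rw [hn, ← integral_gaussian_quadratic A hA (by simpa using hβ)]
    congr 1
    ext z
    rw [Complex.ofReal_exp, ← Complex.exp_add]
    congr 1
    push_cast
    ring
  have hlim2 : Filter.Tendsto (fun β : ℝ =>
      |A.det|⁻¹ • (Real.pi / (β - Complex.I * ((l / 2 : ℝ) : ℂ)) : ℂ) ^ ((n : ℂ) / 2))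
      (nhdsWithin 0 (Set.Ioi 0)) (nhds (|A.det|⁻¹ •
        (Real.pi / (0 - Complex.I * ((l / 2 : ℝ) : ℂ)) : ℂ) ^ ((n : ℂ) / 2))) := by
    have hl0 : (l : ℂ) ≠ 0 := by exact_mod_cast hl.ne'
    have hne : ((0 : ℝ) : ℂ) - Complex.I * ((l / 2 : ℝ) : ℂ) ≠ 0 := by simp [hl0]
    have hc : ContinuousAt (fun β : ℝ => (Real.pi / (β - Complex.I * ((l / 2 : ℝ) : ℂ)) : ℂ)) 0 := by
      refine ContinuousAt.div continuousAt_const (by fun_prop) hne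
    have hs : (Real.pi / (((0 : ℝ) : ℂ) - Complex.I * ((l / 2 : ℝ) : ℂ)) : ℂ) ∈ Complex.slitPlane := by
      have h1 : (Real.pi / (((0 : ℝ) : ℂ) - Complex.I * ((l / 2 : ℝ) : ℂ)) : ℂ) =
          ((2 * Real.pi / l : ℝ) : ℂ) * Complex.I := by
        have hI := Complex.I_ne_zero
        rw [div_eq_iff hne]
        push_cast
        field_simp
        linear_combination (l : ℂ) * Complex.I_sq
      rw [h1]
      right
      have := Real.pi_pos
      have : 0 < 2 * Real.pi / l := by positivity
      simp [-Complex.ofReal_div, -Complex.ofReal_mul]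
      exact hl.ne'
    have := ((hc.cpow (continuousAt_const (y := (n : ℂ) / 2)) hs).const_smul (|A.det|⁻¹)).tendsto
    exact this.mono_left nhdsWithin_le_nhds
  rw [fresnel_constant hl n] at hlim2
  refine le_of_tendsto (tendsto_const_nhds.sub hlim2).norm ?_
  filter_upwards [Ioo_mem_nhdsGT hD0] with β hβ
  rw [← hval β hβ.1]
  exact hgauss β hβ.1 hβ.2.le

end StationaryPhase

/-! ### Stationary phase, uniform in the size of the Hessian. -/

section StationaryPhase

theorem exp_mul_I_sub_taylor (x : ℝ) :
    Complex.exp (Complex.I * x) - 1 - Complex.I * x =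
      -(x : ℂ) ^ 2 * ∫ t in (0 : ℝ)..1, ((1 - t : ℝ) : ℂ) * Complex.exp (Complex.I * ((t * x : ℝ) : ℂ)) := by
  rw [← intervalIntegral.integral_const_mul]
  have hd : ∀ t ∈ Set.uIcc (0 : ℝ) 1, HasDerivAt
      (fun t : ℝ => (Complex.I * x * (1 - (t : ℂ)) + 1) * Complex.exp (Complex.I * ((t : ℂ) * x)))
      (-(x : ℂ) ^ 2 * (((1 - t : ℝ) : ℂ) * Complex.exp (Complex.I * ((t * x : ℝ) : ℂ)))) t := by
    intro t _
    have h0 : HasDerivAt (fun t : ℝ => (t : ℂ)) 1 t := Complex.ofRealCLM.hasDerivAt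
    have h := (((h0.const_sub 1).const_mul (Complex.I * x)).add_const 1).mul
      (((h0.mul_const (x : ℂ)).const_mul Complex.I).cexp)
    refine h.congr_deriv ?_
    push_cast
    linear_combination ((x : ℂ) ^ 2 * (1 - t) * Complex.exp (Complex.I * (t * x))) * Complex.I_sq
  rw [intervalIntegral.integral_eq_sub_of_hasDerivAt hd
    (Continuous.intervalIntegrable (by fun_prop) _ _)]
  push_cast
  simp
  ring

set_option maxHeartbeats 1000000 in
/-- Stationary phase with explicit dependence on a lower bound `δ` of the Hessian. -/
theorem stationary_phase (F : Type*) [NormedAddCommGroup F] [InnerProductSpace ℝ F]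
    [FiniteDimensional ℝ F] [MeasurableSpace F] [BorelSpace F] (C c : ℝ) (hC : 0 ≤ C) (hc : 0 < c) :
    ∃ K, 0 ≤ K ∧ ∀ (A : F →L[ℝ] F) (P : F → ℝ) (δ r l : ℝ), A.det ≠ 0 → ContDiff ℝ ∞ P →
      0 < δ → 0 < r → 0 < l → c * δ ≤ r → C * r ≤ δ / 2 → δ ≤ C →
      (∀ z, δ * ‖z‖ ^ 2 ≤ ‖A z‖ ^ 2) →
      FieldBound (fun z : F => z) (Metric.closedBall 0 r) (Module.finrank ℝ F + 5) C
        (fun z => ‖z‖ ^ 3) P →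
      FieldBound (fun z : F => z) (Metric.closedBall 0 r) (Module.finrank ℝ F + 5) C
        (fun z => ‖z‖ ^ 4) (fun z => P z + P (-z)) →
      ‖(∫ z, ((cutoff ((r ^ 2)⁻¹ * ‖z‖ ^ 2) : ℝ) : ℂ) *
          Complex.exp (Complex.I * ((l * (1 / 2 * ‖A z‖ ^ 2 + P z) : ℝ) : ℂ))) -
        |A.det|⁻¹ • ((((2 * Real.pi / l) ^ ((Module.finrank ℝ F : ℝ) / 2) : ℝ) : ℂ) *
          Complex.exp (Real.pi * Complex.I * (Module.finrank ℝ F) / 4))‖ ≤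
        K * ((δ ^ 3)⁻¹ * (|A.det|⁻¹ * l ^ (-(1 + (Module.finrank ℝ F : ℝ) / 2)))) := by
  set n := Module.finrank ℝ F with hn
  obtain ⟨K0, hK0, hfr⟩ := fresnel_cutoff_asymptotic F
  -- The order $n+5=3+n+2$ is what the case $k=3$ of `quadratic_oscillatory_bound` requires of the
  -- phase perturbation.
  obtain ⟨Cχ, hCχ, hχ⟩ := bounded_fieldDeriv_cutoff (n + 5)
  set C1 := 2 ^ (n + 5) * (Cχ * C) + 2 ^ (n + 5) * (Cχ * (2 ^ (n + 5) * (C * C))) + 1 with hC1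
  have hCle1 : 2 ^ (n + 5) * (Cχ * C) ≤ C1 := by
    have : 0 ≤ 2 ^ (n + 5) * (Cχ * (2 ^ (n + 5) * (C * C))) := by positivity
    linarith
  have hCle2 : 2 ^ (n + 5) * (Cχ * (2 ^ (n + 5) * (C * C))) ≤ C1 := by
    have : 0 ≤ 2 ^ (n + 5) * (Cχ * C) := by positivity
    linarith
  have hCle3 : 1 / 2 ≤ C1 := by
    have : 0 ≤ 2 ^ (n + 5) * (Cχ * C) := by positivity
    have : 0 ≤ 2 ^ (n + 5) * (Cχ * (2 ^ (n + 5) * (C * C))) := by positivity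
    linarith
  obtain ⟨K2, hK2, hosc2⟩ := quadratic_oscillatory_bound F 2 C1
  obtain ⟨K3, hK3, hosc3⟩ := quadratic_oscillatory_bound F 3 C1
  refine ⟨K0 * (c ^ 2)⁻¹ + K2 * C + K3, by positivity, ?_⟩
  intro A P δ r l hA hP hδ hr hl hcr hCr hδC hAδ hPb hPe
  set S := Metric.closedBall (0 : F) r with hS
  have hSm : MeasurableSet S := Metric.isClosed_closedBall.measurableSet
  have hV : ContDiff ℝ ∞ (fun z : F => z) := contDiff_id
  set a : F → ℝ := fun z => cutoff ((r ^ 2)⁻¹ * ‖z‖ ^ 2) with ha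
  have has : ContDiff ℝ ∞ a := contDiff_radial_cutoff _
  have hasup : tsupport a ⊆ S := tsupport_radial_cutoff_subset hr
  have hac : HasCompactSupport a := hasCompactSupport_radial_cutoff hr
  have hab : FieldBound (fun z : F => z) S (n + 5) Cχ (fun _ => 1) a :=
    FieldBound.radial contDiff_cutoff hχ fun _ _ => Set.mem_univ _
  set Q : F → ℝ := fun z => ‖A z‖ ^ 2 with hQ
  have hQs : ContDiff ℝ ∞ Q := contDiff_norm_sq_clm A
  have hzQ : ∀ z, ‖z‖ ^ 2 ≤ δ⁻¹ * Q z := fun z => by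
    rw [inv_mul_eq_div, le_div_iff₀ hδ, mul_comm]; exact hAδ z
  set e : ℝ → F → ℂ := fun t z =>
    Complex.exp (Complex.I * ((l * (1 / 2 * ‖A z‖ ^ 2 + t * P z) : ℝ) : ℂ)) with he
  have hPc := hP.continuous
  have hQc : Continuous fun z => ‖A z‖ := by fun_prop
  have hec : ∀ t, Continuous (e t) := fun t => by fun_prop
  have hen : ∀ t z, ‖e t z‖ = 1 := fun t z => by
    simp only [he]; rw [mul_comm, Complex.norm_exp_ofReal_mul_I]
  set W : ℝ := |A.det|⁻¹ with hW
  have hW0 : 0 < W := inv_pos.2 (abs_pos.2 hA)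
  have hsup : ∀ f : F → ℂ, (∀ z, a z = 0 → f z = 0) → HasCompactSupport f ∧ tsupport f ⊆ S := by
    intro f hf
    have h1 : tsupport f ⊆ tsupport a := closure_mono fun z hz h0 => hz (hf z h0)
    exact ⟨hac.of_isClosed_subset (isClosed_tsupport f) h1, h1.trans hasup⟩
  -- the term of second order
  have hrem : ∀ t ∈ Set.Icc (0 : ℝ) 1,
      ‖∫ z, ((a z * (P z * P z) : ℝ) : ℂ) * e t z‖ ≤
        K3 * ((δ ^ 3)⁻¹ * (W * l ^ (-(3 + (n : ℝ) / 2)))) := by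
    intro t ht
    have hbs : ContDiff ℝ ∞ fun z => a z * (P z * P z) := has.mul (hP.mul hP)
    have hbb := FieldBound.mul hV has (hP.mul hP) hab (FieldBound.mul hV hP hP hPb hPb)
    have hbsc : ContDiff ℝ ∞ fun z => ((a z * (P z * P z) : ℝ) : ℂ) :=
      Complex.ofRealCLM.contDiff.comp hbs
    -- The amplitude $aP^2$ is $O(|z|^6)$ and $\delta|z|^2\le|Az|^2$, so multiplication by
    -- $\delta^3$ makes it an amplitude of order $k=3$ with a constant independent of $\delta$.
    have hb' : FieldBound (fun z : F => z) S (3 + n + 1) C1 (fun z => (‖A z‖ ^ 2) ^ 3)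
        (fun z => ((δ ^ 3 : ℝ) : ℂ) * ((a z * (P z * P z) : ℝ) : ℂ)) := by
      refine ((FieldBound.const_mul hV hbsc _ (hbb.ofReal hV hbs)).mono_level (by omega)).weaken
        fun z _ => ?_
      rw [Complex.norm_real, Real.norm_of_nonneg (by positivity)]
      have h1 : δ ^ 3 * (1 * (‖z‖ ^ 3 * ‖z‖ ^ 3)) ≤ (‖A z‖ ^ 2) ^ 3 := by
        calc δ ^ 3 * (1 * (‖z‖ ^ 3 * ‖z‖ ^ 3)) = (δ * ‖z‖ ^ 2) ^ 3 := by ring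
          _ ≤ _ := by gcongr; exact hAδ z
      calc _ = 2 ^ (n + 5) * (Cχ * (2 ^ (n + 5) * (C * C))) *
            (δ ^ 3 * (1 * (‖z‖ ^ 3 * ‖z‖ ^ 3))) := by ring
        _ ≤ C1 * (‖A z‖ ^ 2) ^ 3 := by gcongr
    -- Because $Cr\le\delta/2$, the cubic remainder is at most half of the quadratic form on the
    -- support. Hence no deformation $\frac12|Az|^2+tP$ with $0\le t\le1$ acquires another critical
    -- point there.
    have hPz : ∀ j ≤ n + 5, ∀ z ∈ S, ‖(fieldDeriv fun z : F => z)^[j] P z‖ ≤ 1 / 2 * ‖A z‖ ^ 2 := by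
      intro j hj z hz
      have hzr : ‖z‖ ≤ r := mem_closedBall_zero_iff.1 hz
      calc _ ≤ C * ‖z‖ ^ 3 := hPb j hj z hz
        _ = C * ‖z‖ * ‖z‖ ^ 2 := by ring
        _ ≤ C * r * ‖z‖ ^ 2 := by gcongr
        _ ≤ δ / 2 * ‖z‖ ^ 2 := by gcongr
        _ ≤ 1 / 2 * ‖A z‖ ^ 2 := by linarith [hAδ z]
    have htP : ∀ z ∈ S, |fderiv ℝ (fun z => t * P z) z z| ≤ ‖A z‖ ^ 2 / 2 := by
      intro z hz
      have h1 := hPz 1 (by omega) z hz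
      simp only [Function.iterate_one, fieldDeriv, Real.norm_eq_abs] at h1
      rw [fderiv_const_mul (hP.differentiable (by simp) z)]
      simp only [smul_apply, smul_eq_mul, abs_mul, abs_of_nonneg ht.1]
      calc _ ≤ 1 * |fderiv ℝ P z z| := by gcongr; exact ht.2
        _ ≤ _ := by linarith
    have htPb : FieldBound (fun z : F => z) S (3 + n + 2) C1 (fun z => ‖A z‖ ^ 2)
        (fun z => t * P z) := by
      have h1 : FieldBound (fun z : F => z) S (3 + n + 2) (1 / 2) (fun z => ‖A z‖ ^ 2) P :=
        fun j hj z hz => hPz j (by omega) z hz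
      refine (FieldBound.const_mul hV hP t h1).weaken fun z _ => ?_
      rw [Real.norm_of_nonneg ht.1]
      have := ht.2
      gcongr
      nlinarith [ht.1]
    have hmain := hosc3 A (fun z => t * P z) S l _ hA (contDiff_const.mul hP) hSm hl
      (contDiff_const.mul hbsc)
      (hsup _ fun z hz => by simp [hz]).1 (hsup _ fun z hz => by simp [hz]).2
      htP htPb hb'
    simp_rw [mul_assoc ((δ ^ 3 : ℝ) : ℂ)] at hmain
    rw [integral_const_mul, norm_mul, Complex.norm_real, Real.norm_of_nonneg (by positivity)] at hmain
    have h3 : 0 < δ ^ 3 := by positivity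
    calc _ ≤ (δ ^ 3)⁻¹ * (K3 * (W * l ^ (-(((3 : ℕ) : ℝ) + (n : ℝ) / 2)))) := by
          rw [inv_mul_eq_div, le_div_iff₀ h3, mul_comm]; exact hmain
      _ = _ := by push_cast; ring
  -- the term of first order
  have hlin : ‖∫ z, ((a z * P z : ℝ) : ℂ) * e 0 z‖ ≤
      K2 * ((δ ^ 2)⁻¹ * (W * l ^ (-(2 + (n : ℝ) / 2)))) := by
    have hPes : ContDiff ℝ ∞ fun z => P z + P (-z) := hP.add (hP.comp contDiff_neg)
    have hbs : ContDiff ℝ ∞ fun z => a z * (P z + P (-z)) := has.mul hPes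
    have hbb := FieldBound.mul hV has hPes hab hPe
    have hbsc : ContDiff ℝ ∞ fun z => ((a z * (P z + P (-z)) : ℝ) : ℂ) :=
      Complex.ofRealCLM.contDiff.comp hbs
    have hb' : FieldBound (fun z : F => z) S (2 + n + 1) C1 (fun z => (‖A z‖ ^ 2) ^ 2)
        (fun z => ((δ ^ 2 : ℝ) : ℂ) * ((a z * (P z + P (-z)) : ℝ) : ℂ)) := by
      refine ((FieldBound.const_mul hV hbsc _ (hbb.ofReal hV hbs)).mono_level (by omega)).weaken
        fun z _ => ?_
      rw [Complex.norm_real, Real.norm_of_nonneg (by positivity)]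
      have h1 : δ ^ 2 * (1 * ‖z‖ ^ 4) ≤ (‖A z‖ ^ 2) ^ 2 := by
        calc δ ^ 2 * (1 * ‖z‖ ^ 4) = (δ * ‖z‖ ^ 2) ^ 2 := by ring
          _ ≤ _ := by gcongr; exact hAδ z
      calc _ = 2 ^ (n + 5) * (Cχ * C) * (δ ^ 2 * (1 * ‖z‖ ^ 4)) := by ring
        _ ≤ C1 * (‖A z‖ ^ 2) ^ 2 := by gcongr
    have hmain := hosc2 A (fun _ => 0) S l _ hA contDiff_const hSm hl
      (contDiff_const.mul hbsc)
      (hsup _ fun z hz => by simp [hz]).1 (hsup _ fun z hz => by simp [hz]).2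
      (fun z _ => by simp; positivity) (FieldBound.const fun z _ => by simp; positivity) hb'
    simp_rw [mul_assoc ((δ ^ 2 : ℝ) : ℂ)] at hmain
    rw [integral_const_mul, norm_mul, Complex.norm_real, Real.norm_of_nonneg (by positivity)] at hmain
    have hi : ∀ f : F → ℝ, Continuous f → Integrable fun z => ((a z * f z : ℝ) : ℂ) * e 0 z := by
      intro f hf
      refine Continuous.integrable_of_hasCompactSupport ?_ ?_
      · have := has.continuous
        have := hec 0
        fun_prop
      · exact (hsup _ fun z hz => by simp [hz]).1
    -- Both $a$ and $e_0$ are even, so $P$ may be replaced by its even part. That part is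
    -- $O(|z|^4)$, one order better than $P$, and this gives the full gain of $l^{-1}$ in the linear
    -- term.
    have hsym : ∫ z, ((a z * (P z + P (-z)) : ℝ) : ℂ) * e 0 z =
        2 * ∫ z, ((a z * P z : ℝ) : ℂ) * e 0 z := by
      have h1 : ∫ z, ((a z * P (-z) : ℝ) : ℂ) * e 0 z = ∫ z, ((a z * P z : ℝ) : ℂ) * e 0 z := by
        rw [← integral_neg_eq_self]
        simp [ha, he]
      have h2 := integral_add (hi P hPc) (hi (fun z => P (-z)) (by fun_prop))
      rw [h1, ← two_mul] at h2
      rw [← h2]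
      congr 1
      ext z
      push_cast
      ring
    have hform : ∫ z, ((a z * (P z + P (-z)) : ℝ) : ℂ) *
        Complex.exp (Complex.I * ((l * (1 / 2 * ‖A z‖ ^ 2 + 0) : ℝ) : ℂ)) =
        ∫ z, ((a z * (P z + P (-z)) : ℝ) : ℂ) * e 0 z := by
      simp [he]
    rw [hform, hsym, norm_mul, Complex.norm_ofNat] at hmain
    have h3 : 0 < δ ^ 2 := by positivity
    have h4 := norm_nonneg (∫ z, ((a z * P z : ℝ) : ℂ) * e 0 z)
    calc _ ≤ (δ ^ 2)⁻¹ * (K2 * (W * l ^ (-(((2 : ℕ) : ℝ) + (n : ℝ) / 2)))) := by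
          rw [inv_mul_eq_div, le_div_iff₀ h3]; nlinarith
      _ = _ := by push_cast; ring
  have h0 := hfr A δ r l hA hδ hr hl hAδ
  -- Taylor expansion in `P`
  have hinta : ∀ f : F → ℂ, Continuous f → Integrable fun z => ((a z : ℝ) : ℂ) * f z := by
    intro f hf
    refine Continuous.integrable_of_hasCompactSupport ?_ ?_
    · have := has.continuous
      fun_prop
    · exact (hsup _ fun z hz => by simp [hz]).1
  have hswap : ∫ z, ((a z : ℝ) : ℂ) * (e 0 z * ((P z : ℂ) ^ 2 *
      ∫ t in (0 : ℝ)..1, ((1 - t : ℝ) : ℂ) * Complex.exp (Complex.I * ((t * (l * P z) : ℝ) : ℂ)))) =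
      ∫ t in (0 : ℝ)..1, ((1 - t : ℝ) : ℂ) * ∫ z, ((a z * (P z * P z) : ℝ) : ℂ) * e t z := by
    have hL : ∀ z, ((a z : ℝ) : ℂ) * (e 0 z * ((P z : ℂ) ^ 2 *
        ∫ t in (0 : ℝ)..1, ((1 - t : ℝ) : ℂ) * Complex.exp (Complex.I * ((t * (l * P z) : ℝ) : ℂ)))) =
        ∫ t in Set.Ioc (0 : ℝ) 1, ((1 - t : ℝ) : ℂ) * (((a z * (P z * P z) : ℝ) : ℂ) * e t z) := by
      intro z
      rw [← intervalIntegral.integral_of_le zero_le_one, ← intervalIntegral.integral_const_mul,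
        ← intervalIntegral.integral_const_mul, ← intervalIntegral.integral_const_mul]
      congr 1
      ext t
      have : e t z = e 0 z * Complex.exp (Complex.I * ((t * (l * P z) : ℝ) : ℂ)) := by
        simp only [he]
        rw [← Complex.exp_add]
        congr 1
        push_cast
        ring
      rw [this]
      push_cast
      ring
    simp_rw [hL]
    rw [intervalIntegral.integral_of_le zero_le_one]
    simp_rw [← integral_const_mul]
    refine integral_integral_swap ?_
    have hmaj : Integrable (fun p : F × ℝ => ‖((a p.1 * (P p.1 * P p.1) : ℝ) : ℂ)‖ * (1 : ℝ))
        ((volume : Measure F).prod (volume.restrict (Set.Ioc (0 : ℝ) 1))) := by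
      refine Integrable.mul_prod (f := fun z => ‖((a z * (P z * P z) : ℝ) : ℂ)‖) (g := fun _ => (1 : ℝ)) ?_ ?_
      · have := (hinta (fun z => ((P z * P z : ℝ) : ℂ)) (by fun_prop)).norm
        refine this.congr (Filter.Eventually.of_forall fun z => ?_)
        simp
      · exact integrable_const _
    refine hmaj.mono' ?_ ?_
    · refine Continuous.aestronglyMeasurable ?_
      have := has.continuous
      simp only [he]
      fun_prop
    · have hae : ∀ᵐ p : F × ℝ ∂((volume : Measure F).prod (volume.restrict (Set.Ioc (0 : ℝ) 1))),
          p.2 ∈ Set.Ioc (0 : ℝ) 1 :=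
        Measure.quasiMeasurePreserving_snd.ae (ae_restrict_mem measurableSet_Ioc)
      filter_upwards [hae] with p hp
      simp only [Function.uncurry]
      rw [norm_mul, norm_mul, hen, mul_one, mul_comm, Complex.norm_real (1 - p.2),
        Real.norm_of_nonneg (by linarith [hp.2])]
      exact mul_le_of_le_one_right (norm_nonneg _) (by linarith [hp.1])
  have hTaylor : ∀ z, ((a z : ℝ) : ℂ) * e 1 z = ((a z : ℝ) : ℂ) * e 0 z +
      ((Complex.I * l) * (((a z * P z : ℝ) : ℂ) * e 0 z) + (-(l : ℂ) ^ 2) * (((a z : ℝ) : ℂ) * (e 0 z * ((P z : ℂ) ^ 2 *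
      ∫ t in (0 : ℝ)..1, ((1 - t : ℝ) : ℂ) * Complex.exp (Complex.I * ((t * (l * P z) : ℝ) : ℂ)))))) := by
    intro z
    have h1 : e 1 z = e 0 z * Complex.exp (Complex.I * ((l * P z : ℝ) : ℂ)) := by
      simp only [he]
      rw [← Complex.exp_add]
      congr 1
      push_cast
      ring
    have h2 := exp_mul_I_sub_taylor (l * P z)
    have h3 : Complex.exp (Complex.I * ((l * P z : ℝ) : ℂ)) = 1 + Complex.I * ((l * P z : ℝ) : ℂ) +
      -((l * P z : ℝ) : ℂ) ^ 2 * ∫ t in (0 : ℝ)..1, ((1 - t : ℝ) : ℂ) *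
        Complex.exp (Complex.I * ((t * (l * P z) : ℝ) : ℂ)) := by rw [← h2]; ring
    rw [h1, h3]
    push_cast
    ring
  have hi2 : Integrable fun z => ((a z : ℝ) : ℂ) * (e 0 z * ((P z : ℂ) ^ 2 *
      ∫ t in (0 : ℝ)..1, ((1 - t : ℝ) : ℂ) * Complex.exp (Complex.I * ((t * (l * P z) : ℝ) : ℂ)))) := by
    refine hinta _ ?_
    have : Continuous fun z => ∫ t in (0 : ℝ)..1, ((1 - t : ℝ) : ℂ) *
        Complex.exp (Complex.I * ((t * (l * P z) : ℝ) : ℂ)) :=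
      intervalIntegral.continuous_parametric_intervalIntegral_of_continuous' (by fun_prop) _ _
    have := hec 0
    fun_prop
  have hi1 : Integrable fun z => ((a z * P z : ℝ) : ℂ) * e 0 z := by
    have := hinta (fun z => (P z : ℂ) * e 0 z) (by have := hec 0; fun_prop)
    refine this.congr (Filter.Eventually.of_forall fun z => ?_)
    push_cast
    ring
  have hsplit : ∫ z, ((a z : ℝ) : ℂ) * e 1 z = (∫ z, ((a z : ℝ) : ℂ) * e 0 z) +
      ((Complex.I * l) * (∫ z, ((a z * P z : ℝ) : ℂ) * e 0 z) + (-(l : ℂ) ^ 2) *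
        ∫ t in (0 : ℝ)..1, ((1 - t : ℝ) : ℂ) * ∫ z, ((a z * (P z * P z) : ℝ) : ℂ) * e t z) := by
    refine (integral_congr_ae (Filter.Eventually.of_forall hTaylor)).trans
      ((integral_add (hinta _ (hec 0))
        ((hi1.const_mul (Complex.I * l)).add (hi2.const_mul (-(l : ℂ) ^ 2)))).trans ?_)
    congr 1
    refine (integral_add (hi1.const_mul (Complex.I * l)) (hi2.const_mul (-(l : ℂ) ^ 2))).trans ?_
    rw [integral_const_mul, integral_const_mul, hswap]
  have hR : ‖∫ t in (0 : ℝ)..1, ((1 - t : ℝ) : ℂ) * ∫ z, ((a z * (P z * P z) : ℝ) : ℂ) * e t z‖ ≤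
      K3 * ((δ ^ 3)⁻¹ * (W * l ^ (-(3 + (n : ℝ) / 2)))) := by
    refine (intervalIntegral.norm_integral_le_of_norm_le_const fun t ht => ?_).trans
      (le_of_eq (by rw [sub_zero, abs_one, mul_one]))
    rw [Set.uIoc_of_le zero_le_one] at ht
    rw [norm_mul, Complex.norm_real, Real.norm_of_nonneg (by linarith [ht.2])]
    refine (mul_le_of_le_one_left (norm_nonneg _) (by linarith [ht.1])).trans
      (hrem t ⟨ht.1.le, ht.2⟩)
  have he1 : ∀ z, Complex.exp (Complex.I * ((l * (1 / 2 * ‖A z‖ ^ 2 + P z) : ℝ) : ℂ)) = e 1 z := by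
    intro z; simp [he]
  have he0 : ∀ z, Complex.exp (Complex.I * ((l * (1 / 2 * ‖A z‖ ^ 2) : ℝ) : ℂ)) = e 0 z := by
    intro z; simp [he]
  simp_rw [he0] at h0
  simp_rw [he1]
  change ‖(∫ z, ((a z : ℝ) : ℂ) * e 1 z) - _‖ ≤ _
  change ‖(∫ z, ((a z : ℝ) : ℂ) * e 0 z) - _‖ ≤ _ at h0
  rw [hsplit]
  have hl1 : l * l ^ (-(2 + (n : ℝ) / 2)) = l ^ (-(1 + (n : ℝ) / 2)) := by
    nth_rewrite 1 [← Real.rpow_one l]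
    rw [← Real.rpow_add hl]
    congr 1
    ring
  have hl2 : l ^ 2 * l ^ (-(3 + (n : ℝ) / 2)) = l ^ (-(1 + (n : ℝ) / 2)) := by
    rw [← Real.rpow_natCast l 2, ← Real.rpow_add hl]
    congr 1
    push_cast
    ring
  set L := l ^ (-(1 + (n : ℝ) / 2)) with hL
  have hL0 : 0 ≤ L := by positivity
  have hb1 : ‖(Complex.I * l) * (∫ z, ((a z * P z : ℝ) : ℂ) * e 0 z)‖ ≤
      K2 * C * ((δ ^ 3)⁻¹ * (W * L)) := by
    rw [norm_mul, norm_mul, Complex.norm_I, one_mul, Complex.norm_real, Real.norm_of_nonneg hl.le]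
    calc _ ≤ l * (K2 * ((δ ^ 2)⁻¹ * (W * l ^ (-(2 + (n : ℝ) / 2))))) := by gcongr
      _ = K2 * ((δ ^ 2)⁻¹ * (W * (l * l ^ (-(2 + (n : ℝ) / 2))))) := by ring
      _ = K2 * δ * ((δ ^ 3)⁻¹ * (W * L)) := by
        rw [hl1]
        field_simp
      _ ≤ _ := by gcongr
  have hb2 : ‖(-(l : ℂ) ^ 2) * ∫ t in (0 : ℝ)..1, ((1 - t : ℝ) : ℂ) *
      ∫ z, ((a z * (P z * P z) : ℝ) : ℂ) * e t z‖ ≤ K3 * ((δ ^ 3)⁻¹ * (W * L)) := by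
    rw [norm_mul, norm_neg, norm_pow, Complex.norm_real, Real.norm_of_nonneg hl.le]
    calc _ ≤ l ^ 2 * (K3 * ((δ ^ 3)⁻¹ * (W * l ^ (-(3 + (n : ℝ) / 2))))) := by gcongr
      _ = K3 * ((δ ^ 3)⁻¹ * (W * (l ^ 2 * l ^ (-(3 + (n : ℝ) / 2))))) := by ring
      _ = _ := by
        rw [hl2]
  -- The lower bound $r\ge c\delta$ converts the cutoff error $(\delta r^2)^{-1}$ into
  -- $\delta^{-3}$, the order of the other two errors.
  have hb0 : K0 * ((δ * r ^ 2)⁻¹ * (W * L)) ≤ K0 * (c ^ 2)⁻¹ * ((δ ^ 3)⁻¹ * (W * L)) := by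
    have h1 : (δ * r ^ 2)⁻¹ ≤ (c ^ 2)⁻¹ * (δ ^ 3)⁻¹ := by
      rw [← mul_inv]
      apply inv_anti₀ (by positivity)
      calc c ^ 2 * δ ^ 3 = δ * (c * δ) ^ 2 := by ring
        _ ≤ δ * r ^ 2 := by gcongr
    calc _ ≤ K0 * ((c ^ 2)⁻¹ * (δ ^ 3)⁻¹ * (W * L)) := by gcongr
      _ = _ := by ring
  generalize (∫ z, ((a z : ℝ) : ℂ) * e 0 z) = X0 at h0 ⊢
  generalize (Complex.I * l) * (∫ z, ((a z * P z : ℝ) : ℂ) * e 0 z) = X1 at hb1 ⊢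
  generalize (-(l : ℂ) ^ 2) * ∫ t in (0 : ℝ)..1, ((1 - t : ℝ) : ℂ) *
      ∫ z, ((a z * (P z * P z) : ℝ) : ℂ) * e t z = X2 at hb2 ⊢
  calc _ = ‖(X0 - W • ((((2 * Real.pi / l) ^ ((n : ℝ) / 2) : ℝ) : ℂ) *
          Complex.exp (Real.pi * Complex.I * n / 4))) + X1 + X2‖ := by congr 1; ring
    _ ≤ _ := norm_add₃_le
    _ ≤ K0 * (c ^ 2)⁻¹ * ((δ ^ 3)⁻¹ * (W * L)) + K2 * C * ((δ ^ 3)⁻¹ * (W * L)) +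
        K3 * ((δ ^ 3)⁻¹ * (W * L)) := by gcongr; exact h0.trans hb0
    _ = _ := by ring

end StationaryPhase

/-! ### Inner and outer cones at a boundary point of a convex set. -/

section ConvexCones

variable {E : Type*} [NormedAddCommGroup E] [NormedSpace ℝ E] {B : Set E} {x x₀ : E} {r : ℝ}

theorem exists_mem_segment_frontier {y z : E} (hy : y ∈ B) (hz : z ∉ B) :
    ∃ w ∈ segment ℝ y z, w ∈ frontier B := by
  by_contra! hcon
  have hs : IsPreconnected (segment ℝ y z) := (convex_segment y z).isPreconnected
  obtain ⟨w, -, hw, hw'⟩ := hs (interior B) (closure B)ᶜ isOpen_interior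
    isClosed_closure.isOpen_compl
    (fun w hw => by
      by_cases h : w ∈ closure B
      · left
        by_contra h'
        exact hcon w hw ⟨h, h'⟩
      · exact Or.inr h)
    ⟨y, left_mem_segment ℝ y z, by
      by_contra h'
      exact hcon y (left_mem_segment ℝ y z) ⟨subset_closure hy, h'⟩⟩
    ⟨z, right_mem_segment ℝ y z, fun h =>
      hcon z (right_mem_segment ℝ y z) ⟨h, fun h' => hz (interior_subset h')⟩⟩
  exact hw' (subset_closure (interior_subset hw))

/-- Otherwise $x$ would be a proper convex combination of that point and the interior point $x_0-b$,
hence interior. -/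
theorem Convex.add_smul_notMem_of_mem_frontier (hB : Convex ℝ B) (hx : x ∈ frontier B)
    (hr : Metric.ball x₀ r ⊆ B) {s : ℝ} (hs : 0 < s) {b : E} (hb : ‖b‖ < r) :
    x + s • ((x - x₀) + b) ∉ B := by
  intro hmem
  have hint : x₀ - b ∈ interior B :=
    interior_maximal hr Metric.isOpen_ball (by simpa [Metric.mem_ball, dist_eq_norm] using hb)
  refine hx.2 ?_
  have := hB.combo_interior_closure_mem_interior hint (subset_closure hmem)
    (a := s / (1 + s)) (b := 1 / (1 + s)) (by positivity) (by positivity) (by field_simp; ring)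
  convert this using 1
  have h1 : x = (1 / (1 + s)) • ((1 + s) • x) := by
    rw [smul_smul, one_div, inv_mul_cancel₀ (by positivity), one_smul]
  rw [div_eq_mul_one_div s, mul_comm s, mul_smul, ← smul_add]
  nth_rewrite 1 [h1]
  congr 1
  module

theorem Convex.sub_smul_mem_interior_of_mem_frontier (hB : Convex ℝ B) (hx : x ∈ frontier B)
    (hr : Metric.ball x₀ r ⊆ B) {s : ℝ} (hs : 0 < s) (hs1 : s ≤ 1) {b : E} (hb : ‖b‖ < r) :
    x - s • ((x - x₀) + b) ∈ interior B := by
  have hint : x₀ - b ∈ interior B :=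
    interior_maximal hr Metric.isOpen_ball (by simpa [Metric.mem_ball, dist_eq_norm] using hb)
  have := hB.combo_interior_closure_mem_interior hint hx.1
    (a := s) (b := 1 - s) hs (by linarith) (by ring)
  convert this using 1
  module

end ConvexCones

/-! ### A global smooth defining function. -/

section DefiningFunction

variable {E : Type*} [NormedAddCommGroup E] [InnerProductSpace ℝ E] [FiniteDimensional ℝ E]
  {B : Set E}

/-- `ρ` is a smooth defining function of the domain `B`. -/
structure IsDefiningFunction (B : Set E) (ρ : E → ℝ) : Prop where
  contDiff : ContDiff ℝ ∞ ρ
  mem_iff : ∀ x, x ∈ B ↔ ρ x ≤ 0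
  frontier_iff : ∀ x, x ∈ frontier B ↔ ρ x = 0
  gradient_ne_zero : ∀ x ∈ frontier B, gradient ρ x ≠ 0
  infDist_le : ∀ x ∈ B, Metric.infDist x (frontier B) ≤ -ρ x

theorem hasDerivAt_comp_ray {f : E → ℝ} {x v : E} {s : ℝ} (hf : DifferentiableAt ℝ f (x + s • v)) :
    HasDerivAt (fun s : ℝ => f (x + s • v)) (fderiv ℝ f (x + s • v) v) s := by
  have h : HasDerivAt (fun s : ℝ => x + s • v) v s := by
    simpa using ((hasDerivAt_id s).smul_const v).const_add x
  exact hf.hasFDerivAt.comp_hasDerivAt s h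

/-- A local equation of the boundary is transversal to the segment from an interior point. -/
theorem fderiv_ne_zero_of_local_equation (hBc : IsClosed B) (hB : Convex ℝ B) {x x₀ : E} {r : ℝ} (hr0 : 0 < r)
    (hr : Metric.ball x₀ r ⊆ B) (hx : x ∈ frontier B) {U : Set E} (hU : IsOpen U) (hxU : x ∈ U)
    {f : E → ℝ} (hf : ContDiffOn ℝ ∞ f U) (hf0 : fderiv ℝ f x ≠ 0)
    (hfU : ∀ y ∈ U, y ∈ frontier B ↔ f y = 0) : fderiv ℝ f x (x - x₀) ≠ 0 := by
  intro h0
  obtain ⟨w, hw⟩ : ∃ w, 0 < fderiv ℝ f x w := by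
    by_contra! h
    refine hf0 (ContinuousLinearMap.ext fun w => le_antisymm (h w) ?_)
    have := h (-w)
    simp only [map_neg] at this
    simpa using this
  obtain ⟨η, hη, hηw⟩ : ∃ η : ℝ, 0 < η ∧ η * ‖w‖ < r := by
    refine ⟨r / (‖w‖ + 1), by positivity, ?_⟩
    rw [div_mul_eq_mul_div, div_lt_iff₀ (by positivity)]
    nlinarith [norm_nonneg w]
  have hdiff : DifferentiableAt ℝ f x := (hf.contDiffAt (hU.mem_nhds hxU)).differentiableAt (by simp)
  have hfx : f x = 0 := (hfU x hxU).1 hx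
  have key : ∀ e : E, 0 < fderiv ℝ f x e → ∀ᶠ s in nhdsWithin (0 : ℝ) (Set.Ioi 0),
      0 < f (x + s • e) ∧ f (x + s • -e) < 0 := by
    intro e he
    have aux : ∀ e' : E, Filter.Tendsto (fun s : ℝ => s⁻¹ * f (x + s • e'))
        (nhdsWithin (0 : ℝ) (Set.Ioi 0)) (nhds (fderiv ℝ f x e')) := by
      intro e'
      have h := hasDerivAt_comp_ray (f := f) (x := x) (v := e') (s := 0) (by simpa using hdiff)
      rw [hasDerivAt_iff_tendsto_slope] at h
      simp only [zero_smul, add_zero] at h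
      refine (h.mono_left (nhdsWithin_mono _ fun s hs => ne_of_gt hs)).congr fun s => ?_
      simp [slope, hfx]
    have h1 := (aux e).eventually (lt_mem_nhds he)
    have h2 := (aux (-e)).eventually (gt_mem_nhds (show fderiv ℝ f x (-e) < 0 by simpa using he))
    filter_upwards [h1, h2, self_mem_nhdsWithin] with s hs1 hs2 hs
    have hs' : (0 : ℝ) < s⁻¹ := inv_pos.2 hs
    exact ⟨pos_of_mul_pos_right hs1 hs'.le, by nlinarith⟩
  -- If the derivative along $x-x_0$ vanished, $f$ would have opposite signs at $x+s((x-x_0)\pm\eta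
  -- w)$ for small $s>0$. The segment between these points lies in the outer cone and would contain
  -- a zero of $f$, that is, a boundary point outside $B$.
  have k1 := key ((x - x₀) + η • w) (by simp only [map_add, h0, map_smul, smul_eq_mul]; positivity)
  have k2 := key (-(x - x₀) + η • w) (by simp only [map_add, map_neg, h0, map_smul, smul_eq_mul]; simp; positivity)
  have k3 : ∀ᶠ s in nhdsWithin (0 : ℝ) (Set.Ioi 0),
      Metric.ball x (s * (‖x - x₀‖ + r + 1)) ⊆ U := by
    obtain ⟨ε, hε, hεU⟩ := Metric.isOpen_iff.1 hU x hxU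
    have h : Filter.Tendsto (fun s : ℝ => s * (‖x - x₀‖ + r + 1)) (nhdsWithin (0 : ℝ) (Set.Ioi 0))
        (nhds 0) := by
      have : Continuous fun s : ℝ => s * (‖x - x₀‖ + r + 1) := by fun_prop
      simpa using (this.tendsto 0).mono_left nhdsWithin_le_nhds
    filter_upwards [h.eventually (gt_mem_nhds hε)] with s hs
    exact (Metric.ball_subset_ball hs.le).trans hεU
  obtain ⟨s, ⟨hs1, -⟩, ⟨-, hs2⟩, hsU, hs⟩ :=
    (k1.and (k2.and (k3.and self_mem_nhdsWithin))).exists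
  have hs0 : (0 : ℝ) < s := hs
  have hbound : ∀ τ ∈ Set.Icc (-1 : ℝ) 1, ‖(τ * η) • w‖ < r := by
    intro τ hτ
    rw [norm_smul, norm_mul, Real.norm_eq_abs, Real.norm_of_nonneg hη.le, mul_assoc]
    exact (mul_le_of_le_one_left (by positivity) (abs_le.2 hτ)).trans_lt hηw
  have hmaps : ∀ τ ∈ Set.Icc (-1 : ℝ) 1, x + s • ((x - x₀) + (τ * η) • w) ∈ U := by
    intro τ hτ
    refine hsU ?_
    rw [Metric.mem_ball, dist_eq_norm, add_sub_cancel_left, norm_smul, Real.norm_of_nonneg hs0.le]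
    refine mul_lt_mul_of_pos_left ?_ hs0
    linarith [norm_add_le (x - x₀) ((τ * η) • w), hbound τ hτ]
  have hcont : ContinuousOn (fun τ : ℝ => f (x + s • ((x - x₀) + (τ * η) • w)))
      (Set.Icc (-1) 1) :=
    hf.continuousOn.comp (by fun_prop) hmaps
  obtain ⟨τ, hτ, hτ0⟩ := intermediate_value_Icc (by norm_num) hcont
    (show (0 : ℝ) ∈ Set.Icc _ _ from ⟨by
      have : x + s • ((x - x₀) + ((-1 : ℝ) * η) • w) = x + s • -(-(x - x₀) + η • w) := by module
      simp only [this]; exact hs2.le, by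
      simpa using hs1.le⟩)
  exact hB.add_smul_notMem_of_mem_frontier hx hr hs0 (hbound τ hτ)
    (hBc.frontier_subset ((hfU _ (hmaps τ hτ)).2 hτ0))

/-- Near a boundary point, the domain is the sublevel set of a local equation of the boundary. -/
theorem exists_local_defining_function (hBc : IsClosed B) (hB : Convex ℝ B) {x x₀ : E} {r : ℝ}
    (hr0 : 0 < r) (hr : Metric.ball x₀ r ⊆ B) (hx : x ∈ frontier B) {U : Set E} (hU : IsOpen U)
    (hxU : x ∈ U) {f : E → ℝ} (hf : ContDiffOn ℝ ∞ f U) (hf0 : fderiv ℝ f x ≠ 0)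
    (hfU : ∀ y ∈ U, y ∈ frontier B ↔ f y = 0) :
    ∃ W ∈ nhds x, ∃ g : E → ℝ, ContDiffOn ℝ ∞ g W ∧ (∀ y ∈ W, y ∈ frontier B ↔ g y = 0) ∧
      (∀ y ∈ W, y ∈ B ↔ g y ≤ 0) ∧ (∀ y ∈ W, y ∉ B → Metric.infDist y B ≤ g y) ∧
      ∀ y ∈ W, y ∈ B → Metric.infDist y (frontier B) ≤ -g y := by
  wlog hpos : 0 < fderiv ℝ f x (x - x₀) generalizing f
  · refine this (f := fun y => -f y) hf.neg ?_ (fun y hy => by simp [hfU y hy]) ?_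
    · rw [fderiv_fun_neg]; simpa using hf0
    · rw [fderiv_fun_neg]
      have := fderiv_ne_zero_of_local_equation hBc hB hr0 hr hx hU hxU hf hf0 hfU
      have h2 := lt_of_le_of_ne (not_lt.1 hpos) this
      simpa using h2
  set v := x - x₀ with hv
  set c := fderiv ℝ f x v / 2 with hc
  have hc0 : 0 < c := by positivity
  have hcontd : ContinuousOn (fun y => fderiv ℝ f y v) U :=
    ((hf.continuousOn_fderiv_of_isOpen hU (by simp)).clm_apply continuousOn_const)
  obtain ⟨ε, hε, hεU⟩ : ∃ ε > 0, ∀ y ∈ Metric.ball x ε, y ∈ U ∧ c < fderiv ℝ f y v := by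
    have h1 : ∀ᶠ y in nhds x, c < fderiv ℝ f y v :=
      (hcontd.continuousAt (hU.mem_nhds hxU)).eventually (lt_mem_nhds (by rw [hc]; linarith))
    have h2 : ∀ᶠ y in nhds x, y ∈ U := hU.mem_nhds hxU
    exact Metric.eventually_nhds_iff_ball.1 (h2.and h1)
  obtain ⟨s₀, hs₀, hs₀1, hs₀v⟩ : ∃ s₀ : ℝ, 0 < s₀ ∧ s₀ ≤ 1 ∧ s₀ * ‖v‖ < ε / 2 := by
    refine ⟨min 1 (ε / 4 / (‖v‖ + 1)), by positivity, min_le_left _ _, ?_⟩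
    have : min 1 (ε / 4 / (‖v‖ + 1)) * (‖v‖ + 1) ≤ ε / 4 := by
      have := min_le_right 1 (ε / 4 / (‖v‖ + 1))
      rwa [le_div_iff₀ (by positivity)] at this
    have h2 : 0 < min 1 (ε / 4 / (‖v‖ + 1)) := by positivity
    nlinarith
  have hcontx : ContinuousAt f x := (hf.continuousOn.continuousAt (hU.mem_nhds hxU))
  have hfx : f x = 0 := (hfU x hxU).1 hx
  obtain ⟨ε', hε', hεf⟩ : ∃ ε' > 0, ∀ y ∈ Metric.ball x ε', |f y| < c * s₀ := by
    have h1 : ∀ᶠ y in nhds x, |f y| < c * s₀ :=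
      (hcontx.abs).eventually (gt_mem_nhds (by simp only [hfx, abs_zero]; positivity))
    exact Metric.eventually_nhds_iff_ball.1 h1
  set δ := min ε' (min (ε / 2) (s₀ * r)) with hδ
  have hδ0 : 0 < δ := by positivity
  have hball : ∀ y ∈ Metric.ball x δ, ∀ s : ℝ, |s| ≤ s₀ → y + s • v ∈ Metric.ball x ε := by
    intro y hy s hs
    rw [Metric.mem_ball, dist_eq_norm] at hy ⊢
    have h1 : ‖y + s • v - x‖ ≤ ‖y - x‖ + ‖s • v‖ := by
      rw [show y + s • v - x = (y - x) + s • v by abel]; exact norm_add_le _ _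
    rw [norm_smul, Real.norm_eq_abs] at h1
    have h2 : |s| * ‖v‖ ≤ s₀ * ‖v‖ := by gcongr
    have h3 : δ ≤ ε / 2 := (min_le_right _ _).trans (min_le_left _ _)
    linarith
  -- monotonicity along the rays
  have hmono : ∀ y ∈ Metric.ball x δ, ∀ s t : ℝ, -s₀ ≤ s → s ≤ t → t ≤ s₀ →
      c * (t - s) ≤ f (y + t • v) - f (y + s • v) := by
    intro y hy s t hs hst ht
    have hd : ∀ τ ∈ Set.Icc (-s₀) s₀, HasDerivAt (fun s : ℝ => f (y + s • v))
        (fderiv ℝ f (y + τ • v) v) τ := fun τ hτ =>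
      hasDerivAt_comp_ray ((hf.contDiffAt (hU.mem_nhds
        (hεU _ (hball y hy τ (abs_le.2 hτ))).1)).differentiableAt (by simp))
    refine (convex_Icc (-s₀) s₀).mul_sub_le_image_sub_of_le_deriv
      (fun τ hτ => (hd τ hτ).continuousAt.continuousWithinAt)
      (fun τ hτ => (hd τ (interior_subset hτ)).differentiableAt.differentiableWithinAt)
      (fun τ hτ => ?_) s ⟨hs, hst.trans ht⟩ t ⟨hs.trans hst, ht⟩ hst
    have hτ' : τ ∈ Set.Icc (-s₀) s₀ := interior_subset hτ
    rw [(hd τ hτ').deriv]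
    exact (hεU _ (hball y hy τ (abs_le.2 hτ'))).2.le
  have hout : ∀ y ∈ Metric.ball x δ, y + s₀ • v ∉ B := by
    intro y hy
    have := hB.add_smul_notMem_of_mem_frontier hx hr hs₀ (b := s₀⁻¹ • (y - x)) ?_
    · convert this using 2
      rw [smul_add, smul_smul, mul_inv_cancel₀ hs₀.ne', one_smul]
      module
    · rw [norm_smul, norm_inv, Real.norm_of_nonneg hs₀.le, inv_mul_lt_iff₀ hs₀, ← dist_eq_norm]
      exact lt_of_lt_of_le hy ((min_le_right _ _).trans (min_le_right _ _))
  have hin : ∀ y ∈ Metric.ball x δ, y + (-s₀) • v ∈ B := by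
    intro y hy
    have := hB.sub_smul_mem_interior_of_mem_frontier hx hr hs₀ hs₀1 (b := -(s₀⁻¹ • (y - x))) ?_
    · convert interior_subset this using 1
      rw [smul_add, smul_neg, smul_smul, mul_inv_cancel₀ hs₀.ne', one_smul]
      module
    · rw [norm_neg, norm_smul, norm_inv, Real.norm_of_nonneg hs₀.le, inv_mul_lt_iff₀ hs₀,
        ← dist_eq_norm]
      exact lt_of_lt_of_le hy ((min_le_right _ _).trans (min_le_right _ _))
  have hsegm : ∀ (y w : E) (s t : ℝ), s ≤ t → w ∈ segment ℝ (y + s • v) (y + t • v) →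
      ∃ τ, s ≤ τ ∧ τ ≤ t ∧ w = y + τ • v := by
    rintro y w s t hst ⟨a, b, ha, hb, hab, rfl⟩
    refine ⟨a * s + b * t, ?_, ?_, ?_⟩
    · obtain rfl : a = 1 - b := by linarith
      nlinarith [mul_le_mul_of_nonneg_left hst hb]
    · obtain rfl : b = 1 - a := by linarith
      nlinarith [mul_le_mul_of_nonneg_left hst ha]
    · rw [show a • (y + s • v) + b • (y + t • v) = (a + b) • y + (a * s + b * t) • v by module, hab,
        one_smul]
  -- The segment through $y$ in direction $v$ begins in $B$ and ends outside, so it crosses the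
  -- boundary, where $f=0$. Since $f$ increases along it, the sign of $f(y)$ tells on which side of
  -- the crossing $y$ lies.
  have hmem : ∀ y ∈ Metric.ball x δ, y ∈ B ↔ f y ≤ 0 := by
    intro y hy
    have hy0 : y = y + (0 : ℝ) • v := by simp
    constructor
    · intro hyB
      obtain ⟨w, hw, hwf⟩ := exists_mem_segment_frontier hyB (hout y hy)
      rw [hy0] at hw
      rw [zero_smul, add_zero] at hw
      obtain ⟨τ, h0, h1, rfl⟩ := hsegm y w 0 s₀ hs₀.le (by simpa using hw)
      have h2 := hmono y hy 0 τ (by linarith) h0 h1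
      have h3 := (hfU _ (hεU _ (hball y hy τ (abs_le.2 ⟨by linarith, h1⟩))).1).1 hwf
      rw [zero_smul, add_zero] at h2
      nlinarith
    · intro hyf
      by_contra hyB
      obtain ⟨w, hw, hwf⟩ := exists_mem_segment_frontier (hin y hy) hyB
      obtain ⟨τ, h0, h1, rfl⟩ := hsegm y w (-s₀) 0 (by linarith) (by simpa using hw)
      have h2 := hmono y hy τ 0 h0 h1 hs₀.le
      have h3 := (hfU _ (hεU _ (hball y hy τ (abs_le.2 ⟨h0, by linarith⟩))).1).1 hwf
      rw [zero_smul, add_zero] at h2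
      have h4 : τ = 0 := by nlinarith
      rw [h4, zero_smul, add_zero] at hwf
      exact hyB (hBc.frontier_subset hwf)
  -- Since $f$ changes at rate at least $c$ along $v$, the boundary or the body is reached within
  -- time $|f|/c$, that is, within distance $\|v\|\,|f|/c$. The factor $k$ makes $|kf|$ dominate
  -- this distance.
  set k := (‖v‖ + 1) / c with hk
  have hk0 : 0 < k := by positivity
  have hsub : Metric.ball x (δ / 2) ⊆ Metric.ball x δ := Metric.ball_subset_ball (by linarith)
  have hUsub : Metric.ball x (δ / 2) ⊆ U := fun y hy =>
    (by simpa using (hεU _ (hball y (hsub hy) 0 (by simpa using hs₀.le))).1)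
  refine ⟨Metric.ball x (δ / 2), Metric.ball_mem_nhds _ (by positivity), fun y => k * f y,
    contDiffOn_const.mul (hf.mono hUsub), fun y hy => ?_, fun y hy => ?_, fun y hy hyB => ?_,
    fun y hy hyB => ?_⟩
  · rw [hfU y (hUsub hy)]
    simp [hk0.ne']
  · rw [hmem y (hsub hy)]
    constructor
    · intro h; nlinarith
    · intro h; by_contra! h'; nlinarith [mul_pos hk0 h']
  · have hfy : 0 < f y := not_le.1 fun h => hyB ((hmem y (hsub hy)).2 h)
    have hfle : f y < c * s₀ := (le_abs_self _).trans_lt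
      (hεf y (Metric.ball_subset_ball (min_le_left _ _) (hsub hy)))
    set s := f y / c with hs
    have hs0 : 0 < s := by positivity
    have hsle : s ≤ s₀ := by rw [hs, div_le_iff₀ hc0]; linarith
    have h1 := hmono y (hsub hy) (-s) 0 (by linarith) (by linarith) hs₀.le
    rw [zero_smul, add_zero] at h1
    have h2 : f (y + (-s) • v) ≤ 0 := by
      have : c * s = f y := by rw [hs]; field_simp
      linarith
    have h3 : y + (-s) • v ∈ B := by
      by_contra hnB
      obtain ⟨w, hw, hwf⟩ := exists_mem_segment_frontier (hin y (hsub hy)) hnB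
      obtain ⟨τ, hτ0, hτ1, rfl⟩ := hsegm y w (-s₀) (-s) (by linarith) hw
      have h5 := hmono y (hsub hy) τ (-s) hτ0 hτ1 (by linarith)
      have h6 := (hfU _ (hεU _ (hball y (hsub hy) τ (abs_le.2 ⟨hτ0, by linarith⟩))).1).1 hwf
      have h4 : τ = -s := by nlinarith
      rw [h4] at hwf
      exact hnB (hBc.frontier_subset hwf)
    refine (Metric.infDist_le_dist_of_mem h3).trans ?_
    rw [dist_eq_norm, show y - (y + (-s) • v) = s • v by module, norm_smul,
      Real.norm_of_nonneg hs0.le, hs, hk]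
    simp only [div_mul_eq_mul_div]
    refine div_le_div_of_nonneg_right ?_ hc0.le
    nlinarith
  · obtain ⟨w, hw, hwf⟩ := exists_mem_segment_frontier hyB (hout y (hsub hy))
    obtain ⟨τ, hτ0, hτ1, rfl⟩ := hsegm y w 0 s₀ hs₀.le (by simpa using hw)
    have h5 := hmono y (hsub hy) 0 τ (by linarith) hτ0 hτ1
    rw [(hfU _ (hεU _ (hball y (hsub hy) τ (abs_le.2 ⟨by linarith, hτ1⟩))).1).1 hwf, zero_smul,
      add_zero, sub_zero, zero_sub] at h5
    refine (Metric.infDist_le_dist_of_mem hwf).trans ?_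
    rw [dist_eq_norm, show y - (y + τ • v) = -(τ • v) by module, norm_neg, norm_smul,
      Real.norm_of_nonneg hτ0, hk]
    simp only [div_mul_eq_mul_div]
    rw [← neg_div, le_div_iff₀ hc0]
    nlinarith [mul_le_mul_of_nonneg_right h5 (norm_nonneg v), mul_nonneg hc0.le hτ0]

/-- A closed convex set with interior whose boundary is locally the regular zero set of smooth
functions has a global smooth defining function. -/
theorem exists_isDefiningFunction (hBc : IsClosed B) (hB : Convex ℝ B)
    (hBi : (interior B).Nonempty)
    (hloc : ∀ x ∈ frontier B, ∃ (U : Set E) (ρ : E → ℝ), IsOpen U ∧ x ∈ U ∧ ContDiffOn ℝ ∞ ρ U ∧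
      fderiv ℝ ρ x ≠ 0 ∧ ∀ y ∈ U, (y ∈ frontier B ↔ ρ y = 0)) :
    ∃ ρ, IsDefiningFunction B ρ := by
  obtain ⟨x₀, hx₀⟩ := hBi
  obtain ⟨r, hr0, hr⟩ := Metric.isOpen_iff.1 isOpen_interior x₀ hx₀
  have hrB := hr.trans interior_subset
  -- All conditions on the value at $x$ are convex, so a smooth partition of unity glues local
  -- solutions. The nonvanishing of the gradient is not a condition of this kind; it is recovered
  -- afterwards from the distance inequality outside $B$.
  let t : E → Set ℝ := fun x => {a | (x ∈ frontier B ↔ a = 0) ∧ (x ∈ B ↔ a ≤ 0) ∧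
    (x ∉ B → Metric.infDist x B ≤ a) ∧ (x ∈ B → Metric.infDist x (frontier B) ≤ -a)}
  have hfsub := hBc.frontier_subset
  have hconv : ∀ x, Convex ℝ (t x) := by
    intro x
    rintro a ⟨ha1, ha2, ha3, ha4⟩ b ⟨hb1, hb2, hb3, hb4⟩ p q hp hq hpq
    simp only [smul_eq_mul]
    by_cases hxB : x ∈ B
    · have ha := ha2.1 hxB
      have hb := hb2.1 hxB
      have hdist : x ∈ B → Metric.infDist x (frontier B) ≤ -(p * a + q * b) := by
        intro _
        have h1 := mul_le_mul_of_nonneg_left (ha4 hxB) hp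
        have h2 := mul_le_mul_of_nonneg_left (hb4 hxB) hq
        calc Metric.infDist x (frontier B) = p * Metric.infDist x (frontier B) +
              q * Metric.infDist x (frontier B) := by rw [← add_mul, hpq, one_mul]
          _ ≤ _ := by linarith
      by_cases hxf : x ∈ frontier B
      · rw [ha1.1 hxf, hb1.1 hxf] at hdist ⊢
        exact ⟨by simp [hxf], by simp [hxB], fun h => absurd hxB h, hdist⟩
      · have ha' : a < 0 := lt_of_le_of_ne ha fun h => hxf (ha1.2 h)
        have hb' : b < 0 := lt_of_le_of_ne hb fun h => hxf (hb1.2 h)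
        have : p * a + q * b < 0 := by
          rcases hp.eq_or_lt with rfl | hp
          · rw [zero_add] at hpq; subst hpq; linarith
          · nlinarith [mul_neg_of_pos_of_neg hp ha', mul_nonpos_of_nonneg_of_nonpos hq hb]
        exact ⟨by simp [hxf, this.ne], by simp [hxB, this.le], fun h => absurd hxB h, hdist⟩
    · have ha : 0 < a := not_le.1 fun h => hxB (ha2.2 h)
      have hb : 0 < b := not_le.1 fun h => hxB (hb2.2 h)
      have : 0 < p * a + q * b := by
        rcases hp.eq_or_lt with rfl | hp
        · rw [zero_add] at hpq; subst hpq; linarith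
        · nlinarith [mul_pos hp ha, mul_nonneg hq hb.le]
      refine ⟨iff_of_false (fun h => hxB (hfsub h)) this.ne', by simp [hxB, this], fun _ => ?_,
        fun h => absurd h hxB⟩
      have h1 := ha3 hxB
      have h2 := hb3 hxB
      calc Metric.infDist x B = p * Metric.infDist x B + q * Metric.infDist x B := by
            rw [← add_mul, hpq, one_mul]
        _ ≤ _ := by gcongr
  obtain ⟨g, hg⟩ := exists_contMDiffMap_forall_mem_convex_of_local (n := (⊤ : ℕ∞)) (modelWithCornersSelf ℝ E) hconv (by
    intro x
    by_cases hxf : x ∈ frontier B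
    · obtain ⟨U, f, hU, hxU, hf, hf0, hfU⟩ := hloc x hxf
      obtain ⟨W, hW, g, hg, h1, h2, h3, h4⟩ :=
        exists_local_defining_function hBc hB hr0 hrB hxf hU hxU hf hf0 hfU
      exact ⟨W, hW, g, hg.contMDiffOn, fun y hy => ⟨h1 y hy, h2 y hy, h3 y hy, h4 y hy⟩⟩
    · by_cases hxB : x ∈ B
      · have hxi : x ∈ interior B := by
          by_contra h
          exact hxf ⟨subset_closure hxB, h⟩
        refine ⟨interior B ∩ Metric.ball x 1, (isOpen_interior.inter Metric.isOpen_ball).mem_nhds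
          ⟨hxi, by simp⟩, fun _ => -(1 + Metric.infDist x (frontier B)), contMDiffOn_const,
          fun y hy => ?_⟩
        have hpos : 0 < 1 + Metric.infDist x (frontier B) := by
          linarith [Metric.infDist_nonneg (x := x) (s := frontier B)]
        refine ⟨?_, ?_, fun h => absurd (interior_subset hy.1) h, fun _ => ?_⟩
        · exact iff_of_false (fun h => h.2 hy.1) (by linarith)
        · exact iff_of_true (interior_subset hy.1) (by linarith)
        · have := Metric.infDist_le_infDist_add_dist (x := y) (y := x) (s := frontier B)
          have h2 : dist y x < 1 := hy.2
          linarith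
      · refine ⟨Bᶜ ∩ Metric.ball x 1, (hBc.isOpen_compl.inter Metric.isOpen_ball).mem_nhds
          ⟨hxB, by simp⟩, fun _ => 1 + Metric.infDist x B, contMDiffOn_const, fun y hy => ?_⟩
        have hpos : 0 < 1 + Metric.infDist x B := by
          linarith [Metric.infDist_nonneg (x := x) (s := B)]
        refine ⟨?_, ?_, fun _ => ?_, fun h => absurd h hy.1⟩
        · exact iff_of_false (fun h => hy.1 (hfsub h)) hpos.ne'
        · simp only [show y ∉ B from hy.1, false_iff, not_le]; exact hpos
        · have := Metric.infDist_le_infDist_add_dist (x := y) (y := x) (s := B)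
          have h2 : dist y x < 1 := hy.2
          linarith)
  refine ⟨g, g.contMDiff.contDiff, fun x => (hg x).2.1, fun x => (hg x).1, fun x hx h0 => ?_,
    fun x => (hg x).2.2.2⟩
  have hgd : DifferentiableAt ℝ g x := g.contMDiff.contDiff.contDiffAt.differentiableAt (by simp)
  have hgx : g x = 0 := (hg x).1.1 hx
  have h := hasDerivAt_comp_ray (f := g) (x := x) (v := x - x₀) (s := 0) (by simpa using hgd)
  rw [zero_smul, add_zero, ← inner_gradient_left, h0, inner_zero_left,
    hasDerivAt_iff_tendsto_slope] at h
  have h' := (h.mono_left (nhdsWithin_mono (0 : ℝ) (fun s hs => ne_of_gt hs : Set.Ioi (0 : ℝ) ⊆ _)))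
  -- By the outer cone, $x+s(x-x_0)$ has distance at least $sr/2$ from $B$, and $g$ dominates this
  -- distance. So the derivative of $g$ along $x-x_0$ is at least $r/2$.
  have hge : ∀ᶠ s in nhdsWithin (0 : ℝ) (Set.Ioi 0), r / 2 ≤
      slope (fun s : ℝ => g (x + s • (x - x₀))) 0 s := by
    filter_upwards [self_mem_nhdsWithin] with s hs
    have hs0 : (0 : ℝ) < s := hs
    have hnot : x + s • (x - x₀) ∉ B := by
      simpa using hB.add_smul_notMem_of_mem_frontier hx hrB hs0 (b := 0) (by simpa using hr0)
    have h1 := (hg (x + s • (x - x₀))).2.2.1 hnot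
    have h2 : s * r / 2 ≤ Metric.infDist (x + s • (x - x₀)) B := by
      rw [Metric.le_infDist ⟨x₀, interior_subset hx₀⟩]
      intro y hy
      by_contra! hlt
      refine hB.add_smul_notMem_of_mem_frontier hx hrB hs0
        (b := s⁻¹ • (y - (x + s • (x - x₀)))) ?_ ?_
      · rw [norm_smul, norm_inv, Real.norm_of_nonneg hs0.le, inv_mul_lt_iff₀ hs0, ← dist_eq_norm,
          dist_comm]
        nlinarith [mul_pos hs0 hr0]
      · convert hy using 1
        rw [smul_add, smul_smul, mul_inv_cancel₀ hs0.ne', one_smul]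
        abel
    simp only [slope, sub_zero, vsub_eq_sub, zero_smul, add_zero, hgx, smul_eq_mul]
    rw [le_inv_mul_iff₀ hs0]
    linarith
  have := ge_of_tendsto h' hge
  linarith

end DefiningFunction

/-! ### Taylor estimates depending on a parameter. -/

section ParametricJets

universe u

variable {Y : Type*} [NormedAddCommGroup Y] [NormedSpace ℝ Y]
  {E : Type u} [NormedAddCommGroup E] [NormedSpace ℝ E]
  {G : Type u} [NormedAddCommGroup G] [NormedSpace ℝ G]

/-- The partial derivative of a function of two variables in the second variable. -/
noncomputable def fderivSnd (f : Y × E → G) (p : Y × E) : E →L[ℝ] G :=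
  (fderiv ℝ f p).comp (ContinuousLinearMap.inr ℝ Y E)

theorem ContDiff.fderivSnd {f : Y × E → G} (hf : ContDiff ℝ ∞ f) : ContDiff ℝ ∞ (fderivSnd f) :=
  (hf.fderiv_right (m := ∞) (by simp)).clm_comp contDiff_const

theorem hasFDerivAt_fderivSnd {f : Y × E → G} (hf : ContDiff ℝ ∞ f) (y : Y) (z : E) :
    HasFDerivAt (fun z => f (y, z)) (fderivSnd f (y, z)) z := by
  have h1 : HasFDerivAt (fun z : E => (y, z)) (ContinuousLinearMap.inr ℝ Y E) z :=
    hasFDerivAt_prodMk_right y z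
  exact ((hf.differentiable (by simp)) (y, z)).hasFDerivAt.comp z h1

theorem fderivSnd_add {f g : Y × E → G} (hf : ContDiff ℝ ∞ f) (hg : ContDiff ℝ ∞ g) :
    fderivSnd (f + g) = fderivSnd f + fderivSnd g := by
  ext p v
  simp only [fderivSnd, Pi.add_apply]
  rw [fderiv_add (hf.differentiable (by simp) p) (hg.differentiable (by simp) p)]
  simp

theorem fderivSnd_neg {f : Y × E → G} :
    fderivSnd (fun p => -f p) = fun p => -fderivSnd f p := by
  ext p v
  simp [fderivSnd, fderiv_fun_neg]

/-- `f (y, ·)` vanishes to order `k` at the origin for all `y ∈ K`. -/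
def VanishesToOrder (K : Set Y) : ℕ → ∀ {G : Type u} [NormedAddCommGroup G] [NormedSpace ℝ G],
    (Y × E → G) → Prop
  | 0, _, _, _, _ => True
  | k + 1, _, _, _, f => (∀ y ∈ K, f (y, 0) = 0) ∧ VanishesToOrder K k (fderivSnd f)

namespace VanishesToOrder

variable {K : Set Y}

theorem add (k : ℕ) {G : Type u} [NormedAddCommGroup G] [NormedSpace ℝ G] {f g : Y × E → G}
    (hf : ContDiff ℝ ∞ f) (hg : ContDiff ℝ ∞ g) (h : VanishesToOrder K k f)
    (h' : VanishesToOrder K k g) : VanishesToOrder K k (f + g) := by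
  induction k generalizing G with
  | zero => trivial
  | succ k ih =>
    refine ⟨fun y hy => by simp [h.1 y hy, h'.1 y hy], ?_⟩
    rw [fderivSnd_add hf hg]
    exact ih hf.fderivSnd hg.fderivSnd h.2 h'.2

/-- Each vanishing derivative gains a factor $\|z\|$ through the mean value inequality on the ball
of radius $\|z\|$; compactness supplies the bound of order zero. -/
theorem exists_bound (hK : IsCompact K) [ProperSpace E] (r : ℝ) (k : ℕ) {G : Type u}
    [NormedAddCommGroup G] [NormedSpace ℝ G] {f : Y × E → G}
    (hf : ContDiff ℝ ∞ f) (h : VanishesToOrder K k f) :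
    ∃ C, 0 ≤ C ∧ ∀ y ∈ K, ∀ z : E, ‖z‖ ≤ r → ‖f (y, z)‖ ≤ C * ‖z‖ ^ k := by
  induction k generalizing G with
  | zero =>
    obtain ⟨C, hC⟩ := (hK.prod (isCompact_closedBall (0 : E) r)).exists_bound_of_continuousOn
      hf.continuous.continuousOn
    refine ⟨max C 0, le_max_right _ _, fun y hy z hz => ?_⟩
    rw [pow_zero, mul_one]
    exact (hC (y, z) ⟨hy, by simpa using hz⟩).trans (le_max_left _ _)
  | succ k ih =>
    obtain ⟨C, hC0, hC⟩ := ih hf.fderivSnd h.2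
    refine ⟨C, hC0, fun y hy z hz => ?_⟩
    have := (convex_closedBall (0 : E) ‖z‖).norm_image_sub_le_of_norm_hasFDerivWithin_le
      (f := fun z => f (y, z)) (f' := fun z => fderivSnd f (y, z)) (C := C * ‖z‖ ^ k)
      (fun w _ => (hasFDerivAt_fderivSnd hf y w).hasFDerivWithinAt)
      (fun w hw => by
        have hw' : ‖w‖ ≤ ‖z‖ := by simpa using hw
        exact (hC y hy w (hw'.trans hz)).trans (by gcongr))
      (x := 0) (y := z) (by simp) (by simp)
    rw [h.1 y hy, sub_zero, sub_zero] at this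
    rw [pow_succ, ← mul_assoc]
    exact this

end VanishesToOrder

/-- The Euler field in the second variable. -/
def eulerSnd (p : Y × E) : Y × E := (0, p.2)

theorem contDiff_eulerSnd : ContDiff ℝ ∞ (eulerSnd : Y × E → Y × E) :=
  contDiff_const.prodMk contDiff_snd

/-- The commutator of $\partial_z$ with the Euler field is $\partial_z$. Consequently the Euler
field preserves the order of vanishing. -/
theorem fderivSnd_fieldDeriv_eulerSnd {f : Y × E → G} (hf : ContDiff ℝ ∞ f) :
    fderivSnd (fieldDeriv eulerSnd f) = fderivSnd f + fieldDeriv eulerSnd (fderivSnd f) := by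
  ext p v
  have hd := (hf.fderiv_right (m := ∞) (by simp)).differentiable (by simp) p
  have he : HasFDerivAt (eulerSnd : Y × E → Y × E)
      ((0 : Y × E →L[ℝ] Y).prod (ContinuousLinearMap.snd ℝ Y E)) p :=
    (hasFDerivAt_const _ _).prodMk hasFDerivAt_snd
  have h1 := hd.hasFDerivAt.clm_apply he
  have hsymm : IsSymmSndFDerivAt ℝ f p :=
    (hf.contDiffAt (x := p)).isSymmSndFDerivAt (by rw [minSmoothness_of_isRCLikeNormedField]; exact WithTop.coe_le_coe.2 le_top)
  have h2 : HasFDerivAt (fderivSnd f)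
      ((ContinuousLinearMap.compL ℝ E (Y × E) G).flip (ContinuousLinearMap.inr ℝ Y E) ∘L
        fderiv ℝ (fderiv ℝ f) p) p :=
    ((ContinuousLinearMap.compL ℝ E (Y × E) G).flip
      (ContinuousLinearMap.inr ℝ Y E)).hasFDerivAt.comp p hd.hasFDerivAt
  change (fderiv ℝ (fun p => (fderiv ℝ f p) (eulerSnd p)) p) (ContinuousLinearMap.inr ℝ Y E v) = _
  rw [h1.fderiv]
  simp only [Pi.add_apply, add_apply, fieldDeriv, h2.fderiv]
  simp [fderivSnd, eulerSnd, hsymm.eq (0, p.2) (0, v)]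

theorem VanishesToOrder.fieldDeriv_eulerSnd {K : Set Y} (k : ℕ) {G : Type u}
    [NormedAddCommGroup G] [NormedSpace ℝ G] {f : Y × E → G} (hf : ContDiff ℝ ∞ f)
    (h : VanishesToOrder K k f) : VanishesToOrder K k (fieldDeriv eulerSnd f) := by
  induction k generalizing G with
  | zero => trivial
  | succ k ih =>
    refine ⟨fun y hy => ?_, ?_⟩
    · simp only [fieldDeriv, eulerSnd]
      exact map_zero _
    · rw [fderivSnd_fieldDeriv_eulerSnd hf]
      exact VanishesToOrder.add k hf.fderivSnd (hf.fderivSnd.fieldDeriv contDiff_eulerSnd) h.2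
        (ih hf.fderivSnd h.2)

theorem VanishesToOrder.fieldDeriv_eulerSnd_iterate {K : Set Y} {k : ℕ} {f : Y × E → G}
    (hf : ContDiff ℝ ∞ f) (h : VanishesToOrder K k f) (j : ℕ) :
    VanishesToOrder K k ((fieldDeriv eulerSnd)^[j] f) := by
  induction j with
  | zero => exact h
  | succ j ih =>
    rw [Function.iterate_succ_apply']
    exact VanishesToOrder.fieldDeriv_eulerSnd k (hf.fieldDeriv_iterate contDiff_eulerSnd j) ih

theorem fderivSnd_reflect {f : Y × E → G} (hf : ContDiff ℝ ∞ f) :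
    fderivSnd (fun p : Y × E => f (p.1, -p.2)) = fun p => -fderivSnd f (p.1, -p.2) := by
  ext p v
  have h1 : HasFDerivAt (fun p : Y × E => (p.1, -p.2))
      ((ContinuousLinearMap.fst ℝ Y E).prod (-ContinuousLinearMap.snd ℝ Y E)) p :=
    hasFDerivAt_fst.prodMk hasFDerivAt_snd.neg
  have h2 := ((hf.differentiable (by simp)) (p.1, -p.2)).hasFDerivAt.comp p h1
  rw [fderivSnd, show (fun p : Y × E => f (p.1, -p.2)) = f ∘ (fun p : Y × E => (p.1, -p.2)) from rfl,
    h2.fderiv]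
  simp only [fderivSnd, ContinuousLinearMap.comp_apply, neg_apply]
  rw [← map_neg]
  simp

theorem ContDiff.reflectSnd {f : Y × E → G} (hf : ContDiff ℝ ∞ f) :
    ContDiff ℝ ∞ (fun p : Y × E => f (p.1, -p.2)) :=
  hf.comp (contDiff_fst.prodMk contDiff_snd.neg)

/-- The leading Taylor term is homogeneous of degree $k$, so the combination with the reflected
function that has the opposite parity cancels it. Differentiation exchanges the two parities, whence
the simultaneous induction. The case $k=3$ gives the fourth-order bound on the even part of the
phase remainder. -/
theorem VanishesToOrder.add_reflect_aux {K : Set Y} (k : ℕ) {G : Type u}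
    [NormedAddCommGroup G] [NormedSpace ℝ G] {f : Y × E → G} (hf : ContDiff ℝ ∞ f)
    (h : VanishesToOrder K k f) :
    (Even k → VanishesToOrder K (k + 1) (fun p => f p - f (p.1, -p.2))) ∧
      (Odd k → VanishesToOrder K (k + 1) (fun p => f p + f (p.1, -p.2))) := by
  induction k generalizing G with
  | zero => exact ⟨fun _ => ⟨by simp, trivial⟩, fun h => by simp at h⟩
  | succ k ih =>
    obtain ⟨ih1, ih2⟩ := ih hf.fderivSnd h.2
    constructor
    · intro hk
      refine ⟨by simp, ?_⟩
      have hk' : Odd k := by grind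
      convert ih2 hk' using 1
      rw [show (fun p : Y × E => f p - f (p.1, -p.2)) = f + fun p => -f (p.1, -p.2) from
        funext fun p => sub_eq_add_neg _ _, fderivSnd_add hf hf.reflectSnd.neg, fderivSnd_neg,
        fderivSnd_reflect hf]
      ext p v
      simp
    · intro hk
      refine ⟨fun y hy => by simp [h.1 y hy], ?_⟩
      have hk' : Even k := by grind
      convert ih1 hk' using 1
      rw [show (fun p : Y × E => f p + f (p.1, -p.2)) = f + fun p => f (p.1, -p.2) from rfl,
        fderivSnd_add hf hf.reflectSnd, fderivSnd_reflect hf]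
      ext p v
      simp [sub_eq_add_neg]

/-- Linear maps intertwine Euler fields. This carries bounds on the ambient space over to every
parametrization $R$ of a tangent hyperplane, uniformly in $R$. -/
theorem fieldDeriv_iterate_comp_linear {F : Type*} [NormedAddCommGroup F] [NormedSpace ℝ F]
    {f : Y × E → G} (hf : ContDiff ℝ ∞ f) (y : Y) (R : F →L[ℝ] E) (j : ℕ) :
    (fieldDeriv (fun z : F => z))^[j] (fun z => f (y, R z)) =
      fun z => ((fieldDeriv eulerSnd)^[j] f) (y, R z) := by
  induction j with
  | zero => rfl
  | succ j ih =>
    rw [Function.iterate_succ_apply', Function.iterate_succ_apply', ih]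
    ext z
    have h := (hasFDerivAt_fderivSnd (hf.fieldDeriv_iterate contDiff_eulerSnd j) y (R z)).comp z
      R.hasFDerivAt
    rw [fieldDeriv, show (fun z => ((fieldDeriv eulerSnd)^[j] f) (y, R z)) =
      (fun w => ((fieldDeriv eulerSnd)^[j] f) (y, w)) ∘ R from rfl, h.fderiv]
    simp [fieldDeriv, fderivSnd, eulerSnd]

/-- Uniform bounds for the Euler derivatives of a family of functions vanishing to third order. -/
theorem VanishesToOrder.exists_fieldBound_three [ProperSpace E] {K : Set Y} (hK : IsCompact K)
    {f : Y × E → G} (hf : ContDiff ℝ ∞ f) (h : VanishesToOrder K 3 f) (r : ℝ) (n : ℕ) :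
    ∃ C, 0 ≤ C ∧ ∀ {F : Type*} [NormedAddCommGroup F] [NormedSpace ℝ F] (R : F →L[ℝ] E),
      (∀ z, ‖R z‖ = ‖z‖) → ∀ y ∈ K,
      FieldBound (fun z : F => z) (Metric.closedBall 0 r) n C (fun z => ‖z‖ ^ 3)
        (fun z => f (y, R z)) ∧
      FieldBound (fun z : F => z) (Metric.closedBall 0 r) n C (fun z => ‖z‖ ^ 4)
        (fun z => f (y, R z) + f (y, R (-z))) := by
  have h4 := (VanishesToOrder.add_reflect_aux 3 hf h).2 (by decide)
  have hf4 : ContDiff ℝ ∞ (fun p : Y × E => f p + f (p.1, -p.2)) := hf.add hf.reflectSnd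
  choose C₁ hC₁0 hC₁ using fun j => VanishesToOrder.exists_bound hK r 3
    (hf.fieldDeriv_iterate contDiff_eulerSnd j) (h.fieldDeriv_eulerSnd_iterate hf j)
  choose C₂ hC₂0 hC₂ using fun j => VanishesToOrder.exists_bound hK r 4
    (hf4.fieldDeriv_iterate contDiff_eulerSnd j) (h4.fieldDeriv_eulerSnd_iterate hf4 j)
  have hs : ∀ j ∈ Finset.range (n + 1), C₁ j + C₂ j ≤ ∑ j ∈ Finset.range (n + 1), (C₁ j + C₂ j) :=
    fun j hj => Finset.single_le_sum (f := fun j => C₁ j + C₂ j)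
      (fun i _ => add_nonneg (hC₁0 i) (hC₂0 i)) hj
  refine ⟨∑ j ∈ Finset.range (n + 1), (C₁ j + C₂ j),
    Finset.sum_nonneg fun i _ => add_nonneg (hC₁0 i) (hC₂0 i), fun R hR y hy => ⟨?_, ?_⟩⟩
  · intro j hj z hz
    rw [fieldDeriv_iterate_comp_linear hf]
    have := hC₁ j y hy (R z) (by rw [hR]; simpa using hz)
    rw [hR] at this
    refine this.trans (mul_le_mul_of_nonneg_right ?_ (by positivity))
    linarith [hs j (Finset.mem_range.2 (by omega)), hC₂0 j]
  · intro j hj z hz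
    have e : (fun z => f (y, R z) + f (y, R (-z))) =
        fun z => (fun p : Y × E => f p + f (p.1, -p.2)) (y, R z) := by
      ext z; simp
    rw [e, fieldDeriv_iterate_comp_linear hf4]
    have := hC₂ j y hy (R z) (by rw [hR]; simpa using hz)
    rw [hR] at this
    refine this.trans (mul_le_mul_of_nonneg_right ?_ (by positivity))
    linarith [hs j (Finset.mem_range.2 (by omega)), hC₁0 j]

/-- The field on a product acting along the second factor. -/
def fieldSnd (W : Y × E → E) (p : Y × E) : Y × E := (0, W p)

theorem fieldDeriv_fieldSnd_iterate {W : Y × E → E} (hW : ContDiff ℝ ∞ W) {f : Y × E → G}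
    (hf : ContDiff ℝ ∞ f) (y : Y) (j : ℕ) :
    (fieldDeriv (fun z : E => W (y, z)))^[j] (fun z => f (y, z)) =
      fun z => ((fieldDeriv (fieldSnd W))^[j] f) (y, z) := by
  have hW' : ContDiff ℝ ∞ (fieldSnd W) := contDiff_const.prodMk hW
  induction j with
  | zero => rfl
  | succ j ih =>
    rw [Function.iterate_succ_apply', Function.iterate_succ_apply', ih]
    ext z
    rw [fieldDeriv, (hasFDerivAt_fderivSnd (hf.fieldDeriv_iterate hW' j) y z).fderiv]
    simp [fieldDeriv, fderivSnd, fieldSnd]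

/-- Uniform bounds for derivatives along a family of fields. -/
theorem exists_fieldBound_const [ProperSpace E] {K : Set Y} (hK : IsCompact K) {W : Y × E → E}
    (hW : ContDiff ℝ ∞ W) {f : Y × E → G} (hf : ContDiff ℝ ∞ f) (r : ℝ) (n : ℕ) :
    ∃ C, 0 ≤ C ∧ ∀ y ∈ K, FieldBound (fun z => W (y, z)) (Metric.closedBall 0 r) n C (fun _ => 1)
        (fun z => f (y, z)) := by
  have hW' : ContDiff ℝ ∞ (fieldSnd W) := contDiff_const.prodMk hW
  choose C hC0 hC using fun j => VanishesToOrder.exists_bound (K := K) hK r 0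
    (hf.fieldDeriv_iterate hW' j) trivial
  refine ⟨∑ j ∈ Finset.range (n + 1), C j, Finset.sum_nonneg fun i _ => hC0 i,
    fun y hy j hj z hz => ?_⟩
  rw [fieldDeriv_fieldSnd_iterate hW hf]
  refine (hC j y hy z (by simpa using hz)).trans ?_
  rw [pow_zero, mul_one, mul_one]
  exact Finset.single_le_sum (f := C) (fun i _ => hC0 i) (Finset.mem_range.2 (by omega))

/-- Uniform bounds for derivatives along a family of fields vanishing at the origin, of functions
vanishing at the origin. -/
theorem exists_fieldBound_norm [ProperSpace E] {K : Set Y} (hK : IsCompact K) {W : Y × E → E}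
    (hW : ContDiff ℝ ∞ W) (hW0 : ∀ y ∈ K, W (y, 0) = 0) {f : Y × E → G} (hf : ContDiff ℝ ∞ f)
    (hf0 : ∀ y ∈ K, f (y, 0) = 0) (r : ℝ) (n : ℕ) :
    ∃ C, 0 ≤ C ∧ ∀ y ∈ K, FieldBound (fun z => W (y, z)) (Metric.closedBall 0 r) n C (fun z => ‖z‖)
        (fun z => f (y, z)) := by
  have hW' : ContDiff ℝ ∞ (fieldSnd W) := contDiff_const.prodMk hW
  have hv : ∀ j, VanishesToOrder K 1 ((fieldDeriv (fieldSnd W))^[j] f) := by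
    intro j
    refine ⟨fun y hy => ?_, trivial⟩
    cases j with
    | zero => exact hf0 y hy
    | succ j =>
      rw [Function.iterate_succ_apply']
      simp only [fieldDeriv, fieldSnd, hW0 y hy]
      exact map_zero _
  choose C hC0 hC using fun j => VanishesToOrder.exists_bound (K := K) hK r 1
    (hf.fieldDeriv_iterate hW' j) (hv j)
  refine ⟨∑ j ∈ Finset.range (n + 1), C j, Finset.sum_nonneg fun i _ => hC0 i,
    fun y hy j hj z hz => ?_⟩
  rw [fieldDeriv_fieldSnd_iterate hW hf]
  refine (hC j y hy z (by simpa using hz)).trans ?_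
  rw [pow_one]
  refine mul_le_mul_of_nonneg_right ?_ (norm_nonneg _)
  exact Finset.single_le_sum (f := C) (fun i _ => hC0 i) (Finset.mem_range.2 (by omega))

end ParametricJets

/-! ### Implicit functions and smooth extension. -/

theorem hasDerivAt_prodMk_right_comp {X : Type*} [NormedAddCommGroup X] [NormedSpace ℝ X]
    {H : X × ℝ → ℝ} {p : X} {u : ℝ} (hH : DifferentiableAt ℝ H (p, u)) :
    HasDerivAt (fun u => H (p, u)) (fderiv ℝ H (p, u) (0, 1)) u := by
  have h : HasDerivAt (fun u : ℝ => (p, u)) ((0 : X), (1 : ℝ)) u :=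
    (hasDerivAt_const u p).prodMk (hasDerivAt_id u)
  exact hH.hasFDerivAt.comp_hasDerivAt u h

/-- A scalar implicit function theorem: near a regular zero, the sublevel set is an epigraph. -/
theorem exists_implicit_sublevel {X : Type*} [NormedAddCommGroup X] [NormedSpace ℝ X]
    [CompleteSpace X] {H : X × ℝ → ℝ} {O : Set (X × ℝ)} (hO : IsOpen O) (hH : ContDiffOn ℝ ∞ H O)
    {p₀ : X} (h0 : (p₀, (0 : ℝ)) ∈ O) (hz : H (p₀, 0) = 0) (hd : fderiv ℝ H (p₀, 0) (0, 1) < 0) :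
    ∃ ε > 0, ∃ δ > 0, ∃ ψ : X → ℝ, ContDiffOn ℝ ∞ ψ (Metric.ball p₀ δ) ∧
      ∀ p ∈ Metric.ball p₀ δ, |ψ p| < ε ∧ (∀ u, |u| < ε → (p, u) ∈ O) ∧ H (p, ψ p) = 0 ∧
        ∀ u, |u| < ε → (H (p, u) ≤ 0 ↔ ψ p ≤ u) := by
  set c := -fderiv ℝ H (p₀, 0) (0, 1) / 2 with hc
  have hc0 : 0 < c := by rw [hc]; linarith
  have hcd : ContinuousOn (fun q => fderiv ℝ H q (0, 1)) O :=
    (hH.continuousOn_fderiv_of_isOpen hO (by simp)).clm_apply continuousOn_const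
  obtain ⟨ε, hε, hεO⟩ : ∃ ε > 0, ∀ q ∈ Metric.ball (p₀, (0 : ℝ)) ε,
      q ∈ O ∧ fderiv ℝ H q (0, 1) < -c := by
    have h1 : ∀ᶠ q in nhds (p₀, (0 : ℝ)), fderiv ℝ H q (0, 1) < -c :=
      (hcd.continuousAt (hO.mem_nhds h0)).eventually (gt_mem_nhds (by rw [hc]; linarith))
    have h2 : ∀ᶠ q in nhds (p₀, (0 : ℝ)), q ∈ O := hO.mem_nhds h0
    exact Metric.eventually_nhds_iff_ball.1 (h2.and h1)
  obtain ⟨δ', hδ', hδH⟩ : ∃ δ > 0, ∀ p ∈ Metric.ball p₀ δ, |H (p, 0)| < c * (ε / 2) := by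
    have hcont : ContinuousAt (fun p : X => |H (p, 0)|) p₀ := by
      have h1 : ContinuousAt H (p₀, 0) := hH.continuousOn.continuousAt (hO.mem_nhds h0)
      exact (ContinuousAt.comp (f := fun p : X => (p, (0 : ℝ))) h1 (by fun_prop)).abs
    exact Metric.eventually_nhds_iff_ball.1 (hcont.eventually (gt_mem_nhds (by
      simp only [hz, abs_zero]; positivity)))
  set δ := min ε δ'
  have hδ0 : 0 < δ := by positivity
  have hmem : ∀ p ∈ Metric.ball p₀ δ, ∀ u : ℝ, |u| < ε → (p, u) ∈ Metric.ball (p₀, (0 : ℝ)) ε := by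
    intro p hp u hu
    rw [Metric.mem_ball, Prod.dist_eq, max_lt_iff]
    exact ⟨lt_of_lt_of_le hp (min_le_left _ _), by simpa using hu⟩
  have hdiff : ∀ p ∈ Metric.ball p₀ δ, ∀ u : ℝ, |u| < ε →
      HasDerivAt (fun u => H (p, u)) (fderiv ℝ H (p, u) (0, 1)) u := fun p hp u hu =>
    hasDerivAt_prodMk_right_comp ((hH.contDiffAt (hO.mem_nhds
      (hεO _ (hmem p hp u hu)).1)).differentiableAt (by simp))
  -- Strict decrease in $u$ gives both uniqueness of the zero and the description of the sublevel
  -- set as the points above it.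
  have hmono : ∀ p ∈ Metric.ball p₀ δ, ∀ u v : ℝ, |u| < ε → |v| < ε → u ≤ v →
      H (p, v) - H (p, u) ≤ -c * (v - u) := by
    intro p hp u v hu hv huv
    have hsub : ∀ τ ∈ Set.Icc u v, |τ| < ε := fun τ hτ =>
      abs_lt.2 ⟨(abs_lt.1 hu).1.trans_le hτ.1, hτ.2.trans_lt (abs_lt.1 hv).2⟩
    refine (convex_Icc u v).image_sub_le_mul_sub_of_deriv_le
      (f := fun u => H (p, u))
      (fun τ hτ => (hdiff p hp τ (hsub τ hτ)).continuousAt.continuousWithinAt)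
      (fun τ hτ => (hdiff p hp τ (hsub τ (interior_subset hτ))).differentiableAt.differentiableWithinAt)
      (fun τ hτ => ?_) u ⟨le_rfl, huv⟩ v ⟨huv, le_rfl⟩ huv
    have hτ' := hsub τ (interior_subset hτ)
    rw [(hdiff p hp τ hτ').deriv]
    exact (hεO _ (hmem p hp τ hτ')).2.le
  have hex : ∀ p ∈ Metric.ball p₀ δ, ∃ u : ℝ, |u| < ε ∧ H (p, u) = 0 := by
    intro p hp
    have hH0 := abs_lt.1 (hδH p (Metric.ball_subset_ball (min_le_right _ _) hp))
    have e1 : |(0 : ℝ)| < ε := by simpa using hε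
    have e2 : |ε / 2| < ε := by rw [abs_of_pos (by positivity)]; linarith
    have e3 : |-(ε / 2)| < ε := by rwa [abs_neg]
    have h1 := hmono p hp 0 (ε / 2) e1 e2 (by positivity)
    have h2 := hmono p hp (-(ε / 2)) 0 e3 e1 (by linarith)
    have hsub : ∀ τ ∈ Set.Icc (-(ε / 2)) (ε / 2), |τ| < ε := fun τ hτ =>
      (abs_le.2 hτ).trans_lt (by linarith)
    have hcont : ContinuousOn (fun u => H (p, u)) (Set.Icc (-(ε / 2)) (ε / 2)) := fun τ hτ =>
      (hdiff p hp τ (hsub τ hτ)).continuousAt.continuousWithinAt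
    obtain ⟨u, hu, hu0⟩ := intermediate_value_Icc' (by linarith) hcont
      (show (0 : ℝ) ∈ Set.Icc _ _ from ⟨by nlinarith, by nlinarith⟩)
    exact ⟨u, hsub u hu, hu0⟩
  choose! ψ hψε hψ0 using hex
  have huniq : ∀ p ∈ Metric.ball p₀ δ, ∀ u, |u| < ε → H (p, u) = 0 → u = ψ p := by
    intro p hp u hu hu0
    rcases le_total u (ψ p) with h | h
    · have := hmono p hp u (ψ p) hu (hψε p hp) h
      rw [hu0, hψ0 p hp] at this
      nlinarith
    · have := hmono p hp (ψ p) u (hψε p hp) hu h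
      rw [hu0, hψ0 p hp] at this
      nlinarith
  refine ⟨ε, hε, δ, hδ0, ψ, fun p hp => ContDiffAt.contDiffWithinAt ?_, fun p hp => ⟨hψε p hp,
    fun u hu => (hεO _ (hmem p hp u hu)).1, hψ0 p hp, fun u hu => ⟨fun h => ?_, fun h => ?_⟩⟩⟩
  · have hq := hεO _ (hmem p hp (ψ p) (hψε p hp))
    have cdf : ContDiffAt ℝ ∞ H (p, ψ p) := hH.contDiffAt (hO.mem_nhds hq.1)
    have hinv : (fderiv ℝ H (p, ψ p) ∘L .inr ℝ X ℝ).IsInvertible := by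
      have hne : fderiv ℝ H (p, ψ p) (0, 1) ≠ 0 := by linarith [hq.2]
      refine ⟨ContinuousLinearEquiv.unitsEquivAut ℝ (Units.mk0 _ hne), ?_⟩
      ext
      simp
    -- Smoothness of $\psi$ is checked point by point: the implicit function based at $(p,\psi(p))$
    -- is smooth and near $p$ solves the same equation within $(-\varepsilon,\varepsilon)$, so
    -- uniqueness identifies it with $\psi$.
    have h1 := cdf.contDiffAt_implicitFunction (by simp) hinv
    refine h1.congr_of_eventuallyEq ?_
    have h2 := cdf.eventually_apply_implicitFunction (by simp) hinv
    have h3 := cdf.implicitFunction_apply_self (by simp) hinv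
    have h4 : ∀ᶠ q in nhds p, |cdf.implicitFunction (by simp) hinv q| < ε := by
      refine h1.continuousAt.abs.eventually (gt_mem_nhds ?_)
      simp only at h3 ⊢
      rw [h3]
      exact hψε p hp
    filter_upwards [h2, h4, Metric.isOpen_ball.mem_nhds hp] with q hq1 hq2 hq3
    rw [hψ0 p hp] at hq1
    exact (huniq q hq3 _ hq2 hq1).symm
  · by_contra! hlt
    have := hmono p hp u (ψ p) hu (hψε p hp) hlt.le
    rw [hψ0 p hp] at this
    nlinarith
  · have := hmono p hp (ψ p) u (hψε p hp) hu h
    rw [hψ0 p hp] at this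
    nlinarith

/-- A function smooth near a point agrees near that point with a globally smooth function. -/
theorem exists_contDiff_eqOn_ball {X : Type*} [NormedAddCommGroup X] [NormedSpace ℝ X]
    [FiniteDimensional ℝ X] {G : Type*} [NormedAddCommGroup G] [NormedSpace ℝ G] {f : X → G}
    {p : X} {δ : ℝ} (hδ : 0 < δ) (hf : ContDiffOn ℝ ∞ f (Metric.ball p δ)) :
    ∃ g : X → G, ContDiff ℝ ∞ g ∧ Set.EqOn g f (Metric.ball p (δ / 4)) := by
  let b : ContDiffBump p := ⟨δ / 4, δ / 2, by positivity, by linarith⟩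
  refine ⟨fun x => b x • f x, ?_, fun x hx => ?_⟩
  · rw [contDiff_iff_contDiffAt]
    intro x
    by_cases hx : x ∈ Metric.ball p δ
    · exact b.contDiff.contDiffAt.smul (hf.contDiffAt (Metric.isOpen_ball.mem_nhds hx))
    · have hx' : x ∉ tsupport b := by
        rw [b.tsupport_eq]
        simp only [Metric.mem_closedBall, Metric.mem_ball, not_le, not_lt] at hx ⊢
        exact lt_of_lt_of_le (by change δ / 2 < δ; linarith) hx
      have : (fun x => b x • f x) =ᶠ[nhds x] fun _ => 0 := by
        filter_upwards [(isClosed_tsupport b).isOpen_compl.mem_nhds hx'] with y hy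
        rw [image_eq_zero_of_notMem_tsupport hy, zero_smul]
      exact contDiffAt_const.congr_of_eventuallyEq this
  · simp only
    rw [b.one_of_mem_closedBall (Metric.ball_subset_closedBall hx), one_smul]

/-! ### Gradient and exterior normal. -/

section Normals

variable {E : Type*} [NormedAddCommGroup E] [InnerProductSpace ℝ E] [FiniteDimensional ℝ E]
  {B : Set E} {ρ : E → ℝ}

/-- The unit normal to the level sets of `ρ`. -/
noncomputable def unitNormal (ρ : E → ℝ) (x : E) : E := ‖gradient ρ x‖⁻¹ • gradient ρ x

namespace IsDefiningFunction

variable (hρ : IsDefiningFunction B ρ)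
include hρ

theorem contDiff_gradient : ContDiff ℝ ∞ (gradient ρ) :=
  (InnerProductSpace.toDual ℝ E).symm.toContinuousLinearEquiv.contDiff.comp
    (hρ.contDiff.fderiv_right (m := ∞) (by simp))

theorem differentiableAt (x : E) : DifferentiableAt ℝ ρ x :=
  hρ.contDiff.contDiffAt.differentiableAt (by simp)

theorem norm_gradient_pos {x : E} (hx : x ∈ frontier B) : 0 < ‖gradient ρ x‖ :=
  norm_pos_iff.2 (hρ.gradient_ne_zero x hx)

theorem norm_unitNormal {x : E} (hx : x ∈ frontier B) : ‖unitNormal ρ x‖ = 1 := by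
  have := hρ.norm_gradient_pos hx
  rw [unitNormal, norm_smul, norm_inv, norm_norm, inv_mul_cancel₀ this.ne']

theorem gradient_eq_smul_unitNormal {x : E} (hx : x ∈ frontier B) :
    gradient ρ x = ‖gradient ρ x‖ • unitNormal ρ x := by
  have := hρ.norm_gradient_pos hx
  rw [unitNormal, smul_smul, mul_inv_cancel₀ this.ne', one_smul]

theorem contDiffOn_unitNormal : ContDiffOn ℝ ∞ (unitNormal ρ) {x | gradient ρ x ≠ 0} := by
  intro x hx
  have h := hρ.contDiff_gradient.contDiffAt (x := x)
  exact (((h.norm ℝ hx).inv (norm_ne_zero_iff.2 hx)).smul h).contDiffWithinAt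

theorem isOpen_gradient_ne_zero : IsOpen {x | gradient ρ x ≠ 0} :=
  isOpen_ne_fun hρ.contDiff_gradient.continuous continuous_const

theorem contDiffAt_unitNormal {x : E} (hx : x ∈ frontier B) : ContDiffAt ℝ ∞ (unitNormal ρ) x :=
  hρ.contDiffOn_unitNormal.contDiffAt
    (hρ.isOpen_gradient_ne_zero.mem_nhds (hρ.gradient_ne_zero x hx))

theorem isClosed : IsClosed B := by
  have : B = {x | ρ x ≤ 0} := Set.ext fun x => hρ.mem_iff x
  rw [this]
  exact isClosed_le hρ.contDiff.continuous continuous_const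

theorem frontier_subset : frontier B ⊆ B := hρ.isClosed.frontier_subset

theorem mem_of_inner_neg {x w : E} (hx : x ∈ frontier B) (hw : ⟪gradient ρ x, w⟫_ℝ < 0) :
    ∃ s : ℝ, 0 < s ∧ x + s • w ∈ B := by
  have h := hasDerivAt_comp_ray (f := ρ) (x := x) (v := w) (s := 0)
    (by simpa using hρ.differentiableAt x)
  rw [zero_smul, add_zero, ← inner_gradient_left, hasDerivAt_iff_tendsto_slope] at h
  have h' := h.mono_left (nhdsWithin_mono (0 : ℝ)
    (fun s hs => ne_of_gt hs : Set.Ioi (0 : ℝ) ⊆ _))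
  obtain ⟨s, hs1, hs2⟩ := ((h'.eventually (gt_mem_nhds hw)).and self_mem_nhdsWithin).exists
  have hs0 : (0 : ℝ) < s := hs2
  refine ⟨s, hs0, (hρ.mem_iff _).2 ?_⟩
  simp only [slope, sub_zero, vsub_eq_sub, zero_smul, add_zero, (hρ.frontier_iff x).1 hx,
    smul_eq_mul] at hs1
  by_contra! hcon
  exact absurd (mul_pos (inv_pos.2 hs0) hcon) hs1.not_gt

theorem inner_gradient_sub_nonpos (hB : Convex ℝ B) {x y : E} (hx : x ∈ frontier B) (hy : y ∈ B) :
    ⟪gradient ρ x, y - x⟫_ℝ ≤ 0 := by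
  have h := hasDerivAt_comp_ray (f := ρ) (x := x) (v := y - x) (s := 0)
    (by simpa using hρ.differentiableAt x)
  rw [zero_smul, add_zero, ← inner_gradient_left, hasDerivAt_iff_tendsto_slope] at h
  have h' := h.mono_left (nhdsWithin_mono (0 : ℝ)
    (fun s hs => ne_of_gt hs : Set.Ioi (0 : ℝ) ⊆ _))
  refine le_of_tendsto h' ?_
  filter_upwards [Ioo_mem_nhdsGT (show (0 : ℝ) < 1 by norm_num)] with s hs
  have hmem : x + s • (y - x) ∈ B :=
    hB.add_smul_sub_mem (hρ.frontier_subset hx) hy ⟨hs.1.le, hs.2.le⟩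
  simp only [slope, sub_zero, vsub_eq_sub, zero_smul, add_zero, (hρ.frontier_iff x).1 hx,
    smul_eq_mul]
  exact mul_nonpos_of_nonneg_of_nonpos (inv_nonneg.2 hs.1.le) ((hρ.mem_iff _).1 hmem)

theorem inner_unitNormal_sub_nonpos (hB : Convex ℝ B) {x y : E} (hx : x ∈ frontier B)
    (hy : y ∈ B) : ⟪unitNormal ρ x, y - x⟫_ℝ ≤ 0 := by
  rw [unitNormal, real_inner_smul_left]
  exact mul_nonpos_of_nonneg_of_nonpos (by positivity) (hρ.inner_gradient_sub_nonpos hB hx hy)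

/-- Every $w$ with $\langle\nabla\rho,w\rangle<0$ points into $B$, so $\nu$ is nonpositive on an
open half-space. This forces $\nu$ to be a nonnegative multiple of $\nabla\rho$, and its length
fixes the multiple. -/
theorem eq_unitNormal {x ν : E} (hx : x ∈ frontier B) (hν : ‖ν‖ = 1)
    (h : ∀ y ∈ B, ⟪ν, y - x⟫_ℝ ≤ 0) : ν = unitNormal ρ x := by
  set G := gradient ρ x with hG
  have hGp : 0 < ‖G‖ := hρ.norm_gradient_pos hx
  have hle : ∀ w, ⟪G, w⟫_ℝ < 0 → ⟪ν, w⟫_ℝ ≤ 0 := by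
    intro w hw
    obtain ⟨s, hs, hmem⟩ := hρ.mem_of_inner_neg hx hw
    have := h _ hmem
    rw [add_sub_cancel_left, real_inner_smul_right] at this
    exact nonpos_of_mul_nonpos_right this hs
  have hGG : ⟪G, G⟫_ℝ = ‖G‖ ^ 2 := real_inner_self_eq_norm_sq G
  set a := ⟪ν, G⟫_ℝ / ‖G‖ ^ 2 with ha
  have hp : ν - a • G = 0 := by
    rw [← norm_eq_zero, ← sq_eq_zero_iff]
    refine le_antisymm (le_of_forall_pos_le_add fun ε hε => ?_) (sq_nonneg _)
    have horth : ⟪G, ν - a • G⟫_ℝ = 0 := by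
      rw [inner_sub_right, real_inner_smul_right, hGG, ha, real_inner_comm]
      field_simp
      ring
    set η := ε / (|⟪ν, G⟫_ℝ| + 1) with hη
    have hη0 : 0 < η := by positivity
    have h1 := hle (ν - a • G - η • G) (by
      rw [inner_sub_right, horth, real_inner_smul_right, hGG]
      have : 0 < η * ‖G‖ ^ 2 := by positivity
      linarith)
    rw [inner_sub_right, real_inner_smul_right] at h1
    have h2 : ⟪ν, ν - a • G⟫_ℝ = ‖ν - a • G‖ ^ 2 := by
      rw [← real_inner_self_eq_norm_sq]
      rw [inner_sub_left ν (a • G), real_inner_smul_left, horth]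
      ring
    have h3 : η * |⟪ν, G⟫_ℝ| ≤ ε := by
      rw [hη, div_mul_eq_mul_div, div_le_iff₀ (by positivity)]
      nlinarith [abs_nonneg ⟪ν, G⟫_ℝ]
    have h4 : η * ⟪ν, G⟫_ℝ ≤ η * |⟪ν, G⟫_ℝ| := by gcongr; exact le_abs_self _
    linarith
  have hν' : ν = a • G := sub_eq_zero.1 hp
  have ha0 : 0 ≤ a := by
    have := hle (-G) (by rw [inner_neg_right, hGG]; simp; positivity)
    rw [inner_neg_right] at this
    rw [ha]
    exact div_nonneg (by linarith) (by positivity)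
  have h5 : a * ‖G‖ = 1 := by
    rw [hν', norm_smul, Real.norm_of_nonneg ha0] at hν
    exact hν
  rw [hν', unitNormal, ← hG, eq_inv_of_mul_eq_one_left h5]

end IsDefiningFunction

end Normals

/-! ### The boundary as a graph over its tangent hyperplanes. -/

section Graph

variable {E : Type} [NormedAddCommGroup E] [InnerProductSpace ℝ E] [FiniteDimensional ℝ E]
  {B : Set E} {ρ : E → ℝ}

/-- The point over `ζ` at height `-u`, in the coordinates given by the normal at `x`. -/
noncomputable def normalCoord (ρ : E → ℝ) (x ζ : E) (u : ℝ) : E :=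
  x + ζ - (u + ⟪unitNormal ρ x, ζ⟫_ℝ) • unitNormal ρ x

/-- `Ψ (x, ·)` describes the boundary as a graph over its tangent hyperplanes at the boundary
points `x` with `x ∈ U`. -/
structure IsBoundaryGraph (B : Set E) (ρ : E → ℝ) (U : Set E) (η ε : ℝ) (Ψ : E × E → ℝ) : Prop where
  contDiff : ContDiff ℝ ∞ Ψ
  eta_pos : 0 < η
  eps_pos : 0 < ε
  abs_lt : ∀ x ∈ U, x ∈ frontier B → ∀ ζ, ‖ζ‖ < η → |Ψ (x, ζ)| < ε
  eq_zero : ∀ x ∈ U, x ∈ frontier B → ∀ ζ, ‖ζ‖ < η → ρ (normalCoord ρ x ζ (Ψ (x, ζ))) = 0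
  mem_iff : ∀ x ∈ U, x ∈ frontier B → ∀ ζ, ‖ζ‖ < η → ∀ u, |u| < ε →
    (normalCoord ρ x ζ u ∈ B ↔ Ψ (x, ζ) ≤ u)

/-- The implicit function theorem is applied with the base point among the variables, so the graph
depends smoothly on it and later bounds are uniform. Since `normalCoord` sees only the tangential
part of $\zeta$, the vector $\zeta$ may range over the fixed space $E$ rather than over a moving
hyperplane. -/
theorem IsDefiningFunction.exists_isBoundaryGraph (hρ : IsDefiningFunction B ρ) {x : E}
    (hx : x ∈ frontier B) : ∃ η ε Ψ, IsBoundaryGraph B ρ (Metric.ball x η) η ε Ψ := by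
  have : CompleteSpace E := FiniteDimensional.complete ℝ E
  set H : (E × E) × ℝ → ℝ := fun q => ρ (normalCoord ρ q.1.1 q.1.2 q.2) with hH
  set O : Set ((E × E) × ℝ) := (fun q => q.1.1) ⁻¹' {x | gradient ρ x ≠ 0} with hO
  have hOo : IsOpen O := hρ.isOpen_gradient_ne_zero.preimage (by fun_prop)
  have hN : ContDiffOn ℝ ∞ (fun q : (E × E) × ℝ => unitNormal ρ q.1.1) O :=
    hρ.contDiffOn_unitNormal.comp (contDiff_fst.comp contDiff_fst).contDiffOn fun q hq => hq
  have hHs : ContDiffOn ℝ ∞ H O := by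
    refine hρ.contDiff.comp_contDiffOn ?_
    have h1 : ContDiffOn ℝ ∞ (fun q : (E × E) × ℝ => q.1.1) O :=
      (contDiff_fst.comp contDiff_fst).contDiffOn
    have h2 : ContDiffOn ℝ ∞ (fun q : (E × E) × ℝ => q.1.2) O :=
      (contDiff_snd.comp contDiff_fst).contDiffOn
    exact (h1.add h2).sub ((contDiff_snd.contDiffOn.add (hN.inner ℝ h2)).smul hN)
  have h0 : ((x, (0 : E)), (0 : ℝ)) ∈ O := hρ.gradient_ne_zero x hx
  have hz : H ((x, 0), 0) = 0 := by
    simp only [hH, normalCoord, inner_zero_right, add_zero, zero_smul, sub_zero]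
    exact (hρ.frontier_iff x).1 hx
  have hd : fderiv ℝ H ((x, 0), 0) (0, 1) < 0 := by
    have h1 := hasDerivAt_prodMk_right_comp
      ((hHs.contDiffAt (hOo.mem_nhds h0)).differentiableAt (by simp))
    have h2 := hasDerivAt_comp_ray (f := ρ) (x := x) (v := -unitNormal ρ x) (s := 0)
      (by simpa using hρ.differentiableAt x)
    have e : (fun u => H ((x, 0), u)) = fun s : ℝ => ρ (x + s • -unitNormal ρ x) := by
      ext u
      simp [hH, normalCoord, sub_eq_add_neg]
    rw [e] at h1
    rw [h1.unique h2, zero_smul, add_zero, ← inner_gradient_left, inner_neg_right,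
      hρ.gradient_eq_smul_unitNormal hx, real_inner_smul_left, real_inner_self_eq_norm_sq,
      hρ.norm_unitNormal hx]
    have := hρ.norm_gradient_pos hx
    simpa using this
  obtain ⟨ε, hε, δ, hδ, ψ, hψ, hψ'⟩ := exists_implicit_sublevel hOo hHs h0 hz hd
  obtain ⟨Ψ, hΨ, hΨψ⟩ := exists_contDiff_eqOn_ball hδ hψ
  have hmem : ∀ y ∈ Metric.ball x (δ / 4), ∀ ζ : E, ‖ζ‖ < δ / 4 →
      (y, ζ) ∈ Metric.ball (x, (0 : E)) (δ / 4) := by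
    intro y hy ζ hζ
    rw [Metric.mem_ball, Prod.dist_eq, max_lt_iff]
    exact ⟨hy, by simpa using hζ⟩
  have hsub : Metric.ball (x, (0 : E)) (δ / 4) ⊆ Metric.ball (x, (0 : E)) δ :=
    Metric.ball_subset_ball (by linarith)
  refine ⟨δ / 4, ε, Ψ, hΨ, by positivity, hε, ?_, ?_, ?_⟩
  · intro y hy _ ζ hζ
    rw [hΨψ (hmem y hy ζ hζ)]
    exact (hψ' _ (hsub (hmem y hy ζ hζ))).1
  · intro y hy _ ζ hζ
    rw [hΨψ (hmem y hy ζ hζ)]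
    exact (hψ' _ (hsub (hmem y hy ζ hζ))).2.2.1
  · intro y hy _ ζ hζ u hu
    rw [hΨψ (hmem y hy ζ hζ), hρ.mem_iff]
    exact (hψ' _ (hsub (hmem y hy ζ hζ))).2.2.2 u hu

namespace IsBoundaryGraph

variable {U : Set E} {η ε : ℝ} {Ψ : E × E → ℝ} (hΨ : IsBoundaryGraph B ρ U η ε Ψ)
  (hρ : IsDefiningFunction B ρ) {x : E} (hxU : x ∈ U) (hx : x ∈ frontier B)
include hΨ hρ hxU hx

theorem apply_zero : Ψ (x, 0) = 0 := by
  have h0 := hΨ.abs_lt x hxU hx 0 (by simpa using hΨ.eta_pos)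
  have h1 := hΨ.mem_iff x hxU hx 0 (by simpa using hΨ.eta_pos) 0 (by simpa using hΨ.eps_pos)
  have e : ∀ u, normalCoord ρ x 0 u = x + u • -unitNormal ρ x := by
    intro u; simp [normalCoord, sub_eq_add_neg]
  rw [e, zero_smul, add_zero] at h1
  have h2 := h1.1 (hρ.frontier_subset hx)
  refine le_antisymm h2 ?_
  by_contra! hneg
  -- points just outside along the normal would belong to `B`
  have h3 := hasDerivAt_comp_ray (f := ρ) (x := x) (v := unitNormal ρ x) (s := 0)
    (by simpa using hρ.differentiableAt x)
  rw [zero_smul, add_zero, ← inner_gradient_left, hρ.gradient_eq_smul_unitNormal hx,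
    real_inner_smul_left, real_inner_self_eq_norm_sq, hρ.norm_unitNormal hx,
    hasDerivAt_iff_tendsto_slope] at h3
  have h4 := h3.mono_left (nhdsWithin_mono (0 : ℝ)
    (fun s hs => ne_of_gt hs : Set.Ioi (0 : ℝ) ⊆ _))
  have hG := hρ.norm_gradient_pos hx
  obtain ⟨s, hs1, hs2⟩ := ((h4.eventually (lt_mem_nhds (show (0 : ℝ) < _ by simpa using hG))).and
    (Ioo_mem_nhdsGT (show (0 : ℝ) < -Ψ (x, 0) by linarith))).exists
  simp only [slope, sub_zero, vsub_eq_sub, zero_smul, add_zero, (hρ.frontier_iff x).1 hx,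
    smul_eq_mul] at hs1
  have h5 := (hΨ.mem_iff x hxU hx 0 (by simpa using hΨ.eta_pos) (-s) (by
    rw [abs_neg, abs_of_pos hs2.1]
    have := _root_.abs_lt.1 h0
    linarith [hs2.2])).2 (by linarith [hs2.2])
  rw [e, neg_smul, smul_neg, neg_neg, hρ.mem_iff] at h5
  have := pos_of_mul_pos_right hs1 (inv_pos.2 hs2.1).le
  linarith

theorem hasFDerivAt_normalCoord (ζ : E) : HasFDerivAt (fun ζ => normalCoord ρ x ζ (Ψ (x, ζ)))
    (ContinuousLinearMap.id ℝ E - (fderivSnd Ψ (x, ζ) + innerSL ℝ (unitNormal ρ x)).smulRight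
      (unitNormal ρ x)) ζ := by
  have h1 := hasFDerivAt_fderivSnd hΨ.contDiff x ζ
  have h2 := ((h1.add (innerSL ℝ (unitNormal ρ x)).hasFDerivAt).smul_const (unitNormal ρ x))
  exact ((hasFDerivAt_id ζ).const_add x).sub h2

/-- This is the derivative of the equation $\rho=0$ along the graph. It is kept as a product, not
solved for $d\Psi$, so that it can be differentiated once more. -/
theorem fderivSnd_mul_inner {ζ : E} (hζ : ‖ζ‖ < η) (v : E) :
    fderivSnd Ψ (x, ζ) v * ⟪gradient ρ (normalCoord ρ x ζ (Ψ (x, ζ))), unitNormal ρ x⟫_ℝ =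
      ⟪gradient ρ (normalCoord ρ x ζ (Ψ (x, ζ))), v - ⟪unitNormal ρ x, v⟫_ℝ • unitNormal ρ x⟫_ℝ := by
  have h1 := (hρ.differentiableAt (normalCoord ρ x ζ (Ψ (x, ζ)))).hasFDerivAt.comp ζ
    (hΨ.hasFDerivAt_normalCoord hρ hxU hx ζ)
  have h2 : (ρ ∘ fun ζ => normalCoord ρ x ζ (Ψ (x, ζ))) =ᶠ[nhds ζ] fun _ => 0 := by
    filter_upwards [Metric.isOpen_ball.mem_nhds (show ζ ∈ Metric.ball (0 : E) η by simpa using hζ)]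
      with w hw
    exact hΨ.eq_zero x hxU hx w (by simpa using hw)
  have h3 := h1.unique ((hasFDerivAt_const (0 : ℝ) ζ).congr_of_eventuallyEq h2)
  have h4 := congrFun (congrArg DFunLike.coe h3) v
  simp only [ContinuousLinearMap.comp_apply, zero_apply, ← inner_gradient_left, sub_apply,
    ContinuousLinearMap.id_apply, ContinuousLinearMap.smulRight_apply, add_apply, innerSL_apply_apply,
    inner_sub_right, real_inner_smul_right] at h4
  rw [inner_sub_right, real_inner_smul_right]
  linarith

theorem fderivSnd_zero : fderivSnd Ψ (x, 0) = 0 := by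
  ext v
  have h := hΨ.fderivSnd_mul_inner hρ hxU hx (ζ := 0) (by simpa using hΨ.eta_pos) v
  have e : normalCoord ρ x 0 (Ψ (x, 0)) = x := by
    rw [hΨ.apply_zero hρ hxU hx]; simp [normalCoord]
  have hG := hρ.norm_gradient_pos hx
  rw [e, hρ.gradient_eq_smul_unitNormal hx, real_inner_smul_left, real_inner_smul_left,
    inner_sub_right, real_inner_smul_right, real_inner_self_eq_norm_sq, hρ.norm_unitNormal hx] at h
  have : fderivSnd Ψ (x, 0) v * ‖gradient ρ x‖ = 0 := by linarith
  simpa [hG.ne'] using this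

/-- Differentiating `fderivSnd_mul_inner` at the origin, where $d\Psi=0$, leaves only the term in
which the second derivative of $\Psi$ multiplies $|\nabla\rho|$. -/
theorem fderivSnd_fderivSnd_zero (w v : E) :
    fderivSnd (fderivSnd Ψ) (x, 0) w v = ‖gradient ρ x‖⁻¹ *
      ⟪fderiv ℝ (gradient ρ) x (w - ⟪unitNormal ρ x, w⟫_ℝ • unitNormal ρ x),
        v - ⟪unitNormal ρ x, v⟫_ℝ • unitNormal ρ x⟫_ℝ := by
  have e : normalCoord ρ x 0 (Ψ (x, 0)) = x := by
    rw [hΨ.apply_zero hρ hxU hx]; simp [normalCoord]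
  have hγ := hΨ.hasFDerivAt_normalCoord hρ hxU hx 0
  have hG := (hρ.contDiff_gradient.contDiffAt (x := normalCoord ρ x 0 (Ψ (x, 0)))).differentiableAt
    (by simp)
  have hGγ := hG.hasFDerivAt.comp (0 : E) hγ
  have hD := (hasFDerivAt_fderivSnd hΨ.contDiff.fderivSnd x 0).clm_apply (hasFDerivAt_const v (0 : E))
  have h1 := hD.mul (hGγ.inner ℝ (hasFDerivAt_const (unitNormal ρ x) (0 : E)))
  have h2 := hGγ.inner ℝ (hasFDerivAt_const (v - ⟪unitNormal ρ x, v⟫_ℝ • unitNormal ρ x) (0 : E))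
  have h3 := h1.unique (h2.congr_of_eventuallyEq (by
    filter_upwards [Metric.isOpen_ball.mem_nhds (show (0 : E) ∈ Metric.ball (0 : E) η by
      simpa using hΨ.eta_pos)] with ζ hζ
    exact hΨ.fderivSnd_mul_inner hρ hxU hx (by simpa using hζ) v))
  have h4 := congrFun (congrArg DFunLike.coe h3) w
  have hGp := hρ.norm_gradient_pos hx
  simp only [Function.comp_apply, e, hΨ.fderivSnd_zero hρ hxU hx] at h4
  simp at h4
  rw [← inner_gradient_left, hρ.gradient_eq_smul_unitNormal hx, real_inner_smul_left,
    real_inner_self_eq_norm_sq, hρ.norm_unitNormal hx, one_pow, mul_one] at h4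
  rw [map_sub, map_smul, ← h4, inv_mul_cancel_left₀ hGp.ne']

/-- The curve over $s\mapsto sv$ in the graph lies in the boundary and has velocity $v$ at $x$.
Hence a derivative within the boundary is determined on tangent vectors. -/
theorem mem_tangentConeAt {v : E} (hv : ⟪unitNormal ρ x, v⟫_ℝ = 0) :
    v ∈ tangentConeAt ℝ (frontier B) x := by
  set γ : ℝ → E := fun s => normalCoord ρ x (s • v) (Ψ (x, s • v)) with hγ
  have hγ0 : γ 0 = x := by
    simp only [hγ, zero_smul, hΨ.apply_zero hρ hxU hx]; simp [normalCoord]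
  have h1 : HasDerivAt γ v 0 := by
    have h := hΨ.hasFDerivAt_normalCoord hρ hxU hx ((0 : ℝ) • v)
    have h2 : HasDerivAt (fun s : ℝ => s • v) v 0 := by
      simpa using (hasDerivAt_id (0 : ℝ)).smul_const v
    have h3 := h.comp_hasDerivAt (0 : ℝ) h2
    rw [zero_smul, hΨ.fderivSnd_zero hρ hxU hx] at h3
    have h4 : HasDerivAt γ _ 0 := h3
    simpa [hv] using h4
  rw [hasDerivAt_iff_tendsto_slope] at h1
  have h2 : Filter.Tendsto (fun s : ℝ => s • v) (nhdsWithin 0 {(0 : ℝ)}ᶜ) (nhds 0) := by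
    have : Continuous fun s : ℝ => s • v := by fun_prop
    simpa using (this.tendsto 0).mono_left nhdsWithin_le_nhds
  refine mem_tangentConeAt_of_seq (nhdsWithin (0 : ℝ) {0}ᶜ) (fun s => s⁻¹) (fun s => γ s - x) ?_ ?_ ?_
  · have h3 : ContinuousAt γ 0 := by
      have h := hΨ.hasFDerivAt_normalCoord hρ hxU hx ((0 : ℝ) • v)
      exact ContinuousAt.comp (f := fun s : ℝ => s • v)
        (g := fun ζ => normalCoord ρ x ζ (Ψ (x, ζ))) h.continuousAt (by fun_prop)
    have := (h3.tendsto.mono_left (nhdsWithin_le_nhds (s := {(0 : ℝ)}ᶜ))).sub_const x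
    rwa [hγ0, sub_self] at this
  · filter_upwards [h2.eventually (Metric.ball_mem_nhds 0 hΨ.eta_pos)] with s hs
    rw [add_sub_cancel, hρ.frontier_iff]
    exact hΨ.eq_zero x hxU hx _ (by simpa using hs)
  · refine h1.congr fun s => ?_
    simp [slope, hγ0]

theorem nonneg_of_inner_eq_zero (hB : Convex ℝ B) {ζ : E} (hζ : ‖ζ‖ < η)
    (hv : ⟪unitNormal ρ x, ζ⟫_ℝ = 0) : 0 ≤ Ψ (x, ζ) := by
  have h1 : normalCoord ρ x ζ (Ψ (x, ζ)) ∈ B :=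
    (hΨ.mem_iff x hxU hx ζ hζ _ (hΨ.abs_lt x hxU hx ζ hζ)).2 le_rfl
  have h2 := hρ.inner_unitNormal_sub_nonpos hB hx h1
  rw [normalCoord, hv, add_zero, add_sub_assoc, add_sub_cancel_left, inner_sub_right, hv,
    real_inner_smul_right, real_inner_self_eq_norm_sq, hρ.norm_unitNormal hx] at h2
  linarith

end IsBoundaryGraph

/-- The second fundamental form of the level sets of `ρ`. -/
noncomputable def secondForm (ρ : E → ℝ) (x v w : E) : ℝ :=
  ‖gradient ρ x‖⁻¹ * ⟪fderiv ℝ (gradient ρ) x v, w⟫_ℝ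

namespace IsDefiningFunction

variable (hρ : IsDefiningFunction B ρ)
include hρ

theorem secondForm_comm (x v w : E) : secondForm ρ x v w = secondForm ρ x w v := by
  have hd : ∀ a b : E, ⟪fderiv ℝ (gradient ρ) x a, b⟫_ℝ = fderiv ℝ (fderiv ℝ ρ) x a b := by
    intro a b
    have h1 := ((hρ.contDiff_gradient.contDiffAt (x := x)).differentiableAt
      (by simp)).hasFDerivAt.inner ℝ (hasFDerivAt_const b x)
    have h2 := (((hρ.contDiff.fderiv_right (m := ∞) (by simp)).contDiffAt (x := x)).differentiableAt
      (by simp)).hasFDerivAt.clm_apply (hasFDerivAt_const b x)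
    have h3 := congrFun (congrArg DFunLike.coe (h1.unique (by
      simpa only [inner_gradient_left] using h2))) a
    simpa using h3
  have hs : IsSymmSndFDerivAt ℝ ρ x := (hρ.contDiff.contDiffAt (x := x)).isSymmSndFDerivAt
    (by rw [minSmoothness_of_isRCLikeNormedField]; exact WithTop.coe_le_coe.2 le_top)
  rw [secondForm, secondForm, hd, hd, hs.eq]

/-- Differentiating the normalizing factor contributes only a multiple of $\nabla\rho$, which is
orthogonal to $w$. -/
theorem inner_fderiv_unitNormal {x : E} (hx : x ∈ frontier B) (v : E) {w : E}
    (hw : ⟪unitNormal ρ x, w⟫_ℝ = 0) :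
    ⟪fderiv ℝ (unitNormal ρ) x v, w⟫_ℝ = secondForm ρ x v w := by
  have hG := ((hρ.contDiff_gradient.contDiffAt (x := x)).differentiableAt (by simp)).hasFDerivAt
  have hn := ((((hρ.contDiff_gradient.contDiffAt (x := x)).norm ℝ
    (hρ.gradient_ne_zero x hx)).inv (hρ.norm_gradient_pos hx).ne').differentiableAt
      (n := ∞) (by simp)).hasFDerivAt
  have h := hn.smul hG
  have e : fderiv ℝ (unitNormal ρ) x = _ := h.fderiv
  have hw' : ⟪gradient ρ x, w⟫_ℝ = 0 := by
    rw [hρ.gradient_eq_smul_unitNormal hx, real_inner_smul_left, hw, mul_zero]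
  rw [e, secondForm]
  simp only [add_apply, smul_apply, ContinuousLinearMap.smulRight_apply, inner_add_left,
    real_inner_smul_left, hw', mul_zero, add_zero]
  rfl

/-- A derivative of the unit normal within the boundary is determined on tangent vectors. -/
theorem fderivWithin_unitNormal {x : E} (hx : x ∈ frontier B) {f : E → E}
    (hf : Set.EqOn f (unitNormal ρ) (frontier B)) {v : E} (hv : ⟪unitNormal ρ x, v⟫_ℝ = 0) :
    fderivWithin ℝ f (frontier B) x v = fderiv ℝ (unitNormal ρ) x v := by
  obtain ⟨η, ε, Ψ, hΨ⟩ := hρ.exists_isBoundaryGraph hx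
  have h1 : HasFDerivWithinAt f (fderiv ℝ (unitNormal ρ) x) (frontier B) x :=
    (((hρ.contDiffAt_unitNormal hx).differentiableAt
      (by simp)).hasFDerivAt.hasFDerivWithinAt).congr hf (hf hx)
  exact h1.differentiableWithinAt.hasFDerivWithinAt.unique_on h1
    (hΨ.mem_tangentConeAt hρ (Metric.mem_ball_self hΨ.eta_pos) hx hv)

end IsDefiningFunction

/-- The second order Taylor remainder in the second variable. -/
noncomputable def taylorRemainderSnd {Y : Type*} [NormedAddCommGroup Y] [NormedSpace ℝ Y]
    (f : Y × E → ℝ) (p : Y × E) : ℝ :=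
  f p - 1 / 2 * fderivSnd (fderivSnd f) (p.1, 0) p.2 p.2

section Taylor

variable {Y : Type*} [NormedAddCommGroup Y] [NormedSpace ℝ Y] {f : Y × E → ℝ}

theorem fderivSnd_fderivSnd_comm (hf : ContDiff ℝ ∞ f) (p : Y × E) (v w : E) :
    fderivSnd (fderivSnd f) p v w = fderivSnd (fderivSnd f) p w v := by
  have hd := (hf.fderiv_right (m := ∞) (by simp)).differentiable (by simp) p
  have hsymm : IsSymmSndFDerivAt ℝ f p := (hf.contDiffAt (x := p)).isSymmSndFDerivAt
    (by rw [minSmoothness_of_isRCLikeNormedField]; exact WithTop.coe_le_coe.2 le_top)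
  have h2 : HasFDerivAt (fderivSnd f)
      ((ContinuousLinearMap.compL ℝ E (Y × E) ℝ).flip (ContinuousLinearMap.inr ℝ Y E) ∘L
        fderiv ℝ (fderiv ℝ f) p) p :=
    ((ContinuousLinearMap.compL ℝ E (Y × E) ℝ).flip
      (ContinuousLinearMap.inr ℝ Y E)).hasFDerivAt.comp p hd.hasFDerivAt
  rw [fderivSnd, h2.fderiv]
  simp [hsymm.eq (0, v) (0, w)]

theorem contDiff_taylorRemainderSnd (hf : ContDiff ℝ ∞ f) :
    ContDiff ℝ ∞ (taylorRemainderSnd f) := by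
  have h2 : ContDiff ℝ ∞ fun p : Y × E => fderivSnd (fderivSnd f) (p.1, 0) :=
    hf.fderivSnd.fderivSnd.comp (contDiff_fst.prodMk contDiff_const)
  exact hf.sub (contDiff_const.mul ((h2.clm_apply contDiff_snd).clm_apply contDiff_snd))

theorem vanishesToOrder_taylorRemainderSnd {K : Set Y} (hf : ContDiff ℝ ∞ f)
    (h0 : ∀ y ∈ K, f (y, 0) = 0) (h1 : ∀ y ∈ K, fderivSnd f (y, 0) = 0) :
    VanishesToOrder K 3 (taylorRemainderSnd f) := by
  have hs := contDiff_taylorRemainderSnd hf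
  have e1 : fderivSnd (taylorRemainderSnd f) =
      fun p => fderivSnd f p - fderivSnd (fderivSnd f) (p.1, 0) p.2 := by
    ext ⟨y, z⟩ v
    have h := (hasFDerivAt_fderivSnd hs y z).unique ((hasFDerivAt_fderivSnd hf y z).sub
      ((((fderivSnd (fderivSnd f) (y, 0)).hasFDerivAt (x := z)).clm_apply
        (hasFDerivAt_id z)).const_mul (1 / 2)))
    rw [h]
    simp only [sub_apply, smul_apply, add_apply, ContinuousLinearMap.flip_apply,
      ContinuousLinearMap.comp_apply, ContinuousLinearMap.id_apply, id, smul_eq_mul,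
      fderivSnd_fderivSnd_comm hf (y, 0) v z]
    ring
  have hs1 := hs.fderivSnd
  have e2 : fderivSnd (fderivSnd (taylorRemainderSnd f)) =
      fun p => fderivSnd (fderivSnd f) p - fderivSnd (fderivSnd f) (p.1, 0) := by
    ext ⟨y, z⟩ v w
    have h := (hasFDerivAt_fderivSnd hs1 y z).unique (by
      rw [e1]
      exact (hasFDerivAt_fderivSnd hf.fderivSnd y z).sub
        ((fderivSnd (fderivSnd f) (y, 0)).hasFDerivAt (x := z)))
    rw [h]
  refine ⟨fun y hy => by simp [taylorRemainderSnd, h0 y hy], fun y hy => ?_, fun y hy => ?_, trivial⟩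
  · rw [e1]; simp [h1 y hy]
  · rw [e2]; simp

end Taylor

end Graph

/-! ### Boundary charts with uniform constants. -/

section Charts

variable {E : Type} [NormedAddCommGroup E] [InnerProductSpace ℝ E] [FiniteDimensional ℝ E]
  {F : Type} [NormedAddCommGroup F] [InnerProductSpace ℝ F] [FiniteDimensional ℝ F]
  {B : Set E} {ρ : E → ℝ}

/-- In the coordinates `x + R z - u ν` the domain is the epigraph of `φ` near the origin, `S` is the
Hessian of `φ` at the origin and the Taylor remainder is controlled. -/
structure IsBoundaryChart (B : Set E) (x ν : E) (r₀ C : ℝ) (m : ℕ) (R : F →ₗᵢ[ℝ] E) (φ : F → ℝ)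
    (S : F →L[ℝ] F) : Prop where
  contDiff : ContDiff ℝ ∞ φ
  nonneg : ∀ z, ‖z‖ ≤ r₀ → 0 ≤ φ z
  mem_iff : ∀ z, ‖z‖ ≤ r₀ → ∀ u, |u| ≤ r₀ → (x + R z - u • ν ∈ B ↔ φ z ≤ u)
  norm_hessian_le : ∀ z, ‖S z‖ ≤ C * ‖z‖
  remainder : FieldBound (fun z : F => z) (Metric.closedBall 0 r₀) m C (fun z => ‖z‖ ^ 3)
    (fun z => φ z - 1 / 2 * ⟪S z, z⟫_ℝ)
  remainder_even : FieldBound (fun z : F => z) (Metric.closedBall 0 r₀) m C (fun z => ‖z‖ ^ 4)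
    (fun z => (φ z - 1 / 2 * ⟪S z, z⟫_ℝ) + (φ (-z) - 1 / 2 * ⟪S (-z), -z⟫_ℝ))

/-- The matrix of the second fundamental form in the coordinates given by `R`. -/
noncomputable def chartHessian (ρ : E → ℝ) (x : E) (R : F →ₗᵢ[ℝ] E) : F →L[ℝ] F :=
  haveI : CompleteSpace E := FiniteDimensional.complete ℝ E
  haveI : CompleteSpace F := FiniteDimensional.complete ℝ F
  ‖gradient ρ x‖⁻¹ • ((ContinuousLinearMap.adjoint R.toContinuousLinearMap) ∘L
    (fderiv ℝ (gradient ρ) x) ∘L R.toContinuousLinearMap)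

theorem inner_chartHessian (x : E) (R : F →ₗᵢ[ℝ] E) (z w : F) :
    ⟪chartHessian ρ x R z, w⟫_ℝ = secondForm ρ x (R z) (R w) := by
  have : CompleteSpace E := FiniteDimensional.complete ℝ E
  have : CompleteSpace F := FiniteDimensional.complete ℝ F
  simp [chartHessian, secondForm, real_inner_smul_left, ContinuousLinearMap.adjoint_inner_left]

theorem IsBoundaryGraph.isBoundaryChart {U : Set E} {η ε : ℝ} {Ψ : E × E → ℝ}
    (hΨ : IsBoundaryGraph B ρ U η ε Ψ) (hρ : IsDefiningFunction B ρ) (hB : Convex ℝ B)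
    {x : E} (hxU : x ∈ U) (hx : x ∈ frontier B) (R : F →ₗᵢ[ℝ] E)
    (hR : ∀ z, ⟪unitNormal ρ x, R z⟫_ℝ = 0) {r₀ : ℝ} (hη : r₀ < η) (hε : r₀ < ε) {C : ℝ} {m : ℕ}
    (hS : ∀ z, ‖chartHessian ρ x R z‖ ≤ C * ‖z‖)
    (h3 : FieldBound (fun z : F => z) (Metric.closedBall 0 r₀) m C (fun z => ‖z‖ ^ 3)
      (fun z => taylorRemainderSnd Ψ (x, R z)))
    (h4 : FieldBound (fun z : F => z) (Metric.closedBall 0 r₀) m C (fun z => ‖z‖ ^ 4)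
      (fun z => taylorRemainderSnd Ψ (x, R z) + taylorRemainderSnd Ψ (x, R (-z)))) :
    IsBoundaryChart B x (unitNormal ρ x) r₀ C m R (fun z => Ψ (x, R z)) (chartHessian ρ x R) := by
  have e : ∀ z, Ψ (x, R z) - 1 / 2 * ⟪chartHessian ρ x R z, z⟫_ℝ =
      taylorRemainderSnd Ψ (x, R z) := by
    intro z
    simp only [taylorRemainderSnd]
    rw [hΨ.fderivSnd_fderivSnd_zero hρ hxU hx, hR, zero_smul, sub_zero, inner_chartHessian,
      secondForm]
  have hz : ∀ z, ‖z‖ ≤ r₀ → ‖R z‖ < η := fun z hz => by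
    rw [R.norm_map]; linarith
  refine ⟨hΨ.contDiff.comp (contDiff_const.prodMk R.toContinuousLinearMap.contDiff),
    fun z hz' => hΨ.nonneg_of_inner_eq_zero hρ hxU hx hB (hz z hz') (hR z), fun z hz' u hu => ?_,
    hS, ?_, ?_⟩
  · have := hΨ.mem_iff x hxU hx (R z) (hz z hz') u (by linarith)
    rwa [normalCoord, hR, add_zero] at this
  · simpa only [e] using h3
  · simpa only [e] using h4

theorem IsDefiningFunction.exists_norm_chartHessian_le (hρ : IsDefiningFunction B ρ)
    (hBc : IsCompact B) : ∃ C, 0 ≤ C ∧ ∀ {F : Type} [NormedAddCommGroup F] [InnerProductSpace ℝ F]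
      [FiniteDimensional ℝ F], ∀ x ∈ frontier B, ∀ (R : F →ₗᵢ[ℝ] E) (z : F),
      ‖chartHessian ρ x R z‖ ≤ C * ‖z‖ := by
  have hcont : ContinuousOn (fun x => ‖gradient ρ x‖⁻¹ * ‖fderiv ℝ (gradient ρ) x‖) (frontier B) :=
    (hρ.contDiff_gradient.continuous.norm.continuousOn.inv₀
      fun x hx => (hρ.norm_gradient_pos hx).ne').mul
      (hρ.contDiff_gradient.continuous_fderiv (by simp)).norm.continuousOn
  have hK : IsCompact (frontier B) := hBc.of_isClosed_subset isClosed_frontier hρ.frontier_subset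
  obtain ⟨C, hC⟩ := hK.exists_bound_of_continuousOn hcont
  refine ⟨max C 0, le_max_right _ _, fun {F} _ _ _ x hx R z => ?_⟩
  have h1 := hC x hx
  rw [Real.norm_of_nonneg (by positivity)] at h1
  have h2 : ‖chartHessian ρ x R z‖ ^ 2 ≤ (max C 0 * ‖z‖) * ‖chartHessian ρ x R z‖ := by
    rw [← real_inner_self_eq_norm_sq, inner_chartHessian, secondForm]
    calc ‖gradient ρ x‖⁻¹ * ⟪fderiv ℝ (gradient ρ) x (R z), R (chartHessian ρ x R z)⟫_ℝ
        ≤ ‖gradient ρ x‖⁻¹ * (‖fderiv ℝ (gradient ρ) x‖ * ‖z‖ * ‖chartHessian ρ x R z‖) := by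
          gcongr
          refine (real_inner_le_norm _ _).trans ?_
          rw [R.norm_map]
          gcongr
          exact (ContinuousLinearMap.le_opNorm _ _).trans (by rw [R.norm_map])
      _ = (‖gradient ρ x‖⁻¹ * ‖fderiv ℝ (gradient ρ) x‖) * ‖z‖ * ‖chartHessian ρ x R z‖ := by ring
      _ ≤ _ := by gcongr; exact h1.trans (le_max_left _ _)
  rcases (norm_nonneg (chartHessian ρ x R z)).eq_or_lt with h | h
  · rw [← h]; positivity
  · rw [sq] at h2
    exact le_of_mul_le_mul_right h2 h

/-- Uniform charts at all boundary points. -/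
theorem IsDefiningFunction.exists_uniform_isBoundaryChart (hρ : IsDefiningFunction B ρ)
    (hBc : IsCompact B) (hB : Convex ℝ B) (m : ℕ) : ∃ r₀ C, 0 < r₀ ∧ 0 ≤ C ∧
      ∀ {F : Type} [NormedAddCommGroup F] [InnerProductSpace ℝ F] [FiniteDimensional ℝ F],
      ∀ x ∈ frontier B, ∀ (R : F →ₗᵢ[ℝ] E), (∀ z, ⟪unitNormal ρ x, R z⟫_ℝ = 0) →
        ∃ φ, IsBoundaryChart B x (unitNormal ρ x) r₀ C m R φ (chartHessian ρ x R) := by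
  obtain ⟨C₀, hC₀, hS⟩ := hρ.exists_norm_chartHessian_le hBc
  have hK : IsCompact (frontier B) := hBc.of_isClosed_subset isClosed_frontier hρ.frontier_subset
  let p : Set E → Prop := fun s => ∃ r₀ C, 0 < r₀ ∧ 0 ≤ C ∧
      ∀ {F : Type} [NormedAddCommGroup F] [InnerProductSpace ℝ F] [FiniteDimensional ℝ F],
      ∀ x ∈ frontier B, x ∈ s → ∀ (R : F →ₗᵢ[ℝ] E), (∀ z, ⟪unitNormal ρ x, R z⟫_ℝ = 0) →
        ∃ φ, IsBoundaryChart B x (unitNormal ρ x) r₀ C m R φ (chartHessian ρ x R)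
  have hmono : ∀ {F : Type} [NormedAddCommGroup F] [InnerProductSpace ℝ F] [FiniteDimensional ℝ F]
      {x ν : E} {r r' C C' : ℝ} {R : F →ₗᵢ[ℝ] E} {φ : F → ℝ} {S : F →L[ℝ] F}, r' ≤ r → C ≤ C' →
      IsBoundaryChart B x ν r C m R φ S → IsBoundaryChart B x ν r' C' m R φ S := by
    intro F _ _ _ x ν r r' C C' R φ S hr hC h
    have hsub : Metric.closedBall (0 : F) r' ⊆ Metric.closedBall 0 r :=
      Metric.closedBall_subset_closedBall hr
    exact ⟨h.contDiff, fun z hz => h.nonneg z (hz.trans hr),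
      fun z hz u hu => h.mem_iff z (hz.trans hr) u (hu.trans hr),
      fun z => (h.norm_hessian_le z).trans (by gcongr),
      (h.remainder.mono_set hsub).mono_const hC (fun _ _ => by positivity),
      (h.remainder_even.mono_set hsub).mono_const hC (fun _ _ => by positivity)⟩
  -- Compactness induction: two sets with charts are merged by taking the smaller radius and the
  -- larger constant, and `exists_isBoundaryGraph` gives charts near each point.
  have hp : p (frontier B) := by
    refine hK.induction_on (p := p) ⟨1, 0, one_pos, le_rfl, by simp⟩ ?_ ?_ ?_
    · rintro s t hst ⟨r₀, C, hr, hC, h⟩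
      exact ⟨r₀, C, hr, hC, fun x hx hxs => h x hx (hst hxs)⟩
    · rintro s t ⟨r₁, C₁, hr₁, hC₁, h₁⟩ ⟨r₂, C₂, hr₂, hC₂, h₂⟩
      refine ⟨min r₁ r₂, max C₁ C₂, lt_min hr₁ hr₂, hC₁.trans (le_max_left _ _),
        fun x hx hxst R hR => ?_⟩
      rcases hxst with hxs | hxt
      · obtain ⟨φ, hφ⟩ := h₁ x hx hxs R hR
        exact ⟨φ, hmono (min_le_left _ _) (le_max_left _ _) hφ⟩
      · obtain ⟨φ, hφ⟩ := h₂ x hx hxt R hR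
        exact ⟨φ, hmono (min_le_right _ _) (le_max_right _ _) hφ⟩
    · intro x hx
      obtain ⟨η, ε, Ψ, hΨ⟩ := hρ.exists_isBoundaryGraph hx
      have hη := hΨ.eta_pos
      have hε := hΨ.eps_pos
      refine ⟨Metric.ball x (η / 2), mem_nhdsWithin_of_mem_nhds (Metric.ball_mem_nhds _ (by positivity)), ?_⟩
      have hK' : IsCompact (frontier B ∩ Metric.closedBall x (η / 2)) :=
        hK.inter_right Metric.isClosed_closedBall
      have hsub : Metric.closedBall x (η / 2) ⊆ Metric.ball x η :=
        Metric.closedBall_subset_ball (by linarith)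
      have hv : VanishesToOrder (frontier B ∩ Metric.closedBall x (η / 2)) 3
          (taylorRemainderSnd Ψ) :=
        vanishesToOrder_taylorRemainderSnd hΨ.contDiff
          (fun y hy => hΨ.apply_zero hρ (hsub hy.2) hy.1)
          (fun y hy => hΨ.fderivSnd_zero hρ (hsub hy.2) hy.1)
      set r₀ := min (η / 2) (ε / 2)
      have : ProperSpace E := FiniteDimensional.proper ℝ E
      obtain ⟨C, hC, hCb⟩ := hv.exists_fieldBound_three hK'
        (contDiff_taylorRemainderSnd hΨ.contDiff) r₀ m
      refine ⟨r₀, max C C₀, by positivity, hC.trans (le_max_left _ _), fun y hy hyx R hR => ?_⟩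
      obtain ⟨h3, h4⟩ := hCb R.toContinuousLinearMap R.norm_map y
        ⟨hy, Metric.ball_subset_closedBall hyx⟩
      refine ⟨_, hΨ.isBoundaryChart hρ hB (hsub (Metric.ball_subset_closedBall hyx)) hy R hR
        (by linarith [min_le_left (η / 2) (ε / 2)]) (by linarith [min_le_right (η / 2) (ε / 2)])
        (fun z => (hS y hy R z).trans (by gcongr; exact le_max_right _ _))
        (h3.mono_const (le_max_left _ _) fun _ _ => by positivity)
        (h4.mono_const (le_max_left _ _) fun _ _ => by positivity)⟩
  obtain ⟨r₀, C, hr, hC, h⟩ := hp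
  exact ⟨r₀, C, hr, hC, fun x hx => h x hx hx⟩

/-- From $0\le\varphi(sz)=\frac12s^2\langle Sz,z\rangle+O(s^3)$, dividing by $s^2$ and letting
$s\to0$. -/
theorem IsBoundaryChart.inner_hessian_nonneg {x ν : E} {r₀ C : ℝ} {m : ℕ} {R : F →ₗᵢ[ℝ] E}
    {φ : F → ℝ} {S : F →L[ℝ] F} (h : IsBoundaryChart B x ν r₀ C m R φ S) (hr : 0 < r₀) (z : F) :
    0 ≤ ⟪S z, z⟫_ℝ := by
  have h1 : Filter.Tendsto (fun s : ℝ => ⟪S z, z⟫_ℝ + 2 * s * (C * ‖z‖ ^ 3))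
      (nhdsWithin 0 (Set.Ioi 0)) (nhds (⟪S z, z⟫_ℝ)) := by
    have : Continuous fun s : ℝ => ⟪S z, z⟫_ℝ + 2 * s * (C * ‖z‖ ^ 3) := by fun_prop
    simpa using (this.tendsto 0).mono_left (nhdsWithin_le_nhds (s := Set.Ioi (0 : ℝ)))
  refine ge_of_tendsto h1 ?_
  have hpos : (0 : ℝ) < r₀ / (‖z‖ + 1) := by positivity
  filter_upwards [Ioo_mem_nhdsGT hpos] with s hs
  have hs0 := hs.1
  have hsz : ‖s • z‖ ≤ r₀ := by
    rw [norm_smul, Real.norm_of_nonneg hs0.le]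
    have := (lt_div_iff₀ (by positivity)).1 hs.2
    nlinarith [norm_nonneg z]
  have h2 := h.nonneg _ hsz
  have h3 := h.remainder.base (s • z) (by simpa using hsz)
  rw [Real.norm_eq_abs] at h3
  have h4 := (abs_le.1 h3).2
  rw [map_smul, real_inner_smul_left, real_inner_smul_right, norm_smul,
    Real.norm_of_nonneg hs0.le, mul_pow] at h4
  have h5 : 0 ≤ s ^ 2 * (⟪S z, z⟫_ℝ + 2 * s * (C * ‖z‖ ^ 3)) := by nlinarith
  exact nonneg_of_mul_nonneg_right h5 (by positivity)

end Charts

/-! ### Square root of the Hessian. -/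

section SquareRoot

variable {F : Type*} [NormedAddCommGroup F] [InnerProductSpace ℝ F] [FiniteDimensional ℝ F]

/-- A positive semidefinite operator is the square of the norm of another operator, and is bounded
below by its determinant. -/
theorem exists_norm_sq_eq_inner {S : F →L[ℝ] F} (hs : (S : F →ₗ[ℝ] F).IsSymmetric)
    (hp : ∀ z, 0 ≤ ⟪S z, z⟫_ℝ) {C : ℝ} (hC : 1 ≤ C) (hSC : ∀ z, ‖S z‖ ≤ C * ‖z‖) :
    ∃ A : F →L[ℝ] F, (∀ z, ‖A z‖ ^ 2 = ⟪S z, z⟫_ℝ) ∧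
      |A.det| = √(LinearMap.det (S : F →ₗ[ℝ] F)) ∧
      LinearMap.det (S : F →ₗ[ℝ] F) ≤ C ^ Module.finrank ℝ F ∧
      ∀ z, LinearMap.det (S : F →ₗ[ℝ] F) * (C ^ Module.finrank ℝ F)⁻¹ * ‖z‖ ^ 2 ≤ ⟪S z, z⟫_ℝ := by
  set n := Module.finrank ℝ F with hn
  set b := hs.eigenvectorBasis hn.symm with hb
  set μ := hs.eigenvalues hn.symm with hμ
  have hSb : ∀ i, S (b i) = μ i • b i := fun i => hs.apply_eigenvectorBasis hn.symm i
  have hbn : ∀ i, ‖b i‖ = 1 := fun i => b.orthonormal.1 i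
  have hμ0 : ∀ i, 0 ≤ μ i := by
    intro i
    have := hp (b i)
    rwa [hSb, real_inner_smul_left, real_inner_self_eq_norm_sq, hbn, one_pow, mul_one] at this
  have hμC : ∀ i, μ i ≤ C := by
    intro i
    have := hSC (b i)
    rwa [hSb, norm_smul, hbn, mul_one, mul_one, Real.norm_of_nonneg (hμ0 i)] at this
  have hdet : LinearMap.det (S : F →ₗ[ℝ] F) = ∏ i, μ i := by
    have := hs.det_eq_prod_eigenvalues hn.symm
    simpa using this
  have hrepr : ∀ z i, b.repr (S z) i = μ i * b.repr z i := by
    intro z i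
    have := hs.eigenvectorBasis_apply_self_apply hn.symm z i
    simpa using this
  have hinner : ∀ z, ⟪S z, z⟫_ℝ = ∑ i, μ i * (b.repr z i) ^ 2 := by
    intro z
    rw [← b.repr.inner_map_map, PiLp.inner_apply]
    refine Finset.sum_congr rfl fun i _ => ?_
    rw [hrepr]
    simp
    ring
  have hnorm : ∀ z, ‖z‖ ^ 2 = ∑ i, (b.repr z i) ^ 2 := by
    intro z
    rw [← b.repr.norm_map, EuclideanSpace.norm_sq_eq]
    simp
  let A₀ : F →ₗ[ℝ] F := Matrix.toLin b.toBasis b.toBasis (Matrix.diagonal fun i => √(μ i))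
  have hA₀ : ∀ z i, b.repr (A₀ z) i = √(μ i) * b.repr z i := by
    intro z i
    have h := LinearMap.toMatrix_mulVec_repr b.toBasis b.toBasis A₀ z
    rw [LinearMap.toMatrix_toLin] at h
    have h' := congrFun h i
    rw [Matrix.mulVec_diagonal] at h'
    simpa using h'.symm
  refine ⟨LinearMap.toContinuousLinearMap A₀, fun z => ?_, ?_, ?_, fun z => ?_⟩
  · rw [hnorm, hinner]
    refine Finset.sum_congr rfl fun i _ => ?_
    simp only [LinearMap.coe_toContinuousLinearMap', hA₀, mul_pow, Real.sq_sqrt (hμ0 i)]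
  · have h1 : (LinearMap.toContinuousLinearMap A₀).det = ∏ i, √(μ i) := by
      rw [ContinuousLinearMap.det, LinearMap.coe_toContinuousLinearMap, LinearMap.det_toLin,
        Matrix.det_diagonal]
    rw [h1, hdet, abs_of_nonneg (Finset.prod_nonneg fun i _ => Real.sqrt_nonneg _)]
    rw [Real.sqrt_eq_rpow, ← Real.finsetProd_rpow _ _ fun i _ => hμ0 i]
    simp only [Real.sqrt_eq_rpow]
  · rw [hdet]
    calc ∏ i, μ i ≤ ∏ _i : Fin n, C := Finset.prod_le_prod (fun i _ => hμ0 i) fun i _ => hμC i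
      _ = C ^ n := by simp
  -- Each eigenvalue is the determinant divided by the product of the others, and that product is at
  -- most $C^{n-1}\le C^n$. This is how the curvature alone bounds the Hessian from below.
  · rw [hinner, hnorm, hdet, Finset.mul_sum]
    refine Finset.sum_le_sum fun i _ => ?_
    refine mul_le_mul_of_nonneg_right ?_ (sq_nonneg _)
    rw [mul_inv_le_iff₀ (by positivity), ← Finset.mul_prod_erase Finset.univ μ (Finset.mem_univ i)]
    refine mul_le_mul_of_nonneg_left ?_ (hμ0 i)
    calc ∏ j ∈ Finset.univ.erase i, μ j ≤ ∏ _j ∈ Finset.univ.erase i, C :=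
          Finset.prod_le_prod (fun i _ => hμ0 i) fun i _ => hμC i
      _ = C ^ (Finset.univ.erase i).card := by simp
      _ ≤ C ^ n := pow_le_pow_right₀ hC ((Finset.card_le_univ _).trans (by simp))

end SquareRoot

/-! ### Gaussian curvature in a chart. -/

section Curvature

variable {d : ℕ} {B : Set (EuclideanSpace ℝ (Fin d))} {ρ : EuclideanSpace ℝ (Fin d) → ℝ}

theorem IsDefiningFunction.gaussMap_eq (hρ : IsDefiningFunction B ρ) (hB : Convex ℝ B)
    {x : EuclideanSpace ℝ (Fin d)} (hx : x ∈ frontier B) : gaussMap B x = unitNormal ρ x := by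
  have h : IsUnitExteriorNormal B x (gaussMap B x) := Classical.epsilon_spec
    (⟨unitNormal ρ x, hρ.norm_unitNormal hx, fun y hy => hρ.inner_unitNormal_sub_nonpos hB hx hy⟩ :
      ∃ ν, IsUnitExteriorNormal B x ν)
  exact hρ.eq_unitNormal hx h.1 h.2

/-- An isometric parametrization of the orthogonal complement of a unit vector. -/
theorem exists_linearIsometry_orthogonal {n : ℕ} (hd : d = n + 1) {ν : EuclideanSpace ℝ (Fin d)}
    (hν : ‖ν‖ = 1) : ∃ R : EuclideanSpace ℝ (Fin n) →ₗᵢ[ℝ] EuclideanSpace ℝ (Fin d),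
      (∀ z, ⟪ν, R z⟫_ℝ = 0) ∧ ∀ p, ⟪ν, p⟫_ℝ = 0 → ∃ z, R z = p := by
  subst hd
  have hν0 : ν ≠ 0 := by
    rintro rfl
    simp at hν
  have : Fact (Module.finrank ℝ (EuclideanSpace ℝ (Fin (n + 1))) = n + 1) := ⟨by simp⟩
  have hfin : Module.finrank ℝ (ℝ ∙ ν)ᗮ = n := Submodule.finrank_orthogonal_span_singleton hν0
  let b := (stdOrthonormalBasis ℝ (ℝ ∙ ν)ᗮ).reindex (finCongr hfin)
  refine ⟨(ℝ ∙ ν)ᗮ.subtypeₗᵢ.comp b.repr.symm.toLinearIsometry, fun z => ?_, fun p hp => ?_⟩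
  · exact Submodule.mem_orthogonal_singleton_iff_inner_right.1 (b.repr.symm z).2
  · have hp' : p ∈ (ℝ ∙ ν)ᗮ := Submodule.mem_orthogonal_singleton_iff_inner_right.2 hp
    exact ⟨b.repr ⟨p, hp'⟩, by simp⟩

/-- The isometry $R$ identifies the coordinate space with the tangent hyperplane and conjugates the
chart Hessian into the shape operator. -/
theorem IsDefiningFunction.gaussCurvature_eq_det (hρ : IsDefiningFunction B ρ) (hB : Convex ℝ B)
    {x : EuclideanSpace ℝ (Fin d)} (hx : x ∈ frontier B) {n : ℕ}
    (R : EuclideanSpace ℝ (Fin n) →ₗᵢ[ℝ] EuclideanSpace ℝ (Fin d))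
    (hR : ∀ z, ⟪unitNormal ρ x, R z⟫_ℝ = 0)
    (hR' : ∀ p, ⟪unitNormal ρ x, p⟫_ℝ = 0 → ∃ z, R z = p) :
    gaussCurvature B x = LinearMap.det
      (chartHessian ρ x R : EuclideanSpace ℝ (Fin n) →ₗ[ℝ] EuclideanSpace ℝ (Fin n)) := by
  have hg := hρ.gaussMap_eq hB hx
  have hmem : ∀ p, p ∈ tangentHyperplane B x ↔ ⟪unitNormal ρ x, p⟫_ℝ = 0 := fun p => by
    rw [tangentHyperplane, Submodule.mem_orthogonal_singleton_iff_inner_right, hg]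
  let e : EuclideanSpace ℝ (Fin n) ≃ₗ[ℝ] tangentHyperplane B x := LinearEquiv.ofBijective
    (R.toLinearMap.codRestrict (tangentHyperplane B x) fun z => (hmem _).2 (hR z))
    ⟨fun z w h => R.injective (congrArg Subtype.val h), fun p => by
      obtain ⟨z, hz⟩ := hR' p ((hmem _).1 p.2)
      exact ⟨z, Subtype.ext hz⟩⟩
  have he : ∀ z, (e z : EuclideanSpace ℝ (Fin d)) = R z := fun z => rfl
  have hkey : ∀ z, shapeOperator B x (e z) = e (chartHessian ρ x R z) := by
    intro z
    refine ext_inner_right ℝ fun q => ?_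
    obtain ⟨w, rfl⟩ := e.surjective q
    have h1 : ⟪shapeOperator B x (e z), e w⟫_ℝ =
        ⟪fderivWithin ℝ (gaussMap B) (frontier B) x (R z), R w⟫_ℝ := by
      rw [shapeOperator]
      simp only [ContinuousLinearMap.comp_apply]
      rw [Submodule.inner_orthogonalProjectionOnto_eq_of_mem_right]
      rfl
    rw [h1, hρ.fderivWithin_unitNormal hx (fun y hy => hρ.gaussMap_eq hB hy) (hR z),
      hρ.inner_fderiv_unitNormal hx _ (hR w), Submodule.coe_inner, he, he, R.inner_map_map,
      inner_chartHessian]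
  have hconj : (shapeOperator B x : tangentHyperplane B x →ₗ[ℝ] tangentHyperplane B x) =
      e ∘ₗ (chartHessian ρ x R : EuclideanSpace ℝ (Fin n) →ₗ[ℝ] EuclideanSpace ℝ (Fin n)) ∘ₗ
        (e.symm : tangentHyperplane B x →ₗ[ℝ] EuclideanSpace ℝ (Fin n)) := by
    ext1 q
    obtain ⟨w, rfl⟩ := e.surjective q
    simp [hkey]
  rw [gaussCurvature, hconj, LinearMap.det_conj]

/-- Uniform charts at the boundary points of positive curvature, with the square root of the
Hessian. -/
theorem IsDefiningFunction.exists_curved_chart {n : ℕ} (hd : d = n + 1)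
    (hρ : IsDefiningFunction B ρ) (hBc : IsCompact B) (hB : Convex ℝ B) (m : ℕ) :
    ∃ r₀ C c : ℝ, 0 < r₀ ∧ 1 ≤ C ∧ 0 < c ∧ ∀ x ∈ frontier B, 0 < gaussCurvature B x →
      ∃ (R : EuclideanSpace ℝ (Fin n) →ₗᵢ[ℝ] EuclideanSpace ℝ (Fin d))
        (φ : EuclideanSpace ℝ (Fin n) → ℝ)
        (S A : EuclideanSpace ℝ (Fin n) →L[ℝ] EuclideanSpace ℝ (Fin n)),
        (∀ z, ⟪unitNormal ρ x, R z⟫_ℝ = 0) ∧ (∀ p, ⟪unitNormal ρ x, p⟫_ℝ = 0 → ∃ z, R z = p) ∧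
        IsBoundaryChart B x (unitNormal ρ x) r₀ C m R φ S ∧
        (∀ z, ‖A z‖ ^ 2 = ⟪S z, z⟫_ℝ) ∧ |A.det| = √(gaussCurvature B x) ∧
        gaussCurvature B x ≤ C ∧ ∀ z, c * gaussCurvature B x * ‖z‖ ^ 2 ≤ ‖A z‖ ^ 2 := by
  obtain ⟨r₀, C, hr, hC, h⟩ := hρ.exists_uniform_isBoundaryChart hBc hB m
  have hC1 : 1 ≤ max C 1 := le_max_right _ _
  have hCn : max C 1 ≤ (max C 1) ^ (n + 1) := le_self_pow₀ hC1 (by omega)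
  refine ⟨r₀, (max C 1) ^ (n + 1), (max C 1 ^ n)⁻¹, hr, one_le_pow₀ hC1, by positivity,
    fun x hx hK => ?_⟩
  obtain ⟨R, hR, hR'⟩ := exists_linearIsometry_orthogonal hd (hρ.norm_unitNormal hx)
  obtain ⟨φ, hφ⟩ := h x hx R hR
  have hdet := hρ.gaussCurvature_eq_det hB hx R hR hR'
  have hs : (chartHessian ρ x R : EuclideanSpace ℝ (Fin n) →ₗ[ℝ] EuclideanSpace ℝ (Fin n)).IsSymmetric := by
    intro z w
    change ⟪chartHessian ρ x R z, w⟫_ℝ = ⟪z, chartHessian ρ x R w⟫_ℝ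
    rw [real_inner_comm, real_inner_comm, inner_chartHessian, real_inner_comm, inner_chartHessian,
      hρ.secondForm_comm]
  obtain ⟨A, hA1, hA2, hA3, hA4⟩ := exists_norm_sq_eq_inner hs (hφ.inner_hessian_nonneg hr) hC1
    (fun z => (hφ.norm_hessian_le z).trans (by gcongr; exact le_max_left _ _))
  rw [finrank_euclideanSpace_fin] at hA3 hA4
  rw [← hdet] at hA2 hA3 hA4
  refine ⟨R, φ, _, A, hR, hR', ⟨hφ.contDiff, hφ.nonneg, hφ.mem_iff, fun z => ?_,
    hφ.remainder.mono_const ?_ fun _ _ => by positivity,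
    hφ.remainder_even.mono_const ?_ fun _ _ => by positivity⟩, hA1, hA2, ?_, fun z => ?_⟩
  · refine (hφ.norm_hessian_le z).trans ?_
    gcongr
    exact (le_max_left _ _).trans hCn
  · exact (le_max_left _ _).trans hCn
  · exact (le_max_left _ _).trans hCn
  · exact hA3.trans (pow_le_pow_right₀ hC1 (by omega))
  · rw [hA1]
    refine le_trans (le_of_eq ?_) (hA4 z)
    ring

end Curvature

/-! ### Integration along vertical rays. -/

theorem iteratedDeriv_eq_zero_of_eqOn {q : ℝ → ℝ} (hq : ContDiff ℝ ∞ q) {c : ℝ} {s : Set ℝ}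
    (hs : IsOpen s) (hqs : ∀ v ∈ s, q v = c) (j : ℕ) {v : ℝ} (hv : v ∈ closure s) :
    iteratedDeriv (j + 1) q v = 0 := by
  have hcont : Continuous (iteratedDeriv (j + 1) q) := hq.continuous_iteratedDeriv _ (by exact_mod_cast le_top)
  have hmem : s ⊆ {v | iteratedDeriv (j + 1) q v = 0} := by
    intro w hw
    have h : q =ᶠ[nhds w] fun _ => c := by
      filter_upwards [hs.mem_nhds hw] with u hu using hqs u hu
    have := Filter.EventuallyEq.iteratedDeriv_eq (n := j + 1) h
    rw [Set.mem_ofPred_eq, this, iteratedDeriv_const]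
    simp
  exact closure_minimal hmem (isClosed_eq hcont continuous_const) hv

/-- Rapid decay of the boundary contribution of the vertical cutoff. -/
theorem exists_integral_deriv_cutoff_le (N : ℕ) : ∃ C, 0 ≤ C ∧ ∀ μ : ℝ, 0 < μ →
    ‖∫ v in (1 / 2 : ℝ)..1, ((deriv (fun v => cutoff (v ^ 2)) v : ℝ) : ℂ) *
      Complex.exp (Complex.I * (μ * v))‖ ≤ C * (μ ^ N)⁻¹ := by
  set q : ℝ → ℝ := fun v => cutoff (v ^ 2) with hq
  have hqs : ContDiff ℝ ∞ q := contDiff_cutoff.comp (contDiff_id.pow 2)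
  -- The function $q(v)$ is $1$ for $0<v<\frac35$, as $v^2<\frac12$ there, and $0$ for $v>1$. So its
  -- derivatives vanish at both ends of $[\frac12,1]$ and repeated integration by parts has no
  -- boundary terms.
  have hz1 : ∀ j, iteratedDeriv (j + 1) q (1 / 2) = 0 := fun j =>
    iteratedDeriv_eq_zero_of_eqOn hqs (c := 1) (s := Set.Ioo 0 (3 / 5)) isOpen_Ioo
      (fun v hv => cutoff_eq_one (by rw [abs_of_nonneg (by positivity)]; nlinarith [hv.1, hv.2])) j
      (subset_closure ⟨by norm_num, by norm_num⟩)
  have hz2 : ∀ j, iteratedDeriv (j + 1) q 1 = 0 := fun j =>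
    iteratedDeriv_eq_zero_of_eqOn hqs (c := 0) (s := Set.Ioi 1) isOpen_Ioi
      (fun v hv => cutoff_eq_zero (by
        rw [abs_of_nonneg (by positivity)]
        have : (1 : ℝ) < v := hv
        nlinarith)) j
      (by rw [closure_Ioi]; exact Set.self_mem_Ici)
  have hcont : ∀ j, Continuous (iteratedDeriv j q) := fun j =>
    hqs.continuous_iteratedDeriv _ (by exact_mod_cast le_top)
  have hstep : ∀ μ : ℝ, 0 < μ → ∀ j, (∫ v in (1 / 2 : ℝ)..1, ((iteratedDeriv (j + 1) q v : ℝ) : ℂ) *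
      Complex.exp (Complex.I * (μ * v))) = (Complex.I / μ) *
        ∫ v in (1 / 2 : ℝ)..1, ((iteratedDeriv (j + 2) q v : ℝ) : ℂ) *
          Complex.exp (Complex.I * (μ * v)) := by
    intro μ hμ j
    have hμ' : (μ : ℂ) ≠ 0 := by exact_mod_cast hμ.ne'
    have hu : ∀ v ∈ Set.uIcc (1 / 2 : ℝ) 1, HasDerivAt
        (fun v => ((iteratedDeriv (j + 1) q v : ℝ) : ℂ)) ((iteratedDeriv (j + 2) q v : ℝ) : ℂ) v := by
      intro v _
      have h1 : DifferentiableAt ℝ (iteratedDeriv (j + 1) q) v :=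
        (hqs.differentiable_iteratedDeriv (j + 1) (by exact_mod_cast WithTop.coe_lt_top _)) v
      have h2 := h1.hasDerivAt
      rw [← iteratedDeriv_succ] at h2
      exact h2.ofReal_comp
    have hv : ∀ v ∈ Set.uIcc (1 / 2 : ℝ) 1, HasDerivAt
        (fun v : ℝ => Complex.exp (Complex.I * (μ * v)) / (Complex.I * μ))
        (Complex.exp (Complex.I * (μ * v))) v := by
      intro v _
      have h1 : HasDerivAt (fun v : ℝ => Complex.I * ((μ : ℂ) * (v : ℂ))) (Complex.I * (μ * 1)) v :=
        ((Complex.ofRealCLM.hasDerivAt (x := v)).const_mul (μ : ℂ)).const_mul Complex.I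
      have h2 := h1.cexp.div_const (Complex.I * μ)
      rwa [mul_one, mul_div_assoc, div_self (mul_ne_zero Complex.I_ne_zero hμ'), mul_one] at h2
    have hi : ∀ j, IntervalIntegrable (fun v => ((iteratedDeriv j q v : ℝ) : ℂ)) volume (1 / 2) 1 :=
      fun j => (Complex.continuous_ofReal.comp (hcont j)).intervalIntegrable _ _
    rw [intervalIntegral.integral_mul_deriv_eq_deriv_mul hu hv (hi _)
      (Continuous.intervalIntegrable (by fun_prop) _ _), hz1, hz2]
    simp only [Complex.ofReal_zero, zero_mul, sub_zero, zero_sub]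
    rw [← intervalIntegral.integral_neg, ← intervalIntegral.integral_const_mul]
    refine intervalIntegral.integral_congr fun v _ => ?_
    field_simp
    rw [Complex.I_sq]
    ring
  have hiter : ∀ μ : ℝ, 0 < μ → ∀ j, (∫ v in (1 / 2 : ℝ)..1, ((iteratedDeriv 1 q v : ℝ) : ℂ) *
      Complex.exp (Complex.I * (μ * v))) = (Complex.I / μ) ^ j *
        ∫ v in (1 / 2 : ℝ)..1, ((iteratedDeriv (j + 1) q v : ℝ) : ℂ) *
          Complex.exp (Complex.I * (μ * v)) := by
    intro μ hμ j
    induction j with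
    | zero => simp
    | succ j ih => rw [ih, hstep μ hμ j, pow_succ, mul_assoc]
  obtain ⟨C, hC⟩ := (isCompact_Icc (a := (1 / 2 : ℝ)) (b := 1)).exists_bound_of_continuousOn
    (hcont (N + 1)).continuousOn
  have hC0 : 0 ≤ C := (norm_nonneg _).trans (hC 1 ⟨by norm_num, le_rfl⟩)
  refine ⟨C, hC0, fun μ hμ => ?_⟩
  have e : deriv q = iteratedDeriv 1 q := iteratedDeriv_one.symm
  rw [e, hiter μ hμ N, norm_mul, norm_pow, norm_div, Complex.norm_I, Complex.norm_real,
    Real.norm_of_nonneg hμ.le, one_div, inv_pow, mul_comm]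
  gcongr
  have := intervalIntegral.norm_integral_le_of_norm_le_const (a := (1 / 2 : ℝ)) (b := 1) (C := C)
    (f := fun v => ((iteratedDeriv (N + 1) q v : ℝ) : ℂ) * Complex.exp (Complex.I * (μ * v)))
    (fun v hv => by
      rw [Set.uIoc_of_le (by norm_num)] at hv
      rw [norm_mul, Complex.norm_real, mul_comm Complex.I, ← Complex.ofReal_mul,
        Complex.norm_exp_ofReal_mul_I, mul_one]
      exact hC v ⟨hv.1.le, hv.2⟩)
  refine this.trans ?_
  rw [abs_of_pos (by norm_num)]
  linarith

/-- The contribution of a vertical ray, cut off above height `r / 2`. -/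
theorem integral_cutoff_mul_exp {r Λ h : ℝ} (hr : 0 < r) (hΛ : 0 < Λ) (h0 : 0 ≤ h) (h1 : h ≤ r / 2) :
    ∫ u in Set.Ici h, ((cutoff ((r ^ 2)⁻¹ * u ^ 2) : ℝ) : ℂ) * Complex.exp (Complex.I * (Λ * u)) =
      (Complex.I / Λ) * (Complex.exp (Complex.I * (Λ * h)) +
        ∫ v in (1 / 2 : ℝ)..1, ((deriv (fun v => cutoff (v ^ 2)) v : ℝ) : ℂ) *
          Complex.exp (Complex.I * ((Λ * r : ℝ) * v))) := by
  set q : ℝ → ℝ := fun v => cutoff (v ^ 2) with hq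
  have hqs : ContDiff ℝ ∞ q := contDiff_cutoff.comp (contDiff_id.pow 2)
  have hqc : Continuous (deriv q) := hqs.continuous_deriv (by simp)
  have hΛ' : (Λ : ℂ) ≠ 0 := by exact_mod_cast hΛ.ne'
  have hqd : ∀ u : ℝ, HasDerivAt (fun u => q (r⁻¹ * u)) (r⁻¹ * deriv q (r⁻¹ * u)) u := by
    intro u
    have h1 := (hqs.differentiable (by simp) (r⁻¹ * u)).hasDerivAt
    have h2 : HasDerivAt (fun u : ℝ => r⁻¹ * u) r⁻¹ u := by
      simpa using (hasDerivAt_id u).const_mul r⁻¹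
    have := h1.comp u h2
    rwa [mul_comm] at this
  have e1 : ∀ u : ℝ, cutoff ((r ^ 2)⁻¹ * u ^ 2) = q (r⁻¹ * u) := fun u => by
    simp only [hq]; congr 1; ring
  simp only [e1]
  have hqz : ∀ u : ℝ, r < u → q (r⁻¹ * u) = 0 := by
    intro u hu
    refine cutoff_eq_zero ?_
    rw [abs_of_nonneg (by positivity)]
    have : 1 ≤ r⁻¹ * u := by rw [inv_mul_eq_div, one_le_div hr]; exact hu.le
    nlinarith
  have e2 : ∫ u in Set.Ici h, ((q (r⁻¹ * u) : ℝ) : ℂ) * Complex.exp (Complex.I * (Λ * u)) =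
      ∫ u in h..r, ((q (r⁻¹ * u) : ℝ) : ℂ) * Complex.exp (Complex.I * (Λ * u)) := by
    rw [intervalIntegral.integral_of_le (by linarith), integral_Ici_eq_integral_Ioi]
    refine (setIntegral_eq_of_subset_of_forall_sdiff_eq_zero measurableSet_Ioi
      Set.Ioc_subset_Ioi_self fun u hu => ?_)
    have : r < u := by
      by_contra! hcon
      exact hu.2 ⟨hu.1, hcon⟩
    rw [hqz u this]
    simp
  have hv : ∀ u ∈ Set.uIcc h r, HasDerivAt
      (fun v : ℝ => Complex.exp (Complex.I * (Λ * v)) / (Complex.I * Λ))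
      (Complex.exp (Complex.I * (Λ * u))) u := by
    intro v _
    have h1 : HasDerivAt (fun v : ℝ => Complex.I * ((Λ : ℂ) * (v : ℂ))) (Complex.I * (Λ * 1)) v :=
      ((Complex.ofRealCLM.hasDerivAt (x := v)).const_mul (Λ : ℂ)).const_mul Complex.I
    have h2 := h1.cexp.div_const (Complex.I * Λ)
    rwa [mul_one, mul_div_assoc, div_self (mul_ne_zero Complex.I_ne_zero hΛ'), mul_one] at h2
  have hcont : Continuous fun u : ℝ => ((r⁻¹ * deriv q (r⁻¹ * u) : ℝ) : ℂ) := by fun_prop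
  rw [e2, intervalIntegral.integral_mul_deriv_eq_deriv_mul (fun u _ => (hqd u).ofReal_comp) hv
    (hcont.intervalIntegrable _ _) (Continuous.intervalIntegrable (by fun_prop) _ _)]
  have hq1 : q (r⁻¹ * h) = 1 := by
    refine cutoff_eq_one ?_
    rw [abs_of_nonneg (by positivity)]
    have : r⁻¹ * h ≤ 1 / 2 := by rw [inv_mul_le_iff₀ hr]; linarith
    have h3 : 0 ≤ r⁻¹ * h := by positivity
    nlinarith
  have hqr : q (r⁻¹ * r) = 0 := by
    rw [inv_mul_cancel₀ hr.ne']
    exact cutoff_eq_zero (by norm_num)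
  rw [hq1, hqr]
  -- The derivative of the cutoff lives in $r/2\le u\le r$, and $h\le r/2$, so the remaining
  -- integral does not depend on the starting height $h$.
  have e3 : ∫ u in h..r, ((r⁻¹ * deriv q (r⁻¹ * u) : ℝ) : ℂ) *
      (Complex.exp (Complex.I * (Λ * u)) / (Complex.I * Λ)) =
      (Complex.I * Λ)⁻¹ * ∫ v in (1 / 2 : ℝ)..1, ((deriv q v : ℝ) : ℂ) *
          Complex.exp (Complex.I * ((Λ * r : ℝ) * v)) := by
    have hint : ∀ a b : ℝ, IntervalIntegrable (fun u : ℝ => ((r⁻¹ * deriv q (r⁻¹ * u) : ℝ) : ℂ) *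
      (Complex.exp (Complex.I * (Λ * u)) / (Complex.I * Λ))) volume a b := fun a b =>
      Continuous.intervalIntegrable (by fun_prop) _ _
    rw [← intervalIntegral.integral_add_adjacent_intervals (hint h (r / 2)) (hint (r / 2) r)]
    have hzero : ∫ u in h..(r / 2), ((r⁻¹ * deriv q (r⁻¹ * u) : ℝ) : ℂ) *
      (Complex.exp (Complex.I * (Λ * u)) / (Complex.I * Λ)) = 0 := by
      rw [intervalIntegral.integral_congr (g := fun _ => 0), intervalIntegral.integral_zero]
      intro u hu
      rw [Set.uIcc_of_le h1] at hu
      have hz : iteratedDeriv (0 + 1) q (r⁻¹ * u) = 0 :=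
        iteratedDeriv_eq_zero_of_eqOn hqs (c := 1) (s := Set.Ioo (-(3 / 5)) (3 / 5)) isOpen_Ioo
          (fun v hv => cutoff_eq_one (by
            rw [abs_of_nonneg (by positivity)]; nlinarith [hv.1, hv.2])) 0
          (subset_closure ⟨by
            have : 0 ≤ r⁻¹ * u := mul_nonneg (by positivity) (h0.trans hu.1)
            linarith, by
            have : r⁻¹ * u ≤ 1 / 2 := by rw [inv_mul_le_iff₀ hr]; linarith [hu.2]
            linarith⟩)
      rw [zero_add, iteratedDeriv_one] at hz
      simp [hz]
    rw [hzero, zero_add, ← intervalIntegral.integral_const_mul]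
    have hsub := intervalIntegral.integral_comp_mul_left (a := r / 2) (b := r)
      (fun v => (Complex.I * Λ)⁻¹ * (((deriv q v : ℝ) : ℂ) *
          Complex.exp (Complex.I * ((Λ * r : ℝ) * v)))) (inv_ne_zero hr.ne')
    rw [inv_mul_cancel₀ hr.ne', show r⁻¹ * (r / 2) = 1 / 2 by field_simp, inv_inv] at hsub
    have h5 : (∫ v in (1 / 2 : ℝ)..1, (Complex.I * Λ)⁻¹ * (((deriv q v : ℝ) : ℂ) *
          Complex.exp (Complex.I * ((Λ * r : ℝ) * v)))) = (r⁻¹ : ℝ) • ∫ u in (r / 2)..r,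
          (Complex.I * Λ)⁻¹ * (((deriv q (r⁻¹ * u) : ℝ) : ℂ) *
          Complex.exp (Complex.I * ((Λ * r : ℝ) * ((r⁻¹ * u : ℝ) : ℂ)))) := by
      rw [hsub, smul_smul, inv_mul_cancel₀ hr.ne', one_smul]
    rw [h5, ← intervalIntegral.integral_smul]
    refine intervalIntegral.integral_congr fun u _ => ?_
    simp only [Complex.real_smul, Complex.ofReal_mul, Complex.ofReal_inv]
    have hr' : (r : ℂ) ≠ 0 := by exact_mod_cast hr.ne'
    have e4 : (Λ : ℂ) * r * ((r : ℂ)⁻¹ * u) = Λ * u := by field_simp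
    rw [e4]
    ring
  rw [e3]
  simp only [Complex.ofReal_zero, Complex.ofReal_one, zero_mul, one_mul, zero_sub]
  field_simp
  ring_nf
  simp only [Complex.I_sq]
  ring

/-! ### Cylindrical cutoffs and chart coordinates. -/

section LocalCutoff

variable {E : Type} [NormedAddCommGroup E] [InnerProductSpace ℝ E] [FiniteDimensional ℝ E]
  {F : Type} [NormedAddCommGroup F] [InnerProductSpace ℝ F] [FiniteDimensional ℝ F]

/-- A cutoff to the cylinder of radius and height `r` around `x` with axis `ξ`. -/
noncomputable def localCutoff (x ξ : E) (r : ℝ) (p : E) : ℝ :=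
  cutoff ((r ^ 2)⁻¹ * (‖p - x‖ ^ 2 - ⟪p - x, ξ⟫_ℝ ^ 2)) * cutoff ((r ^ 2)⁻¹ * ⟪p - x, ξ⟫_ℝ ^ 2)

theorem contDiff_localCutoff (x ξ : E) (r : ℝ) : ContDiff ℝ ∞ (localCutoff x ξ r) := by
  have h1 : ContDiff ℝ ∞ fun p : E => p - x := contDiff_id.sub contDiff_const
  have h2 : ContDiff ℝ ∞ fun p : E => ⟪p - x, ξ⟫_ℝ := h1.inner ℝ contDiff_const
  exact (contDiff_cutoff.comp (contDiff_const.mul ((h1.norm_sq ℝ).sub (h2.pow 2)))).mul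
    (contDiff_cutoff.comp (contDiff_const.mul (h2.pow 2)))

theorem localCutoff_apply_chart {x ν : E} (hν : ‖ν‖ = 1) {R : F →ₗᵢ[ℝ] E}
    (hR : ∀ z, ⟪ν, R z⟫_ℝ = 0) (r : ℝ) (z : F) (u : ℝ) :
    localCutoff x ν r (x + R z - u • ν) = cutoff ((r ^ 2)⁻¹ * ‖z‖ ^ 2) * cutoff ((r ^ 2)⁻¹ * u ^ 2) := by
  have e1 : x + R z - u • ν - x = R z - u • ν := by abel
  have hR' : ⟪R z, ν⟫_ℝ = 0 := by rw [real_inner_comm, hR]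
  have e2 : ⟪R z - u • ν, ν⟫_ℝ = -u := by
    rw [inner_sub_left, hR', real_inner_smul_left, real_inner_self_eq_norm_sq, hν]; ring
  have e3 : ‖R z - u • ν‖ ^ 2 = ‖z‖ ^ 2 + u ^ 2 := by
    rw [norm_sub_sq_real, real_inner_smul_right, hR', R.norm_map, norm_smul, hν, mul_one,
      Real.norm_eq_abs, sq_abs]
    ring
  rw [localCutoff, e1, e2, e3, neg_sq, add_sub_cancel_right]

theorem exists_measurePreserving_chart [MeasurableSpace E] [BorelSpace E] [MeasurableSpace F]
    [BorelSpace F] (hdim : Module.finrank ℝ E = Module.finrank ℝ F + 1) (x : E) {ν : E}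
    (hν : ‖ν‖ = 1) {R : F →ₗᵢ[ℝ] E} (hR : ∀ z, ⟪ν, R z⟫_ℝ = 0) :
    ∃ e : F × ℝ ≃ᵐ E, MeasurePreserving e ∧ ∀ p, e p = x + R p.1 - p.2 • ν := by
  let L₀ : WithLp 2 (F × ℝ) →ₗ[ℝ] E :=
    (R.toLinearMap.coprod (LinearMap.toSpanSingleton ℝ E (-ν))) ∘ₗ
      (WithLp.linearEquiv 2 ℝ (F × ℝ)).toLinearMap
  have hL₀ : ∀ q, L₀ q = R q.fst - q.snd • ν := fun q => by
    simp [L₀, sub_eq_add_neg]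
  let L₁ : WithLp 2 (F × ℝ) →ₗᵢ[ℝ] E := ⟨L₀, fun q => by
    rw [← sq_eq_sq₀ (norm_nonneg _) (norm_nonneg _), hL₀, WithLp.prod_norm_sq_eq_of_L2,
      norm_sub_sq_real, real_inner_smul_right, real_inner_comm, hR, R.norm_map, norm_smul, hν,
      mul_one]
    ring⟩
  let L := L₁.toLinearIsometryEquiv (by
    rw [hdim, (WithLp.linearEquiv 2 ℝ (F × ℝ)).finrank_eq]; simp)
  have hL : ∀ q, L q = R q.fst - q.snd • ν := hL₀
  refine ⟨((MeasurableEquiv.toLp 2 (F × ℝ)).trans L.toHomeomorph.toMeasurableEquiv).trans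
    (Homeomorph.addLeft x).toMeasurableEquiv, ?_, fun p => ?_⟩
  · exact ((WithLp.volume_preserving_toLp F ℝ).trans L.measurePreserving).trans
      (measurePreserving_add_left volume x)
  · have := hL (WithLp.toLp 2 p)
    change x + L (WithLp.toLp 2 p) = _
    rw [this, add_sub_assoc]
    rfl

end LocalCutoff

/-! ### Reduction of the local contribution to the tangent hyperplane. -/

section LocalIntegral

variable {E : Type} [NormedAddCommGroup E] [InnerProductSpace ℝ E] [FiniteDimensional ℝ E]
  [MeasurableSpace E] [BorelSpace E]
  {F : Type} [NormedAddCommGroup F] [InnerProductSpace ℝ F] [FiniteDimensional ℝ F]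
  [MeasurableSpace F] [BorelSpace F] {B : Set E}

/-- Fubini in the chart, where the body is $u\ge\varphi(z)$ and the phase is linear in $u$: the
vertical integral is `integral_cutoff_mul_exp` with $h=\varphi(z)$. Its error term is the same for
all $z$ and factors out. -/
theorem setIntegral_localCutoff (hBm : MeasurableSet B)
    (hdim : Module.finrank ℝ E = Module.finrank ℝ F + 1) {x ν : E}
    (hν : ‖ν‖ = 1) {R : F →ₗᵢ[ℝ] E} (hR : ∀ z, ⟪ν, R z⟫_ℝ = 0) {r₀ C : ℝ} {m : ℕ} {φ : F → ℝ}
    {S : F →L[ℝ] F} (hφ : IsBoundaryChart B x ν r₀ C m R φ S) {r Λ : ℝ} (hr : 0 < r) (hr₀ : r ≤ r₀)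
    (hφr : ∀ z, ‖z‖ ≤ r → φ z ≤ r / 2) (hΛ : 0 < Λ) :
    ∫ p in B, ((localCutoff x ν r p : ℝ) : ℂ) * Complex.exp (Complex.I * ((Λ * -⟪p, ν⟫_ℝ : ℝ) : ℂ)) =
      Complex.exp (Complex.I * ((Λ * -⟪x, ν⟫_ℝ : ℝ) : ℂ)) * (Complex.I / Λ) *
        ((∫ z, ((cutoff ((r ^ 2)⁻¹ * ‖z‖ ^ 2) : ℝ) : ℂ) *
          Complex.exp (Complex.I * ((Λ * φ z : ℝ) : ℂ))) +
        (∫ v in (1 / 2 : ℝ)..1, ((deriv (fun v => cutoff (v ^ 2)) v : ℝ) : ℂ) *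
          Complex.exp (Complex.I * ((Λ * r : ℝ) * v))) *
        ∫ z : F, ((cutoff ((r ^ 2)⁻¹ * ‖z‖ ^ 2) : ℝ) : ℂ)) := by
  obtain ⟨e, he, hep⟩ := exists_measurePreserving_chart hdim x hν hR
  set f : E → ℂ := fun p => ((localCutoff x ν r p : ℝ) : ℂ) *
    Complex.exp (Complex.I * ((Λ * -⟪p, ν⟫_ℝ : ℝ) : ℂ)) with hf
  set χ : F → ℝ := fun z => cutoff ((r ^ 2)⁻¹ * ‖z‖ ^ 2) with hχ
  set J := ∫ v in (1 / 2 : ℝ)..1, ((deriv (fun v => cutoff (v ^ 2)) v : ℝ) : ℂ) *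
          Complex.exp (Complex.I * ((Λ * r : ℝ) * v)) with hJ
  have hχ0 : ∀ z, r ≤ ‖z‖ → χ z = 0 := by
    intro z hz
    refine cutoff_eq_zero ?_
    rw [abs_of_nonneg (by positivity), inv_mul_eq_div, one_le_div (by positivity)]
    gcongr
  have hχu0 : ∀ u : ℝ, r ≤ |u| → cutoff ((r ^ 2)⁻¹ * u ^ 2) = 0 := by
    intro z hz
    refine cutoff_eq_zero ?_
    rw [abs_of_nonneg (by positivity), inv_mul_eq_div, one_le_div (by positivity), ← sq_abs z]
    gcongr
  have hfe : ∀ z u, f (x + R z - u • ν) = Complex.exp (Complex.I * ((Λ * -⟪x, ν⟫_ℝ : ℝ) : ℂ)) *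
      (((χ z : ℝ) : ℂ) * (((cutoff ((r ^ 2)⁻¹ * u ^ 2) : ℝ) : ℂ) *
        Complex.exp (Complex.I * (Λ * u)))) := by
    intro z u
    have e2 : ⟪x + R z - u • ν, ν⟫_ℝ = ⟪x, ν⟫_ℝ - u := by
      rw [inner_sub_left, inner_add_left, real_inner_comm _ (R z), hR, real_inner_smul_left,
        real_inner_self_eq_norm_sq, hν]
      ring
    simp only [hf]
    rw [localCutoff_apply_chart hν hR, e2,
      show Complex.I * ((Λ * -(⟪x, ν⟫_ℝ - u) : ℝ) : ℂ) =
        Complex.I * ((Λ * -⟪x, ν⟫_ℝ : ℝ) : ℂ) + Complex.I * (Λ * u) by push_cast; ring,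
      Complex.exp_add]
    push_cast
    ring
  have hcut : Continuous cutoff := contDiff_cutoff.continuous
  rw [← integral_indicator hBm, ← he.integral_comp']
  have hg : ∀ p : F × ℝ, B.indicator f (e p) = Complex.exp (Complex.I * ((Λ * -⟪x, ν⟫_ℝ : ℝ) : ℂ)) *
      (((χ p.1 : ℝ) : ℂ) * (Set.Ici (φ p.1)).indicator
        (fun u => ((cutoff ((r ^ 2)⁻¹ * u ^ 2) : ℝ) : ℂ) * Complex.exp (Complex.I * (Λ * u))) p.2) := by
    rintro ⟨z, u⟩
    rw [hep]
    simp only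
    by_cases hz : r ≤ ‖z‖
    · simp [Set.indicator_apply, hfe, hχ0 z hz]
    · by_cases hu : r ≤ |u|
      · simp [Set.indicator_apply, hfe, hχu0 u hu]
      · push Not at hz hu
        have h := hφ.mem_iff z (by linarith) u (by linarith)
        by_cases hmem : φ z ≤ u
        · rw [Set.indicator_of_mem (h.2 hmem), Set.indicator_of_mem (Set.mem_Ici.2 hmem), hfe]
        · rw [Set.indicator_of_notMem (fun h' => hmem (h.1 h')),
            Set.indicator_of_notMem (show u ∉ Set.Ici (φ z) from hmem)]
          simp
  have hint : Integrable (fun p => B.indicator f (e p)) (volume.prod volume) := by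
    refine (he.integrable_comp_emb e.measurableEmbedding (g := B.indicator f)).2 ?_
    refine IntegrableOn.integrable_indicator ?_ hBm
    have hcpt : HasCompactSupport f := by
      have : ProperSpace E := FiniteDimensional.proper ℝ E
      refine HasCompactSupport.intro (isCompact_closedBall x (2 * r)) fun p hp => ?_
      have hp' : 2 * r < ‖p - x‖ := by simpa [dist_eq_norm] using hp
      have : localCutoff x ν r p = 0 := by
        by_cases hu : r ≤ |⟪p - x, ν⟫_ℝ|
        · rw [localCutoff, hχu0 _ hu, mul_zero]
        · push Not at hu
          have h1 : ⟪p - x, ν⟫_ℝ ^ 2 ≤ r ^ 2 := by rw [← sq_abs]; gcongr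
          have h2 : r ^ 2 ≤ ‖p - x‖ ^ 2 - ⟪p - x, ν⟫_ℝ ^ 2 := by nlinarith
          rw [localCutoff, cutoff_eq_zero, zero_mul]
          rw [abs_of_nonneg (mul_nonneg (by positivity) ((sq_nonneg r).trans h2)), inv_mul_eq_div,
            one_le_div (by positivity)]
          exact h2
      simp [hf, this]
    have hfc : Continuous f := by
      have := (contDiff_localCutoff x ν r).continuous
      simp only [hf]
      fun_prop
    exact (hfc.integrable_of_hasCompactSupport hcpt).integrableOn
  rw [show (volume : Measure (F × ℝ)) = volume.prod volume from rfl, integral_prod _ hint]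
  have hinner : ∀ z, ∫ u, B.indicator f (e (z, u)) =
      Complex.exp (Complex.I * ((Λ * -⟪x, ν⟫_ℝ : ℝ) : ℂ)) * (Complex.I / Λ) *
        (((χ z : ℝ) : ℂ) * Complex.exp (Complex.I * ((Λ * φ z : ℝ) : ℂ)) + J * ((χ z : ℝ) : ℂ)) := by
    intro z
    simp only [hg]
    rw [integral_const_mul, integral_const_mul]
    by_cases hz : r ≤ ‖z‖
    · simp [hχ0 z hz]
    · push Not at hz
      rw [integral_indicator measurableSet_Ici, integral_cutoff_mul_exp hr hΛ
        (hφ.nonneg z (by linarith)) (hφr z hz.le), ← hJ]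
      push_cast
      ring
  simp only [hinner]
  have hχc : HasCompactSupport fun z => ((χ z : ℝ) : ℂ) := by
    have : ProperSpace F := FiniteDimensional.proper ℝ F
    refine HasCompactSupport.intro (isCompact_closedBall (0 : F) r) fun z hz => ?_
    simp [hχ0 z (by simpa using hz : r < ‖z‖).le]
  have hχcont : Continuous fun z => ((χ z : ℝ) : ℂ) := by
    simp only [hχ]; fun_prop
  have hφc := hφ.contDiff.continuous
  have hi1 : Integrable fun z => ((χ z : ℝ) : ℂ) * Complex.exp (Complex.I * ((Λ * φ z : ℝ) : ℂ)) :=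
    (hχcont.mul (by fun_prop)).integrable_of_hasCompactSupport hχc.mul_right
  have hi2 : Integrable fun z => J * ((χ z : ℝ) : ℂ) :=
    (hχcont.integrable_of_hasCompactSupport hχc).const_mul J
  rw [integral_const_mul, integral_add hi1 hi2, integral_const_mul]

end LocalIntegral

/-! ### The contribution of one boundary point. -/

section LocalAsymptotics

variable {E : Type} [NormedAddCommGroup E] [InnerProductSpace ℝ E] [FiniteDimensional ℝ E]
  [MeasurableSpace E] [BorelSpace E]

theorem norm_integral_cutoff_le {F : Type} [NormedAddCommGroup F] [InnerProductSpace ℝ F]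
    [FiniteDimensional ℝ F] [MeasurableSpace F] [BorelSpace F] {r : ℝ} (hr : 0 < r) (hr1 : r ≤ 1) :
    ‖∫ z : F, ((cutoff ((r ^ 2)⁻¹ * ‖z‖ ^ 2) : ℝ) : ℂ)‖ ≤
      volume.real (Metric.closedBall (0 : F) 1) := by
  have : ProperSpace F := FiniteDimensional.proper ℝ F
  have h0 : ∀ z ∉ Metric.closedBall (0 : F) 1, ((cutoff ((r ^ 2)⁻¹ * ‖z‖ ^ 2) : ℝ) : ℂ) = 0 := by
    intro z hz
    have hz' : 1 < ‖z‖ := by simpa using hz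
    rw [cutoff_eq_zero, Complex.ofReal_zero]
    rw [abs_of_nonneg (by positivity), inv_mul_eq_div, one_le_div (by positivity)]
    gcongr
    linarith
  rw [← setIntegral_eq_integral_of_forall_compl_eq_zero h0]
  have := norm_setIntegral_le_of_norm_le_const (μ := (volume : Measure F))
    (s := Metric.closedBall (0 : F) 1) (C := 1)
    (f := fun z => ((cutoff ((r ^ 2)⁻¹ * ‖z‖ ^ 2) : ℝ) : ℂ)) measure_closedBall_lt_top
    (fun z _ => by
      rw [Complex.norm_real, Real.norm_of_nonneg (cutoff_nonneg _)]
      exact cutoff_le_one _)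
  simpa using this

/-- The contribution of a neighborhood of a boundary point with Hessian at least `δ`. -/
theorem exists_local_asymptotic (F : Type) [NormedAddCommGroup F] [InnerProductSpace ℝ F]
    [FiniteDimensional ℝ F] [MeasurableSpace F] [BorelSpace F] (N : ℕ) {C c : ℝ} (hC : 1 ≤ C)
    (hc : 0 < c) : ∃ K, 0 ≤ K ∧ ∀ {B : Set E}, MeasurableSet B →
      Module.finrank ℝ E = Module.finrank ℝ F + 1 → ∀ {x ν : E}, ‖ν‖ = 1 →
      ∀ {R : F →ₗᵢ[ℝ] E}, (∀ z, ⟪ν, R z⟫_ℝ = 0) → ∀ {r₀ : ℝ} {φ : F → ℝ} {S A : F →L[ℝ] F},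
      IsBoundaryChart B x ν r₀ C (Module.finrank ℝ F + 5) R φ S →
      (∀ z, ‖A z‖ ^ 2 = ⟪S z, z⟫_ℝ) → A.det ≠ 0 → ∀ {δ r Λ : ℝ}, 0 < δ → 0 < Λ →
      (∀ z, δ * ‖z‖ ^ 2 ≤ ‖A z‖ ^ 2) → δ ≤ C → c * δ ≤ r → r ≤ r₀ → r ≤ 1 → C * r ≤ δ / 2 →
      C * r ≤ 1 / 4 →
      ‖(∫ p in B, ((localCutoff x ν r p : ℝ) : ℂ) *
          Complex.exp (Complex.I * ((Λ * -⟪p, ν⟫_ℝ : ℝ) : ℂ))) -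
        Complex.exp (Complex.I * ((Λ * -⟪x, ν⟫_ℝ : ℝ) : ℂ)) * (Complex.I / Λ) *
          (|A.det|⁻¹ • ((((2 * Real.pi / Λ) ^ ((Module.finrank ℝ F : ℝ) / 2) : ℝ) : ℂ) *
          Complex.exp (Real.pi * Complex.I * (Module.finrank ℝ F) / 4)))‖ ≤
        K * (Λ⁻¹ * ((δ ^ 3)⁻¹ * (|A.det|⁻¹ * Λ ^ (-(1 + (Module.finrank ℝ F : ℝ) / 2)))) +
          Λ⁻¹ * ((Λ * δ) ^ N)⁻¹) := by
  obtain ⟨K₁, hK₁, hsp⟩ := stationary_phase F C c (by linarith) hc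
  obtain ⟨K₂, hK₂, hJ⟩ := exists_integral_deriv_cutoff_le N
  set V := volume.real (Metric.closedBall (0 : F) 1) with hV
  have hV0 : 0 ≤ V := measureReal_nonneg
  refine ⟨K₁ + K₂ * (c ^ N)⁻¹ * V, by positivity, ?_⟩
  intro B hBm hdim x ν hν R hR r₀ φ S A hφ hA hdet δ r Λ hδ hΛ hδA hδC hcr hr₀ hr1 hCr hCr4
  have hr : 0 < r := lt_of_lt_of_le (by positivity) hcr
  -- The boundary stays at depth at most $\frac12Cr^2+Cr^3\le r/2$, where the vertical cutoff is
  -- still $1$. This uses $Cr\le\frac14$ and $r\le1$.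
  have hφr : ∀ z, ‖z‖ ≤ r → φ z ≤ r / 2 := by
    intro z hz
    have h1 := hφ.remainder.base z (by simpa using hz.trans hr₀)
    rw [Real.norm_eq_abs] at h1
    have h2 := (abs_le.1 h1).2
    have h3 : ⟪S z, z⟫_ℝ ≤ C * ‖z‖ * ‖z‖ := (real_inner_le_norm _ _).trans (by
      gcongr; exact hφ.norm_hessian_le z)
    have h4 : ‖z‖ ^ 2 ≤ r ^ 2 := by gcongr
    have h5 : ‖z‖ ^ 3 ≤ r ^ 3 := by gcongr
    have h6 : C * ‖z‖ ^ 2 ≤ C * r ^ 2 := by gcongr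
    have h7 : C * ‖z‖ ^ 3 ≤ C * r ^ 3 := by gcongr
    have h8 : C * r ^ 2 ≤ r / 4 := by nlinarith
    have h9 : C * r ^ 3 ≤ r / 4 := by nlinarith
    nlinarith
  rw [setIntegral_localCutoff hBm hdim hν hR hφ hr hr₀ hφr hΛ]
  set J := ∫ v in (1 / 2 : ℝ)..1, ((deriv (fun v => cutoff (v ^ 2)) v : ℝ) : ℂ) *
          Complex.exp (Complex.I * ((Λ * r : ℝ) * v)) with hJd
  set I₁ := ∫ z : F, ((cutoff ((r ^ 2)⁻¹ * ‖z‖ ^ 2) : ℝ) : ℂ) *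
          Complex.exp (Complex.I * ((Λ * φ z : ℝ) : ℂ)) with hI₁
  set T := |A.det|⁻¹ • ((((2 * Real.pi / Λ) ^ ((Module.finrank ℝ F : ℝ) / 2) : ℝ) : ℂ) *
          Complex.exp (Real.pi * Complex.I * (Module.finrank ℝ F) / 4)) with hT
  set P : F → ℝ := fun z => φ z - 1 / 2 * ⟪S z, z⟫_ℝ with hP
  have hsub : Metric.closedBall (0 : F) r ⊆ Metric.closedBall 0 r₀ :=
    Metric.closedBall_subset_closedBall hr₀
  have hPs : ContDiff ℝ ∞ P :=
    hφ.contDiff.sub (contDiff_const.mul (S.contDiff.inner ℝ contDiff_id))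
  have h1 := hsp A P δ r Λ hdet hPs hδ hr hΛ hcr hCr hδC hδA
    (hφ.remainder.mono_set hsub) (hφ.remainder_even.mono_set hsub)
  have e1 : ∀ z, 1 / 2 * ‖A z‖ ^ 2 + P z = φ z := fun z => by rw [hA]; simp only [hP]; ring
  simp only [e1] at h1
  rw [← hI₁, ← hT] at h1
  have h2 := hJ (Λ * r) (by positivity)
  rw [← hJd] at h2
  have h3 := norm_integral_cutoff_le (F := F) hr hr1
  rw [← hV] at h3
  set V' := ∫ z : F, ((cutoff ((r ^ 2)⁻¹ * ‖z‖ ^ 2) : ℝ) : ℂ)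
  have h4 : ((Λ * r) ^ N)⁻¹ ≤ (c ^ N)⁻¹ * ((Λ * δ) ^ N)⁻¹ := by
    rw [← mul_inv, ← mul_pow]
    gcongr ?_⁻¹
    gcongr ?_ ^ N
    nlinarith
  rw [← mul_sub, norm_mul, norm_mul, mul_comm Complex.I,
    Complex.norm_exp_ofReal_mul_I, one_mul, norm_div, Complex.norm_I, Complex.norm_real,
    Real.norm_of_nonneg hΛ.le, one_div]
  set X := (δ ^ 3)⁻¹ * (|A.det|⁻¹ * Λ ^ (-(1 + (Module.finrank ℝ F : ℝ) / 2))) with hX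
  set Z := ((Λ * δ) ^ N)⁻¹ with hZ
  have hX0 : 0 ≤ X := by positivity
  have hZ0 : 0 ≤ Z := by positivity
  have h5 : ‖I₁ + J * V' - T‖ ≤ K₁ * X + K₂ * (c ^ N)⁻¹ * V * Z := by
    calc ‖I₁ + J * V' - T‖ = ‖(I₁ - T) + J * V'‖ := by congr 1; ring
      _ ≤ ‖I₁ - T‖ + ‖J * V'‖ := norm_add_le _ _
      _ ≤ K₁ * X + (K₂ * ((c ^ N)⁻¹ * Z)) * V := by
          rw [norm_mul]
          refine add_le_add h1 (mul_le_mul (h2.trans ?_) h3 (norm_nonneg _) (by positivity))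
          gcongr
      _ = _ := by ring
  have h6 : K₁ * X + K₂ * (c ^ N)⁻¹ * V * Z ≤ (K₁ + K₂ * (c ^ N)⁻¹ * V) * (X + Z) := by
    have : 0 ≤ K₂ * (c ^ N)⁻¹ * V := by positivity
    nlinarith [mul_nonneg hK₁ hZ0, mul_nonneg this hX0]
  calc Λ⁻¹ * ‖I₁ + J * V' - T‖ ≤ Λ⁻¹ * ((K₁ + K₂ * (c ^ N)⁻¹ * V) * (X + Z)) := by
        gcongr; exact h5.trans h6
    _ = _ := by ring

end LocalAsymptotics

/-! ### A field tangent to the boundary that moves the phase. -/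

section TangentField

variable {E : Type} [NormedAddCommGroup E] [InnerProductSpace ℝ E] [FiniteDimensional ℝ E]
  {B : Set E} {ρ : E → ℝ}

/-- The component of the gradient in the direction `ξ`. -/
noncomputable def gradComp (ρ : E → ℝ) (q : E × E) : ℝ := ⟪gradient ρ q.2, q.1⟫_ℝ

/-- The component of the gradient orthogonal to `ξ`. -/
noncomputable def gradPerp (ρ : E → ℝ) (q : E × E) : E := gradient ρ q.2 - gradComp ρ q • q.1

/-- The derivative of the phase along `phaseField`. -/
noncomputable def phaseSpeed (ρ : E → ℝ) (q : E × E) : ℝ := ‖gradPerp ρ q‖ ^ 2 - ρ q.2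

/-- A family of vector fields, indexed by the direction `ξ`, tangent to the boundary and vanishing
exactly where the normal is parallel to `ξ`. -/
noncomputable def phaseField (ρ : E → ℝ) (q : E × E) : E :=
  gradComp ρ q • gradPerp ρ q - phaseSpeed ρ q • q.1

/-- The derivative of `gradPerp` in the point. -/
noncomputable def gradPerpDeriv (ρ : E → ℝ) (q : E × E) : E →L[ℝ] E :=
  fderiv ℝ (gradient ρ) q.2 -
    ((innerSL ℝ q.1) ∘L (fderiv ℝ (gradient ρ) q.2)).smulRight q.1

namespace IsDefiningFunction

variable (hρ : IsDefiningFunction B ρ)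
include hρ

theorem contDiff_gradient_snd : ContDiff ℝ ∞ fun q : E × E => gradient ρ q.2 :=
  hρ.contDiff_gradient.comp contDiff_snd

theorem contDiff_gradComp : ContDiff ℝ ∞ (gradComp ρ) :=
  hρ.contDiff_gradient_snd.inner ℝ contDiff_fst

theorem contDiff_gradPerp : ContDiff ℝ ∞ (gradPerp ρ) :=
  hρ.contDiff_gradient_snd.sub (hρ.contDiff_gradComp.smul contDiff_fst)

theorem contDiff_phaseSpeed : ContDiff ℝ ∞ (phaseSpeed ρ) :=
  (hρ.contDiff_gradPerp.norm_sq ℝ).sub (hρ.contDiff.comp contDiff_snd)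

theorem contDiff_phaseField : ContDiff ℝ ∞ (phaseField ρ) :=
  (hρ.contDiff_gradComp.smul hρ.contDiff_gradPerp).sub (hρ.contDiff_phaseSpeed.smul contDiff_fst)

theorem contDiff_gradPerpDeriv : ContDiff ℝ ∞ (gradPerpDeriv ρ) := by
  have h1 : ContDiff ℝ ∞ fun q : E × E => fderiv ℝ (gradient ρ) q.2 :=
    (hρ.contDiff_gradient.fderiv_right (m := ∞) (by simp)).comp contDiff_snd
  have h2 : ContDiff ℝ ∞ fun q : E × E => innerSL ℝ q.1 :=
    (innerSL ℝ (E := E)).contDiff.comp contDiff_fst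
  exact h1.sub ((h2.clm_comp h1).smulRight contDiff_fst)

theorem inner_gradPerp {ξ : E} (hξ : ‖ξ‖ = 1) (x : E) : ⟪gradPerp ρ (ξ, x), ξ⟫_ℝ = 0 := by
  rw [gradPerp, inner_sub_left, real_inner_smul_left, real_inner_self_eq_norm_sq, hξ]
  simp [gradComp]

theorem inner_gradient_gradPerp {ξ : E} (hξ : ‖ξ‖ = 1) (x : E) :
    ⟪gradient ρ x, gradPerp ρ (ξ, x)⟫_ℝ = ‖gradPerp ρ (ξ, x)‖ ^ 2 := by
  have h : gradient ρ x = gradPerp ρ (ξ, x) + gradComp ρ (ξ, x) • ξ := by simp [gradPerp]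
  nth_rewrite 1 [h]
  rw [inner_add_left, real_inner_smul_left, real_inner_comm, real_inner_self_eq_norm_sq,
    real_inner_comm, hρ.inner_gradPerp hξ, mul_zero, add_zero]

theorem inner_phaseField {ξ : E} (hξ : ‖ξ‖ = 1) (x : E) :
    ⟪phaseField ρ (ξ, x), ξ⟫_ℝ = -phaseSpeed ρ (ξ, x) := by
  rw [phaseField, inner_sub_left, real_inner_smul_left, real_inner_smul_left, hρ.inner_gradPerp hξ,
    real_inner_self_eq_norm_sq, hξ]
  ring

/-- The field is tangent to the level set `ρ = 0`. -/
theorem fderiv_phaseField {ξ : E} (hξ : ‖ξ‖ = 1) (x : E) :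
    fderiv ℝ ρ x (phaseField ρ (ξ, x)) = gradComp ρ (ξ, x) * ρ x := by
  rw [← inner_gradient_left, phaseField, inner_sub_right, real_inner_smul_right,
    real_inner_smul_right, hρ.inner_gradient_gradPerp hξ, phaseSpeed]
  simp only [gradComp]
  ring

theorem hasFDerivAt_gradPerp (ξ x : E) :
    HasFDerivAt (fun x => gradPerp ρ (ξ, x)) (gradPerpDeriv ρ (ξ, x)) x := by
  have h1 := ((hρ.contDiff_gradient.contDiffAt (x := x)).differentiableAt (by simp)).hasFDerivAt
  have h2 : HasFDerivAt (fun x => gradComp ρ (ξ, x)) ((innerSL ℝ ξ) ∘L fderiv ℝ (gradient ρ) x) x := by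
    have := (innerSL ℝ ξ).hasFDerivAt.comp x h1
    refine this.congr_of_eventuallyEq (Filter.Eventually.of_forall fun y => ?_)
    simp [gradComp, real_inner_comm]
  exact h1.sub (h2.smul_const ξ)

omit hρ in
theorem contDiff_adjoint : ContDiff ℝ ∞ fun L : E →L[ℝ] E =>
    haveI : CompleteSpace E := FiniteDimensional.complete ℝ E
    ContinuousLinearMap.adjoint L := by
  have : CompleteSpace E := FiniteDimensional.complete ℝ E
  let a : (E →L[ℝ] E) →ₗ[ℝ] (E →L[ℝ] E) :=
    { toFun := fun L => ContinuousLinearMap.adjoint L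
      map_add' := fun L L' => map_add _ L L'
      map_smul' := fun c L => by simp }
  let a' : (E →L[ℝ] E) →L[ℝ] (E →L[ℝ] E) := a.mkContinuous 1 fun L => by simp [a]
  exact a'.contDiff

/-- Expressions $\langle Ap,p\rangle+c\rho$, with $p$ the tangential gradient, are stable under the
field $V$: $V\rho$ is a multiple of $\rho$, while $Vp$ is linear in $p$ up to a multiple of the
speed $|p|^2-\rho$, which is itself of this form. -/
theorem exists_iterate_phaseSpeed (j : ℕ) : ∃ (A : E × E → E →L[ℝ] E) (c : E × E → ℝ),
    ContDiff ℝ ∞ A ∧ ContDiff ℝ ∞ c ∧ ∀ ξ : E, ‖ξ‖ = 1 → ∀ x,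
      (fieldDeriv (fun x => phaseField ρ (ξ, x)))^[j] (fun x => phaseSpeed ρ (ξ, x)) x =
        ⟪A (ξ, x) (gradPerp ρ (ξ, x)), gradPerp ρ (ξ, x)⟫_ℝ + c (ξ, x) * ρ x := by
  have : CompleteSpace E := FiniteDimensional.complete ℝ E
  induction j with
  | zero =>
    refine ⟨fun _ => ContinuousLinearMap.id ℝ E, fun _ => -1, contDiff_const, contDiff_const,
      fun ξ _ x => ?_⟩
    simp only [Function.iterate_zero, id, phaseSpeed, ContinuousLinearMap.id_apply,
      real_inner_self_eq_norm_sq]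
    ring
  | succ j ih =>
    obtain ⟨A, c, hA, hc, h⟩ := ih
    have hV := hρ.contDiff_phaseField
    have hM := hρ.contDiff_gradPerpDeriv
    have hh := hρ.contDiff_gradComp
    have hp := hρ.contDiff_gradPerp
    set M := gradPerpDeriv ρ with hMd
    set p := gradPerp ρ with hpd
    have hMξ : ContDiff ℝ ∞ fun q : E × E => M q q.1 := hM.clm_apply contDiff_fst
    -- The component of the field along $-\xi$ contributes $-(|p|^2-\rho)s$: the part $-s|p|^2$ goes
    -- into the new $A$ and $+s\rho$ into the new $c$.
    set s : E × E → ℝ := fun q => ⟪A q (M q q.1), p q⟫_ℝ + ⟪A q (p q), M q q.1⟫_ℝ with hs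
    have hss : ContDiff ℝ ∞ s :=
      ((hA.clm_apply hMξ).inner ℝ hp).add ((hA.clm_apply hp).inner ℝ hMξ)
    have hadj : ContDiff ℝ ∞ fun q => ContinuousLinearMap.adjoint (M q) := contDiff_adjoint.comp hM
    refine ⟨fun q => fderivSnd A q (phaseField ρ q) + gradComp ρ q • ((A q) ∘L M q) +
      gradComp ρ q • (ContinuousLinearMap.adjoint (M q) ∘L A q) -
        s q • ContinuousLinearMap.id ℝ E,
      fun q => fderivSnd c q (phaseField ρ q) + gradComp ρ q * c q + s q, ?_, ?_, fun ξ hξ x => ?_⟩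
    · exact (((hA.fderivSnd.clm_apply hV).add (hh.smul (hA.clm_comp hM))).add
        (hh.smul (hadj.clm_comp hA))).sub (hss.smul contDiff_const)
    · exact ((hc.fderivSnd.clm_apply hV).add (hh.mul hc)).add hss
    · rw [Function.iterate_succ_apply', show (fieldDeriv (fun x => phaseField ρ (ξ, x)))^[j]
        (fun x => phaseSpeed ρ (ξ, x)) = fun x => ⟪A (ξ, x) (p (ξ, x)), p (ξ, x)⟫_ℝ +
          c (ξ, x) * ρ x from funext (h ξ hξ)]
      have hpx := hρ.hasFDerivAt_gradPerp ξ x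
      have hd := (((hasFDerivAt_fderivSnd hA ξ x).clm_apply hpx).inner ℝ hpx).add
        ((hasFDerivAt_fderivSnd hc ξ x).mul (hρ.differentiableAt x).hasFDerivAt)
      have hdx : M (ξ, x) (phaseField ρ (ξ, x)) = gradComp ρ (ξ, x) • M (ξ, x) (p (ξ, x)) -
          phaseSpeed ρ (ξ, x) • M (ξ, x) ξ := by
        rw [phaseField, map_sub, map_smul, map_smul]
      have hg : phaseSpeed ρ (ξ, x) = ‖p (ξ, x)‖ ^ 2 - ρ x := rfl
      have hval : fieldDeriv (fun x => phaseField ρ (ξ, x))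
          (fun x => ⟪A (ξ, x) (p (ξ, x)), p (ξ, x)⟫_ℝ + c (ξ, x) * ρ x) x =
          ⟪(fderivSnd A (ξ, x) (phaseField ρ (ξ, x))) (p (ξ, x)), p (ξ, x)⟫_ℝ +
          ⟪A (ξ, x) (M (ξ, x) (phaseField ρ (ξ, x))), p (ξ, x)⟫_ℝ +
          ⟪A (ξ, x) (p (ξ, x)), M (ξ, x) (phaseField ρ (ξ, x))⟫_ℝ +
          (c (ξ, x) * fderiv ℝ ρ x (phaseField ρ (ξ, x)) +
            fderivSnd c (ξ, x) (phaseField ρ (ξ, x)) * ρ x) := by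
        have e : fderiv ℝ (fun x => ⟪A (ξ, x) (p (ξ, x)), p (ξ, x)⟫_ℝ + c (ξ, x) * ρ x) x = _ :=
          hd.fderiv
        rw [fieldDeriv, e]
        simp only [add_apply, ContinuousLinearMap.flip_apply, ContinuousLinearMap.comp_apply,
          smul_apply, smul_eq_mul, fderivInnerCLM_apply, ContinuousLinearMap.prod_apply,
          inner_add_left]
        ring
      rw [hval, hdx, hρ.fderiv_phaseField hξ, hg]
      simp only [hs, map_sub, map_smul, sub_apply, add_apply, smul_apply, smul_eq_mul,
        ContinuousLinearMap.comp_apply, ContinuousLinearMap.id_apply, inner_add_left,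
        inner_sub_left, inner_sub_right, real_inner_smul_left, real_inner_smul_right,
        real_inner_self_eq_norm_sq, ContinuousLinearMap.adjoint_inner_left]
      ring

theorem phaseSpeed_nonneg (ξ : E) {x : E} (hx : x ∈ B) : 0 ≤ phaseSpeed ρ (ξ, x) := by
  have := (hρ.mem_iff x).1 hx
  rw [phaseSpeed]
  have h2 : 0 ≤ ‖gradPerp ρ (ξ, x)‖ ^ 2 := by positivity
  simp only
  linarith

/-- On $B$ both $|p|^2$ and $-\rho$ are at most the speed, so the normal form of
`exists_iterate_phaseSpeed` is bounded by it. The coefficients are bounded by compactness in $\xi$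
and $x$. -/
theorem exists_fieldBound_phaseSpeed (hBc : IsCompact B) (n : ℕ) : ∃ C, 0 ≤ C ∧
    ∀ ξ : E, ‖ξ‖ = 1 → FieldBound (fun x => phaseField ρ (ξ, x)) B n C
      (fun x => phaseSpeed ρ (ξ, x)) (fun x => phaseSpeed ρ (ξ, x)) := by
  have : ProperSpace E := FiniteDimensional.proper ℝ E
  choose A c hA hc h using hρ.exists_iterate_phaseSpeed
  have hK : IsCompact (Metric.sphere (0 : E) 1 ×ˢ B) := (isCompact_sphere 0 1).prod hBc
  have hb : ∀ j, ∃ C, ∀ q ∈ Metric.sphere (0 : E) 1 ×ˢ B, ‖A j q‖ + ‖c j q‖ ≤ C := by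
    intro j
    obtain ⟨C₁, h₁⟩ := hK.exists_bound_of_continuousOn (f := fun q => ‖A j q‖ + ‖c j q‖)
      ((hA j).continuous.norm.add (hc j).continuous.norm).continuousOn
    exact ⟨C₁, fun q hq => (le_abs_self _).trans (h₁ q hq)⟩
  choose C hC using hb
  refine ⟨∑ j ∈ Finset.range (n + 1), |C j|, Finset.sum_nonneg fun i _ => abs_nonneg _,
    fun ξ hξ j hj x hx => ?_⟩
  have hCj := hC j (ξ, x) ⟨by simpa using hξ, hx⟩
  have hρx := (hρ.mem_iff x).1 hx
  have hg := hρ.phaseSpeed_nonneg ξ hx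
  rw [h j ξ hξ x]
  have h1 : ‖⟪A j (ξ, x) (gradPerp ρ (ξ, x)), gradPerp ρ (ξ, x)⟫_ℝ + c j (ξ, x) * ρ x‖ ≤
      C j * phaseSpeed ρ (ξ, x) := by
    have e1 : ‖⟪A j (ξ, x) (gradPerp ρ (ξ, x)), gradPerp ρ (ξ, x)⟫_ℝ‖ ≤
        ‖A j (ξ, x)‖ * ‖gradPerp ρ (ξ, x)‖ ^ 2 := by
      rw [sq, ← mul_assoc]
      exact (norm_inner_le_norm _ _).trans (by gcongr; exact (A j (ξ, x)).le_opNorm _)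
    have e2 : ‖c j (ξ, x) * ρ x‖ = ‖c j (ξ, x)‖ * -ρ x := by
      rw [norm_mul, Real.norm_of_nonpos hρx]
    refine (norm_add_le _ _).trans ?_
    rw [e2, phaseSpeed]
    have n1 := norm_nonneg (A j (ξ, x))
    have n2 := norm_nonneg (c j (ξ, x))
    have n3 : 0 ≤ ‖gradPerp ρ (ξ, x)‖ ^ 2 := by positivity
    simp only
    nlinarith [mul_nonneg n2 n3, mul_nonneg n1 (neg_nonneg.2 hρx)]
  refine h1.trans (mul_le_mul_of_nonneg_right ((le_abs_self _).trans ?_) hg)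
  exact Finset.single_le_sum (f := fun j => |C j|) (fun i _ => abs_nonneg _)
    (Finset.mem_range.2 (by omega))

end IsDefiningFunction

end TangentField

/-! ### Cutoffs at small scales under a field vanishing at their centre. -/

section CutoffBounds

theorem fieldDeriv_iterate_translate {E G : Type*} [NormedAddCommGroup E] [NormedSpace ℝ E]
    [NormedAddCommGroup G] [NormedSpace ℝ G] (V : E → E) (f : E → G) (x : E) (j : ℕ) :
    (fieldDeriv (fun z => V (x + z)))^[j] (fun z => f (x + z)) =
      fun z => (fieldDeriv V)^[j] f (x + z) := by
  induction j with
  | zero => rfl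
  | succ j ih =>
    rw [Function.iterate_succ_apply', Function.iterate_succ_apply', ih]
    ext z
    simp only [fieldDeriv]
    rw [fderiv_comp_add_left]

theorem FieldBound.sum {E A ι : Type*} [NormedAddCommGroup E] [NormedSpace ℝ E]
    [NormedAddCommGroup A] [NormedSpace ℝ A] {V : E → E} {S : Set E} {n : ℕ} {C : ℝ} {w : E → ℝ}
    (hV : ContDiff ℝ ∞ V) (s : Finset ι) {f : ι → E → A} (hf : ∀ i, ContDiff ℝ ∞ (f i))
    (h : ∀ i, FieldBound V S n C w (f i)) :
    FieldBound V S n (s.card * C) w (fun x => ∑ i ∈ s, f i x) := by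
  classical
  induction s using Finset.induction_on with
  | empty => simpa using FieldBound.const (V := V) (S := S) (n := n) (C := 0) (w := w) (c := (0 : A)) (by simp)
  | insert i s hi ih =>
    have := FieldBound.add hV (hf i) (ContDiff.sum fun i _ => hf i) (h i) ih
    simp only [Finset.sum_insert hi, Finset.card_insert_of_notMem hi]
    refine this.weaken fun x _ => le_of_eq ?_
    push_cast; ring

theorem exists_abs_iterate_deriv_cutoff_le (n : ℕ) :
    ∃ K : ℝ, ∀ i ≤ n, ∀ s, |deriv^[i] cutoff s| ≤ K := by
  have h : ∀ i : ℕ, ∃ C, ∀ s, ‖deriv^[i] cutoff s‖ ≤ C := by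
    intro i
    rw [← iteratedDeriv_eq_iterate]
    exact (contDiff_cutoff.continuous_iteratedDeriv i (by exact_mod_cast le_top)).bounded_above_of_compact_support
      (by
        induction i with
        | zero => simpa using hasCompactSupport_cutoff
        | succ i ih => rw [iteratedDeriv_succ]; exact ih.deriv)
  choose C hC using h
  refine ⟨∑ j ∈ Finset.range (n + 1), |C j|, fun i hi s => ?_⟩
  exact ((hC i s).trans (le_abs_self _)).trans (Finset.single_le_sum (f := fun j => |C j|)
    (fun _ _ => abs_nonneg _) (Finset.mem_range.2 (by omega)))

variable {E : Type} [NormedAddCommGroup E] [InnerProductSpace ℝ E] [FiniteDimensional ℝ E]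
  {Y : Type} [NormedAddCommGroup Y] [NormedSpace ℝ Y]

theorem exists_fieldBound_sq {K : Set Y} (hK : IsCompact K) {W : Y × E → E}
    (hW : ContDiff ℝ ∞ W) (hW0 : ∀ y ∈ K, W (y, 0) = 0) {f : Y × E → ℝ} (hf : ContDiff ℝ ∞ f)
    (hf0 : ∀ y ∈ K, f (y, 0) = 0) (r : ℝ) (n : ℕ) :
    ∃ C, 0 ≤ C ∧ ∀ y ∈ K, FieldBound (fun z => W (y, z)) (Metric.closedBall 0 r) n C
      (fun z => ‖z‖ ^ 2) (fun z => f (y, z) ^ 2) := by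
  have : ProperSpace E := FiniteDimensional.proper ℝ E
  obtain ⟨C, hC, h⟩ := exists_fieldBound_norm hK hW hW0 hf hf0 r n
  refine ⟨2 ^ n * (C * C), by positivity, fun y hy => ?_⟩
  have hs : ∀ {G : Type} [NormedAddCommGroup G] [NormedSpace ℝ G] {g : Y × E → G},
      ContDiff ℝ ∞ g → ContDiff ℝ ∞ fun z => g (y, z) := fun hg =>
    hg.comp (contDiff_const.prodMk contDiff_id)
  have := FieldBound.mul (hs hW) (hs hf) (hs hf) (h y hy) (h y hy)
  simpa only [sq] using this

theorem exists_fieldBound_norm_sq {K : Set Y} (hK : IsCompact K) {W : Y × E → E}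
    (hW : ContDiff ℝ ∞ W) (hW0 : ∀ y ∈ K, W (y, 0) = 0) (r : ℝ) (n : ℕ) :
    ∃ C, 0 ≤ C ∧ ∀ y ∈ K, FieldBound (fun z => W (y, z)) (Metric.closedBall 0 r) n C
      (fun z => ‖z‖ ^ 2) (fun z => ‖z‖ ^ 2) := by
  let b := stdOrthonormalBasis ℝ E
  have hb : ∀ i, ContDiff ℝ ∞ fun p : Y × E => ⟪b i, p.2⟫_ℝ := fun i =>
    contDiff_const.inner ℝ contDiff_snd
  choose C hC h using fun i => exists_fieldBound_sq hK hW hW0 (hb i) (by simp) r n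
  refine ⟨(Finset.univ : Finset (Fin (Module.finrank ℝ E))).card * ∑ i, C i,
    mul_nonneg (by positivity) (Finset.sum_nonneg fun i _ => hC i), fun y hy => ?_⟩
  have h1 := FieldBound.sum (V := fun z => W (y, z)) (hW.comp (contDiff_const.prodMk contDiff_id))
    Finset.univ (f := fun i z => ⟪b i, z⟫_ℝ ^ 2)
    (fun i => (contDiff_const.inner ℝ contDiff_id).pow 2)
    (fun i => (h i y hy).mono_const (Finset.single_le_sum (fun i _ => hC i) (Finset.mem_univ i))
      fun x _ => by positivity)
  have e : ∀ z : E, ∑ i, ⟪b i, z⟫_ℝ ^ 2 = ‖z‖ ^ 2 := fun z => by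
    simpa using b.sum_sq_norm_inner_right z
  simpa only [e] using h1

theorem localCutoff_eventuallyEq_zero {x ξ p : E} {r : ℝ} (hr : 0 < r) (h : 2 * r < ‖p - x‖) :
    localCutoff x ξ r =ᶠ[nhds p] fun _ => 0 := by
  have ho : IsOpen {p : E | 2 * r < ‖p - x‖} :=
    isOpen_lt continuous_const (continuous_id.sub continuous_const).norm
  filter_upwards [ho.mem_nhds h] with q hq
  have h4 : 4 * r ^ 2 ≤ ‖q - x‖ ^ 2 := by
    have : 2 * r < ‖q - x‖ := hq
    nlinarith
  have hr2 : 0 < r ^ 2 := by positivity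
  rcases le_or_gt (r ^ 2) (⟪q - x, ξ⟫_ℝ ^ 2) with h1 | h1
  · rw [localCutoff, cutoff_eq_zero (s := (r ^ 2)⁻¹ * ⟪q - x, ξ⟫_ℝ ^ 2), mul_zero]
    rw [abs_of_nonneg (by positivity), ← div_eq_inv_mul, le_div_iff₀ hr2, one_mul]
    exact h1
  · rw [localCutoff, cutoff_eq_zero (s := (r ^ 2)⁻¹ * (‖q - x‖ ^ 2 - ⟪q - x, ξ⟫_ℝ ^ 2)), zero_mul]
    refine le_trans ?_ (le_abs_self _)
    rw [← div_eq_inv_mul, le_div_iff₀ hr2]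
    nlinarith

/-- Cutoffs at scale `r` around zeros of a family of fields have bounded derivatives along the
fields, uniformly in `r`. -/
theorem exists_fieldBound_localCutoff {K : Set (E × E)} (hK : IsCompact K) {W : E × E → E}
    (hW : ContDiff ℝ ∞ W) (hW0 : ∀ q ∈ K, W q = 0) (n : ℕ) :
    ∃ C, 0 ≤ C ∧ ∀ q ∈ K, ∀ r : ℝ, 0 < r → r ≤ 1 →
      FieldBound (fun x => W (q.1, x)) Set.univ n C (fun _ => 1) (localCutoff q.2 q.1 r) := by
  let W' : (E × E) × E → E := fun p => W (p.1.1, p.1.2 + p.2)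
  have hW' : ContDiff ℝ ∞ W' := hW.comp
    ((contDiff_fst.comp contDiff_fst).prodMk ((contDiff_snd.comp contDiff_fst).add contDiff_snd))
  have hW0' : ∀ q ∈ K, W' (q, 0) = 0 := fun q hq => by simpa [W'] using hW0 q hq
  obtain ⟨C₁, hC₁, h₁⟩ := exists_fieldBound_norm_sq hK hW' hW0' 2 n
  obtain ⟨C₂, hC₂, h₂⟩ := exists_fieldBound_sq hK hW' hW0'
    (f := fun p => ⟪p.2, p.1.1⟫_ℝ) (contDiff_snd.inner ℝ (contDiff_fst.comp contDiff_fst))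
    (by simp) 2 n
  obtain ⟨Kc, hKc⟩ := exists_abs_iterate_deriv_cutoff_le n
  obtain ⟨C₃, h₃⟩ := FieldBound.comp_real n (4 * (C₁ + C₂)) Kc
  refine ⟨|2 ^ n * (C₃ * C₃)|, abs_nonneg _, fun q hq r hr hr1 => ?_⟩
  have hV : ContDiff ℝ ∞ fun z => W' (q, z) := hW'.comp (contDiff_const.prodMk contDiff_id)
  have hi : ContDiff ℝ ∞ fun z : E => ⟪z, q.1⟫_ℝ ^ 2 := (contDiff_id.inner ℝ contDiff_const).pow 2
  have hn : ContDiff ℝ ∞ fun z : E => ‖z‖ ^ 2 := contDiff_norm_sq ℝ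
  have hsub : Metric.closedBall (0 : E) (2 * r) ⊆ Metric.closedBall 0 2 :=
    Metric.closedBall_subset_closedBall (by linarith)
  -- Since the field vanishes at the centre, derivatives of the quadratic arguments remain
  -- $O(|z|^2)$. On the ball of radius $2r$, outside which the cutoff is zero, this compensates the
  -- factor $r^{-2}$.
  have hw : ∀ {C : ℝ}, 0 ≤ C → C ≤ C₁ + C₂ → ∀ z ∈ Metric.closedBall (0 : E) (2 * r),
      ‖(r ^ 2)⁻¹‖ * C * ‖z‖ ^ 2 ≤ 4 * (C₁ + C₂) * 1 := by
    intro C hC hC' z hz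
    have hz' : ‖z‖ ≤ 2 * r := by simpa using hz
    have : ‖z‖ ^ 2 ≤ (2 * r) ^ 2 := by gcongr
    rw [Real.norm_of_nonneg (by positivity)]
    calc (r ^ 2)⁻¹ * C * ‖z‖ ^ 2 ≤ (r ^ 2)⁻¹ * C * (2 * r) ^ 2 := by gcongr
      _ = 4 * C := by field_simp; ring
      _ ≤ _ := by linarith
  have hi' : FieldBound (fun z => W' (q, z)) (Metric.closedBall 0 (2 * r)) n (4 * (C₁ + C₂))
      (fun _ => 1) (fun z => (r ^ 2)⁻¹ * ⟪z, q.1⟫_ℝ ^ 2) :=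
    (FieldBound.const_mul hV hi _ ((h₂ q hq).mono_set hsub)).weaken (hw hC₂ (by linarith))
  have hd' : FieldBound (fun z => W' (q, z)) (Metric.closedBall 0 (2 * r)) n (4 * (C₁ + C₂))
      (fun _ => 1) (fun z => (r ^ 2)⁻¹ * (‖z‖ ^ 2 - ⟪z, q.1⟫_ℝ ^ 2)) := by
    have := FieldBound.const_mul hV (hn.add (contDiff_const.mul hi)) ((r ^ 2)⁻¹)
      (((h₁ q hq).mono_set hsub).add hV hn (contDiff_const.mul hi)
        (FieldBound.const_mul hV hi (-1) ((h₂ q hq).mono_set hsub)))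
    simp only [neg_one_mul, norm_neg, norm_one, one_mul, ← sub_eq_add_neg] at this
    exact this.weaken (hw (by linarith) le_rfl)
  have c1 := h₃ _ _ _ cutoff hV (contDiff_const.mul (hn.sub hi)) contDiff_cutoff hd'
    fun i hi x _ => hKc i hi _
  have c2 := h₃ _ _ _ cutoff hV (contDiff_const.mul hi) contDiff_cutoff hi'
    fun i hi x _ => hKc i hi _
  have c3 := FieldBound.mul hV (contDiff_cutoff.comp (contDiff_const.mul (hn.sub hi)))
    (contDiff_cutoff.comp (contDiff_const.mul hi)) c1 c2
  have e : (fun z => cutoff ((r ^ 2)⁻¹ * (‖z‖ ^ 2 - ⟪z, q.1⟫_ℝ ^ 2)) *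
      cutoff ((r ^ 2)⁻¹ * ⟪z, q.1⟫_ℝ ^ 2)) = fun z => localCutoff q.2 q.1 r (q.2 + z) := by
    ext z; simp [localCutoff]
  intro j hj x _
  by_cases hx : ‖x - q.2‖ ≤ 2 * r
  · have h4 := c3 j hj (x - q.2) (by simpa using hx)
    simp only [Function.comp_def] at h4
    rw [e, show (fun z => W' (q, z)) = fun z => W (q.1, q.2 + z) from rfl,
      fieldDeriv_iterate_translate (fun x => W (q.1, x))] at h4
    simp only [add_sub_cancel] at h4
    exact (h4.trans (by simp)).trans (mul_le_mul_of_nonneg_right (le_abs_self _) zero_le_one)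
  · rw [(fieldDeriv_eqOn_of_eventuallyEq
      (localCutoff_eventuallyEq_zero hr (not_le.1 hx)) j).eq_of_nhds]
    exact FieldBound.const (V := fun x => W (q.1, x)) (S := Set.univ) (n := n) (w := fun _ => 1)
      (c := (0 : ℝ)) (by simp [mul_self_nonneg]) j hj x trivial

theorem localCutoff_neg (x ξ : E) (r : ℝ) : localCutoff x (-ξ) r = localCutoff x ξ r := by
  ext p; simp [localCutoff]

end CutoffBounds

/-! ### The contribution away from the two stationary points. -/

section NonStationary

variable {E : Type} [NormedAddCommGroup E] [InnerProductSpace ℝ E] [FiniteDimensional ℝ E]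
  {B : Set E} {ρ : E → ℝ}

namespace IsDefiningFunction

variable (hρ : IsDefiningFunction B ρ)
include hρ

theorem exists_fieldBound_divergence (hBc : IsCompact B) (n : ℕ) : ∃ C, 0 ≤ C ∧
    ∀ ξ : E, ‖ξ‖ = 1 → FieldBound (fun x => phaseField ρ (ξ, x)) B n C (fun _ => 1)
      (divergence fun x => phaseField ρ (ξ, x)) := by
  have : ProperSpace E := FiniteDimensional.proper ℝ E
  let L : (E →L[ℝ] E) →ₗ[ℝ] ℝ := LinearMap.trace ℝ E ∘ₗ ContinuousLinearMap.coeLM ℝ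
  let D : E × E → ℝ := fun q => LinearMap.toContinuousLinearMap L (fderivSnd (phaseField ρ) q)
  have hD : ContDiff ℝ ∞ D := (LinearMap.toContinuousLinearMap L).contDiff.comp
    hρ.contDiff_phaseField.fderivSnd
  obtain ⟨r, hr⟩ := hBc.isBounded.subset_closedBall (0 : E)
  obtain ⟨C, hC, h⟩ := exists_fieldBound_const (isCompact_sphere (0 : E) 1)
    hρ.contDiff_phaseField hD r n
  refine ⟨C, hC, fun ξ hξ => ?_⟩
  have e : (divergence fun x => phaseField ρ (ξ, x)) = fun x => D (ξ, x) := by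
    ext x
    rw [divergence, (hasFDerivAt_fderivSnd hρ.contDiff_phaseField ξ x).fderiv]
    rfl
  rw [e]
  exact (h ξ (by simpa using hξ)).mono_set hr

/-- The product of the complements of two cutoffs has bounded derivatives. -/
theorem exists_fieldBound_outerCutoff (hBc : IsCompact B) (n : ℕ) : ∃ C, 0 ≤ C ∧
    ∀ ξ : E, ‖ξ‖ = 1 → ∀ x₁ ∈ frontier B, ∀ x₂ ∈ frontier B, gradPerp ρ (ξ, x₁) = 0 →
      gradPerp ρ (ξ, x₂) = 0 → ∀ r : ℝ, 0 < r → r ≤ 1 →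
      FieldBound (fun x => phaseField ρ (ξ, x)) Set.univ n C (fun _ => 1)
        (fun p => (1 + -1 * localCutoff x₁ ξ r p) * (1 + -1 * localCutoff x₂ ξ r p)) := by
  have : ProperSpace E := FiniteDimensional.proper ℝ E
  let K : Set (E × E) := (Metric.sphere 0 1 ×ˢ frontier B) ∩ {q | gradPerp ρ q = 0}
  have hK : IsCompact K := ((isCompact_sphere 0 1).prod
    (hBc.of_isClosed_subset isClosed_frontier hBc.isClosed.frontier_subset)).inter_right
      (isClosed_eq hρ.contDiff_gradPerp.continuous continuous_const)
  have hW0 : ∀ q ∈ K, phaseField ρ q = 0 := by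
    rintro ⟨ξ, x⟩ ⟨⟨-, hx⟩, h⟩
    have h' : gradPerp ρ (ξ, x) = 0 := h
    simp [phaseField, phaseSpeed, h', (hρ.frontier_iff x).1 hx]
  obtain ⟨C, hC, h⟩ := exists_fieldBound_localCutoff hK hρ.contDiff_phaseField hW0 n
  refine ⟨2 ^ n * ((1 + C) * (1 + C)), by positivity,
    fun ξ hξ x₁ hx₁ x₂ hx₂ h₁ h₂ r hr hr1 => ?_⟩
  have hV : ContDiff ℝ ∞ fun x => phaseField ρ (ξ, x) :=
    hρ.contDiff_phaseField.comp (contDiff_const.prodMk contDiff_id)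
  have hb : ∀ x ∈ frontier B, gradPerp ρ (ξ, x) = 0 →
      FieldBound (fun x => phaseField ρ (ξ, x)) Set.univ n (1 + C) (fun _ => 1)
        (fun p => 1 + -1 * localCutoff x ξ r p) := by
    intro x hx hx0
    have h3 := h (ξ, x) ⟨⟨by simpa using hξ, hx⟩, hx0⟩ r hr hr1
    have := FieldBound.add hV contDiff_const (contDiff_const.mul (contDiff_localCutoff x ξ r))
      (FieldBound.const (c := (1 : ℝ)) (C := 1) (by simp))
      (FieldBound.const_mul hV (contDiff_localCutoff x ξ r) (-1) h3)
    simpa using this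
  have hs : ∀ x, ContDiff ℝ ∞ fun p => 1 + -1 * localCutoff x ξ r p := fun x =>
    contDiff_const.add (contDiff_const.mul (contDiff_localCutoff x ξ r))
  simpa using FieldBound.mul hV (hs x₁) (hs x₂) (hb x₁ hx₁ h₁) (hb x₂ hx₂ h₂)

variable [MeasurableSpace E] [BorelSpace E]

theorem volume_zero (hB : Convex ℝ B) : volume {x | ρ x = 0} = 0 := by
  have : {x | ρ x = 0} = frontier B := by ext x; exact (hρ.frontier_iff x).symm
  rw [this]
  exact hB.addHaar_frontier volume

/-- Of $N+2$ integrations by parts along the tangent field, $N$ use that the speed is at least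
$\eta$ on the support of the amplitude. The last two use that the speed dominates $|\rho|$, and
`setIntegral_inv_one_add_le` turns them into $l^{-1}$. -/
theorem exists_nonstationary_bound (hBc : IsCompact B) (hB : Convex ℝ B) (N : ℕ) :
    ∃ C, 0 ≤ C ∧ ∀ ξ : E, ‖ξ‖ = 1 → ∀ x₁ ∈ frontier B, ∀ x₂ ∈ frontier B,
      gradPerp ρ (ξ, x₁) = 0 → gradPerp ρ (ξ, x₂) = 0 → ∀ r : ℝ, 0 < r → r ≤ 1 →
      ∀ η l : ℝ, 0 < η → 0 < l →
      (∀ x ∈ B, phaseSpeed ρ (ξ, x) < η →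
        (fun p => (1 - localCutoff x₁ ξ r p) * (1 - localCutoff x₂ ξ r p)) =ᶠ[nhds x] fun _ => 0) →
      ‖∫ p in B, (((1 - localCutoff x₁ ξ r p) * (1 - localCutoff x₂ ξ r p) : ℝ) : ℂ) *
        Complex.exp (Complex.I * ((l * -⟪p, ξ⟫_ℝ : ℝ) : ℂ))‖ ≤ C * (l⁻¹ * (l * η)⁻¹ ^ N) := by
  obtain ⟨C₁, hC₁, h₁⟩ := hρ.exists_fieldBound_phaseSpeed hBc (N + 2)
  obtain ⟨C₂, hC₂, h₂⟩ := hρ.exists_fieldBound_divergence hBc (N + 2)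
  obtain ⟨C₃, hC₃, h₃⟩ := hρ.exists_fieldBound_outerCutoff hBc (N + 2)
  obtain ⟨A, hA, hosc⟩ := oscillatory_bound (N + 2) (C₁ + C₂ + C₃)
  obtain ⟨C₄, hC₄, h₄⟩ := setIntegral_inv_one_add_le volume hBc hρ.contDiff hρ.contDiff_gradient
    (fun x v => inner_gradient_left.symm) hρ.mem_iff (hρ.volume_zero hB)
    fun x hx => hρ.gradient_ne_zero x ((hρ.frontier_iff x).2 hx)
  refine ⟨A * C₄, by positivity, fun ξ hξ x₁ hx₁ x₂ hx₂ e₁ e₂ r hr hr1 η l hη hl hsupp => ?_⟩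
  have hV : ContDiff ℝ ∞ fun x => phaseField ρ (ξ, x) :=
    hρ.contDiff_phaseField.comp (contDiff_const.prodMk contDiff_id)
  have hg : ContDiff ℝ ∞ fun x => phaseSpeed ρ (ξ, x) :=
    hρ.contDiff_phaseSpeed.comp (contDiff_const.prodMk contDiff_id)
  let g : E → ℝ := fun x => phaseSpeed ρ (ξ, x)
  set b : E → ℝ := fun p => (1 - localCutoff x₁ ξ r p) * (1 - localCutoff x₂ ξ r p) with hbd
  have hbs : ContDiff ℝ ∞ b := (contDiff_const.sub (contDiff_localCutoff _ _ _)).mul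
    (contDiff_const.sub (contDiff_localCutoff _ _ _))
  let S : Set E := B ∩ {x | η ≤ phaseSpeed ρ (ξ, x)}
  have hScl : IsClosed {x | η ≤ phaseSpeed ρ (ξ, x)} := isClosed_le continuous_const hg.continuous
  have hSc : IsCompact S := hBc.inter_right hScl
  have hSm : MeasurableSet S := hSc.measurableSet
  have hSB : S ⊆ B := Set.inter_subset_left
  have hpos : ∀ x ∈ S, 0 < 1 + l * phaseSpeed ρ (ξ, x) := fun x hx => by
    have : η ≤ phaseSpeed ρ (ξ, x) := hx.2
    nlinarith
  have hcont : ContinuousOn (fun x => (1 : ℝ) * (1 + l * phaseSpeed ρ (ξ, x))⁻¹ ^ (N + 2)) S :=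
    continuousOn_const.mul (((continuousOn_const.add (continuousOn_const.mul
      hg.continuous.continuousOn)).inv₀ fun x hx => (hpos x hx).ne').pow _)
  have hbb : FieldBound (fun x => phaseField ρ (ξ, x)) S (N + 2) (C₁ + C₂ + C₃) (fun _ => 1)
      (fun x => (b x : ℂ)) := by
    have := (h₃ ξ hξ x₁ hx₁ x₂ hx₂ e₁ e₂ r hr hr1)
    simp only [neg_one_mul, ← sub_eq_add_neg] at this
    exact ((this.mono_set (Set.subset_univ S)).mono_const (by linarith) (by simp)).ofReal hV hbs
  obtain ⟨Cg, hCg⟩ := hBc.exists_bound_of_continuousOn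
    (f := fun x => gradComp ρ (ξ, x))
    (hρ.contDiff_gradComp.continuous.comp (by fun_prop)).continuousOn
  have key := hosc (volume.restrict B) (fun x => phaseField ρ (ξ, x))
    (fun x => ((divergence (fun x => phaseField ρ (ξ, x)) x : ℝ) : ℂ)) g (fun x => -⟪x, ξ⟫_ℝ) l
    (fun x => (b x : ℂ)) (fun _ => 1) S hV (Complex.ofRealCLM.contDiff.comp hV.divergence) hg
    (contDiff_id.inner ℝ contDiff_const).neg (Complex.ofRealCLM.contDiff.comp hbs) hl.le
    (by
      ext x
      have : HasFDerivAt (fun x : E => -⟪x, ξ⟫_ℝ) (-(innerSL ℝ ξ)) x := by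
        have := (innerSL ℝ ξ).hasFDerivAt (x := x)
        refine this.neg.congr_of_eventuallyEq (Filter.Eventually.of_forall fun y => ?_)
        simp [real_inner_comm]
      rw [fieldDeriv, this.fderiv]
      simp only [neg_apply, innerSL_apply_apply, g]
      rw [real_inner_comm, hρ.inner_phaseField hξ, neg_neg])
    (fun x hx => hρ.phaseSpeed_nonneg ξ (hSB hx)) (fun _ _ => zero_le_one)
    (((h₁ ξ hξ).mono_set hSB).mono_const (by linarith)
      fun x hx => hρ.phaseSpeed_nonneg ξ (hSB hx))
    ((((h₂ ξ hξ).mono_set hSB).mono_const (by linarith) (by simp)).ofReal hV hV.divergence)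
    hbb hSm
    (by
      filter_upwards [ae_restrict_mem hBc.measurableSet] with x hx hxt
      refine ⟨hx, ?_⟩
      change η ≤ phaseSpeed ρ (ξ, x)
      by_contra hlt
      have := hsupp x hx (not_le.1 hlt)
      refine (notMem_tsupport_iff_eventuallyEq.2 ?_) hxt
      filter_upwards [this] with y hy
      simp [hy])
    -- The derivative of $\rho$ along the field is a bounded multiple of $\rho$; this tangency
    -- removes the boundary term for an arbitrary smooth $f$.
    (fun f hf _ => by
      obtain ⟨Cf, hCf⟩ := hBc.exists_bound_of_continuousOn hf.continuous.continuousOn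
      refine ⟨hf.continuous.continuousOn.integrableOn_compact hBc, ?_⟩
      refine setIntegral_fieldDeriv_add_divergence volume hBc hρ.contDiff hρ.mem_iff
        (hρ.volume_zero hB) hV hf (C := Cf * Cg) fun x hx => ?_
      rw [hρ.fderiv_phaseField hξ, abs_mul, ← mul_assoc]
      have h1 := hCf x hx
      have h2 := hCg x hx
      rw [Real.norm_eq_abs] at h2
      gcongr
      exact (norm_nonneg _).trans h1)
    (by
      rw [IntegrableOn, Measure.restrict_restrict_of_subset hSB]
      exact hcont.integrableOn_compact hSc)
  refine key.trans ?_
  rw [mul_assoc]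
  refine mul_le_mul_of_nonneg_left ?_ hA
  rw [Measure.restrict_restrict_of_subset hSB]
  have hpos' : ∀ x, 0 < 1 + l * |ρ x| := fun x => by positivity
  have hc2 : ContinuousOn (fun x => (l * η)⁻¹ ^ N * (1 + l * |ρ x|)⁻¹ ^ 2) B :=
    continuousOn_const.mul (((continuousOn_const.add (continuousOn_const.mul
      hρ.contDiff.continuous.abs.continuousOn)).inv₀ fun x _ => (hpos' x).ne').pow _)
  calc ∫ x in S, (1 : ℝ) * (1 + l * g x)⁻¹ ^ (N + 2)
      ≤ ∫ x in S, (l * η)⁻¹ ^ N * (1 + l * |ρ x|)⁻¹ ^ 2 := by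
        refine setIntegral_mono_on (hcont.integrableOn_compact hSc)
          ((hc2.mono hSB).integrableOn_compact hSc) hSm fun x hx => ?_
        have h1 : η ≤ phaseSpeed ρ (ξ, x) := hx.2
        have h2 := (hρ.mem_iff x).1 (hSB hx)
        have h3 : |ρ x| ≤ phaseSpeed ρ (ξ, x) := by
          rw [abs_of_nonpos h2, phaseSpeed]
          have : 0 ≤ ‖gradPerp ρ (ξ, x)‖ ^ 2 := by positivity
          simp only
          linarith
        have h4 := hpos x hx
        rw [one_mul, pow_add]
        gcongr
        · change l * η ≤ 1 + l * phaseSpeed ρ (ξ, x)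
          nlinarith
    _ ≤ ∫ x in B, (l * η)⁻¹ ^ N * (1 + l * |ρ x|)⁻¹ ^ 2 :=
        setIntegral_mono_set (hc2.integrableOn_compact hBc)
          (Filter.Eventually.of_forall fun x => by
            change 0 ≤ (l * η)⁻¹ ^ N * (1 + l * |ρ x|)⁻¹ ^ 2
            positivity)
          (Filter.Eventually.of_forall hSB)
    _ ≤ _ := by
        rw [integral_const_mul]
        calc _ ≤ (l * η)⁻¹ ^ N * (C₄ * l⁻¹) := by gcongr; exact h₄ l hl
          _ = _ := by ring

end IsDefiningFunction

end NonStationary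

/-! ### Near-stationary points lie close to the base points. -/

section Cylinder

variable {E : Type} [NormedAddCommGroup E] [InnerProductSpace ℝ E] [FiniteDimensional ℝ E]
  {F : Type} [NormedAddCommGroup F] [InnerProductSpace ℝ F] [FiniteDimensional ℝ F]
  {B : Set E} {ρ : E → ℝ} {x ν : E} {r₀ C : ℝ} {m : ℕ} {R : F →ₗᵢ[ℝ] E} {φ : F → ℝ} {S : F →L[ℝ] F}

namespace IsBoundaryChart

theorem quadratic_lower_bound (h : IsBoundaryChart B x ν r₀ C m R φ S) {δ r : ℝ}
    (hS : ∀ z, δ * ‖z‖ ^ 2 ≤ ⟪S z, z⟫_ℝ) (hr : r ≤ r₀) (hCr : C * r ≤ δ / 4) (hC : 0 ≤ C)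
    {z : F} (hz : ‖z‖ ≤ r) : δ / 4 * ‖z‖ ^ 2 ≤ φ z := by
  have h1 := h.remainder.base z (by simpa using hz.trans hr)
  rw [Real.norm_eq_abs] at h1
  have h2 := neg_le_of_abs_le h1
  have h3 := hS z
  have h4 : C * ‖z‖ ≤ δ / 4 := (mul_le_mul_of_nonneg_left hz hC).trans hCr
  have h5 : C * ‖z‖ ^ 3 ≤ δ / 4 * ‖z‖ ^ 2 := by
    calc C * ‖z‖ ^ 3 = C * ‖z‖ * ‖z‖ ^ 2 := by ring
      _ ≤ _ := by gcongr
  nlinarith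

/-- Away from its base point a convex body with a strictly convex chart lies inside a cone. -/
theorem cone_bound (h : IsBoundaryChart B x ν r₀ C m R φ S) (hB : Convex ℝ B) (hx : x ∈ B)
    {δ r : ℝ} (hS : ∀ z, δ * ‖z‖ ^ 2 ≤ ⟪S z, z⟫_ℝ) (hr0 : 0 < r) (hr : r ≤ r₀)
    (hCr : C * r ≤ δ / 4) (hC : 0 ≤ C) (hδr : δ / 4 * r ^ 2 ≤ r₀) {z : F} {u : ℝ} (hu : 0 ≤ u)
    (hp : x + R z - u • ν ∈ B) (hz : r ≤ ‖z‖) : δ / 4 * r * ‖z‖ ≤ u := by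
  have hz0 : 0 < ‖z‖ := hr0.trans_le hz
  -- The point is contracted towards $x$ until its tangential distance is $r$. It stays in $B$ by
  -- convexity, and there the chart forces its depth to be at least $\frac\delta4r^2$; scaling back
  -- gives the cone.
  set t := r / ‖z‖ with ht
  have ht0 : 0 < t := by positivity
  have ht1 : t ≤ 1 := (div_le_one hz0).2 hz
  have htz : t * ‖z‖ = r := div_mul_cancel₀ _ hz0.ne'
  have hnz : ‖t • z‖ = r := by rw [norm_smul, Real.norm_of_nonneg ht0.le, htz]
  have hq : x + R (t • z) - (t * u) • ν ∈ B := by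
    have := hB.add_smul_sub_mem hx hp ⟨ht0.le, ht1⟩
    convert this using 1
    rw [map_smul, mul_smul]
    module
  have h2 : δ / 4 * r ^ 2 ≤ t * u := by
    rcases le_or_gt (t * u) r₀ with hle | hgt
    · have h3 := (h.mem_iff (t • z) (by rw [hnz]; exact hr) (t * u)
        (by rw [abs_of_nonneg (by positivity)]; exact hle)).1 hq
      have h4 := h.quadratic_lower_bound hS hr hCr hC (z := t • z) hnz.le
      rw [hnz] at h4
      exact h4.trans h3
    · exact hδr.trans hgt.le
  have h3 : t * (δ / 4 * r * ‖z‖) ≤ t * u := by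
    calc t * (δ / 4 * r * ‖z‖) = δ / 4 * r * (t * ‖z‖) := by ring
      _ = δ / 4 * r ^ 2 := by rw [htz]; ring
      _ ≤ _ := h2
  exact le_of_mul_le_mul_left h3 ht0

/-- Points of the body where some supporting direction is close to `ν` are close to the base point. -/
theorem mem_cylinder (h : IsBoundaryChart B x ν r₀ C m R φ S) (hB : Convex ℝ B) (hx : x ∈ B)
    (hν : ‖ν‖ = 1) (hνB : ∀ y ∈ B, ⟪ν, y - x⟫_ℝ ≤ 0) (hR : ∀ z, ⟪ν, R z⟫_ℝ = 0)
    (hRs : ∀ p, ⟪ν, p⟫_ℝ = 0 → ∃ z, R z = p)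
    {δ r κ : ℝ} (hS : ∀ z, δ * ‖z‖ ^ 2 ≤ ⟪S z, z⟫_ℝ) (hr0 : 0 < r) (hr : r ≤ r₀)
    (hCr : C * r ≤ δ / 4) (hC : 0 ≤ C) (hδr : δ / 4 * r ^ 2 ≤ r₀)
    {p ν' : E} (hp : p ∈ B) (hν' : ‖ν'‖ = 1) (hp' : 0 ≤ ⟪ν', p - x⟫_ℝ) (hκ : ‖ν' - ν‖ ≤ κ)
    (hκ1 : κ < 1 / 2) (hκr : 8 * κ < δ * r) :
    |⟪p - x, ν⟫_ℝ| < r ∧ ‖p - x‖ ^ 2 - ⟪p - x, ν⟫_ℝ ^ 2 < r ^ 2 := by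
  have hκ0 : 0 ≤ κ := (norm_nonneg _).trans hκ
  set u := -⟪ν, p - x⟫_ℝ with hu
  have hu0 : 0 ≤ u := by linarith [hνB p hp]
  obtain ⟨z, hz⟩ := hRs (p - x + u • ν) (by
    rw [inner_add_right, real_inner_smul_right, real_inner_self_eq_norm_sq, hν, hu]; ring)
  have hpe : p = x + R z - u • ν := by rw [hz]; abel
  have hpx : p - x = R z - u • ν := by rw [hz]; abel
  have hin : ⟪p - x, ν⟫_ℝ = -u := by rw [real_inner_comm, hu, neg_neg]
  have hnorm : ‖p - x‖ ^ 2 - ⟪p - x, ν⟫_ℝ ^ 2 = ‖z‖ ^ 2 := by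
    rw [hin, hpx, norm_sub_sq_real, real_inner_smul_right, real_inner_comm, hR, R.norm_map,
      norm_smul, hν, mul_one, Real.norm_eq_abs, sq_abs]
    ring
  have h1 : 1 / 2 ≤ ⟪ν', ν⟫_ℝ := by
    have := norm_sub_sq_real ν' ν
    rw [hν, hν'] at this
    have h2 : ‖ν' - ν‖ ^ 2 ≤ (1 / 2) ^ 2 := by
      gcongr
      linarith
    linarith
  have h2 : ⟪ν', R z⟫_ℝ ≤ κ * ‖z‖ := by
    have : ⟪ν', R z⟫_ℝ = ⟪ν' - ν, R z⟫_ℝ := by rw [inner_sub_left, hR, sub_zero]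
    rw [this]
    refine (real_inner_le_norm _ _).trans ?_
    rw [R.norm_map]
    gcongr
  -- The supporting direction $\nu'$ bounds the depth from above by $2\kappa|z|$, since
  -- $\langle\nu',\nu\rangle\ge\frac12$. Beyond tangential distance $r$ the cone bounds it from
  -- below by $\frac\delta4r|z|$, which is incompatible with $8\kappa<\delta r$.
  have h3 : u ≤ 2 * κ * ‖z‖ := by
    rw [hpx, inner_sub_right, real_inner_smul_right] at hp'
    nlinarith
  have hzr : ‖z‖ < r := by
    by_contra hcon
    have hcon := not_lt.1 hcon
    have hz0 : 0 < ‖z‖ := hr0.trans_le hcon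
    have h4 := h.cone_bound hB hx hS hr0 hr hCr hC hδr hu0 (hpe ▸ hp) hcon
    have h5 : (δ / 4 * r) * ‖z‖ ≤ (2 * κ) * ‖z‖ := by linarith
    have h6 := le_of_mul_le_mul_right h5 hz0
    linarith
  refine ⟨?_, ?_⟩
  · rw [hin, abs_neg, abs_of_nonneg hu0]
    nlinarith [norm_nonneg z]
  · rw [hnorm]
    gcongr

end IsBoundaryChart

theorem localCutoff_eventuallyEq_one {x ξ p : E} {r : ℝ} (hξ : ‖ξ‖ = 1)
    (h1 : |⟪p - x, ξ⟫_ℝ| < r / 2) (h2 : ‖p - x‖ ^ 2 - ⟪p - x, ξ⟫_ℝ ^ 2 < (r / 2) ^ 2) :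
    localCutoff x ξ r =ᶠ[nhds p] fun _ => 1 := by
  have hr : 0 < r := by linarith [abs_nonneg ⟪p - x, ξ⟫_ℝ]
  have c1 : Continuous fun p : E => p - x := continuous_id.sub continuous_const
  have c2 : Continuous fun p : E => ⟪p - x, ξ⟫_ℝ := c1.inner continuous_const
  have ho1 : IsOpen {p : E | |⟪p - x, ξ⟫_ℝ| < r / 2} := isOpen_lt c2.abs continuous_const
  have ho2 : IsOpen {p : E | ‖p - x‖ ^ 2 - ⟪p - x, ξ⟫_ℝ ^ 2 < (r / 2) ^ 2} :=
    isOpen_lt ((c1.norm.pow 2).sub (c2.pow 2)) continuous_const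
  filter_upwards [ho1.mem_nhds h1, ho2.mem_nhds h2] with q hq1 hq2
  have hq1 : |⟪q - x, ξ⟫_ℝ| < r / 2 := hq1
  have hq2 : ‖q - x‖ ^ 2 - ⟪q - x, ξ⟫_ℝ ^ 2 < (r / 2) ^ 2 := hq2
  have hr2 : 0 < r ^ 2 := by positivity
  have h3 : ⟪q - x, ξ⟫_ℝ ^ 2 < (r / 2) ^ 2 := by
    rw [← sq_abs]; gcongr
  have h4 : 0 ≤ ‖q - x‖ ^ 2 - ⟪q - x, ξ⟫_ℝ ^ 2 := by
    have := abs_real_inner_le_norm (q - x) ξ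
    rw [hξ, mul_one] at this
    rw [← sq_abs ⟪q - x, ξ⟫_ℝ]
    have : |⟪q - x, ξ⟫_ℝ| ^ 2 ≤ ‖q - x‖ ^ 2 := by gcongr
    linarith
  have key : ∀ s, 0 ≤ s → s < (r / 2) ^ 2 → cutoff ((r ^ 2)⁻¹ * s) = 1 := fun s hs hs' => by
    apply cutoff_eq_one
    rw [abs_of_nonneg (by positivity), ← div_eq_inv_mul, div_le_iff₀ hr2]
    nlinarith
  rw [localCutoff, key _ h4 hq2, key _ (by positivity) h3, one_mul]

namespace IsDefiningFunction

variable (hρ : IsDefiningFunction B ρ)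
include hρ

/-- The normalization `infDist_le` of the defining function is made for this: a small value of
$-\rho$ yields a boundary point at comparable distance. -/
theorem exists_frontier_dist_le (hBc : IsCompact B) (hne : (frontier B).Nonempty) {x : E}
    (hx : x ∈ B) : ∃ x' ∈ frontier B, ‖x - x'‖ ≤ -ρ x := by
  obtain ⟨x', hx', h⟩ := (hBc.of_isClosed_subset isClosed_frontier
    hρ.frontier_subset).exists_infDist_eq_dist hne x
  refine ⟨x', hx', ?_⟩
  rw [← dist_eq_norm, ← h]
  exact hρ.infDist_le x hx

theorem exists_lipschitz_gradient (hBc : IsCompact B) (hB : Convex ℝ B) : ∃ L, 0 ≤ L ∧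
    ∀ x ∈ B, ∀ y ∈ B, ‖gradient ρ x - gradient ρ y‖ ≤ L * ‖x - y‖ := by
  obtain ⟨L, hL⟩ := hBc.exists_bound_of_continuousOn
    (hρ.contDiff_gradient.continuous_fderiv (by simp)).continuousOn
  refine ⟨|L|, abs_nonneg _, fun x hx y hy => ?_⟩
  exact hB.norm_image_sub_le_of_norm_fderiv_le
    (fun z _ => hρ.contDiff_gradient.differentiable (by simp) z)
    (fun z hz => (hL z hz).trans (le_abs_self _)) hy hx

theorem exists_norm_gradient_ge (hBc : IsCompact B) : ∃ g, 0 < g ∧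
    ∀ x ∈ frontier B, g ≤ ‖gradient ρ x‖ := by
  rcases (frontier B).eq_empty_or_nonempty with h | h
  · exact ⟨1, one_pos, by simp [h]⟩
  · obtain ⟨x, hx, hm⟩ := (hBc.of_isClosed_subset isClosed_frontier
      hρ.frontier_subset).exists_isMinOn h hρ.contDiff_gradient.continuous.norm.continuousOn
    exact ⟨_, hρ.norm_gradient_pos hx, fun y hy => hm hy⟩

/-- Where the phase is nearly stationary, the normal at a nearby boundary point is nearly parallel
to the given direction. -/
theorem exists_norm_unitNormal_sub_le (hBc : IsCompact B) (hB : Convex ℝ B) : ∃ M, 0 < M ∧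
    ∀ ξ : E, ‖ξ‖ = 1 → ∀ η : ℝ, η ≤ 1 → (frontier B).Nonempty → ∀ x ∈ B,
      phaseSpeed ρ (ξ, x) < η → ∃ x' ∈ frontier B, ‖x - x'‖ < η ∧
        (‖unitNormal ρ x' - ξ‖ ≤ M * √η ∨ ‖unitNormal ρ x' - -ξ‖ ≤ M * √η) := by
  obtain ⟨L, hL, hLip⟩ := hρ.exists_lipschitz_gradient hBc hB
  obtain ⟨g, hg, hgr⟩ := hρ.exists_norm_gradient_ge hBc
  refine ⟨2 * ((1 + L) / g), by positivity, fun ξ hξ η hη1 hne x hx hs => ?_⟩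
  have hρx := (hρ.mem_iff x).1 hx
  have hη0 : 0 < η := (hρ.phaseSpeed_nonneg ξ hx).trans_lt hs
  have hs' : ‖gradPerp ρ (ξ, x)‖ ^ 2 - ρ x < η := hs
  obtain ⟨x', hx', hd⟩ := hρ.exists_frontier_dist_le hBc hne hx
  have hdη : ‖x - x'‖ < η := by nlinarith [sq_nonneg ‖gradPerp ρ (ξ, x)‖]
  refine ⟨x', hx', hdη, ?_⟩
  have h1 : ‖gradPerp ρ (ξ, x)‖ ≤ √η := Real.le_sqrt_of_sq_le (by linarith)
  have hsq : η ≤ √η := by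
    have := Real.sq_sqrt hη0.le
    have h2 : √η ≤ 1 := by exact Real.sqrt_le_one.2 hη1
    nlinarith [Real.sqrt_nonneg η]
  have h2 : ‖gradPerp ρ (ξ, x') - gradPerp ρ (ξ, x)‖ ≤ L * η := by
    have e : gradPerp ρ (ξ, x') - gradPerp ρ (ξ, x) = (gradient ρ x' - gradient ρ x) -
        ⟪gradient ρ x' - gradient ρ x, ξ⟫_ℝ • ξ := by
      simp only [gradPerp, gradComp, inner_sub_left, sub_smul]; abel
    have h3 : ∀ v : E, ‖v - ⟪v, ξ⟫_ℝ • ξ‖ ≤ ‖v‖ := fun v => by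
      rw [← sq_le_sq₀ (norm_nonneg _) (norm_nonneg _), norm_sub_sq_real, real_inner_smul_right,
        norm_smul, hξ, mul_one, Real.norm_eq_abs, sq_abs]
      nlinarith [sq_nonneg ⟪v, ξ⟫_ℝ]
    rw [e]
    refine (h3 _).trans ((hLip x' (hρ.frontier_subset hx') x hx).trans ?_)
    rw [norm_sub_rev]
    gcongr
  have h3 : ‖gradPerp ρ (ξ, x')‖ ≤ (1 + L) * √η := by
    have := norm_add_le (gradPerp ρ (ξ, x)) (gradPerp ρ (ξ, x') - gradPerp ρ (ξ, x))
    rw [add_sub_cancel] at this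
    nlinarith
  have hgx := hgr x' hx'
  set n := unitNormal ρ x' with hn
  have hn1 : ‖n‖ = 1 := hρ.norm_unitNormal hx'
  set a := ⟪n, ξ⟫_ℝ with ha
  have hw : ‖n - a • ξ‖ ≤ (1 + L) / g * √η := by
    have e : gradPerp ρ (ξ, x') = ‖gradient ρ x'‖ • (n - a • ξ) := by
      have h5 := hρ.gradient_eq_smul_unitNormal hx'
      have h6 : gradComp ρ (ξ, x') = ‖gradient ρ x'‖ * a := by
        simp only [gradComp]
        nth_rewrite 1 [h5]
        rw [real_inner_smul_left]
      rw [gradPerp, h6, smul_sub, smul_smul]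
      congr 1
    rw [e, norm_smul, norm_norm] at h3
    rw [div_mul_eq_mul_div, le_div_iff₀ hg]
    nlinarith [norm_nonneg (n - a • ξ)]
  have hwsq : ‖n - a • ξ‖ ^ 2 = 1 - a ^ 2 := by
    rw [norm_sub_sq_real, real_inner_smul_right, norm_smul, hξ, mul_one, Real.norm_eq_abs, sq_abs,
      hn1]
    ring
  have ha1 : a ^ 2 ≤ 1 := by nlinarith [sq_nonneg ‖n - a • ξ‖]
  -- The tangential part $n-a\xi$ has square norm $1-a^2$, and $\|n\mp\xi\|^2=2(1-|a|)\le2(1-a^2)$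
  -- with the sign chosen according to that of $a$.
  have hfin : ∀ v : E, ‖n - v‖ ^ 2 ≤ 2 * (1 - a ^ 2) → ‖n - v‖ ≤ 2 * ((1 + L) / g) * √η := by
    intro v hv
    have : ‖n - v‖ ≤ 2 * ‖n - a • ξ‖ := by
      rw [← sq_le_sq₀ (norm_nonneg _) (by positivity), mul_pow, hwsq]
      linarith
    rw [mul_assoc]
    linarith
  rcases le_total 0 a with h0 | h0
  · left
    apply hfin
    rw [norm_sub_sq_real, hn1, hξ, ← ha]
    nlinarith
  · right
    apply hfin
    rw [norm_sub_sq_real, inner_neg_right, norm_neg, hn1, hξ, ← ha]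
    nlinarith

end IsDefiningFunction

end Cylinder

/-! ### Where the cutoffs equal one, and their disjointness. -/

section CutoffRegion

variable {E : Type} [NormedAddCommGroup E] [InnerProductSpace ℝ E] [FiniteDimensional ℝ E]
  {F : Type} [NormedAddCommGroup F] [InnerProductSpace ℝ F] [FiniteDimensional ℝ F]
  {B : Set E} {ρ : E → ℝ} {x ν : E} {r₀ C : ℝ} {m : ℕ} {R : F →ₗᵢ[ℝ] E} {φ : F → ℝ} {S : F →L[ℝ] F}

theorem norm_sq_sub_inner_sq {ν : E} (hν : ‖ν‖ = 1) (v : E) :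
    ‖v‖ ^ 2 - ⟪v, ν⟫_ℝ ^ 2 = ‖v - ⟪v, ν⟫_ℝ • ν‖ ^ 2 := by
  rw [norm_sub_sq_real, real_inner_smul_right, norm_smul, hν, mul_one, Real.norm_eq_abs, sq_abs]
  ring

/-- By `mem_cylinder` at scale $r/4$, the boundary point $p'$ lies in the cylinder of size $r/4$;
its own supporting hyperplane provides the required inequality. As $p$ is within $r/4$ of $p'$, it
lies in the cylinder of size $r/2$, where the cutoff is $1$. -/
theorem IsDefiningFunction.localCutoff_eventuallyEq_one (hρ : IsDefiningFunction B ρ)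
    (hB : Convex ℝ B) (hx : x ∈ frontier B) (hν : unitNormal ρ x = ν)
    (h : IsBoundaryChart B x ν r₀ C m R φ S) (hR : ∀ z, ⟪ν, R z⟫_ℝ = 0)
    (hRs : ∀ p, ⟪ν, p⟫_ℝ = 0 → ∃ z, R z = p)
    {δ r κ : ℝ} (hS : ∀ z, δ * ‖z‖ ^ 2 ≤ ⟪S z, z⟫_ℝ) (hr0 : 0 < r) (hr : r ≤ r₀)
    (hCr : C * r ≤ δ) (hC : 0 ≤ C) (hδr : δ * r ^ 2 ≤ r₀)
    {p p' : E} (hp' : p' ∈ frontier B) (hpp : ‖p - p'‖ < r / 4)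
    (hκ : ‖unitNormal ρ p' - ν‖ ≤ κ) (hκ1 : κ < 1 / 2) (hκr : 8 * κ < δ * (r / 4)) :
    localCutoff x ν r =ᶠ[nhds p] fun _ => 1 := by
  have hν1 : ‖ν‖ = 1 := hν ▸ hρ.norm_unitNormal hx
  obtain ⟨h1, h2⟩ := h.mem_cylinder hB (hρ.frontier_subset hx) hν1
    (fun y hy => hν ▸ hρ.inner_unitNormal_sub_nonpos hB hx hy) hR hRs hS
    (r := r / 4) (by linarith) (by linarith) (by linarith) hC
    (by
      have : 0 ≤ δ := (mul_nonneg hC hr0.le).trans hCr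
      nlinarith [mul_nonneg this (sq_nonneg r)])
    (hρ.frontier_subset hp') (hρ.norm_unitNormal hp')
    (by
      have := hρ.inner_unitNormal_sub_nonpos hB hp' (hρ.frontier_subset hx)
      rw [← neg_sub, inner_neg_right] at this
      linarith) hκ hκ1 hκr
  have e : p - x = (p - p') + (p' - x) := by abel
  refine _root_.localCutoff_eventuallyEq_one hν1 ?_ ?_
  · rw [e, inner_add_left]
    have h3 := abs_real_inner_le_norm (p - p') ν
    rw [hν1, mul_one] at h3
    linarith [abs_add_le ⟪p - p', ν⟫_ℝ ⟪p' - x, ν⟫_ℝ]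
  · rw [norm_sq_sub_inner_sq hν1] at h2 ⊢
    have h3 : ‖p' - x - ⟪p' - x, ν⟫_ℝ • ν‖ < r / 4 := lt_of_pow_lt_pow_left₀ 2 (by linarith) h2
    have h4 : ‖p - p' - ⟪p - p', ν⟫_ℝ • ν‖ ≤ ‖p - p'‖ := by
      rw [← sq_le_sq₀ (norm_nonneg _) (norm_nonneg _), ← norm_sq_sub_inner_sq hν1]
      nlinarith [sq_nonneg ⟪p - p', ν⟫_ℝ]
    have e2 : p - x - ⟪p - x, ν⟫_ℝ • ν = (p - p' - ⟪p - p', ν⟫_ℝ • ν) +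
        (p' - x - ⟪p' - x, ν⟫_ℝ • ν) := by
      rw [e, inner_add_left, add_smul]; abel
    rw [e2]
    gcongr
    refine (norm_add_le _ _).trans_lt ?_
    linarith

/-- A ball of radius $s$ inside $B$ keeps the supporting hyperplanes with normals $\xi$ and $-\xi$
at distance at least $2s$, so the slabs of half-width $r\le s$ around them do not overlap. -/
theorem IsDefiningFunction.localCutoff_mul_localCutoff (hρ : IsDefiningFunction B ρ)
    (hB : Convex ℝ B) {x₁ x₂ ξ : E} (hx₁ : x₁ ∈ frontier B) (hx₂ : x₂ ∈ frontier B)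
    (h₁ : unitNormal ρ x₁ = ξ) (h₂ : unitNormal ρ x₂ = -ξ) {y : E} {s r : ℝ} (hr0 : 0 < r)
    (hr : r ≤ s) (hs : Metric.closedBall y s ⊆ B) (p : E) :
    localCutoff x₁ ξ r p * localCutoff x₂ ξ r p = 0 := by
  have hξ : ‖ξ‖ = 1 := h₁ ▸ hρ.norm_unitNormal hx₁
  have hs0 : 0 < s := hr0.trans_le hr
  have hcut : ∀ z : E, r ≤ |⟪p - z, ξ⟫_ℝ| → localCutoff z ξ r p = 0 := fun z hz => by
    rw [localCutoff, cutoff_eq_zero (s := (r ^ 2)⁻¹ * ⟪p - z, ξ⟫_ℝ ^ 2), mul_zero]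
    rw [abs_of_nonneg (by positivity), ← div_eq_inv_mul, le_div_iff₀ (by positivity), one_mul,
      ← sq_abs ⟪p - z, ξ⟫_ℝ]
    gcongr
  have m1 : y + s • ξ ∈ B := hs (by simp [norm_smul, hξ, abs_of_pos hs0])
  have m2 : y - s • ξ ∈ B := hs (by simp [norm_smul, hξ, abs_of_pos hs0])
  have k1 := hρ.inner_unitNormal_sub_nonpos hB hx₁ m1
  have k2 := hρ.inner_unitNormal_sub_nonpos hB hx₂ m2
  rw [h₁, inner_sub_right, inner_add_right, real_inner_smul_right, real_inner_self_eq_norm_sq,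
    hξ] at k1
  rw [h₂, inner_neg_left, inner_sub_right, inner_sub_right, real_inner_smul_right,
    real_inner_self_eq_norm_sq, hξ] at k2
  by_cases hc : r ≤ |⟪p - x₁, ξ⟫_ℝ|
  · rw [hcut _ hc, zero_mul]
  · rw [hcut x₂, mul_zero]
    have hc := abs_lt.1 (not_le.1 hc)
    refine le_trans ?_ (le_abs_self _)
    rw [inner_sub_left, real_inner_comm, real_inner_comm ξ x₂]
    rw [inner_sub_left, real_inner_comm, real_inner_comm ξ x₁] at hc
    linarith [hc.1]

end CutoffRegion

/-! ### Choice of scales and assembly of the estimate over the body. -/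

section MainEstimate

/-- Stationary phase gives $D^{-3}K^{-1/2}\le D^{-7/2}$. Because $D\le C$ and $n\ge1$, this is
dominated by $D^{-(n+6)/2}$, with loss $C^{(n-1)/2}$; likewise $(\Lambda D)^{-N}$ is dominated by
$(\Lambda D^4)^{-N}$. -/
theorem local_error_le {n : ℕ} (hn : 1 ≤ n) (N : ℕ) {c C D K Λ : ℝ} (hc : 0 < c) (hC : 1 ≤ C)
    (hD : 0 < D) (hDK : D ≤ K) (hDC : D ≤ C) (hΛ : 0 < Λ) :
    Λ⁻¹ * (((c * D) ^ 3)⁻¹ * ((√K)⁻¹ * Λ ^ (-(1 + (n : ℝ) / 2)))) + Λ⁻¹ * ((Λ * (c * D)) ^ N)⁻¹ ≤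
      ((c ^ 3)⁻¹ * C ^ (((n : ℝ) - 1) / 2) + (C ^ 3 / c) ^ N) *
        (Λ ^ (-(2 + (n : ℝ) / 2)) * D ^ (-((n : ℝ) + 6) / 2) + Λ⁻¹ * ((Λ * D ^ 4)⁻¹) ^ N) := by
  have hC0 : 0 < C := by linarith
  set P := Λ ^ (-(2 + (n : ℝ) / 2)) * D ^ (-((n : ℝ) + 6) / 2) with hP
  set Q := Λ⁻¹ * ((Λ * D ^ 4)⁻¹) ^ N with hQ
  have hP0 : 0 ≤ P := by positivity
  have hQ0 : 0 ≤ Q := by positivity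
  have h1 : Λ⁻¹ * (((c * D) ^ 3)⁻¹ * ((√K)⁻¹ * Λ ^ (-(1 + (n : ℝ) / 2)))) ≤
      (c ^ 3)⁻¹ * C ^ (((n : ℝ) - 1) / 2) * P := by
    have e1 : Λ⁻¹ * Λ ^ (-(1 + (n : ℝ) / 2)) = Λ ^ (-(2 + (n : ℝ) / 2)) := by
      rw [← Real.rpow_neg_one, ← Real.rpow_add hΛ]; congr 1; ring
    have e2 : (D ^ 3)⁻¹ * (√D)⁻¹ = D ^ (((n : ℝ) - 1) / 2) * D ^ (-((n : ℝ) + 6) / 2) := by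
      rw [← Real.rpow_add hD, Real.sqrt_eq_rpow, ← Real.rpow_neg hD.le, ← Real.rpow_natCast,
        ← Real.rpow_neg hD.le, ← Real.rpow_add hD]
      congr 1; push_cast; ring
    have h2 : (√K)⁻¹ ≤ (√D)⁻¹ := by
      have : 0 < √D := Real.sqrt_pos.2 hD
      gcongr
    have h3 : D ^ (((n : ℝ) - 1) / 2) ≤ C ^ (((n : ℝ) - 1) / 2) := by
      refine Real.rpow_le_rpow hD.le hDC ?_
      have : (1 : ℝ) ≤ n := by exact_mod_cast hn
      linarith
    calc _ = (Λ⁻¹ * Λ ^ (-(1 + (n : ℝ) / 2))) * ((c ^ 3)⁻¹ * ((D ^ 3)⁻¹ * (√K)⁻¹)) := by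
          rw [mul_pow, mul_inv]; ring
      _ ≤ (Λ⁻¹ * Λ ^ (-(1 + (n : ℝ) / 2))) * ((c ^ 3)⁻¹ * ((D ^ 3)⁻¹ * (√D)⁻¹)) := by gcongr
      _ = (c ^ 3)⁻¹ * D ^ (((n : ℝ) - 1) / 2) * P := by rw [e1, e2, hP]; ring
      _ ≤ _ := by gcongr
  have h2 : Λ⁻¹ * ((Λ * (c * D)) ^ N)⁻¹ ≤ (C ^ 3 / c) ^ N * Q := by
    have e : ((Λ * (c * D)) ^ N)⁻¹ = (D ^ 3 / c) ^ N * ((Λ * D ^ 4)⁻¹) ^ N := by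
      rw [← mul_pow, ← inv_pow]; congr 1; field_simp
    rw [e, hQ]
    calc _ = (D ^ 3 / c) ^ N * (Λ⁻¹ * ((Λ * D ^ 4)⁻¹) ^ N) := by ring
      _ ≤ _ := by gcongr
  have h3 : 0 ≤ (c ^ 3)⁻¹ * C ^ (((n : ℝ) - 1) / 2) := by positivity
  have h4 : 0 ≤ (C ^ 3 / c) ^ N := by positivity
  nlinarith [mul_nonneg h3 hQ0, mul_nonneg h4 hP0]

/-- The radius is $r=c_1\delta$, so that the cubic remainder is dominated by the Hessian. The
threshold is $\eta=(\sigma\delta^2)^2$, so that the normal deviation $M\sqrt\eta$ is small against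
$\delta r$. This fourth power of $\delta$ is the origin of $\delta^{-4N}$. -/
theorem exists_scales {C r₀ s M : ℝ} (hC : 1 ≤ C) (hr₀ : 0 < r₀) (hs : 0 < s) (hM : 0 < M) :
    ∃ c₁ σ : ℝ, 0 < c₁ ∧ 0 < σ ∧ ∀ δ, 0 < δ → δ ≤ C → c₁ * δ ≤ 1 ∧ C * (c₁ * δ) ≤ 1 / 4 ∧
      c₁ * δ ≤ r₀ ∧ c₁ * δ ≤ s ∧ C * (c₁ * δ) ≤ δ / 2 ∧ δ * (c₁ * δ) ^ 2 ≤ r₀ ∧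
      (σ * δ ^ 2) ^ 2 ≤ 1 ∧ (σ * δ ^ 2) ^ 2 ≤ c₁ * δ / 4 ∧ M * √((σ * δ ^ 2) ^ 2) < 1 / 2 ∧
      8 * (M * √((σ * δ ^ 2) ^ 2)) < δ * (c₁ * δ / 4) := by
  have hC0 : 0 < C := by linarith
  obtain ⟨c₁, hc₁, hc₁a, hc₁b, hc₁c⟩ : ∃ c₁ : ℝ, 0 < c₁ ∧ c₁ * (4 * C ^ 2) ≤ 1 ∧ c₁ * C ≤ r₀ ∧
      c₁ * C ≤ s := by
    refine ⟨min (1 / (4 * C ^ 2)) (min (r₀ / C) (s / C)), by positivity, ?_, ?_, ?_⟩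
    · rw [← le_div_iff₀ (by positivity)]; exact min_le_left _ _
    · rw [← le_div_iff₀ hC0]; exact (min_le_right _ _).trans (min_le_left _ _)
    · rw [← le_div_iff₀ hC0]; exact (min_le_right _ _).trans (min_le_right _ _)
  obtain ⟨σ, hσ, hσa, hσb, hσc, hσe⟩ : ∃ σ : ℝ, 0 < σ ∧ σ * C ^ 2 ≤ 1 ∧ σ * (4 * C) ≤ c₁ ∧
      σ * (4 * M * C ^ 2) ≤ 1 ∧ σ * (64 * M) ≤ c₁ := by
    refine ⟨min (1 / C ^ 2) (min (c₁ / (4 * C)) (min (1 / (4 * M * C ^ 2)) (c₁ / (64 * M)))),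
      by positivity, ?_, ?_, ?_, ?_⟩
    · rw [← le_div_iff₀ (by positivity)]; exact min_le_left _ _
    · rw [← le_div_iff₀ (by positivity)]; exact (min_le_right _ _).trans (min_le_left _ _)
    · rw [← le_div_iff₀ (by positivity)]
      exact (min_le_right _ _).trans ((min_le_right _ _).trans (min_le_left _ _))
    · rw [← le_div_iff₀ (by positivity)]
      exact (min_le_right _ _).trans ((min_le_right _ _).trans (min_le_right _ _))
  refine ⟨c₁, σ, hc₁, hσ, fun δ hδ hδC => ?_⟩
  set r := c₁ * δ with hrd
  have hr : 0 < r := by positivity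
  have hrC : r ≤ c₁ * C := by rw [hrd]; gcongr
  have hr4 : C * r ≤ 1 / 4 := by nlinarith
  have hr1 : r ≤ 1 := by nlinarith
  have hc₁C : C * c₁ ≤ 1 / 4 := by nlinarith
  have hδ2 : δ ^ 2 ≤ C ^ 2 := by gcongr
  have hσ1 : σ * δ ^ 2 ≤ 1 := by
    have : σ * δ ^ 2 ≤ σ * C ^ 2 := by gcongr
    linarith
  have hsq : √((σ * δ ^ 2) ^ 2) = σ * δ ^ 2 := Real.sqrt_sq (by positivity)
  rw [hsq]
  refine ⟨hr1, hr4, by linarith, by linarith, ?_, ?_, pow_le_one₀ (by positivity) hσ1, ?_, ?_, ?_⟩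
  · calc C * r = (C * c₁) * δ := by rw [hrd]; ring
      _ ≤ 1 / 4 * δ := by gcongr
      _ ≤ _ := by linarith
  · calc δ * r ^ 2 = (δ * r) * r := by ring
      _ ≤ (C * r) * r := by gcongr
      _ ≤ 1 * r := by gcongr; linarith
      _ ≤ r₀ := by linarith
  · have h1 : σ * δ ≤ c₁ / 4 := by
      have : σ * δ ≤ σ * C := by gcongr
      linarith
    calc (σ * δ ^ 2) ^ 2 = (σ * δ ^ 2) * ((σ * δ) * δ) := by ring
      _ ≤ 1 * (c₁ / 4 * δ) := by gcongr
      _ = r / 4 := by rw [hrd]; ring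
  · have : M * (σ * δ ^ 2) ≤ M * (σ * C ^ 2) := by gcongr
    linarith
  · have h1 : σ * (64 * M) * δ ^ 2 ≤ c₁ * δ ^ 2 := by gcongr
    have h2 : 0 < c₁ * δ ^ 2 := by positivity
    rw [hrd]
    nlinarith

/-- The contribution of a boundary point `x` with normal `ν` and curvature `K` to the Fourier
transform of a domain of dimension `n + 1`. -/
noncomputable def boundaryTerm {E : Type} [NormedAddCommGroup E] [InnerProductSpace ℝ E] (n : ℕ)
    (x ν : E) (K Λ : ℝ) : ℂ :=
  Complex.exp (Complex.I * ((Λ * -⟪x, ν⟫_ℝ : ℝ) : ℂ)) * (Complex.I / Λ) *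
    ((√K)⁻¹ • ((((2 * Real.pi / Λ) ^ ((n : ℝ) / 2) : ℝ) : ℂ) *
      Complex.exp (Real.pi * Complex.I * n / 4)))

variable {d : ℕ} {B : Set (EuclideanSpace ℝ (Fin d))} {ρ : EuclideanSpace ℝ (Fin d) → ℝ}

theorem setIntegral_exp_split {E : Type} [NormedAddCommGroup E] [InnerProductSpace ℝ E]
    [FiniteDimensional ℝ E] [MeasurableSpace E] [BorelSpace E] {B : Set E} (hBc : IsCompact B)
    {a₁ a₂ : E → ℝ} (ha₁ : Continuous a₁) (ha₂ : Continuous a₂) (h : ∀ p, a₁ p * a₂ p = 0)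
    {e : E → ℂ} (he : Continuous e) :
    ∫ p in B, e p = (∫ p in B, (((1 - a₁ p) * (1 - a₂ p) : ℝ) : ℂ) * e p) +
      (∫ p in B, (a₁ p : ℂ) * e p) + ∫ p in B, (a₂ p : ℂ) * e p := by
  have hint : ∀ a : E → ℝ, Continuous a → IntegrableOn (fun p => (a p : ℂ) * e p) B := fun a ha =>
    ((Complex.continuous_ofReal.comp ha).mul he).continuousOn.integrableOn_compact hBc
  have hb := hint (fun p => (1 - a₁ p) * (1 - a₂ p)) (by fun_prop)
  have h12 : IntegrableOn (fun p => (((1 - a₁ p) * (1 - a₂ p) : ℝ) : ℂ) * e p + (a₁ p : ℂ) * e p) B :=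
    hb.add (hint _ ha₁)
  rw [← integral_add hb (hint _ ha₁), ← integral_add h12 (hint _ ha₂)]
  refine integral_congr_ae (Filter.Eventually.of_forall fun p => ?_)
  have h1 : (1 - a₁ p) * (1 - a₂ p) + a₁ p + a₂ p = 1 := by linear_combination h p
  have h2 : ((((1 - a₁ p) * (1 - a₂ p) : ℝ) : ℂ) + (a₁ p : ℂ)) + (a₂ p : ℂ) = 1 := by
    exact_mod_cast h1
  change e p = _ * e p + _ * e p + _ * e p
  rw [← add_mul, ← add_mul, h2, one_mul]

open ComplexConjugate in
-- In the chart at $x(-\xi)$ the natural phase belongs to the normal $-\xi$; conjugation brings back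
-- the phase of $\xi$.
theorem setIntegral_conj_exp {E : Type} [NormedAddCommGroup E] [InnerProductSpace ℝ E]
    [MeasurableSpace E] (μ : Measure E) (B : Set E) (a : E → ℝ) (Λ : ℝ) (ξ : E) :
    ∫ p in B, (a p : ℂ) * Complex.exp (Complex.I * ((Λ * -⟪p, ξ⟫_ℝ : ℝ) : ℂ)) ∂μ =
      conj (∫ p in B, (a p : ℂ) * Complex.exp (Complex.I * ((Λ * -⟪p, -ξ⟫_ℝ : ℝ) : ℂ)) ∂μ) := by
  rw [← integral_conj]
  refine integral_congr_ae (Filter.Eventually.of_forall fun p => ?_)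
  simp only [map_mul, Complex.conj_ofReal, ← Complex.exp_conj, Complex.conj_I, inner_neg_right]
  congr 2
  push_cast
  ring

theorem IsDefiningFunction.gradPerp_eq_zero {E : Type} [NormedAddCommGroup E]
    [InnerProductSpace ℝ E] [FiniteDimensional ℝ E] {B : Set E} {ρ : E → ℝ}
    (hρ : IsDefiningFunction B ρ) {x ξ : E} (hx : x ∈ frontier B) {a : ℝ} (ha : a ^ 2 = 1)
    (h : unitNormal ρ x = a • ξ) : gradPerp ρ (ξ, x) = 0 := by
  have h1 := hρ.norm_unitNormal hx
  have ha' : |a| = 1 := by rw [← Real.sqrt_sq_eq_abs, ha, Real.sqrt_one]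
  have hξ : ‖ξ‖ = 1 := by
    rwa [h, norm_smul, Real.norm_eq_abs, ha', one_mul] at h1
  rw [gradPerp, gradComp]
  simp only
  rw [hρ.gradient_eq_smul_unitNormal hx, h, smul_smul, real_inner_smul_left,
    real_inner_self_eq_norm_sq, hξ]
  simp

open ComplexConjugate in
theorem IsDefiningFunction.exists_setIntegral_exp_asymptotic {n : ℕ} (hd : d = n + 1) (hn : 1 ≤ n)
    (hρ : IsDefiningFunction B ρ) (hBc : IsCompact B) (hB : Convex ℝ B)
    (hBi : (interior B).Nonempty) (N : ℕ) :
    ∃ C, 0 ≤ C ∧ ∀ ξ : EuclideanSpace ℝ (Fin d), ∀ x₁ ∈ frontier B, ∀ x₂ ∈ frontier B,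
      unitNormal ρ x₁ = ξ → unitNormal ρ x₂ = -ξ → ∀ K₁ K₂ D : ℝ, K₁ = gaussCurvature B x₁ →
      K₂ = gaussCurvature B x₂ → D = min K₁ K₂ → 0 < D → ∀ Λ : ℝ, 0 < Λ →
      ‖(∫ p in B, Complex.exp (Complex.I * ((Λ * -⟪p, ξ⟫_ℝ : ℝ) : ℂ))) -
        (boundaryTerm n x₁ ξ K₁ Λ + conj (boundaryTerm n x₂ (-ξ) K₂ Λ))‖ ≤
        C * (Λ ^ (-(2 + (n : ℝ) / 2)) * D ^ (-((n : ℝ) + 6) / 2) + Λ⁻¹ * ((Λ * D ^ 4)⁻¹) ^ N) := by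
  obtain ⟨y, hy⟩ := hBi
  obtain ⟨s, hs, hsB⟩ := Metric.nhds_basis_closedBall.mem_iff.1 (mem_interior_iff_mem_nhds.1 hy)
  obtain ⟨r₀, C, c₀, hr₀, hC, hc₀, hchart⟩ := hρ.exists_curved_chart hd hBc hB (n + 5)
  obtain ⟨M, hM, hMη⟩ := hρ.exists_norm_unitNormal_sub_le hBc hB
  obtain ⟨C₁, hC₁, hns⟩ := hρ.exists_nonstationary_bound hBc hB N
  set c := min c₀ 1 with hcd
  have hc : 0 < c := lt_min hc₀ one_pos
  have hC0 : 0 < C := by linarith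
  obtain ⟨c₁, σ, hc₁, hσ, hscale⟩ := exists_scales hC hr₀ hs hM
  obtain ⟨K₀, hK₀, hloc⟩ := exists_local_asymptotic (E := EuclideanSpace ℝ (Fin d))
    (EuclideanSpace ℝ (Fin n)) N hC hc₁
  set W := (c ^ 3)⁻¹ * C ^ (((n : ℝ) - 1) / 2) + (C ^ 3 / c) ^ N with hWd
  have hW0 : 0 ≤ W := by positivity
  set U := C₁ * ((σ ^ 2 * c ^ 4)⁻¹) ^ N with hUd
  have hU0 : 0 ≤ U := by positivity
  refine ⟨U + K₀ * W + K₀ * W, by positivity, ?_⟩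
  intro ξ x₁ hx₁ x₂ hx₂ hν₁ hν₂ K₁ K₂ D hK₁ hK₂ hDd hD Λ hΛ
  have hξ : ‖ξ‖ = 1 := hν₁ ▸ hρ.norm_unitNormal hx₁
  have hDK₁ : D ≤ K₁ := hDd ▸ min_le_left _ _
  have hDK₂ : D ≤ K₂ := hDd ▸ min_le_right _ _
  have hK₁0 : 0 < K₁ := hD.trans_le hDK₁
  have hK₂0 : 0 < K₂ := hD.trans_le hDK₂
  obtain ⟨R₁, φ₁, S₁, A₁, hR₁, hRs₁, hch₁, hA₁, hdet₁, hKC₁, hlow₁⟩ := hchart x₁ hx₁ (hK₁ ▸ hK₁0)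
  obtain ⟨R₂, φ₂, S₂, A₂, hR₂, hRs₂, hch₂, hA₂, hdet₂, hKC₂, hlow₂⟩ := hchart x₂ hx₂ (hK₂ ▸ hK₂0)
  rw [← hK₁] at hdet₁ hKC₁ hlow₁
  rw [← hK₂] at hdet₂ hKC₂ hlow₂
  rw [hν₁] at hR₁ hRs₁ hch₁
  rw [hν₂] at hR₂ hRs₂ hch₂
  have hDC : D ≤ C := hDK₁.trans hKC₁
  -- A common lower bound for both Hessians. The choice $c=\min(c_0,1)$ also gives $\delta\le D$.
  set δ := c * D with hδd
  have hδ : 0 < δ := by positivity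
  have hδD : δ ≤ D := mul_le_of_le_one_left hD.le (min_le_right _ _)
  have hδC : δ ≤ C := hδD.trans hDC
  have hlow₁' : ∀ z, δ * ‖z‖ ^ 2 ≤ ‖A₁ z‖ ^ 2 := fun z => le_trans (by
    have : c * D ≤ c₀ * K₁ := mul_le_mul (min_le_left _ _) hDK₁ hD.le hc₀.le
    gcongr) (hlow₁ z)
  have hlow₂' : ∀ z, δ * ‖z‖ ^ 2 ≤ ‖A₂ z‖ ^ 2 := fun z => le_trans (by
    have : c * D ≤ c₀ * K₂ := mul_le_mul (min_le_left _ _) hDK₂ hD.le hc₀.le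
    gcongr) (hlow₂ z)
  obtain ⟨hr1, hr4, hrr₀, hrs, hCr, hδr, hη1, hη4, hκ1, hκr⟩ := hscale δ hδ hδC
  set r := c₁ * δ with hrd
  have hr : 0 < r := by positivity
  set η := (σ * δ ^ 2) ^ 2 with hηd
  have hη : 0 < η := by positivity
  have hne : (frontier B).Nonempty := ⟨x₁, hx₁⟩
  have hp₁ : gradPerp ρ (ξ, x₁) = 0 :=
    hρ.gradPerp_eq_zero hx₁ (a := 1) (by norm_num) (by rw [hν₁, one_smul])
  have hp₂ : gradPerp ρ (ξ, x₂) = 0 :=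
    hρ.gradPerp_eq_zero hx₂ (a := -1) (by norm_num) (by rw [hν₂, neg_one_smul])
  set a₁ := localCutoff x₁ ξ r with ha₁
  set a₂ := localCutoff x₂ ξ r with ha₂
  -- A point of slow phase is close to a boundary point with normal near $\xi$ or $-\xi$. In either
  -- case one of the two cutoffs is identically $1$ around it and the outer amplitude vanishes.
  have hsupp : ∀ x ∈ B, phaseSpeed ρ (ξ, x) < η →
      (fun p => (1 - a₁ p) * (1 - a₂ p)) =ᶠ[nhds x] fun _ => 0 := by
    intro x hx hsp
    obtain ⟨x', hx', hd', h⟩ := hMη ξ hξ η hη1 hne x hx hsp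
    rcases h with h | h
    · filter_upwards [hρ.localCutoff_eventuallyEq_one hB hx₁ hν₁ hch₁ hR₁ hRs₁
        (fun z => (hlow₁' z).trans (hA₁ z).le) hr hrr₀ (by linarith) hC0.le hδr hx'
        (hd'.trans_le hη4) h hκ1 hκr] with p hp
      rw [ha₁, hp]; ring
    · filter_upwards [hρ.localCutoff_eventuallyEq_one hB hx₂ hν₂ hch₂ hR₂ hRs₂
        (fun z => (hlow₂' z).trans (hA₂ z).le) hr hrr₀ (by linarith) hC0.le hδr hx'
        (hd'.trans_le hη4) h hκ1 hκr] with p hp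
      rw [localCutoff_neg] at hp
      rw [ha₂, hp]; ring
  have est := hns ξ hξ x₁ hx₁ x₂ hx₂ hp₁ hp₂ r hr hr1 η Λ hη hΛ hsupp
  have hd1 : A₁.det ≠ 0 := abs_pos.1 (by rw [hdet₁]; exact Real.sqrt_pos.2 hK₁0)
  have hd2 : A₂.det ≠ 0 := abs_pos.1 (by rw [hdet₂]; exact Real.sqrt_pos.2 hK₂0)
  have hfr : Module.finrank ℝ (EuclideanSpace ℝ (Fin n)) = n := by simp
  have est₁ := hloc hBc.measurableSet (by simp [hd]) hξ hR₁ (by rw [hfr]; exact hch₁) hA₁ hd1 hδ hΛ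
    hlow₁' hδC le_rfl hrr₀ hr1 hCr hr4
  have est₂ := hloc hBc.measurableSet (by simp [hd]) (ν := -ξ) (by simpa using hξ) hR₂
    (by rw [hfr]; exact hch₂) hA₂ hd2 hδ hΛ hlow₂' hδC le_rfl hrr₀ hr1 hCr hr4
  rw [hfr, hdet₁] at est₁
  rw [hfr, hdet₂, localCutoff_neg] at est₂
  replace est₁ := est₁.trans (mul_le_mul_of_nonneg_left
    (local_error_le hn N hc hC hD hDK₁ hDC hΛ) hK₀)
  replace est₂ := est₂.trans (mul_le_mul_of_nonneg_left
    (local_error_le hn N hc hC hD hDK₂ hDC hΛ) hK₀)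
  set X := Λ ^ (-(2 + (n : ℝ) / 2)) * D ^ (-((n : ℝ) + 6) / 2) + Λ⁻¹ * ((Λ * D ^ 4)⁻¹) ^ N with hX
  have estU : C₁ * (Λ⁻¹ * (Λ * η)⁻¹ ^ N) ≤ U * X := by
    have e : (Λ * η)⁻¹ = (σ ^ 2 * c ^ 4)⁻¹ * (Λ * D ^ 4)⁻¹ := by
      rw [← mul_inv, hηd, hδd]; ring
    have h1 : Λ⁻¹ * ((Λ * D ^ 4)⁻¹) ^ N ≤ X := by
      rw [hX]
      exact le_add_of_nonneg_left (by positivity)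
    rw [e, mul_pow]
    calc _ = U * (Λ⁻¹ * ((Λ * D ^ 4)⁻¹) ^ N) := by rw [hUd]; ring
      _ ≤ _ := by gcongr
  set e : EuclideanSpace ℝ (Fin d) → ℂ :=
    fun p => Complex.exp (Complex.I * ((Λ * -⟪p, ξ⟫_ℝ : ℝ) : ℂ)) with he
  have hec : Continuous e := by
    have : Continuous fun p : EuclideanSpace ℝ (Fin d) => Λ * -⟪p, ξ⟫_ℝ := by fun_prop
    exact Complex.continuous_exp.comp (continuous_const.mul (Complex.continuous_ofReal.comp this))
  have hsplit := setIntegral_exp_split hBc (contDiff_localCutoff x₁ ξ r).continuous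
    (contDiff_localCutoff x₂ ξ r).continuous
    (hρ.localCutoff_mul_localCutoff hB hx₁ hx₂ hν₁ hν₂ hr hrs hsB) hec
  have est₂' : ‖(∫ p in B, (a₂ p : ℂ) * e p) - conj (boundaryTerm n x₂ (-ξ) K₂ Λ)‖ ≤ K₀ * (W * X) := by
    rw [he, setIntegral_conj_exp, ← map_sub, Complex.norm_conj]
    exact est₂
  rw [hsplit]
  calc _ = ‖(∫ p in B, (((1 - a₁ p) * (1 - a₂ p) : ℝ) : ℂ) * e p) +
        ((∫ p in B, (a₁ p : ℂ) * e p) - boundaryTerm n x₁ ξ K₁ Λ) +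
        ((∫ p in B, (a₂ p : ℂ) * e p) - conj (boundaryTerm n x₂ (-ξ) K₂ Λ))‖ := by
        congr 1; ring
    _ ≤ U * X + K₀ * (W * X) + K₀ * (W * X) := by
        refine (norm_add₃_le).trans ?_
        exact add_le_add (add_le_add (est.trans estU) est₁) est₂'
    _ = _ := by ring

end MainEstimate

/-! ### The Fourier transform of the indicator function. -/

section FourierIndicator

theorem exp_pi_I_half_add (a : ℂ) :
    Complex.exp (Real.pi * Complex.I * (a + 2) / 4) =
      Complex.I * Complex.exp (Real.pi * Complex.I * a / 4) := by
  rw [show (Real.pi * Complex.I * (a + 2) / 4 : ℂ) =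
    Real.pi / 2 * Complex.I + Real.pi * Complex.I * a / 4 by ring, Complex.exp_add,
    Complex.exp_pi_div_two_mul_I]

theorem exp_neg_pi_I_half_add (a : ℂ) :
    Complex.exp (-Real.pi * Complex.I * (a + 2) / 4) =
      -Complex.I * Complex.exp (-Real.pi * Complex.I * a / 4) := by
  rw [show (-Real.pi * Complex.I * (a + 2) / 4 : ℂ) =
    -Real.pi / 2 * Complex.I + -Real.pi * Complex.I * a / 4 by ring, Complex.exp_add,
    Complex.exp_neg_pi_div_two_mul_I]

/-- With $\Lambda=2\pi t$ the Fresnel factor becomes $t^{-n/2}$, and the only remaining $2\pi$ is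
that of $i/\Lambda$. The factor $i$ advances the phase from $e^{i\pi n/4}$ to
$e^{i\pi(n+2)/4}=e^{i\pi(d+1)/4}$. -/
theorem boundaryTerm_two_pi_mul {E : Type} [NormedAddCommGroup E] [InnerProductSpace ℝ E] {d n : ℕ}
    (hd : d = n + 1) (x ν : E) {K t : ℝ} (hK : 0 < K) (ht : 0 < t) :
    boundaryTerm n x ν K (2 * Real.pi * t) =
      ((2 * Real.pi : ℂ)⁻¹ * Complex.exp (Real.pi * Complex.I * (d + 1) / 4) *
        (K ^ (-(1 / 2 : ℝ)) : ℝ) *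
        Complex.exp (-2 * Real.pi * Complex.I * t * ((⟪x, ν⟫_ℝ : ℝ) : ℂ))) *
        (t ^ (-((d : ℝ) + 1) / 2) : ℝ) := by
  have hπ := Real.pi_pos
  have hπ' : (Real.pi : ℂ) ≠ 0 := by exact_mod_cast hπ.ne'
  have ht' : (t : ℂ) ≠ 0 := by exact_mod_cast ht.ne'
  have e1 : (√K)⁻¹ = K ^ (-(1 / 2 : ℝ)) := by
    rw [Real.sqrt_eq_rpow, ← Real.rpow_neg hK.le]
  have e2 : 2 * Real.pi / (2 * Real.pi * t) = t⁻¹ := by field_simp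
  have e3 : (t⁻¹) ^ ((n : ℝ) / 2) = t * t ^ (-((d : ℝ) + 1) / 2) := by
    rw [Real.inv_rpow ht.le, ← Real.rpow_neg ht.le]
    nth_rewrite 2 [← Real.rpow_one t]
    rw [← Real.rpow_add ht, hd]
    congr 1; push_cast; ring
  have e4 : (d : ℂ) + 1 = n + 2 := by rw [hd]; push_cast; ring
  rw [boundaryTerm, e1, e2, e3, e4, exp_pi_I_half_add, Complex.real_smul]
  rw [show Complex.I * ((2 * Real.pi * t * -⟪x, ν⟫_ℝ : ℝ) : ℂ) =
    -2 * Real.pi * Complex.I * t * ((⟪x, ν⟫_ℝ : ℝ) : ℂ) by push_cast; ring]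
  push_cast
  field_simp

open ComplexConjugate in
theorem conj_boundaryTerm_two_pi_mul {E : Type} [NormedAddCommGroup E] [InnerProductSpace ℝ E]
    {d n : ℕ} (hd : d = n + 1) (x ν : E) {K t : ℝ} (hK : 0 < K) (ht : 0 < t) :
    conj (boundaryTerm n x ν K (2 * Real.pi * t)) =
      ((2 * Real.pi : ℂ)⁻¹ * Complex.exp (-Real.pi * Complex.I * (d + 1) / 4) *
        (K ^ (-(1 / 2 : ℝ)) : ℝ) *
        Complex.exp (2 * Real.pi * Complex.I * t * ((⟪x, ν⟫_ℝ : ℝ) : ℂ))) *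
        (t ^ (-((d : ℝ) + 1) / 2) : ℝ) := by
  rw [boundaryTerm_two_pi_mul hd x ν hK ht]
  simp only [map_mul, Complex.conj_ofReal, ← Complex.exp_conj, Complex.conj_I, map_inv₀, map_div₀,
    map_add, map_neg, map_natCast, map_ofNat, map_one]
  congr 5
  · ring
  · ring

theorem fourier_indicator {E : Type} [NormedAddCommGroup E] [InnerProductSpace ℝ E]
    [MeasurableSpace E] [BorelSpace E] [FiniteDimensional ℝ E] {B : Set E} (hB : MeasurableSet B)
    (ξ : E) (t : ℝ) :
    𝓕 (B.indicator fun _ => (1 : ℂ)) (t • ξ) =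
      ∫ p in B, Complex.exp (Complex.I * ((2 * Real.pi * t * -⟪p, ξ⟫_ℝ : ℝ) : ℂ)) := by
  rw [Real.fourier_eq, ← integral_indicator hB]
  refine integral_congr_ae (Filter.Eventually.of_forall fun p => ?_)
  by_cases hp : p ∈ B
  · simp only [hp, Set.indicator_of_mem, Circle.smul_def, Real.fourierChar_apply,
      real_inner_smul_right, smul_eq_mul, mul_one]
    congr 1
    push_cast
    ring
  · simp [hp]

variable {d : ℕ} {B : Set (EuclideanSpace ℝ (Fin d))} {ρ : EuclideanSpace ℝ (Fin d) → ℝ}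

theorem gaussInv_spec {ξ : EuclideanSpace ℝ (Fin d)} (h : ξ ∈ gaussMap B '' posCurvBoundary B) :
    gaussInv B ξ ∈ frontier B ∧ 0 < gaussCurvature B (gaussInv B ξ) ∧
      gaussMap B (gaussInv B ξ) = ξ := by
  obtain ⟨h1, h2⟩ := Function.invFunOn_mem h
  exact ⟨h1, h2, Function.invFunOn_eq h⟩

theorem IsDefiningFunction.supportFn_eq (hρ : IsDefiningFunction B ρ) (hB : Convex ℝ B)
    {x ξ : EuclideanSpace ℝ (Fin d)} (hx : x ∈ frontier B) (h : unitNormal ρ x = ξ) :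
    supportFn B ξ = ⟪x, ξ⟫_ℝ := by
  refine IsGreatest.csSup_eq ⟨⟨x, hρ.frontier_subset hx, rfl⟩, ?_⟩
  rintro _ ⟨y, hy, rfl⟩
  have := hρ.inner_unitNormal_sub_nonpos hB hx hy
  rw [h, inner_sub_right, real_inner_comm, real_inner_comm x] at this
  simp only
  linarith

theorem asymptotic_error_le {n N : ℕ} {d : ℕ} (hd : d = n + 1) {D t : ℝ} (hD : 0 < D) (ht : 0 < t) :
    (2 * Real.pi * t) ^ (-(2 + (n : ℝ) / 2)) * D ^ (-((n : ℝ) + 6) / 2) +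
      (2 * Real.pi * t)⁻¹ * ((2 * Real.pi * t * D ^ 4)⁻¹) ^ N ≤
    t ^ (-((d : ℝ) + 3) / 2) * D ^ (-((d : ℝ) + 5) / 2) + t ^ (-(N : ℝ) - 1) * D ^ (-4 * (N : ℝ)) := by
  have hle : t ≤ 2 * Real.pi * t := by nlinarith [Real.pi_gt_three]
  have e1 : -((d : ℝ) + 3) / 2 = -(2 + (n : ℝ) / 2) := by rw [hd]; push_cast; ring
  have e2 : -((d : ℝ) + 5) / 2 = -((n : ℝ) + 6) / 2 := by rw [hd]; push_cast; ring
  have e3 : t ^ (-(N : ℝ) - 1) * D ^ (-4 * (N : ℝ)) = t⁻¹ * ((t * D ^ 4)⁻¹) ^ N := by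
    rw [Real.rpow_sub_one ht.ne', Real.rpow_neg ht.le, Real.rpow_natCast, inv_pow, mul_pow, mul_inv,
      ← pow_mul, show (-4 * (N : ℝ)) = -((4 * N : ℕ) : ℝ) by push_cast; ring, Real.rpow_neg hD.le,
      Real.rpow_natCast]
    ring
  rw [e1, e2, e3]
  have h1 : (2 * Real.pi * t) ^ (-(2 + (n : ℝ) / 2)) ≤ t ^ (-(2 + (n : ℝ) / 2)) :=
    Real.rpow_le_rpow_of_nonpos ht hle (by
      have : (0 : ℝ) ≤ n := by positivity
      linarith)
  gcongr

theorem IsDefiningFunction.fourier_indicator_asymptotic (hρ : IsDefiningFunction B ρ) (hd : 2 ≤ d)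
    (hB_compact : IsCompact B) (hB_convex : Convex ℝ B) (hB_int : (interior B).Nonempty) (N : ℕ) :
    ∃ C : ℝ, ∀ ξ : EuclideanSpace ℝ (Fin d),
      ξ ∈ gaussMap B '' posCurvBoundary B → -ξ ∈ gaussMap B '' posCurvBoundary B →
      ∀ t : ℝ, 0 < t →
        ‖𝓕 (B.indicator (fun _ => (1 : ℂ))) (t • ξ) -
            ((2 * Real.pi : ℂ)⁻¹ * Complex.exp (Real.pi * Complex.I * (d + 1) / 4) *
                (curvatureAt B ξ ^ (-(1 / 2 : ℝ)) : ℝ) *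
                Complex.exp (-2 * Real.pi * Complex.I * t * supportFn B ξ) +
              (2 * Real.pi : ℂ)⁻¹ * Complex.exp (-Real.pi * Complex.I * (d + 1) / 4) *
                (curvatureAt B (-ξ) ^ (-(1 / 2 : ℝ)) : ℝ) *
                Complex.exp (2 * Real.pi * Complex.I * t * supportFn B (-ξ))) *
              (t ^ (-((d : ℝ) + 1) / 2) : ℝ)‖ ≤
          C * (t ^ (-((d : ℝ) + 3) / 2) *
                min (curvatureAt B ξ) (curvatureAt B (-ξ)) ^ (-((d : ℝ) + 5) / 2) +
              t ^ (-(N : ℝ) - 1) *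
                min (curvatureAt B ξ) (curvatureAt B (-ξ)) ^ (-4 * (N : ℝ))) := by
  obtain ⟨n, rfl⟩ : ∃ n, d = n + 1 := ⟨d - 1, by omega⟩
  obtain ⟨C, hC, h⟩ := hρ.exists_setIntegral_exp_asymptotic rfl (by omega) hB_compact hB_convex
    hB_int N
  refine ⟨C, fun ξ h₁ h₂ t ht => ?_⟩
  obtain ⟨hx₁, hK₁, hg₁⟩ := gaussInv_spec h₁
  obtain ⟨hx₂, hK₂, hg₂⟩ := gaussInv_spec h₂
  rw [hρ.gaussMap_eq hB_convex hx₁] at hg₁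
  rw [hρ.gaussMap_eq hB_convex hx₂] at hg₂
  change 0 < curvatureAt B ξ at hK₁
  change 0 < curvatureAt B (-ξ) at hK₂
  have hD : 0 < min (curvatureAt B ξ) (curvatureAt B (-ξ)) := lt_min hK₁ hK₂
  have := h ξ _ hx₁ _ hx₂ hg₁ hg₂ (curvatureAt B ξ) (curvatureAt B (-ξ)) _ rfl rfl rfl hD
    (2 * Real.pi * t) (by positivity)
  rw [← fourier_indicator hB_compact.measurableSet, boundaryTerm_two_pi_mul rfl _ _ hK₁ ht,
    conj_boundaryTerm_two_pi_mul rfl _ _ hK₂ ht, ← hρ.supportFn_eq hB_convex hx₁ hg₁,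
    ← hρ.supportFn_eq hB_convex hx₂ hg₂, ← add_mul] at this
  exact this.trans (mul_le_mul_of_nonneg_left (asymptotic_error_le rfl hD ht) hC)

/-- The asymptotics of the normal components, given the divergence theorem. -/
theorem fourierNormalSurface_asymptotic
    (hdiv : ∀ (l : Fin d) (ζ : EuclideanSpace ℝ (Fin d)), fourierNormalSurface B l ζ =
      -2 * Real.pi * Complex.I * (ζ l : ℂ) * 𝓕 (B.indicator (fun _ => (1 : ℂ))) ζ)
    {ξ : EuclideanSpace ℝ (Fin d)} (hξ : ‖ξ‖ = 1) (l : Fin d) {t : ℝ} (ht : 0 < t) {N : ℕ}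
    {C K₁ K₂ H₁ H₂ P Q : ℝ}
    (h : ‖𝓕 (B.indicator (fun _ => (1 : ℂ))) (t • ξ) -
            ((2 * Real.pi : ℂ)⁻¹ * Complex.exp (Real.pi * Complex.I * (d + 1) / 4) *
                (K₁ : ℂ) * Complex.exp (-2 * Real.pi * Complex.I * t * H₁) +
              (2 * Real.pi : ℂ)⁻¹ * Complex.exp (-Real.pi * Complex.I * (d + 1) / 4) *
                (K₂ : ℂ) * Complex.exp (2 * Real.pi * Complex.I * t * H₂)) *
              (t ^ (-((d : ℝ) + 1) / 2) : ℝ)‖ ≤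
          C * (t ^ (-((d : ℝ) + 3) / 2) * P + t ^ (-(N : ℝ) - 1) * Q)) :
    ‖fourierNormalSurface B l (t • ξ) -
            (Complex.exp (Real.pi * Complex.I * (d - 1) / 4) * (ξ l : ℂ) * (K₁ : ℂ) *
                Complex.exp (-2 * Real.pi * Complex.I * t * H₁) +
              Complex.exp (-Real.pi * Complex.I * (d - 1) / 4) * (-(ξ l : ℂ)) * (K₂ : ℂ) *
                Complex.exp (2 * Real.pi * Complex.I * t * H₂)) *
              (t ^ (-((d : ℝ) - 1) / 2) : ℝ)‖ ≤
          2 * Real.pi * C * (t ^ (-((d : ℝ) + 1) / 2) * P + t ^ (-(N : ℝ)) * Q) := by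
  have hπ : (Real.pi : ℂ) ≠ 0 := by exact_mod_cast Real.pi_ne_zero
  have e1 : t ^ (-((d : ℝ) - 1) / 2) = t * t ^ (-((d : ℝ) + 1) / 2) := by
    nth_rewrite 2 [← Real.rpow_one t]
    rw [← Real.rpow_add ht]; congr 1; ring
  have e2 : t ^ (-((d : ℝ) + 1) / 2) = t * t ^ (-((d : ℝ) + 3) / 2) := by
    nth_rewrite 2 [← Real.rpow_one t]
    rw [← Real.rpow_add ht]; congr 1; ring
  have e3 : t ^ (-(N : ℝ)) = t * t ^ (-(N : ℝ) - 1) := by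
    nth_rewrite 2 [← Real.rpow_one t]
    rw [← Real.rpow_add ht]; congr 1; ring
  have c1 := exp_pi_I_half_add ((d : ℂ) - 1)
  have c2 := exp_neg_pi_I_half_add ((d : ℂ) - 1)
  rw [show (d : ℂ) - 1 + 2 = d + 1 by ring] at c1 c2
  rw [c1, c2] at h
  have hl : |ξ l| ≤ 1 := by
    rw [← hξ, ← Real.norm_eq_abs]; exact PiLp.norm_apply_le ξ l
  have key : fourierNormalSurface B l (t • ξ) -
            (Complex.exp (Real.pi * Complex.I * (d - 1) / 4) * (ξ l : ℂ) * (K₁ : ℂ) *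
                Complex.exp (-2 * Real.pi * Complex.I * t * H₁) +
              Complex.exp (-Real.pi * Complex.I * (d - 1) / 4) * (-(ξ l : ℂ)) * (K₂ : ℂ) *
                Complex.exp (2 * Real.pi * Complex.I * t * H₂)) *
              (t ^ (-((d : ℝ) - 1) / 2) : ℝ) =
      (-2 * Real.pi * Complex.I * t * (ξ l : ℂ)) *
      (𝓕 (B.indicator (fun _ => (1 : ℂ))) (t • ξ) -
            ((2 * Real.pi : ℂ)⁻¹ * (Complex.I * Complex.exp (Real.pi * Complex.I * (d - 1) / 4)) *
                (K₁ : ℂ) * Complex.exp (-2 * Real.pi * Complex.I * t * H₁) +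
              (2 * Real.pi : ℂ)⁻¹ * (-Complex.I * Complex.exp (-Real.pi * Complex.I * (d - 1) / 4)) *
                (K₂ : ℂ) * Complex.exp (2 * Real.pi * Complex.I * t * H₂)) *
              (t ^ (-((d : ℝ) + 1) / 2) : ℝ)) := by
    rw [hdiv, e1]
    simp only [PiLp.smul_apply, smul_eq_mul, Complex.ofReal_mul]
    have hI : Complex.I * Complex.I = -1 := Complex.I_mul_I
    field_simp
    ring_nf
    simp only [Complex.I_sq]
    ring
  rw [key, norm_mul]
  have hn : ‖(-2 * Real.pi * Complex.I * t * (ξ l : ℂ))‖ ≤ 2 * Real.pi * t := by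
    simp only [norm_mul, norm_neg, Complex.norm_ofNat, Complex.norm_real, Complex.norm_I,
      Real.norm_eq_abs, abs_of_pos ht, abs_of_pos Real.pi_pos, mul_one]
    exact mul_le_of_le_one_right (by positivity) hl
  have hp : 0 ≤ 2 * Real.pi * t := by positivity
  refine (mul_le_mul hn h (norm_nonneg _) hp).trans (le_of_eq ?_)
  rw [e2, e3]
  ring

end FourierIndicator

/-! ### The divergence theorem over an epigraph. -/

section GraphIntegral

variable {E : Type} [NormedAddCommGroup E] [InnerProductSpace ℝ E] [FiniteDimensional ℝ E]
  [MeasurableSpace E] [BorelSpace E]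
  {F : Type} [NormedAddCommGroup F] [InnerProductSpace ℝ F] [FiniteDimensional ℝ F]
  [MeasurableSpace F] [BorelSpace F]

theorem exists_measurePreserving_shear (hdim : Module.finrank ℝ E = Module.finrank ℝ F + 1) (x : E)
    {ν : E} (hν : ‖ν‖ = 1) {R : F →ₗᵢ[ℝ] E} (hR : ∀ z, ⟪ν, R z⟫_ℝ = 0) {φ : F → ℝ}
    (hφ : Continuous φ) :
    MeasurePreserving (fun q : F × ℝ => x + R q.1 - (q.2 + φ q.1) • ν) := by
  obtain ⟨e, he, hep⟩ := exists_measurePreserving_chart hdim x hν hR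
  have hT : MeasurePreserving (fun q : F × ℝ => (q.1, q.2 + φ q.1)) :=
    (MeasurePreserving.id volume).skew_product (g := fun z s => s + φ z)
      (by
        have : Continuous (Function.uncurry fun (z : F) (s : ℝ) => s + φ z) := by
          simp only [Function.uncurry_def]; fun_prop
        exact this.measurable)
      (Filter.Eventually.of_forall fun z => (measurePreserving_add_right volume (φ z)).map_eq)
  have := he.comp hT
  convert this using 1
  ext q
  simp [hep]

/-- Differentiation under the integral over an epigraph. -/
theorem setIntegral_fderiv_epigraph (hdim : Module.finrank ℝ E = Module.finrank ℝ F + 1) {x ν : E}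
    (hν : ‖ν‖ = 1) {R : F →ₗᵢ[ℝ] E} (hR : ∀ z, ⟪ν, R z⟫_ℝ = 0) {φ : F → ℝ} (hφ : ContDiff ℝ ∞ φ)
    {B : Set E} (hB : MeasurableSet B) {r : ℝ}
    (hBφ : ∀ z u, x + R z - u • ν ∈ Metric.ball x r → (x + R z - u • ν ∈ B ↔ φ z ≤ u))
    {f : E → ℂ} (hf : ContDiff ℝ ∞ f) (hfr : tsupport f ⊆ Metric.ball x r) (w : F) (a : ℝ) :
    ∫ p in B, fderiv ℝ f p (R w + a • ν) =
      ∫ z, ((a + fderiv ℝ φ z w : ℝ) : ℂ) * f (x + R z - φ z • ν) := by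
  have : ProperSpace E := FiniteDimensional.proper ℝ E
  have : CompleteSpace E := FiniteDimensional.complete ℝ E
  have : CompleteSpace F := FiniteDimensional.complete ℝ F
  have hfc : HasCompactSupport f := (isCompact_closedBall x r).of_isClosed_subset
    (isClosed_tsupport f) (hfr.trans Metric.ball_subset_closedBall)
  have hf1 : ContDiff ℝ ∞ (fderiv ℝ f) := hf.fderiv_right (by simp)
  have hdz : ∀ p, p ∉ tsupport f → fderiv ℝ f p = 0 := fun p hp => by
    by_contra h
    exact hp (support_fderiv_subset ℝ h)
  set c : F × ℝ → E := fun q => x + R q.1 - (q.2 + φ q.1) • ν with hcd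
  have hc : MeasurePreserving c := exists_measurePreserving_shear hdim x hν hR hφ.continuous
  have hcs : ContDiff ℝ ∞ c := (contDiff_const.add (R.toContinuousLinearMap.contDiff.comp
    contDiff_fst)).sub ((contDiff_snd.add (hφ.comp contDiff_fst)).smul contDiff_const)
  have hnorm : ∀ (z : F) (u : ℝ), ‖x + R z - u • ν - x‖ ^ 2 = ‖z‖ ^ 2 + u ^ 2 := fun z u => by
    rw [show x + R z - u • ν - x = R z - u • ν by abel, norm_sub_sq_real, real_inner_smul_right,
      real_inner_comm, hR, R.norm_map, norm_smul, hν, mul_one, Real.norm_eq_abs, sq_abs]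
    ring
  have hmemball : ∀ z u, x + R z - u • ν ∈ tsupport f → ‖z‖ ≤ r ∧ |u| ≤ r := fun z u h => by
    have h1 := hfr h
    rw [Metric.mem_ball, dist_eq_norm] at h1
    have h2 := hnorm z u
    have h0 : 0 ≤ r := (norm_nonneg _).trans h1.le
    have h3 : ‖x + R z - u • ν - x‖ ^ 2 ≤ r ^ 2 := by gcongr
    exact ⟨(le_abs_self _).trans (abs_le_of_sq_le_sq (by nlinarith [sq_nonneg u]) h0),
      abs_le_of_sq_le_sq (by nlinarith [sq_nonneg ‖z‖]) h0⟩
  let Up : Set (F × ℝ) := {q | 0 ≤ q.2}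
  have hUp : MeasurableSet Up := measurableSet_le measurable_const measurable_snd
  -- the two integrands
  let G : F × ℝ → ℂ := fun q => ((a + fderiv ℝ φ q.1 w : ℝ) : ℂ) * fderiv ℝ f (c q) ν
  let D : F × ℝ → ℂ := fun q => fderiv ℝ (fun z => f (c (z, q.2))) q.1 w
  have hder : ∀ q : F × ℝ, D q = fderiv ℝ f (c q) (R w - fderiv ℝ φ q.1 w • ν) := by
    rintro ⟨z, s⟩
    have h1 : HasFDerivAt (fun z => c (z, s))
        (R.toContinuousLinearMap - (fderiv ℝ φ z).smulRight ν) z := by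
      have hφ' := (hφ.differentiable (by simp) z).hasFDerivAt
      exact (R.toContinuousLinearMap.hasFDerivAt.const_add x).sub ((hφ'.const_add s).smul_const ν)
    have h2 := ((hf.differentiable (by simp) (c (z, s))).hasFDerivAt).comp z h1
    have h3 : D (z, s) = _ := congrArg (fun L => L w) h2.fderiv
    rw [h3]
    simp
  -- The direction is split into $Rw-d\varphi(w)\nu$, tangent to the translates of the graph, and
  -- the vertical vector $(a+d\varphi(w))\nu$. The first integrates to zero over each translate, the
  -- second along vertical rays to a boundary value.
  have hsum : ∀ q, fderiv ℝ f (c q) (R w + a • ν) = D q + G q := fun q => by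
    simp only [hder, G, map_sub, map_add, map_smul, Complex.real_smul]
    push_cast
    ring
  -- integrability
  have hint0 : ∀ v, Integrable (fun p => fderiv ℝ f p v) := fun v =>
    (hf1.clm_apply contDiff_const).continuous.integrable_of_hasCompactSupport
      ((hfc.fderiv ℝ).mono' fun p hp => by
        by_contra h
        exact hp (by simp [image_eq_zero_of_notMem_tsupport h]))
  have hintc : ∀ v, Integrable (fun q => fderiv ℝ f (c q) v) := fun v =>
    hc.integrable_comp_of_integrable (hint0 v)
  have hGint : Integrable G := by
    let P : E → F := fun p => ContinuousLinearMap.adjoint R.toContinuousLinearMap (p - x)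
    have hPc : ∀ q, P (c q) = q.1 := fun q => by
      refine ext_inner_right ℝ fun y => ?_
      simp only [P]
      rw [ContinuousLinearMap.adjoint_inner_left]
      simp only [hcd]
      rw [show x + R q.1 - (q.2 + φ q.1) • ν - x = R q.1 - (q.2 + φ q.1) • ν by abel,
        inner_sub_left, real_inner_smul_left]
      simp [hR]
    have hK : Integrable fun p => ((a + fderiv ℝ φ (P p) w : ℝ) : ℂ) * fderiv ℝ f p ν := by
      have hPcont : Continuous P := by fun_prop
      have h1 : Continuous fun p => ((a + fderiv ℝ φ (P p) w : ℝ) : ℂ) :=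
        Complex.continuous_ofReal.comp (continuous_const.add
          (((hφ.continuous_fderiv (by simp)).comp hPcont).clm_apply continuous_const))
      refine (h1.mul (hf1.clm_apply contDiff_const).continuous).integrable_of_hasCompactSupport ?_
      refine HasCompactSupport.mul_left ((hfc.fderiv ℝ).mono' fun p hp => ?_)
      by_contra h
      exact hp (by simp [image_eq_zero_of_notMem_tsupport h])
    have h2 : Integrable ((fun p => ((a + fderiv ℝ φ (P p) w : ℝ) : ℂ) * fderiv ℝ f p ν) ∘ c) :=
      hc.integrable_comp_of_integrable hK
    refine h2.congr (Filter.Eventually.of_forall fun q => ?_)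
    simp only [Function.comp_apply, hPc, G]
  have hDint : Integrable D := by
    refine ((hintc (R w + a • ν)).sub hGint).congr (Filter.Eventually.of_forall fun q => ?_)
    simp only [Pi.sub_apply, hsum, add_sub_cancel_right]
  -- change of variables
  have step1 : ∫ p in B, fderiv ℝ f p (R w + a • ν) =
      ∫ q, (Up.indicator D q + Up.indicator G q) := by
    rw [← integral_indicator hB]
    have hmeas : AEStronglyMeasurable (B.indicator fun p => fderiv ℝ f p (R w + a • ν))
        (Measure.map c volume) :=
      ((hf1.clm_apply contDiff_const).continuous.stronglyMeasurable.indicator hB).aestronglyMeasurable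
    rw [← hc.map_eq, integral_map hc.measurable.aemeasurable hmeas]
    refine integral_congr_ae (Filter.Eventually.of_forall fun q => ?_)
    have hadd : Up.indicator D q + Up.indicator G q = Up.indicator (fun q => D q + G q) q := by
      by_cases h : q ∈ Up <;> simp [h]
    simp only
    rw [hadd]
    by_cases hq : c q ∈ tsupport f
    · have h1 := hBφ q.1 (q.2 + φ q.1) (hfr hq)
      have h2 : c q ∈ B ↔ q ∈ Up := by
        refine h1.trans ?_
        change _ ↔ 0 ≤ q.2
        constructor <;> intro h <;> linarith
      by_cases hqB : c q ∈ B
      · rw [Set.indicator_of_mem hqB, Set.indicator_of_mem (h2.1 hqB), hsum]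
      · rw [Set.indicator_of_notMem hqB, Set.indicator_of_notMem (fun h => hqB (h2.2 h))]
    · have h1 : D q + G q = 0 := by rw [← hsum, hdz _ hq]; rfl
      have h2 : fderiv ℝ f (c q) (R w + a • ν) = 0 := by rw [hdz _ hq]; rfl
      classical
      rw [Set.indicator_apply, Set.indicator_apply, h2, h1]
      simp
  have step2 : ∫ q, Up.indicator D q = 0 := by
    rw [Measure.volume_eq_prod] at *
    rw [integral_prod_symm _ (hDint.indicator hUp)]
    refine integral_eq_zero_of_ae (Filter.Eventually.of_forall fun s => ?_)
    change ∫ z, Up.indicator D (z, s) = 0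
    by_cases hs : 0 ≤ s
    · have h1 : ∀ z, Up.indicator D (z, s) = fieldDeriv (fun _ => w) (fun z => f (c (z, s))) z +
          ((divergence (fun _ : F => w) z : ℝ) : ℂ) * f (c (z, s)) := fun z => by
        rw [Set.indicator_of_mem (show (z, s) ∈ Up from hs)]
        simp [divergence, fieldDeriv, D]
      simp only [h1]
      refine integral_fieldDeriv_add_divergence volume contDiff_const
        (hf.comp (hcs.comp (contDiff_id.prodMk contDiff_const))) ?_
      have : ProperSpace F := FiniteDimensional.proper ℝ F
      refine HasCompactSupport.intro (isCompact_closedBall (0 : F) r) fun z hz => ?_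
      by_contra h
      exact hz (by simpa using (hmemball z _ (subset_tsupport f h)).1)
    · have h1 : ∀ z, Up.indicator D (z, s) = 0 := fun z =>
        Set.indicator_of_notMem (show (z, s) ∉ Up from hs) _
      simp [h1]
  have step3 : ∫ q, Up.indicator G q = ∫ z, ((a + fderiv ℝ φ z w : ℝ) : ℂ) * f (x + R z - φ z • ν) := by
    rw [Measure.volume_eq_prod, integral_prod _ (hGint.indicator hUp)]
    refine integral_congr_ae (Filter.Eventually.of_forall fun z => ?_)
    simp only
    have h1 : ∀ s, Up.indicator G (z, s) = (Set.Ici (0 : ℝ)).indicator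
        (fun s => ((a + fderiv ℝ φ z w : ℝ) : ℂ) * -deriv (fun s => f (c (z, s))) s) s := fun s => by
      have h2 : HasDerivAt (fun s => c (z, s)) (-ν) s := by
        have : HasDerivAt (fun s : ℝ => (s + φ z) • ν) ((1 : ℝ) • ν) s :=
          ((hasDerivAt_id s).add_const _).smul_const ν
        simpa using this.const_sub (x + R z)
      have h3 := ((hf.differentiable (by simp) (c (z, s))).hasFDerivAt).comp_hasDerivAt s h2
      have h4 : deriv (fun s => f (c (z, s))) s = -fderiv ℝ f (c (z, s)) ν := by
        rw [← map_neg]; exact h3.deriv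
      by_cases hs : 0 ≤ s
      · rw [Set.indicator_of_mem (show (z, s) ∈ Up from hs),
          Set.indicator_of_mem (Set.mem_Ici.2 hs), h4, neg_neg]
      · rw [Set.indicator_of_notMem (show (z, s) ∉ Up from hs),
          Set.indicator_of_notMem (show s ∉ Set.Ici (0 : ℝ) from hs)]
    simp only [h1]
    rw [integral_indicator measurableSet_Ici, integral_Ici_eq_integral_Ioi, integral_const_mul,
      integral_neg, HasCompactSupport.integral_Ioi_deriv_eq, neg_neg]
    · simp [hcd]
    · exact (hf.comp (hcs.comp (contDiff_const.prodMk contDiff_id))).of_le (by simp)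
    · refine HasCompactSupport.intro (isCompact_Icc (a := -r - φ z) (b := r - φ z)) fun s hs => ?_
      by_contra h
      have := abs_le.1 (hmemball z _ (subset_tsupport f h)).2
      exact hs ⟨by linarith [this.1], by linarith [this.2]⟩
  rw [step1, integral_add (hDint.indicator hUp) (hGint.indicator hUp), step2, step3, zero_add]

end GraphIntegral

/-! ### Hausdorff measure of an almost flat graph. -/

section GraphMeasure

variable {E : Type} [NormedAddCommGroup E] [InnerProductSpace ℝ E]
  {F : Type} [NormedAddCommGroup F] [InnerProductSpace ℝ F]
  {x ν : E} {R : F →ₗᵢ[ℝ] E} {φ : F → ℝ}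

theorem norm_chart_sub_sq (hν : ‖ν‖ = 1) (hR : ∀ z, ⟪ν, R z⟫_ℝ = 0) (z z' : F) (u u' : ℝ) :
    ‖(x + R z - u • ν) - (x + R z' - u' • ν)‖ ^ 2 = ‖z - z'‖ ^ 2 + (u - u') ^ 2 := by
  rw [show (x + R z - u • ν) - (x + R z' - u' • ν) = R (z - z') - (u - u') • ν by
    rw [map_sub]; module, norm_sub_sq_real, real_inner_smul_right, real_inner_comm, hR, R.norm_map,
    norm_smul, hν, mul_one, Real.norm_eq_abs, sq_abs]
  ring

theorem antilipschitzWith_graph (hν : ‖ν‖ = 1) (hR : ∀ z, ⟪ν, R z⟫_ℝ = 0) :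
    AntilipschitzWith 1 fun z => x + R z - φ z • ν := by
  refine AntilipschitzWith.of_le_mul_dist fun z z' => ?_
  rw [NNReal.coe_one, one_mul, dist_eq_norm, dist_eq_norm,
    ← sq_le_sq₀ (norm_nonneg _) (norm_nonneg _), norm_chart_sub_sq hν hR]
  linarith [sq_nonneg (φ z - φ z')]

theorem lipschitzOnWith_graph (hν : ‖ν‖ = 1) {s : Set F} {K : NNReal}
    (hφ : LipschitzOnWith K φ s) : LipschitzOnWith (1 + K) (fun z => x + R z - φ z • ν) s := by
  refine LipschitzOnWith.of_dist_le_mul fun z hz z' hz' => ?_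
  have h := hφ.dist_le_mul z hz z' hz'
  rw [dist_eq_norm, dist_eq_norm] at *
  have e : (x + R z - φ z • ν) - (x + R z' - φ z' • ν) = R (z - z') - (φ z - φ z') • ν := by
    rw [map_sub]; module
  rw [e]
  refine (norm_sub_le _ _).trans ?_
  rw [R.norm_map, norm_smul, hν, mul_one]
  push_cast
  linarith

/-- The graph map does not decrease distances and is $(1+K)$-Lipschitz. As $K\to0$ at small scales,
these two bounds do the work of an exact area formula. -/
theorem euclideanHausdorffMeasure_image_graph {n d : ℕ} {x ν : EuclideanSpace ℝ (Fin d)}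
    {R : EuclideanSpace ℝ (Fin n) →ₗᵢ[ℝ] EuclideanSpace ℝ (Fin d)} {φ : EuclideanSpace ℝ (Fin n) → ℝ}
    (hν : ‖ν‖ = 1) (hR : ∀ z, ⟪ν, R z⟫_ℝ = 0)
    {s : Set (EuclideanSpace ℝ (Fin n))} {K : NNReal} (hφ : LipschitzOnWith K φ s) :
    volume s ≤ μHE[n] ((fun z => x + R z - φ z • ν) '' s) ∧
      μHE[n] ((fun z => x + R z - φ z • ν) '' s) ≤ (1 + K : NNReal) ^ n * volume s := by
  have h1 := (antilipschitzWith_graph (x := x) (φ := φ) hν hR).le_hausdorffMeasure_image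
    (d := n) (by positivity) s
  have h2 := (lipschitzOnWith_graph (x := x) (R := R) hν hφ).hausdorffMeasure_image_le
    (d := n) (by positivity)
  rw [ENNReal.coe_one, ENNReal.one_rpow, one_mul] at h1
  rw [ENNReal.rpow_natCast] at h2
  rw [← EuclideanSpace.euclideanHausdorffMeasure_eq_volume, Measure.euclideanHausdorffMeasure_def,
    Measure.euclideanHausdorffMeasure_def, Measure.smul_apply, Measure.smul_apply]
  constructor
  · gcongr
  · rw [ENNReal.smul_def, ENNReal.smul_def, smul_eq_mul, smul_eq_mul, mul_left_comm]
    gcongr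

/-- The difference $m_2-m_1$ is a positive measure, so its integral of $|f|$ is
$\int|f|\,dm_2-\int|f|\,dm_1\le\varepsilon\int|f|\,dm_1$. -/
theorem norm_integral_sub_integral_le {α : Type*} [MeasurableSpace α] {m₁ m₂ : Measure α}
    [IsFiniteMeasure m₁] [IsFiniteMeasure m₂] {ε : ℝ} (hε : 0 ≤ ε) (h₁ : m₁ ≤ m₂)
    (h₂ : m₂ ≤ ENNReal.ofReal (1 + ε) • m₁) {f : α → ℂ} (hf : Integrable f m₂) :
    ‖(∫ x, f x ∂m₂) - ∫ x, f x ∂m₁‖ ≤ ε * ∫ x, ‖f x‖ ∂m₂ := by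
  have hm : m₂ - m₁ + m₁ = m₂ := Measure.sub_add_cancel_of_le h₁
  have hf1 : Integrable f m₁ := hf.mono_measure h₁
  have hf3 : Integrable f (m₂ - m₁) := hf.mono_measure Measure.sub_le
  have e1 : (∫ x, f x ∂m₂) - ∫ x, f x ∂m₁ = ∫ x, f x ∂(m₂ - m₁) := by
    nth_rewrite 1 [← hm]
    rw [integral_add_measure hf3 hf1, add_sub_cancel_right]
  have e2 : ∫ x, ‖f x‖ ∂m₂ = (∫ x, ‖f x‖ ∂(m₂ - m₁)) + ∫ x, ‖f x‖ ∂m₁ := by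
    nth_rewrite 1 [← hm]
    rw [integral_add_measure hf3.norm hf1.norm]
  have e3 : ∫ x, ‖f x‖ ∂m₂ ≤ (1 + ε) * ∫ x, ‖f x‖ ∂m₁ := by
    refine (integral_mono_measure h₂ (Filter.Eventually.of_forall fun _ => norm_nonneg _)
      (hf1.norm.smul_measure ENNReal.ofReal_ne_top)).trans ?_
    rw [integral_smul_measure, ENNReal.toReal_ofReal (by linarith), smul_eq_mul]
  have e4 : ∫ x, ‖f x‖ ∂m₁ ≤ ∫ x, ‖f x‖ ∂m₂ :=
    integral_mono_measure h₁ (Filter.Eventually.of_forall fun _ => norm_nonneg _) hf.norm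
  rw [e1]
  refine (norm_integral_le_integral_norm _).trans ?_
  nlinarith

end GraphMeasure

/-! ### Local comparison of the surface with its tangent hyperplane. -/

section LocalSurface

variable {E : Type} [NormedAddCommGroup E] [InnerProductSpace ℝ E] [FiniteDimensional ℝ E]
  {F : Type} [NormedAddCommGroup F] [InnerProductSpace ℝ F] [FiniteDimensional ℝ F]
  {B : Set E} {x ν : E} {r₀ C : ℝ} {m : ℕ} {R : F →ₗᵢ[ℝ] E} {φ : F → ℝ} {S : F →L[ℝ] F}

namespace IsBoundaryChart

theorem apply_zero (h : IsBoundaryChart B x ν r₀ C m R φ S) (hr₀ : 0 < r₀) : φ 0 = 0 := by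
  have := h.remainder.base 0 (by simpa using hr₀.le)
  simpa using this

theorem fderiv_zero (h : IsBoundaryChart B x ν r₀ C m R φ S) (hr₀ : 0 < r₀) : fderiv ℝ φ 0 = 0 := by
  refine IsLocalMin.fderiv_eq_zero ?_
  filter_upwards [Metric.closedBall_mem_nhds (0 : F) hr₀] with z hz
  rw [h.apply_zero hr₀]
  exact h.nonneg z (by simpa using hz)

/-- By continuity, points with $u>\varphi(z)$ have a neighbourhood in $B$; points with
$u=\varphi(z)$ are limits of points with smaller $u$, which lie outside $B$. -/
theorem mem_frontier_iff (h : IsBoundaryChart B x ν r₀ C m R φ S) (hBc : IsClosed B)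
    (hν : ‖ν‖ = 1) (hR : ∀ z, ⟪ν, R z⟫_ℝ = 0) (hRs : ∀ p, ⟪ν, p⟫_ℝ = 0 → ∃ z, R z = p)
    {r : ℝ} (hr : r ≤ r₀) {z : F} {u : ℝ} (hp : x + R z - u • ν ∈ Metric.ball x r) :
    x + R z - u • ν ∈ frontier B ↔ u = φ z := by
  have hball : ∀ z u, x + R z - u • ν ∈ Metric.ball x r → ‖z‖ ≤ r₀ ∧ |u| ≤ r₀ := by
    intro z u hp
    rw [Metric.mem_ball, dist_eq_norm] at hp
    have h0 : 0 ≤ r := (norm_nonneg _).trans hp.le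
    have h1 := norm_chart_sub_sq (x := x) hν hR z 0 u 0
    simp only [map_zero, add_zero, zero_smul, sub_zero] at h1
    have h3 : ‖x + R z - u • ν - x‖ ^ 2 ≤ r ^ 2 := by gcongr
    exact ⟨((le_abs_self _).trans (abs_le_of_sq_le_sq (by nlinarith [sq_nonneg u]) h0)).trans hr,
      (abs_le_of_sq_le_sq (by nlinarith [sq_nonneg ‖z‖]) h0).trans hr⟩
  have hmem : ∀ z u, x + R z - u • ν ∈ Metric.ball x r → (x + R z - u • ν ∈ B ↔ φ z ≤ u) :=
    fun z u hp => h.mem_iff z (hball z u hp).1 u (hball z u hp).2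
  constructor
  · intro hf
    have h1 := (hmem z u hp).1 (hBc.frontier_subset hf)
    by_contra hne
    have hlt : φ z < u := lt_of_le_of_ne h1 (Ne.symm hne)
    have : CompleteSpace E := FiniteDimensional.complete ℝ E
    have : CompleteSpace F := FiniteDimensional.complete ℝ F
    let P : E → F := fun p => ContinuousLinearMap.adjoint R.toContinuousLinearMap (p - x)
    let U : E → ℝ := fun p => -⟪ν, p - x⟫_ℝ
    have hPU : ∀ z u, P (x + R z - u • ν) = z ∧ U (x + R z - u • ν) = u := fun z u => by
      have e : x + R z - u • ν - x = R z - u • ν := by abel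
      constructor
      · refine ext_inner_right ℝ fun y => ?_
        simp only [P]
        rw [ContinuousLinearMap.adjoint_inner_left, e, inner_sub_left, real_inner_smul_left]
        simp [hR]
      · simp only [U]
        rw [e, inner_sub_right, hR, real_inner_smul_right, real_inner_self_eq_norm_sq, hν]
        ring
    have ho : IsOpen {p | φ (P p) < U p} :=
      isOpen_lt (h.contDiff.continuous.comp (by fun_prop)) (by fun_prop)
    have hsub : Metric.ball x r ∩ {p | φ (P p) < U p} ⊆ B := by
      rintro p ⟨hp1, hp2⟩
      obtain ⟨z', hz'⟩ := hRs (p - x - ⟪ν, p - x⟫_ℝ • ν) (by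
        rw [inner_sub_right, real_inner_smul_right, real_inner_self_eq_norm_sq, hν]; ring)
      have hpe : p = x + R z' - (-⟪ν, p - x⟫_ℝ) • ν := by rw [hz', neg_smul]; abel
      generalize -⟪ν, p - x⟫_ℝ = u' at hpe
      subst hpe
      refine (hmem z' u' hp1).2 ?_
      have : φ (P (x + R z' - u' • ν)) < U (x + R z' - u' • ν) := hp2
      rw [(hPU z' u').1, (hPU z' u').2] at this
      exact this.le
    have hint : x + R z - u • ν ∈ interior B := by
      refine mem_interior.2 ⟨_, hsub, Metric.isOpen_ball.inter ho, hp, ?_⟩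
      change φ (P _) < U _
      rwa [(hPU z u).1, (hPU z u).2]
    exact hf.2 hint
  · rintro rfl
    refine ⟨subset_closure ((hmem _ _ hp).2 le_rfl), fun hi => ?_⟩
    have hc : Continuous fun s : ℝ => x + R z - (φ z - s) • ν := by fun_prop
    have hnhds : (fun s : ℝ => x + R z - (φ z - s) • ν) ⁻¹' (B ∩ Metric.ball x r) ∈ nhds (0 : ℝ) := by
      refine hc.continuousAt.preimage_mem_nhds ?_
      simp only [sub_zero]
      exact Filter.inter_mem (mem_interior_iff_mem_nhds.1 hi) (Metric.isOpen_ball.mem_nhds hp)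
    obtain ⟨ε, hε, hsub⟩ := Metric.mem_nhds_iff.1 hnhds
    have h2 := hsub (show ε / 2 ∈ Metric.ball (0 : ℝ) ε by
      rw [Metric.mem_ball, Real.dist_eq, sub_zero, abs_of_pos (by positivity)]; linarith)
    have h3 := (hmem z (φ z - ε / 2) h2.2).1 h2.1
    linarith

end IsBoundaryChart

theorem exists_pos_pow_le (n : ℕ) {ε : ℝ} (hε : 0 < ε) :
    ∃ K : NNReal, 0 < K ∧ (K : ℝ) ≤ ε ∧ (1 + (K : ℝ)) ^ n ≤ 1 + ε := by
  have hc : Filter.Tendsto (fun K : ℝ => (1 + K) ^ n) (nhds 0) (nhds 1) := by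
    have : Continuous fun K : ℝ => (1 + K) ^ n := by fun_prop
    simpa using this.tendsto 0
  have h1 := hc.eventually (gt_mem_nhds (show (1 : ℝ) < 1 + ε by linarith))
  obtain ⟨δ, hδ, h⟩ := Metric.eventually_nhds_iff.1 h1
  have hm : 0 < min (δ / 2) ε := by positivity
  have hc : ((min (δ / 2) ε).toNNReal : ℝ) = min (δ / 2) ε := Real.coe_toNNReal _ hm.le
  refine ⟨(min (δ / 2) ε).toNNReal, Real.toNNReal_pos.2 hm, hc.trans_le (min_le_right _ _), ?_⟩
  rw [hc]
  refine (h ?_).le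
  rw [Real.dist_eq, sub_zero, abs_of_pos hm]
  linarith [min_le_left (δ / 2) ε]

variable {d : ℕ} {ρ : EuclideanSpace ℝ (Fin d) → ℝ}

/-- Near a boundary point the surface measure is almost the Lebesgue measure of the tangent
hyperplane. -/
theorem IsDefiningFunction.exists_local_surfaceMeasure {B : Set (EuclideanSpace ℝ (Fin d))}
    {n : ℕ} (hd : d = n + 1)
    (hρ : IsDefiningFunction B ρ) (hBc : IsCompact B) (hB : Convex ℝ B)
    {x : EuclideanSpace ℝ (Fin d)} (hx : x ∈ frontier B) {ε : ℝ} (hε : 0 < ε) :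
    ∃ r > 0, ∃ m₁ : Measure (EuclideanSpace ℝ (Fin d)), IsFiniteMeasure m₁ ∧
      m₁ ≤ (μHE[n]).restrict (frontier B ∩ Metric.ball x r) ∧
      (μHE[n]).restrict (frontier B ∩ Metric.ball x r) ≤ ENNReal.ofReal (1 + ε) • m₁ ∧
      ∀ (e : EuclideanSpace ℝ (Fin d)) (f : EuclideanSpace ℝ (Fin d) → ℂ), ContDiff ℝ ∞ f →
        tsupport f ⊆ Metric.ball x r →
        ‖(∫ p in B, fderiv ℝ f p e) - ((⟪unitNormal ρ x, e⟫_ℝ : ℝ) : ℂ) * ∫ p, f p ∂m₁‖ ≤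
          ε * ‖e‖ * ∫ p, ‖f p‖ ∂m₁ := by
  obtain ⟨r₀, C, hr₀, hC, hchart⟩ := hρ.exists_uniform_isBoundaryChart hBc hB 0
  set ν := unitNormal ρ x with hνd
  have hν : ‖ν‖ = 1 := hρ.norm_unitNormal hx
  obtain ⟨R, hR, hRs⟩ := exists_linearIsometry_orthogonal hd hν
  obtain ⟨φ, h⟩ := hchart x hx R hR
  obtain ⟨K, hK, hKε, hKn⟩ := exists_pos_pow_le n hε
  have hφ := h.contDiff
  have hdc : Continuous (fderiv ℝ φ) := hφ.continuous_fderiv (by simp)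
  -- Since $\varphi$ has a minimum at the origin, $d\varphi(0)=0$ and the graph is as flat as
  -- desired on a small ball.
  obtain ⟨r₁, hr₁, hdr⟩ : ∃ r₁ > 0, ∀ z ∈ Metric.ball (0 : EuclideanSpace ℝ (Fin n)) r₁,
      ‖fderiv ℝ φ z‖ ≤ K := by
    have : ∀ᶠ z in nhds (0 : EuclideanSpace ℝ (Fin n)), ‖fderiv ℝ φ z‖ < K :=
      (hdc.norm.tendsto 0).eventually (gt_mem_nhds (by
        rw [h.fderiv_zero hr₀, norm_zero]; exact_mod_cast hK))
    obtain ⟨r₁, hr₁, h1⟩ := Metric.eventually_nhds_iff_ball.1 this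
    exact ⟨r₁, hr₁, fun z hz => (h1 z hz).le⟩
  set r := min r₁ r₀ with hr
  have hr0 : 0 < r := lt_min hr₁ hr₀
  set γ : EuclideanSpace ℝ (Fin n) → EuclideanSpace ℝ (Fin d) := fun z => x + R z - φ z • ν with hγ
  have hγc : Continuous γ := (continuous_const.add R.continuous).sub
    (hφ.continuous.smul continuous_const)
  set V := γ ⁻¹' Metric.ball x r with hV
  have hVo : IsOpen V := Metric.isOpen_ball.preimage hγc
  have hVm : MeasurableSet V := hVo.measurableSet
  have hVr : V ⊆ Metric.ball 0 r := fun z hz => by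
    have h1 := (antilipschitzWith_graph (x := x) (φ := φ) hν hR).le_mul_dist z 0
    have h2 : dist (γ z) x < r := hz
    simp only [map_zero, h.apply_zero hr₀, zero_smul, add_zero, sub_zero, NNReal.coe_one,
      one_mul] at h1
    exact h1.trans_lt h2
  have hVd : ∀ z ∈ V, ‖fderiv ℝ φ z‖ ≤ K := fun z hz =>
    hdr z (Metric.ball_subset_ball (min_le_left _ _) (hVr hz))
  have hLip : LipschitzOnWith K φ V := by
    have : LipschitzOnWith K φ (Metric.ball 0 r) :=
      (convex_ball 0 r).lipschitzOnWith_of_nnnorm_fderiv_le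
        (fun z _ => hφ.differentiable (by simp) z)
        (fun z hz => by
          have := hdr z (Metric.ball_subset_ball (min_le_left _ _) hz)
          exact_mod_cast this)
    exact this.mono hVr
  have hVfin : volume V < ⊤ := (measure_mono hVr).trans_lt measure_ball_lt_top
  have : IsFiniteMeasure (volume.restrict V) := ⟨by simpa using hVfin⟩
  -- the surface is the graph
  have himg : ∀ A : Set (EuclideanSpace ℝ (Fin d)),
      A ∩ (frontier B ∩ Metric.ball x r) = γ '' (γ ⁻¹' A ∩ V) := by
    intro A
    ext p
    constructor
    · rintro ⟨hA, hf, hb⟩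
      obtain ⟨z, hz⟩ := hRs (p - x - ⟪ν, p - x⟫_ℝ • ν) (by
        rw [inner_sub_right, real_inner_smul_right, real_inner_self_eq_norm_sq, hν]; ring)
      have hpe : p = x + R z - (-⟪ν, p - x⟫_ℝ) • ν := by rw [hz, neg_smul]; abel
      generalize -⟪ν, p - x⟫_ℝ = u at hpe
      subst hpe
      have hu := (h.mem_frontier_iff hBc.isClosed hν hR hRs (min_le_right _ _) hb).1 hf
      subst hu
      exact ⟨z, ⟨hA, hb⟩, rfl⟩
    · rintro ⟨z, ⟨hA, hb⟩, rfl⟩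
      exact ⟨hA, (h.mem_frontier_iff hBc.isClosed hν hR hRs (min_le_right _ _) hb).2 rfl, hb⟩
  -- The comparison measure is Lebesgue measure on the tangent hyperplane lifted to the graph.
  refine ⟨r, hr0, (volume.restrict V).map γ, Measure.isFiniteMeasure_map _ _, ?_, ?_, ?_⟩
  · refine Measure.le_iff.2 fun A hA => ?_
    rw [Measure.map_apply hγc.measurable hA, Measure.restrict_apply (hγc.measurable hA),
      Measure.restrict_apply hA, himg]
    exact (euclideanHausdorffMeasure_image_graph hν hR (hLip.mono Set.inter_subset_right)).1
  · refine Measure.le_iff.2 fun A hA => ?_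
    rw [Measure.smul_apply, Measure.map_apply hγc.measurable hA,
      Measure.restrict_apply (hγc.measurable hA), Measure.restrict_apply hA, himg, smul_eq_mul]
    refine (euclideanHausdorffMeasure_image_graph hν hR (hLip.mono Set.inter_subset_right)).2.trans ?_
    gcongr
    rw [← ENNReal.ofReal_coe_nnreal, ← ENNReal.ofReal_pow (by positivity)]
    refine ENNReal.ofReal_le_ofReal ?_
    push_cast
    exact hKn
  · intro e f hf hfs
    -- With $e=Rw+\langle\nu,e\rangle\nu$ the epigraph formula has density
    -- $\langle\nu,e\rangle+d\varphi(w)$; the second summand is at most $\varepsilon\|e\|$ and is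
    -- the error.
    obtain ⟨w, hw⟩ := hRs (e - ⟪ν, e⟫_ℝ • ν) (by
        rw [inner_sub_right, real_inner_smul_right, real_inner_self_eq_norm_sq, hν]; ring)
    have he : e = R w + ⟪ν, e⟫_ℝ • ν := by rw [hw]; abel
    have hwe : ‖w‖ ≤ ‖e‖ := by
      rw [← R.norm_map, hw, ← sq_le_sq₀ (norm_nonneg _) (norm_nonneg _), real_inner_comm,
        ← norm_sq_sub_inner_sq hν]
      linarith [sq_nonneg ⟪e, ν⟫_ℝ]
    have hBφ : ∀ z u, x + R z - u • ν ∈ Metric.ball x r → (x + R z - u • ν ∈ B ↔ φ z ≤ u) := by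
      intro z u hp
      rw [Metric.mem_ball, dist_eq_norm] at hp
      have h1 := norm_chart_sub_sq (x := x) hν hR z 0 u 0
      simp only [map_zero, add_zero, zero_smul, sub_zero] at h1
      have h3 : ‖x + R z - u • ν - x‖ ^ 2 ≤ r ^ 2 := by gcongr
      refine h.mem_iff z ?_ u ?_
      · exact ((le_abs_self _).trans (abs_le_of_sq_le_sq (by nlinarith [sq_nonneg u])
          hr0.le)).trans (min_le_right _ _)
      · exact (abs_le_of_sq_le_sq (by nlinarith [sq_nonneg ‖z‖]) hr0.le).trans (min_le_right _ _)
    have key : ∫ p in B, fderiv ℝ f p (R w + ⟪ν, e⟫_ℝ • ν) =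
        ∫ z, ((⟪ν, e⟫_ℝ + fderiv ℝ φ z w : ℝ) : ℂ) * f (γ z) :=
      setIntegral_fderiv_epigraph (by simp [hd]) hν hR hφ hBc.measurableSet hBφ hf hfs w ⟪ν, e⟫_ℝ
    rw [← he] at key
    have hf0 : ∀ z, z ∉ V → f (γ z) = 0 := fun z hz =>
      image_eq_zero_of_notMem_tsupport fun h' => hz (hfs h')
    have hfγ : Continuous fun z => f (γ z) := hf.continuous.comp hγc
    have hfc : HasCompactSupport f := (isCompact_closedBall x r).of_isClosed_subset
      (isClosed_tsupport f) (hfs.trans Metric.ball_subset_closedBall)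
    obtain ⟨Cf, hCf⟩ := hf.continuous.bounded_above_of_compact_support hfc
    have hfi : IntegrableOn (fun z => f (γ z)) V :=
      Measure.integrableOn_of_bounded hVfin.ne hfγ.aestronglyMeasurable
        (Filter.Eventually.of_forall fun z => hCf _)
    have hgi : IntegrableOn (fun z => ((fderiv ℝ φ z w : ℝ) : ℂ) * f (γ z)) V := by
      refine (hfi.norm.const_mul (K * ‖w‖)).mono' ?_ ?_
      · exact ((Complex.continuous_ofReal.comp (hdc.clm_apply continuous_const)).mul
          hfγ).aestronglyMeasurable
      · filter_upwards [ae_restrict_mem hVm] with z hz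
        rw [norm_mul, Complex.norm_real]
        gcongr
        exact (ContinuousLinearMap.le_opNorm _ _).trans (by gcongr; exact hVd z hz)
    have hm1 : ∫ p, f p ∂((volume.restrict V).map γ) = ∫ z in V, f (γ z) :=
      integral_map hγc.measurable.aemeasurable hf.continuous.aestronglyMeasurable
    have hm2 : ∫ p, ‖f p‖ ∂((volume.restrict V).map γ) = ∫ z in V, ‖f (γ z)‖ :=
      integral_map hγc.measurable.aemeasurable hf.continuous.norm.aestronglyMeasurable
    rw [key, hm1, hm2, ← setIntegral_eq_integral_of_forall_compl_eq_zero (s := V)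
      (fun z hz => by rw [hf0 z hz, mul_zero]), ← integral_const_mul, ← integral_sub]
    · have e1 : ∀ z, ((⟪ν, e⟫_ℝ + fderiv ℝ φ z w : ℝ) : ℂ) * f (γ z) - ((⟪ν, e⟫_ℝ : ℝ) : ℂ) * f (γ z) =
          ((fderiv ℝ φ z w : ℝ) : ℂ) * f (γ z) := fun z => by push_cast; ring
      simp only [e1]
      rw [← integral_const_mul]
      refine norm_integral_le_of_norm_le (hfi.norm.const_mul _) ?_
      filter_upwards [ae_restrict_mem hVm] with z hz
      rw [norm_mul, Complex.norm_real]
      gcongr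
      exact (ContinuousLinearMap.le_opNorm _ _).trans (by
        gcongr
        exact (hVd z hz).trans hKε)
    · refine ((hfi.const_mul ((⟪ν, e⟫_ℝ : ℝ) : ℂ)).add hgi).congr
        (Filter.Eventually.of_forall fun z => ?_)
      change ((⟪ν, e⟫_ℝ : ℝ) : ℂ) * f (γ z) + ((fderiv ℝ φ z w : ℝ) : ℂ) * f (γ z) = _
      push_cast
      ring
    · exact hfi.const_mul _

end LocalSurface

/-! ### The divergence theorem for the surface measure. -/

section SurfaceDivergence

variable {d n : ℕ} {B : Set (EuclideanSpace ℝ (Fin d))} {ρ : EuclideanSpace ℝ (Fin d) → ℝ}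

/-- The defect in the divergence theorem for the field `f e`. -/
noncomputable def fluxDefect (B : Set (EuclideanSpace ℝ (Fin d))) (ρ : EuclideanSpace ℝ (Fin d) → ℝ)
    (σ : Measure (EuclideanSpace ℝ (Fin d))) (e : EuclideanSpace ℝ (Fin d))
    (f : EuclideanSpace ℝ (Fin d) → ℂ) : ℂ :=
  (∫ p in B, fderiv ℝ f p e) - ∫ p, ((⟪unitNormal ρ p, e⟫_ℝ : ℝ) : ℂ) * f p ∂σ

namespace IsDefiningFunction

theorem euclideanHausdorffMeasure_frontier_lt_top (hd : d = n + 1) (hρ : IsDefiningFunction B ρ)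
    (hBc : IsCompact B) (hB : Convex ℝ B) :
    (μHE[n] : Measure (EuclideanSpace ℝ (Fin d))) (frontier B) < ⊤ := by
  have hK : IsCompact (frontier B) := hBc.of_isClosed_subset isClosed_frontier hρ.frontier_subset
  refine hK.measure_lt_top_of_nhdsWithin fun x hx => ?_
  obtain ⟨r, hr, m₁, hm, -, h2, -⟩ := hρ.exists_local_surfaceMeasure hd hBc hB hx one_pos
  refine ⟨frontier B ∩ Metric.ball x r, inter_mem_nhdsWithin _ (Metric.ball_mem_nhds x hr), ?_⟩
  have := h2 Set.univ
  rw [Measure.restrict_apply_univ, Measure.smul_apply, smul_eq_mul] at this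
  exact this.trans_lt (ENNReal.mul_lt_top ENNReal.ofReal_lt_top (measure_lt_top _ _))

section Restricted

variable {σ : Measure (EuclideanSpace ℝ (Fin d))} [IsFiniteMeasure σ]

theorem integrable_surface (hρ : IsDefiningFunction B ρ) (hBc : IsCompact B)
    (hσ : σ.restrict (frontier B) = σ) {G : Type*} [NormedAddCommGroup G]
    {f : EuclideanSpace ℝ (Fin d) → G} (hf : ContinuousOn f (frontier B)) : Integrable f σ := by
  have hK : IsCompact (frontier B) := hBc.of_isClosed_subset isClosed_frontier hρ.frontier_subset
  have := hf.integrableOn_compact (μ := σ) hK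
  rwa [IntegrableOn, hσ] at this

theorem continuousOn_unitNormal (hρ : IsDefiningFunction B ρ) :
    ContinuousOn (unitNormal ρ) (frontier B) :=
  hρ.contDiffOn_unitNormal.continuousOn.mono fun x hx => hρ.gradient_ne_zero x hx

theorem integrable_unitNormal_mul (hρ : IsDefiningFunction B ρ) (hBc : IsCompact B)
    (hσ : σ.restrict (frontier B) = σ) (e : EuclideanSpace ℝ (Fin d))
    {f : EuclideanSpace ℝ (Fin d) → ℂ} (hf : Continuous f) :
    Integrable (fun p => ((⟪unitNormal ρ p, e⟫_ℝ : ℝ) : ℂ) * f p) σ :=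
  hρ.integrable_surface hBc hσ ((Complex.continuous_ofReal.comp_continuousOn
    (hρ.continuousOn_unitNormal.inner continuousOn_const)).mul hf.continuousOn)

theorem fluxDefect_add (hρ : IsDefiningFunction B ρ) (hBc : IsCompact B)
    (hσ : σ.restrict (frontier B) = σ) (e : EuclideanSpace ℝ (Fin d))
    {f g : EuclideanSpace ℝ (Fin d) → ℂ} (hf : ContDiff ℝ ∞ f) (hg : ContDiff ℝ ∞ g) :
    fluxDefect B ρ σ e (fun p => f p + g p) = fluxDefect B ρ σ e f + fluxDefect B ρ σ e g := by
  have h1 : ∀ {f : EuclideanSpace ℝ (Fin d) → ℂ}, ContDiff ℝ ∞ f →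
      IntegrableOn (fun p => fderiv ℝ f p e) B := fun hf =>
    ((hf.continuous_fderiv (by simp)).clm_apply
      continuous_const).continuousOn.integrableOn_compact hBc
  have e1 : ∫ p in B, fderiv ℝ (fun p => f p + g p) p e =
      (∫ p in B, fderiv ℝ f p e) + ∫ p in B, fderiv ℝ g p e := by
    rw [← integral_add (h1 hf) (h1 hg)]
    refine integral_congr_ae (Filter.Eventually.of_forall fun p => ?_)
    simp only
    rw [fderiv_fun_add (hf.differentiable (by simp) p) (hg.differentiable (by simp) p)]
    simp
  rw [fluxDefect, e1, fluxDefect, fluxDefect]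
  simp only [mul_add]
  rw [integral_add (hρ.integrable_unitNormal_mul hBc hσ e hf.continuous)
    (hρ.integrable_unitNormal_mul hBc hσ e hg.continuous)]
  ring

/-- Near a boundary point there are three errors, each at most $\varepsilon\|e\|\int|f|\,d\sigma$:
the slope of the graph, the comparison of the two measures, and the variation of the normal. Near an
interior point the defect vanishes. -/
theorem exists_norm_fluxDefect_le (hd : d = n + 1) (hρ : IsDefiningFunction B ρ)
    (hBc : IsCompact B) (hB : Convex ℝ B) (hσd : σ = (μHE[n]).restrict (frontier B))
    (hσ : σ.restrict (frontier B) = σ) (e : EuclideanSpace ℝ (Fin d)) {ε : ℝ} (hε : 0 < ε)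
    {x : EuclideanSpace ℝ (Fin d)} (hx : x ∈ B) :
    ∃ r > 0, ∀ f : EuclideanSpace ℝ (Fin d) → ℂ, ContDiff ℝ ∞ f →
      tsupport f ⊆ Metric.ball x r →
      ‖fluxDefect B ρ σ e f‖ ≤ 3 * ε * ‖e‖ * ∫ p, ‖f p‖ ∂σ := by
  have hae : ∀ᵐ p ∂σ, p ∈ frontier B := by
    rw [hσd]; exact ae_restrict_mem isClosed_frontier.measurableSet
  by_cases hxf : x ∈ frontier B
  · obtain ⟨r, hr, m₁, hm, h1, h2, h3⟩ := hρ.exists_local_surfaceMeasure hd hBc hB hxf hε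
    obtain ⟨r', hr', hN⟩ := Metric.continuousOn_iff.1 hρ.continuousOn_unitNormal x hxf ε hε
    refine ⟨min r r', lt_min hr hr', fun f hf hfs => ?_⟩
    have hfr : tsupport f ⊆ Metric.ball x r :=
      hfs.trans (Metric.ball_subset_ball (min_le_left _ _))
    set m₂ := (μHE[n]).restrict (frontier B ∩ Metric.ball x r) with hm₂
    have hm₂σ : m₂ = σ.restrict (Metric.ball x r) := by
      rw [hσd, Measure.restrict_restrict Metric.isOpen_ball.measurableSet, Set.inter_comm]
    have : IsFiniteMeasure m₂ := by rw [hm₂σ]; infer_instance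
    have hfσ : Integrable f σ := hρ.integrable_surface hBc hσ hf.continuous.continuousOn
    have hf2 : Integrable f m₂ := by rw [hm₂σ]; exact hfσ.restrict
    have hz : ∀ p, p ∉ Metric.ball x r → f p = 0 := fun p hp =>
      image_eq_zero_of_notMem_tsupport fun h => hp (hfr h)
    have e1 : ∫ p, f p ∂m₂ = ∫ p, f p ∂σ := by
      rw [hm₂σ]; exact setIntegral_eq_integral_of_forall_compl_eq_zero hz
    have e2 : ∫ p, ‖f p‖ ∂m₂ = ∫ p, ‖f p‖ ∂σ := by
      rw [hm₂σ]
      exact setIntegral_eq_integral_of_forall_compl_eq_zero fun p hp => by rw [hz p hp, norm_zero]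
    have k1 := h3 e f hf hfr
    have k2 := norm_integral_sub_integral_le hε.le h1 h2 hf2
    rw [e1, e2] at k2
    have k3 : ∫ p, ‖f p‖ ∂m₁ ≤ ∫ p, ‖f p‖ ∂σ := by
      rw [← e2]
      exact integral_mono_measure h1 (Filter.Eventually.of_forall fun _ => norm_nonneg _) hf2.norm
    set a := ⟪unitNormal ρ x, e⟫_ℝ with ha
    have ha1 : |a| ≤ ‖e‖ := by
      have := abs_real_inner_le_norm (unitNormal ρ x) e
      rwa [hρ.norm_unitNormal hxf, one_mul] at this
    have k4 : ‖(∫ p, ((⟪unitNormal ρ p, e⟫_ℝ : ℝ) : ℂ) * f p ∂σ) - (a : ℂ) * ∫ p, f p ∂σ‖ ≤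
        ε * ‖e‖ * ∫ p, ‖f p‖ ∂σ := by
      rw [← integral_const_mul, ← integral_sub
        (hρ.integrable_unitNormal_mul hBc hσ e hf.continuous) (hfσ.const_mul _),
        ← integral_const_mul]
      refine norm_integral_le_of_norm_le (hfσ.norm.const_mul _) ?_
      filter_upwards [hae] with p hp
      by_cases hpr : p ∈ tsupport f
      · have hd' : dist p x < r' := (hfs hpr).trans_le (min_le_right _ _)
        have h5 := hN p hp hd'
        rw [dist_eq_norm] at h5
        rw [← sub_mul, ← Complex.ofReal_sub, ha, ← inner_sub_left, norm_mul, Complex.norm_real]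
        gcongr
        exact (norm_inner_le_norm _ _).trans (by gcongr)
      · rw [image_eq_zero_of_notMem_tsupport hpr]
        simp
    have e3 : fluxDefect B ρ σ e f =
        ((∫ p in B, fderiv ℝ f p e) - (a : ℂ) * ∫ p, f p ∂m₁) -
        (a : ℂ) * ((∫ p, f p ∂σ) - ∫ p, f p ∂m₁) -
        ((∫ p, ((⟪unitNormal ρ p, e⟫_ℝ : ℝ) : ℂ) * f p ∂σ) - (a : ℂ) * ∫ p, f p ∂σ) := by
      rw [fluxDefect]; ring
    rw [e3]
    refine (norm_sub_le _ _).trans ?_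
    refine (add_le_add (norm_sub_le _ _) k4).trans ?_
    have k5 : ‖(a : ℂ) * ((∫ p, f p ∂σ) - ∫ p, f p ∂m₁)‖ ≤ ‖e‖ * (ε * ∫ p, ‖f p‖ ∂σ) := by
      rw [norm_mul, Complex.norm_real]
      gcongr
      exact ha1
    have k6 : ε * ‖e‖ * ∫ p, ‖f p‖ ∂m₁ ≤ ε * ‖e‖ * ∫ p, ‖f p‖ ∂σ := by gcongr
    linarith
  · have hxi : x ∈ interior B := by
      by_contra h
      exact hxf ⟨subset_closure hx, h⟩
    obtain ⟨r, hr, hrB⟩ := Metric.isOpen_iff.1 isOpen_interior x hxi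
    refine ⟨r, hr, fun f hf hfs => ?_⟩
    have hz : ∀ p, p ∉ interior B → f p = 0 := fun p hp =>
      image_eq_zero_of_notMem_tsupport fun h => hp (hrB (hfs h))
    have hfc : HasCompactSupport f := (isCompact_closedBall x r).of_isClosed_subset
      (isClosed_tsupport f) (hfs.trans Metric.ball_subset_closedBall)
    have e1 : ∫ p in B, fderiv ℝ f p e = 0 := by
      rw [setIntegral_eq_integral_of_forall_compl_eq_zero]
      · have := integral_fieldDeriv_add_divergence volume (X := fun _ => e) contDiff_const hf hfc
        simpa [divergence, fieldDeriv] using this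
      · intro p hp
        have h1 : p ∉ tsupport f := fun h => hp (interior_subset (hrB (hfs h)))
        have h2 : fderiv ℝ f p = 0 := by
          by_contra h
          exact h1 (support_fderiv_subset ℝ h)
        rw [h2]; rfl
    have e2 : ∫ p, ((⟪unitNormal ρ p, e⟫_ℝ : ℝ) : ℂ) * f p ∂σ = 0 := by
      refine integral_eq_zero_of_ae ?_
      filter_upwards [hae] with p hp
      rw [hz p hp.2, mul_zero]
      rfl
    rw [fluxDefect, e1, e2, sub_zero, norm_zero]
    positivity

/-- The local bounds are proportional to $\int|f|\,d\sigma$, and $|\chi f|+|(1-\chi)f|=|f|$ for a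
bump $0\le\chi\le1$. So localization does not multiply the error by the number of pieces, and
$\varepsilon\to0$ is allowed. -/
theorem fluxDefect_eq_zero (hd : d = n + 1) (hρ : IsDefiningFunction B ρ)
    (hBc : IsCompact B) (hB : Convex ℝ B) (hσd : σ = (μHE[n]).restrict (frontier B))
    (hσ : σ.restrict (frontier B) = σ) (e : EuclideanSpace ℝ (Fin d))
    {f : EuclideanSpace ℝ (Fin d) → ℂ} (hf : ContDiff ℝ ∞ f) : fluxDefect B ρ σ e f = 0 := by
  classical
  have hae : ∀ᵐ p ∂σ, p ∈ frontier B := by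
    rw [hσd]; exact ae_restrict_mem isClosed_frontier.measurableSet
  have key : ∀ ε : ℝ, 0 < ε → ‖fluxDefect B ρ σ e f‖ ≤ 3 * ε * ‖e‖ * ∫ p, ‖f p‖ ∂σ := by
    intro ε hε
    have hloc := fun x : EuclideanSpace ℝ (Fin d) => fun hx : x ∈ B =>
      hρ.exists_norm_fluxDefect_le hd hBc hB hσd hσ e hε hx
    choose! r hr hloc using hloc
    obtain ⟨t, htB, ht⟩ := hBc.elim_nhds_subcover (fun x => Metric.ball x (r x / 2))
      fun x hx => Metric.ball_mem_nhds x (half_pos (hr x hx))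
    -- Induction on the number of covering balls: a bump equal to $1$ on the half ball peels off one
    -- ball, and what remains vanishes there. In the empty case $f=0$ on $B$, so its derivative
    -- vanishes off the boundary, a Lebesgue null set.
    have hind : ∀ t : Finset (EuclideanSpace ℝ (Fin d)), (∀ x ∈ t, x ∈ B) →
        ∀ f : EuclideanSpace ℝ (Fin d) → ℂ, ContDiff ℝ ∞ f →
        (∀ p ∈ B, (∀ x ∈ t, p ∉ Metric.ball x (r x / 2)) → f p = 0) →
        ‖fluxDefect B ρ σ e f‖ ≤ 3 * ε * ‖e‖ * ∫ p, ‖f p‖ ∂σ := by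
      intro t
      induction t using Finset.induction_on with
      | empty =>
        intro _ f hf hz
        have hz' : ∀ p ∈ B, f p = 0 := fun p hp => hz p hp (by simp)
        have e1 : ∫ p in B, fderiv ℝ f p e = 0 := by
          refine integral_eq_zero_of_ae ?_
          have hnull : ∀ᵐ p, p ∉ frontier B :=
            measure_eq_zero_iff_ae_notMem.1 (hB.addHaar_frontier volume)
          filter_upwards [ae_restrict_mem hBc.measurableSet, ae_restrict_of_ae hnull] with p hp hpf
          have hpi : p ∈ interior B := by
            by_contra h
            exact hpf ⟨subset_closure hp, h⟩
          have : f =ᶠ[nhds p] fun _ => 0 := by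
            filter_upwards [isOpen_interior.mem_nhds hpi] with q hq
            exact hz' q (interior_subset hq)
          rw [this.fderiv_eq]
          simp
        have e2 : ∫ p, ((⟪unitNormal ρ p, e⟫_ℝ : ℝ) : ℂ) * f p ∂σ = 0 := by
          refine integral_eq_zero_of_ae ?_
          filter_upwards [hae] with p hp
          rw [hz' p (hρ.frontier_subset hp), mul_zero]
          rfl
        rw [fluxDefect, e1, e2, sub_zero, norm_zero]
        positivity
      | insert y t hy ih =>
        intro htB f hf hz
        have hyB : y ∈ B := htB y (Finset.mem_insert_self y t)
        have hry := hr y hyB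
        let χ : ContDiffBump y := ⟨r y / 2, 3 * r y / 4, by positivity, by linarith⟩
        have hχ : ContDiff ℝ ∞ fun p => ((χ p : ℝ) : ℂ) := Complex.ofRealCLM.contDiff.comp χ.contDiff
        have hg1 : ContDiff ℝ ∞ fun p => ((χ p : ℝ) : ℂ) * f p := hχ.mul hf
        have hg2 : ContDiff ℝ ∞ fun p => (1 - ((χ p : ℝ) : ℂ)) * f p := (contDiff_const.sub hχ).mul hf
        have b1 := hloc y hyB _ hg1 (by
          refine (tsupport_mul_subset_left (f := fun p => ((χ p : ℝ) : ℂ))).trans ?_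
          have h1 : tsupport (fun p => ((χ p : ℝ) : ℂ)) ⊆ tsupport χ := by
            refine closure_mono fun p hp => ?_
            intro h0
            exact hp (by simp [h0])
          refine h1.trans ?_
          rw [χ.tsupport_eq]
          exact Metric.closedBall_subset_ball (by change 3 * r y / 4 < r y; linarith))
        have b2 := ih (fun x hx => htB x (Finset.mem_insert_of_mem hx)) _ hg2 fun p hp hpt => by
          by_cases h : p ∈ Metric.ball y (r y / 2)
          · rw [χ.one_of_mem_closedBall (Metric.ball_subset_closedBall h)]
            simp
          · rw [hz p hp fun x hx => ?_, mul_zero]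
            rcases Finset.mem_insert.1 hx with rfl | hx
            · exact h
            · exact hpt x hx
        have hsplit : f = fun p => ((χ p : ℝ) : ℂ) * f p + (1 - ((χ p : ℝ) : ℂ)) * f p := by
          ext p; ring
        have hi1 : Integrable (fun p => ((χ p : ℝ) : ℂ) * f p) σ :=
          hρ.integrable_surface hBc hσ hg1.continuous.continuousOn
        have hi2 : Integrable (fun p => (1 - ((χ p : ℝ) : ℂ)) * f p) σ :=
          hρ.integrable_surface hBc hσ hg2.continuous.continuousOn
        have hn : ∫ p, ‖f p‖ ∂σ = (∫ p, ‖((χ p : ℝ) : ℂ) * f p‖ ∂σ) +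
            ∫ p, ‖(1 - ((χ p : ℝ) : ℂ)) * f p‖ ∂σ := by
          rw [← integral_add hi1.norm hi2.norm]
          refine integral_congr_ae (Filter.Eventually.of_forall fun p => ?_)
          have h1 : ‖(1 - ((χ p : ℝ) : ℂ))‖ = 1 - χ p := by
            rw [← Complex.ofReal_one, ← Complex.ofReal_sub, Complex.norm_real,
              Real.norm_of_nonneg (by linarith [χ.le_one (x := p)])]
          simp only [norm_mul, h1, Complex.norm_real, Real.norm_of_nonneg χ.nonneg]
          ring
        nth_rewrite 1 [hsplit]
        rw [hρ.fluxDefect_add hBc hσ e hg1 hg2, hn, mul_add]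
        exact (norm_add_le _ _).trans (add_le_add b1 b2)
    refine hind t htB f hf fun p hp hpt => ?_
    obtain ⟨x, hx, hpx⟩ := Set.mem_iUnion₂.1 (ht hp)
    exact absurd hpx (hpt x hx)
  have hle : ‖fluxDefect B ρ σ e f‖ ≤ 0 := by
    set A := 3 * ‖e‖ * ∫ p, ‖f p‖ ∂σ with hA
    have hA0 : 0 ≤ A := by positivity
    refine le_of_forall_pos_le_add fun δ hδ => ?_
    have h1 := key (δ / (A + 1)) (by positivity)
    have h2 : 3 * (δ / (A + 1)) * ‖e‖ * ∫ p, ‖f p‖ ∂σ = A / (A + 1) * δ := by rw [hA]; ring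
    have h3 : A / (A + 1) ≤ 1 := (div_le_one (by positivity)).2 (by linarith)
    rw [h2] at h1
    nlinarith
  simpa using hle

end Restricted

theorem fourierNormalSurface_eq (hρ : IsDefiningFunction B ρ) (hd : 2 ≤ d) (hBc : IsCompact B)
    (hB : Convex ℝ B) (l : Fin d) (ζ : EuclideanSpace ℝ (Fin d)) :
    fourierNormalSurface B l ζ =
      -2 * Real.pi * Complex.I * (ζ l : ℂ) * 𝓕 (B.indicator (fun _ => (1 : ℂ))) ζ := by
  obtain ⟨n, hn⟩ : ∃ n, d = n + 1 := ⟨d - 1, by omega⟩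
  have hfin := hρ.euclideanHausdorffMeasure_frontier_lt_top hn hBc hB
  set σ := (μHE[n] : Measure (EuclideanSpace ℝ (Fin d))).restrict (frontier B) with hσ
  have : IsFiniteMeasure σ := ⟨by rw [hσ, Measure.restrict_apply_univ]; exact hfin⟩
  have hσ' : σ.restrict (frontier B) = σ := by
    rw [hσ, Measure.restrict_restrict isClosed_frontier.measurableSet, Set.inter_self]
  have hsurf : surfaceMeasure B = σ := by rw [surfaceMeasure, hσ, show d - 1 = n by omega]
  set e : EuclideanSpace ℝ (Fin d) := EuclideanSpace.single l 1 with he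
  set f : EuclideanSpace ℝ (Fin d) → ℂ :=
    fun x => Complex.exp (-2 * Real.pi * Complex.I * (⟪x, ζ⟫_ℝ : ℂ)) with hf
  have hfs : ContDiff ℝ ∞ f := by
    have : ContDiff ℝ ∞ fun x : EuclideanSpace ℝ (Fin d) => ((⟪x, ζ⟫_ℝ : ℝ) : ℂ) :=
      Complex.ofRealCLM.contDiff.comp (contDiff_id.inner ℝ contDiff_const)
    exact (contDiff_const.mul this).cexp
  have hfd : ∀ p, fderiv ℝ f p e = -2 * Real.pi * Complex.I * (ζ l : ℂ) * f p := by
    intro p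
    have h1 : HasFDerivAt (fun x : EuclideanSpace ℝ (Fin d) => ((⟪x, ζ⟫_ℝ : ℝ) : ℂ))
        (Complex.ofRealCLM ∘L innerSL ℝ ζ) p := by
      refine (Complex.ofRealCLM.hasFDerivAt.comp p
        ((innerSL ℝ ζ).hasFDerivAt (x := p))).congr_of_eventuallyEq
          (Filter.Eventually.of_forall fun y => ?_)
      simp [real_inner_comm]
    have h2 := (h1.const_mul (-2 * Real.pi * Complex.I : ℂ)).cexp
    have h3 : fderiv ℝ f p e = _ := congrArg (fun L => L e) h2.fderiv
    rw [h3]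
    simp [he, hf, EuclideanSpace.inner_single_right]
    ring
  have h0 := hρ.fluxDefect_eq_zero hn hBc hB hσ hσ' e hfs
  rw [fluxDefect, sub_eq_zero] at h0
  have h1 : fourierNormalSurface B l ζ = ∫ p, ((⟪unitNormal ρ p, e⟫_ℝ : ℝ) : ℂ) * f p ∂σ := by
    rw [fourierNormalSurface, hsurf]
    refine integral_congr_ae ?_
    filter_upwards [show ∀ᵐ p ∂σ, p ∈ frontier B from
      ae_restrict_mem isClosed_frontier.measurableSet] with p hp
    rw [hρ.gaussMap_eq hB hp, he, EuclideanSpace.inner_single_right]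
    simp [hf]
  have h2 : 𝓕 (B.indicator (fun _ => (1 : ℂ))) ζ = ∫ p in B, f p := by
    have := fourier_indicator hBc.measurableSet ζ 1
    rw [one_smul] at this
    rw [this]
    refine integral_congr_ae (Filter.Eventually.of_forall fun p => ?_)
    simp only [hf]
    congr 1
    push_cast
    ring
  rw [h1, ← h0, h2, ← integral_const_mul]
  exact integral_congr_ae (Filter.Eventually.of_forall hfd)

end IsDefiningFunction

end SurfaceDivergence

/-! ### The theorem. -/

theorem theorem4p2 (d : ℕ) (hd : 2 ≤ d) (B : Set (EuclideanSpace ℝ (Fin d)))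
    (hB_compact : IsCompact B) (hB_convex : Convex ℝ B) (hB_int : (interior B).Nonempty)
    (hB_smooth : IsSmoothHypersurface (frontier B)) :
    (∀ N : ℕ, ∃ C : ℝ, ∀ ξ : EuclideanSpace ℝ (Fin d),
      ξ ∈ gaussMap B '' posCurvBoundary B → -ξ ∈ gaussMap B '' posCurvBoundary B →
      ∀ l : Fin d, ∀ t : ℝ, 0 < t →
        ‖fourierNormalSurface B l (t • ξ) -
            (Complex.exp (Real.pi * Complex.I * (d - 1) / 4) * (ξ l : ℂ) *
                (curvatureAt B ξ ^ (-(1 / 2 : ℝ)) : ℝ) *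
                Complex.exp (-2 * Real.pi * Complex.I * t * supportFn B ξ) +
              Complex.exp (-Real.pi * Complex.I * (d - 1) / 4) * (-(ξ l : ℂ)) *
                (curvatureAt B (-ξ) ^ (-(1 / 2 : ℝ)) : ℝ) *
                Complex.exp (2 * Real.pi * Complex.I * t * supportFn B (-ξ))) *
              (t ^ (-((d : ℝ) - 1) / 2) : ℝ)‖ ≤
          C * (t ^ (-((d : ℝ) + 1) / 2) *
                min (curvatureAt B ξ) (curvatureAt B (-ξ)) ^ (-((d : ℝ) + 5) / 2) +
              t ^ (-(N : ℝ)) *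
                min (curvatureAt B ξ) (curvatureAt B (-ξ)) ^ (-4 * (N : ℝ)))) ∧
    (∀ N : ℕ, ∃ C : ℝ, ∀ ξ : EuclideanSpace ℝ (Fin d),
      ξ ∈ gaussMap B '' posCurvBoundary B → -ξ ∈ gaussMap B '' posCurvBoundary B →
      ∀ t : ℝ, 0 < t →
        ‖𝓕 (B.indicator (fun _ => (1 : ℂ))) (t • ξ) -
            ((2 * Real.pi : ℂ)⁻¹ * Complex.exp (Real.pi * Complex.I * (d + 1) / 4) *
                (curvatureAt B ξ ^ (-(1 / 2 : ℝ)) : ℝ) *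
                Complex.exp (-2 * Real.pi * Complex.I * t * supportFn B ξ) +
              (2 * Real.pi : ℂ)⁻¹ * Complex.exp (-Real.pi * Complex.I * (d + 1) / 4) *
                (curvatureAt B (-ξ) ^ (-(1 / 2 : ℝ)) : ℝ) *
                Complex.exp (2 * Real.pi * Complex.I * t * supportFn B (-ξ))) *
              (t ^ (-((d : ℝ) + 1) / 2) : ℝ)‖ ≤
          C * (t ^ (-((d : ℝ) + 3) / 2) *
                min (curvatureAt B ξ) (curvatureAt B (-ξ)) ^ (-((d : ℝ) + 5) / 2) +
              t ^ (-(N : ℝ) - 1) *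
                min (curvatureAt B ξ) (curvatureAt B (-ξ)) ^ (-4 * (N : ℝ)))) := by
  obtain ⟨ρ, hρ⟩ := exists_isDefiningFunction hB_compact.isClosed hB_convex hB_int hB_smooth
  have h := hρ.fourier_indicator_asymptotic hd hB_compact hB_convex hB_int
  refine ⟨fun N => ?_, h⟩
  obtain ⟨C, hC⟩ := h N
  -- The multiplier $-2\pi it\xi_l$ has modulus at most $2\pi t$, since $\xi$ is a unit vector; $t$
  -- goes into the powers and $2\pi$ into the constant.
  refine ⟨2 * Real.pi * C, fun ξ h₁ h₂ l t ht => ?_⟩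
  obtain ⟨hx₁, -, hg₁⟩ := gaussInv_spec h₁
  rw [hρ.gaussMap_eq hB_convex hx₁] at hg₁
  exact fourierNormalSurface_asymptotic (fun l ζ => hρ.fourierNormalSurface_eq hd hB_compact
    hB_convex l ζ) (hg₁ ▸ hρ.norm_unitNormal hx₁) l ht (hC ξ h₁ h₂ t ht)
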